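/- **Setting.** Let $d\ge 1$, and write $x=(x',x_d)$, $x'=(t,y)\in\mathbb R\times\mathbb R^{d-1}$, $x_d\ge 0$, $\partial_0=\partial_t$. Consider a $3\times 3$ semilinear boundary problem $\tilde L(\partial)v+D(v)v=0$ in $x_d>0$, $\psi(v)v=\text{data}$ on $x_d=0$, where $\tilde L(\partial)=\partial_d+\sum_{j=0}^{d-1}A_j\partial_j$, $A_0=B_d^{-1}$, $A_j=B_d^{-1}B_j$, the $B_j$ are real constant matrices, $D(v)$ is a real $3\times3$ matrix, and $\psi(v)$ is a real $2\times 3$ matrix that is differentiable in $v$ at $0$; put $B=\psi(0)$. Assume: 1. (Strict hyperbolicity) $\det[\tau I+\sum_{j=1}^d\xi_jB_j]=\prod_{k=1}^3(\tau+\lambda_k(\xi))$ for $\xi\ne0$, with $\lambda_1<\lambda_2<\lambda_3$ real analytic on $\mathbb R^d\setminus\{0\}$ and positively homogeneous of degree $1$. 2. $B_d$ is invertible, and the rank of $B$ and the number of positive eigenvalues of $B_d$ (counted with multiplicity) are both $2$. 3. (Weak stability) For $\zeta=(\tau-i\gamma,\eta)\in\mathbb C\times\mathbb R^{d-1}$ let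 $\mathcal A(\zeta)=-iB_d^{-1}\big((\tau-i\gamma)I+\sum_{j=1}^{d-1}\eta_jB_j\big)$, and let $\mathbb E^s(\zeta)$ be its stable subspace for $\gamma>0$, extended continuously to $\gamma=0$, $\zeta\neq0$. Let $\Sigma=\{\gamma\ge0,\ \tau^2+\gamma^2+|\eta|^2=1\}$. Then $\ker B\cap\mathbb E^s(\zeta)=\{0\}$ if $\gamma>0$; the set $\Upsilon_0=\{\zeta\in\Sigma:\gamma=0,\ \ker B\cap\mathbb E^s(\zeta)\ne\{0\}\}$ is nonempty, and at each of its points $\mathcal A$ is diagonalizable with purely imaginary eigenvalues; and near every point of $\Upsilon_0$ in $\Sigma$ there are a real $C^\infty$ function $\sigma$, a $C^\infty$ basis $E_1,E_2$ of $\mathbb E^s(\zeta)$ and a $C^\infty$ matrix $P(\zeta)\in GL_2(\mathbb C)$ with $B\,(E_1\ E_2)=P\,\mathrm{diag}(\gamma+i\sigma,1)$. Let $\beta=(\underline\tau,\underline\eta)\in\Upsilon_0$, let $\omega_1,\omega_2,\omega_3$ be the distinct real roots $\omega$ of $\det[\underline\tau I+\sum_{j<d}\underline\eta_jB_j+\omega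 B_d]=0$, let $r_i\in\mathbb R^3\setminus\{0\}$ span the corresponding kernels, let $l_i\cdot r_k=\delta_{ik}$, and $P_iX=(l_i\cdot X)r_i$. Let $k_i$ be the index with $\underline\tau+\lambda_{k_i}(\underline\eta,\omega_i)=0$, and $\mathbf v_i=\nabla\lambda_{k_i}(\underline\eta,\omega_i)$. Suppose that the phases $1,3$ are incoming and the phase $2$ is outgoing, i.e. $\mathbf v_1\cdot\mathbf e_d>0$, $\mathbf v_3\cdot\mathbf e_d>0$, $\mathbf v_2\cdot\mathbf e_d<0$. Let $e\in\mathbb R^3\setminus\{0\}$ span $\ker B\cap\mathbb E^s(\beta)$, let $e_i=P_ie$, and let $b\in\mathbb R^2\setminus\{0\}$ satisfy $B\,\mathbb E^s(\beta)=\{X\in\mathbb C^2:b\cdot X=0\}$. With $R_i=\sum_{k\ne i}\frac{P_k}{\omega_i-\omega_k}$, define $$X_{\phi_i}=\frac1{\mathbf v_i\cdot\mathbf e_d}(\partial_t+\mathbf v_i\cdot\nabla),\quad X_{Lop}=\sum_{j=0}^{d-1}\Big(b\cdot B\sum_{i\in\{1,3\}}R_iA_je_i\Big)\partial_j,\quad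 e_i^i=-\,l_i\cdot D(0)r_i,$$ $$c_0=b\cdot B\sum_{i\in\{1,3\}}R_iD(0)e_i,\qquad d_0=-\,b\cdot\big((\mathrm d\psi(0)e)e\big).$$ **Spaces.** Let $\Omega_T=\{(x,\theta)\in\mathbb R^{d+1}\times\mathbb R:x_d\ge0,\ t<T\}$ and $b\Omega_T=\{(x',\theta)\in\mathbb R^d\times\mathbb R:t<T\}$. For $s\in\mathbb N$, $\Gamma^s_T$ is the space of $f\in L^2(\Omega_T)$ that vanish in $t<0$ and satisfy $\theta^p\partial_{x,\theta}^\alpha f\in L^2(\Omega_T)$ for $p+|\alpha|\le s$, with norm $\sum_{p+|\alpha|\le s}\|\theta^p\partial^\alpha_{x,\theta}f\|_{L^2(\Omega_T)}$; $b\Gamma^s_T$, with norm $\langle\cdot\rangle_{b\Gamma^s_T}$, is the analogous space on $b\Omega_T$. **Proposition.** Let $T>0$ and let $m\in\mathbb N$ satisfy $m>\frac{d+1}2+1$. There is $\delta>0$ such that for every $\mathbb R^2$-valued $G\in b\Gamma^{m+1}_T$ (in particular $G=0$ in $t<0$) with $\langle G\rangle_{b\Gamma^{m+1}_T}<\delta$,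 the system $$X_{\phi_1}\sigma_1-e_1^1\sigma_1=0,\qquad X_{\phi_3}\sigma_3-e_3^3\sigma_3=0\quad\text{in }\Omega_T,$$ $$X_{Lop}a+c_0\,a+d_0\,\partial_\theta(a^2)=-b\cdot\partial_\theta G\quad\text{on }b\Omega_T,$$ $$\sigma_i(x',0,\theta)\,r_i=a(x',\theta)\,e_i\quad\text{on }b\Omega_T,\ i=1,3,$$ has exactly one solution $(a,\sigma_1,\sigma_3)$ with $a\in b\Gamma^m_T$ and $\sigma_1,\sigma_3\in\Gamma^m_T$ (so that all unknowns vanish in $t<0$). Here the equations hold almost everywhere with weak derivatives, the values on $x_d=0$ are traces, and functions that agree almost everywhere are identified. -/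

import Mathlib

open MeasureTheory TopologicalSpace Topology Filter
open scoped Distributions ContDiff

noncomputable section

/-! ### Weak derivatives and the weighted Sobolev spaces

Points of `Fin (k + 1) → ℝ` have the time `t` as coordinate `0` and the fast variable `θ` as
last coordinate. Test functions are Mathlib's `𝓓(U, ℝ)`: smooth, compactly supported in `U`. -/

/-- The coordinate vector number `i` of `ℝᵏ`. -/
def coordVec {k : ℕ} (i : Fin k) : Fin k → ℝ := Pi.single i 1

/-- The classical derivative `∂₀^{α₀} ⋯ ∂_{k-1}^{α_{k-1}} φ` of a smooth function. -/
def multiDeriv {k : ℕ} (α : Fin k → ℕ) (φ : (Fin k → ℝ) → ℝ) : (Fin k → ℝ) → ℝ :=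
  (List.finRange k).foldr
    (fun i ψ => (fun (χ : (Fin k → ℝ) → ℝ) x => fderiv ℝ χ x (coordVec i))^[α i] ψ) φ

/-- `g` is the weak derivative `∂^α f` on the open set `U`. -/
def HasWeakDeriv {k : ℕ} {F : Type*} [NormedAddCommGroup F] [NormedSpace ℝ F]
    (U : Opens (Fin k → ℝ)) (α : Fin k → ℕ) (f g : (Fin k → ℝ) → F) : Prop :=
  LocallyIntegrableOn f U ∧ LocallyIntegrableOn g U ∧
    ∀ φ : 𝓓(U, ℝ), ∫ x in (U : Set (Fin k → ℝ)), multiDeriv α φ x • f x =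
      (-1 : ℝ) ^ (∑ i, α i) • ∫ x in (U : Set (Fin k → ℝ)), φ x • g x

/-- `g` is the weak derivative `X f = ∑ᵢ Xᵢ ∂ᵢ f` on the open set `U`, along the constant
vector field `X`. -/
def HasWeakDirDeriv {k : ℕ} {F : Type*} [NormedAddCommGroup F] [NormedSpace ℝ F]
    (U : Opens (Fin k → ℝ)) (X : Fin k → ℝ) (f g : (Fin k → ℝ) → F) : Prop :=
  LocallyIntegrableOn f U ∧ LocallyIntegrableOn g U ∧
    ∀ φ : 𝓓(U, ℝ), ∫ x in (U : Set (Fin k → ℝ)), fderiv ℝ φ x X • f x =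
      -∫ x in (U : Set (Fin k → ℝ)), φ x • g x

open Classical in
/-- The weak derivative `∂^α f` on `U` (unique up to null sets), and `0` if there is none. -/
def weakDeriv {k : ℕ} {F : Type*} [NormedAddCommGroup F] [NormedSpace ℝ F]
    (U : Opens (Fin k → ℝ)) (α : Fin k → ℕ) (f : (Fin k → ℝ) → F) : (Fin k → ℝ) → F :=
  if h : ∃ g, HasWeakDeriv U α f g then h.choose else 0

/-- The weighted Sobolev space of order `s` on `U`: all `θ^p ∂^α f` with `p + |α| ≤ s` are in
`L²(U)`, and `f` vanishes in `t < 0`. -/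
def MemGamma {k : ℕ} {F : Type*} [NormedAddCommGroup F] [NormedSpace ℝ F]
    (U : Opens (Fin (k + 1) → ℝ)) (s : ℕ) (f : (Fin (k + 1) → ℝ) → F) : Prop :=
  (∀ (p : ℕ) (α : Fin (k + 1) → ℕ), p + ∑ i, α i ≤ s →
    ∃ g, HasWeakDeriv U α f g ∧
      MemLp (fun x => x (Fin.last k) ^ p • g x) 2 (volume.restrict U)) ∧
  ∀ᵐ x ∂(volume.restrict (U : Set (Fin (k + 1) → ℝ))), x 0 < 0 → f x = 0

/-- The norm `∑_{p + |α| ≤ s} ‖θ^p ∂^α f‖_{L²(U)}` of the weighted Sobolev space. -/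
def normGamma {k : ℕ} {F : Type*} [NormedAddCommGroup F] [NormedSpace ℝ F]
    (U : Opens (Fin (k + 1) → ℝ)) (s : ℕ) (f : (Fin (k + 1) → ℝ) → F) : ℝ :=
  ∑ p ∈ Finset.range (s + 1), ∑ j ∈ Finset.range (s + 1 - p),
    ∑ α ∈ Finset.piAntidiag (Finset.univ : Finset (Fin (k + 1))) j,
      (eLpNorm (fun x => x (Fin.last k) ^ p • weakDeriv U α f x) 2 (volume.restrict U)).toReal

/-! ### The domains

The space dimension is `d = n + 1`. The coordinates of `ℝ^{d+1} = ℝ^{n+2}` are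
`(x', θ) = (t, y₁, …, yₙ, θ)`, those of `ℝ^{d+2} = ℝ^{n+3}` are `(x', x_d, θ)`. -/

/-- The set `{t < T}`. For `k = n + 1` this is the boundary domain `bΩ_T`. -/
def timeSlab (k : ℕ) (T : ℝ) : Opens (Fin (k + 1) → ℝ) :=
  ⟨{x | x 0 < T}, isOpen_lt (continuous_apply _) continuous_const⟩

/-- The boundary domain `bΩ_T = {(x', θ) : t < T}`. -/
abbrev bdryDomain (n : ℕ) (T : ℝ) : Opens (Fin (n + 2) → ℝ) := timeSlab (n + 1) T

/-- The index of the normal coordinate `x_d` among the coordinates `(x', x_d, θ)`. -/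
abbrev normalIdx (n : ℕ) : Fin (n + 3) := (Fin.last (n + 1)).castSucc

/-- The (interior of the) domain `Ω_T = {(x', x_d, θ) : t < T, x_d ≥ 0}`. -/
def intDomain (n : ℕ) (T : ℝ) : Opens (Fin (n + 3) → ℝ) :=
  ⟨{x | x 0 < T ∧ 0 < x (normalIdx n)},
    (isOpen_lt (continuous_apply _) continuous_const).inter
      (isOpen_lt continuous_const (continuous_apply _))⟩

/-- The boundary point `(x', 0, θ)`. -/
def bdryPoint {n : ℕ} (z : Fin (n + 2) → ℝ) : Fin (n + 3) → ℝ :=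
  (normalIdx n).insertNth (α := fun _ => ℝ) 0 z

/-- `g` is the trace on `x_d = 0` of the function `f` on `Ω_T`; both `f` and `∂_d f` are in
`L²(Ω_T)`, and the trace is characterised by Green's formula, with test functions that need not
vanish on `x_d = 0`. -/
def IsTrace {n : ℕ} (T : ℝ) (f : (Fin (n + 3) → ℝ) → ℝ) (g : (Fin (n + 2) → ℝ) → ℝ) : Prop :=
  LocallyIntegrableOn g (bdryDomain n T) ∧
  ∃ f', HasWeakDirDeriv (intDomain n T) (coordVec (normalIdx n)) f f' ∧
    MemLp f 2 (volume.restrict (intDomain n T)) ∧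
    MemLp f' 2 (volume.restrict (intDomain n T)) ∧
    ∀ φ : 𝓓(timeSlab (n + 2) T, ℝ),
      ∫ x in (intDomain n T : Set (Fin (n + 3) → ℝ)),
        (fderiv ℝ φ x (coordVec (normalIdx n)) * f x + φ x * f' x) =
      -∫ z in (bdryDomain n T : Set (Fin (n + 2) → ℝ)), φ (bdryPoint z) * g z

/-! ### The hyperbolic boundary problem -/

/-- A `3 × 3` semilinear boundary problem
`∂_t v + ∑_{j<d} B_j ∂_j v + B_d ∂_d v + B_d D(v) v = 0`, `ψ(v) v = data` on `x_d = 0`,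
with two boundary conditions, in space dimension `d = n + 1`. -/
structure BoundaryProblem (n : ℕ) where
  /-- the tangential matrices `B₁, …, B_{d-1}` -/
  Bt : Fin n → Matrix (Fin 3) (Fin 3) ℝ
  /-- the normal matrix `B_d` -/
  Bd : Matrix (Fin 3) (Fin 3) ℝ
  /-- the zero order term -/
  D : (Fin 3 → ℝ) → Matrix (Fin 3) (Fin 3) ℝ
  /-- the boundary operator, as the array of its entries -/
  ψ : (Fin 3 → ℝ) → Fin 2 → Fin 3 → ℝ
  ψ_diff : DifferentiableAt ℝ ψ 0

namespace BoundaryProblem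

variable {n : ℕ} (S : BoundaryProblem n)

/-- The boundary matrix `B = ψ(0)`. -/
def B : Matrix (Fin 2) (Fin 3) ℝ := Matrix.of (S.ψ 0)

/-- `A₀ = B_d⁻¹` and `A_j = B_d⁻¹ B_j` for `1 ≤ j ≤ d - 1`. -/
def A : Fin (n + 1) → Matrix (Fin 3) (Fin 3) ℝ := Fin.cons S.Bd⁻¹ (fun j => S.Bd⁻¹ * S.Bt j)

/-- `∑_{j=1}^d ξ_j B_j`, for `ξ = (η, ξ_d)`. -/
def symb (ξ : (Fin n → ℝ) × ℝ) : Matrix (Fin 3) (Fin 3) ℝ := ∑ j, ξ.1 j • S.Bt j + ξ.2 • S.Bd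

/-- Strict hyperbolicity: the characteristic polynomial is `∏ₖ (τ + λₖ(ξ))` with
`λ₁ < λ₂ < λ₃` real analytic away from `0` and positively homogeneous of degree one. -/
structure StrictlyHyperbolic (lam : Fin 3 → (Fin n → ℝ) × ℝ → ℝ) : Prop where
  analytic : ∀ k, AnalyticOnNhd ℝ (lam k) {0}ᶜ
  homogeneous : ∀ k (c : ℝ) (ξ : (Fin n → ℝ) × ℝ), 0 < c → ξ ≠ 0 →
    lam k (c • ξ) = c * lam k ξ
  det_eq : ∀ (τ : ℝ) (ξ : (Fin n → ℝ) × ℝ), ξ ≠ 0 →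
    (τ • (1 : Matrix (Fin 3) (Fin 3) ℝ) + S.symb ξ).det = ∏ k, (τ + lam k ξ)
  strictMono : ∀ ξ : (Fin n → ℝ) × ℝ, ξ ≠ 0 → StrictMono (fun k => lam k ξ)

open Classical in
/-- The boundary is noncharacteristic, and `B` has maximal rank, equal to the number (here `2`)
of positive eigenvalues of `B_d`, counted with multiplicity. -/
structure Noncharacteristic : Prop where
  isUnit_det : IsUnit S.Bd.det
  rank_eq : S.B.rank = 2
  card_pos : S.Bd.charpoly.roots.countP (fun μ => 0 < μ) = 2

/-- The symbol `𝒜(ζ) = -i B_d⁻¹ (ζ₀ I + ∑_{j<d} ηⱼ Bⱼ)` at the frequency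
`ζ = (ζ₀, η)`, `ζ₀ = τ - iγ`. -/
def calA (ζ : ℂ × (Fin n → ℝ)) : Matrix (Fin 3) (Fin 3) ℂ :=
  (-Complex.I) • (S.Bd⁻¹.map Complex.ofReal *
    (ζ.1 • (1 : Matrix (Fin 3) (Fin 3) ℂ) + ∑ j, (ζ.2 j : ℂ) • (S.Bt j).map Complex.ofReal))

/-- The stable subspace of `𝒜(ζ)`: the sum of the generalized eigenspaces for the eigenvalues of
negative real part. -/
def stableAux (ζ : ℂ × (Fin n → ℝ)) : Submodule ℂ (Fin 3 → ℂ) :=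
  ⨆ μ : {μ : ℂ // μ.re < 0}, Module.End.maxGenEigenspace (Matrix.toLin' (S.calA ζ)) μ

/-- The set of frequencies `ζ = (τ - iγ, η)` with `γ > 0`. -/
def posFreq (n : ℕ) : Set (ℂ × (Fin n → ℝ)) := {ζ | 0 < -ζ.1.im}

/-- The limits of vectors of the stable subspaces at frequencies with `γ > 0` tending to `ζ`. -/
def stableLim (ζ : ℂ × (Fin n → ℝ)) : Submodule ℂ (Fin 3 → ℂ) where
  carrier := {v | ∃ w : ℂ × (Fin n → ℝ) → Fin 3 → ℂ,
    (∀ ζ' ∈ posFreq n, w ζ' ∈ S.stableAux ζ') ∧ Tendsto w (𝓝[posFreq n] ζ) (𝓝 v)}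
  zero_mem' := ⟨fun _ => 0, fun _ _ => Submodule.zero_mem _, tendsto_const_nhds⟩
  add_mem' := by
    rintro v v' ⟨w, hw, hl⟩ ⟨w', hw', hl'⟩
    exact ⟨fun ζ' => w ζ' + w' ζ', fun ζ' h => Submodule.add_mem _ (hw ζ' h) (hw' ζ' h),
      hl.add hl'⟩
  smul_mem' := by
    rintro c v ⟨w, hw, hl⟩
    exact ⟨fun ζ' => c • w ζ', fun ζ' h => Submodule.smul_mem _ c (hw ζ' h), hl.const_smul c⟩

open Classical in
/-- The bundle `𝔼ˢ(ζ)`: the stable subspace of `𝒜(ζ)` for `γ > 0`, extended continuously to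
`γ = 0`. -/
def Es (ζ : ℂ × (Fin n → ℝ)) : Submodule ℂ (Fin 3 → ℂ) :=
  if ζ ∈ posFreq n then S.stableAux ζ else S.stableLim ζ

/-- The kernel of `B` in `ℂ³`. -/
def kerB : Submodule ℂ (Fin 3 → ℂ) := LinearMap.ker (Matrix.toLin' (S.B.map Complex.ofReal))

/-- The hemisphere `Σ = {τ² + γ² + |η|² = 1, γ ≥ 0}`. -/
def sphere (n : ℕ) : Set (ℂ × (Fin n → ℝ)) :=
  {ζ | 0 ≤ -ζ.1.im ∧ Complex.normSq ζ.1 + ∑ j, ζ.2 j ^ 2 = 1}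

/-- The hyperbolic region: the nonzero real frequencies at which `𝒜` is diagonalizable with purely
imaginary eigenvalues. -/
def hypRegion : Set (ℂ × (Fin n → ℝ)) :=
  {ζ | ζ ≠ 0 ∧ ζ.1.im = 0 ∧
    ⨆ x : ℝ, Module.End.eigenspace (Matrix.toLin' (S.calA ζ)) ((x : ℂ) * Complex.I) = ⊤}

/-- The set `Υ₀` of real frequencies on the unit sphere at which the Lopatinskii condition
fails. -/
def Upsilon : Set (ℂ × (Fin n → ℝ)) :=
  {ζ | ζ ∈ sphere n ∧ ζ.1.im = 0 ∧ S.kerB ⊓ S.Es ζ ≠ ⊥}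

/-- The weak stability assumption (`WR` class). The neighbourhoods in `Σ` are `W ∩ Σ`, with `W`
open; `Pm` is the matrix `P`, and `E` is the basis of `𝔼ˢ`. -/
structure WeaklyStable : Prop where
  ker_inf : ∀ ζ ∈ posFreq n, S.kerB ⊓ S.Es ζ = ⊥
  nonempty : S.Upsilon.Nonempty
  subset_hyp : S.Upsilon ⊆ S.hypRegion
  factor : ∀ ζ₀ ∈ S.Upsilon, ∃ W : Set (ℂ × (Fin n → ℝ)), IsOpen W ∧ ζ₀ ∈ W ∧
    ∃ (σ : ℂ × (Fin n → ℝ) → ℝ) (E : ℂ × (Fin n → ℝ) → Fin 2 → Fin 3 → ℂ)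
      (Pm : ℂ × (Fin n → ℝ) → Matrix (Fin 2) (Fin 2) ℂ),
      ContDiffOn ℝ ∞ σ (W ∩ sphere n) ∧
      ContDiffOn ℝ ∞ E (W ∩ sphere n) ∧
      (∀ i j, ContDiffOn ℝ ∞ (fun ζ => Pm ζ i j) (W ∩ sphere n)) ∧
      ∀ ζ ∈ W ∩ sphere n,
        LinearIndependent ℂ (E ζ) ∧ Submodule.span ℂ (Set.range (E ζ)) = S.Es ζ ∧
        IsUnit (Pm ζ).det ∧
        S.B.map Complex.ofReal * (Matrix.of (E ζ)).transpose =
          Pm ζ * Matrix.diagonal ![((-ζ.1.im : ℝ) : ℂ) + Complex.I * (σ ζ : ℂ), 1]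

end BoundaryProblem

/-! ### Phases, eigenvectors, and the coefficients of the profile equations

The three phases carry the indices `0, 1, 2`; number `1` is outgoing, `0` and `2` are incoming. -/

/-- The boundary frequency `β = (τ, η)`, the roots `ωₘ` (here `om`) of the dispersion relation, the index
`kₘ` of the characteristic root to which `ωₘ` belongs, the right eigenvectors `rₘ`, and the
vectors `e` and `b`. -/
structure PhaseData (n : ℕ) where
  β : Fin (n + 1) → ℝ
  om : Fin 3 → ℝ
  k : Fin 3 → Fin 3
  r : Fin 3 → Fin 3 → ℝ
  e : Fin 3 → ℝ
  b : Fin 2 → ℝ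

namespace PhaseData

variable {n : ℕ} (P : PhaseData n) (S : BoundaryProblem n)
  (lam : Fin 3 → (Fin n → ℝ) × ℝ → ℝ)

/-- `β` as a point of `ℂ × ℝ^{d-1}`. -/
def freq : ℂ × (Fin n → ℝ) := ((P.β 0 : ℂ), Fin.tail P.β)

/-- The spatial frequency `(η, ωₘ)`. -/
def spaceFreq (m : Fin 3) : (Fin n → ℝ) × ℝ := (Fin.tail P.β, P.om m)

/-- The components of the group velocity `vₘ = ∇λ_{kₘ}(η, ωₘ)` along `y₁, …, y_{d-1}`. -/
def velTan (m : Fin 3) (j : Fin n) : ℝ :=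
  fderiv ℝ (lam (P.k m)) (P.spaceFreq m) (Pi.single j 1, 0)

/-- The component of the group velocity `vₘ = ∇λ_{kₘ}(η, ωₘ)` along `x_d`. -/
def velNor (m : Fin 3) : ℝ := fderiv ℝ (lam (P.k m)) (P.spaceFreq m) (0, 1)

/-- The assumptions on `β`, and the defining properties of `ωₘ`, `kₘ`, `rₘ`, `e`, `b`. -/
structure Admissible : Prop where
  mem_Upsilon : P.freq ∈ S.Upsilon
  om_injective : Function.Injective P.om
  k_spec : ∀ m, P.β 0 + lam (P.k m) (P.spaceFreq m) = 0
  r_ne : ∀ m, P.r m ≠ 0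
  r_mem : ∀ m, (P.β 0 • (1 : Matrix (Fin 3) (Fin 3) ℝ) + S.symb (P.spaceFreq m)).mulVec (P.r m) = 0
  incoming_first : 0 < P.velNor lam 0
  outgoing_second : P.velNor lam 1 < 0
  incoming_third : 0 < P.velNor lam 2
  e_ne : P.e ≠ 0
  e_span : S.kerB ⊓ S.Es P.freq = Submodule.span ℂ {fun i => (P.e i : ℂ)}
  b_ne : P.b ≠ 0
  b_spec : ∀ X : Fin 2 → ℂ, (∃ v ∈ S.Es P.freq, (S.B.map Complex.ofReal).mulVec v = X) ↔
    ∑ j, (P.b j : ℂ) * X j = 0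

/-- The left eigenvectors `lₘ`, normalised by `lₘ · rₖ = δₘₖ`. -/
def l (m : Fin 3) : Fin 3 → ℝ := (Matrix.of P.r).transpose⁻¹ m

/-- The projectors `Pₘ X = (lₘ · X) rₘ`. -/
def proj (m : Fin 3) (X : Fin 3 → ℝ) : Fin 3 → ℝ := (P.l m ⬝ᵥ X) • P.r m

/-- The components `eₘ = Pₘ e` of `e`. -/
def eComp (m : Fin 3) : Fin 3 → ℝ := P.proj m P.e

/-- The partial inverses `Rₘ = ∑_{k ≠ m} Pₖ / (ωₘ - ωₖ)`. -/
def R (m : Fin 3) (X : Fin 3 → ℝ) : Fin 3 → ℝ :=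
  ∑ k ∈ Finset.univ.erase m, (P.om m - P.om k)⁻¹ • P.proj k X

/-- `b · B ∑_{m incoming} Rₘ M eₘ`, for a matrix `M`. -/
def bBR (M : Matrix (Fin 3) (Fin 3) ℝ) : ℝ :=
  P.b ⬝ᵥ S.B.mulVec (∑ m ∈ ({0, 2} : Finset (Fin 3)), P.R m (M.mulVec (P.eComp m)))

/-- The Lopatinskii vector field
`X_Lop = b · B ∑_{m incoming} Rₘ L̃(∂) eₘ = ∑_{j=0}^{d-1} (b · B ∑ₘ Rₘ Aⱼ eₘ) ∂ⱼ`
on the boundary, as a vector in the coordinates `(x', θ)`. -/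
def XLop : Fin (n + 2) → ℝ :=
  Fin.snoc (α := fun _ => ℝ) (fun j : Fin (n + 1) => P.bBR S (S.A j)) 0

/-- The characteristic vector field `X_{φₘ} = (vₘ · e_d)⁻¹ (∂_t + vₘ · ∇)`, as a vector in the
coordinates `(x', x_d, θ)`. -/
def Xphi (m : Fin 3) : Fin (n + 3) → ℝ :=
  Fin.snoc (α := fun _ => ℝ) (Fin.snoc (α := fun _ => ℝ)
    (Fin.cons (P.velNor lam m)⁻¹ (fun j => (P.velNor lam m)⁻¹ * P.velTan lam m j) :
      Fin (n + 1) → ℝ) 1) 0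

/-- The coefficient `eₘᵐ = -lₘ · D(0) rₘ` of the transport equation for `σₘ`. -/
def eCoef (m : Fin 3) : ℝ := -(P.l m ⬝ᵥ (S.D 0).mulVec (P.r m))

/-- The coefficient `c = b · B ∑_{m incoming} Rₘ D(0) eₘ` of the boundary equation. -/
def cCoef : ℝ := P.bBR S (S.D 0)

/-- The coefficient `-b · (dψ(0) e) e` of the term `∂_θ (a²)` in the boundary equation. -/
def dCoef : ℝ := -(P.b ⬝ᵥ (Matrix.of (fderiv ℝ S.ψ 0 P.e)).mulVec P.e)

/-- `a ∈ bΓᵐ_T`, `σ₁, σ₃ ∈ Γᵐ_T` solve the key subsystem with data `G`; derivatives are weak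
derivatives, the boundary condition is in the sense of traces, and all equations hold almost
everywhere. That the unknowns vanish in `t < 0` is part of the membership in the spaces. -/
structure IsKeySolution (T : ℝ) (m : ℕ) (G : (Fin (n + 2) → ℝ) → EuclideanSpace ℝ (Fin 2))
    (a : (Fin (n + 2) → ℝ) → ℝ) (σ₁ σ₃ : (Fin (n + 3) → ℝ) → ℝ) : Prop where
  a_mem : MemGamma (bdryDomain n T) m a
  first_mem : MemGamma (intDomain n T) m σ₁
  third_mem : MemGamma (intDomain n T) m σ₃
  first_eq : HasWeakDirDeriv (intDomain n T) (P.Xphi lam 0) σ₁ (fun x => P.eCoef S 0 * σ₁ x)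
  third_eq : HasWeakDirDeriv (intDomain n T) (P.Xphi lam 2) σ₃ (fun x => P.eCoef S 2 * σ₃ x)
  bdry_eq : ∃ (Xa da2 : (Fin (n + 2) → ℝ) → ℝ)
      (dG : (Fin (n + 2) → ℝ) → EuclideanSpace ℝ (Fin 2)),
    HasWeakDirDeriv (bdryDomain n T) (P.XLop S) a Xa ∧
    HasWeakDirDeriv (bdryDomain n T) (coordVec (Fin.last (n + 1))) (fun z => a z ^ 2) da2 ∧
    HasWeakDirDeriv (bdryDomain n T) (coordVec (Fin.last (n + 1))) G dG ∧
    ∀ᵐ z ∂(volume.restrict (bdryDomain n T : Set (Fin (n + 2) → ℝ))),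
      Xa z + P.cCoef S * a z + P.dCoef S * da2 z = -∑ j, P.b j * dG z j
  first_trace : ∃ g, IsTrace T σ₁ g ∧
    ∀ᵐ z ∂(volume.restrict (bdryDomain n T : Set (Fin (n + 2) → ℝ))),
      g z • P.r 0 = a z • P.eComp 0
  third_trace : ∃ g, IsTrace T σ₃ g ∧
    ∀ᵐ z ∂(volume.restrict (bdryDomain n T : Set (Fin (n + 2) → ℝ))),
      g z • P.r 2 = a z • P.eComp 2

end PhaseData

end

noncomputable section

open scoped FourierTransform SchwartzMap LineDeriv ENNReal NNReal ComplexConjugate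

/-! ### Calculus of weak derivatives -/

section WeakCalculus

variable {k : ℕ} {F : Type*} [NormedAddCommGroup F] [NormedSpace ℝ F]

/-! The system is triangular: the boundary equation involves `a` alone, and once `a` is known each
σ_i is carried into the interior by a transport equation. Everything rests on a scalar Burgers-type
equation in the d + 1 variables (t, y, θ), and on the fact that it evolves in t. Below, the phases
carry the indices 0, 2 (incoming) and 1 (outgoing).

Evolution in t means that the coefficient of ∂_t in X_Lop is nonzero
(`PhaseData.Admissible.XLop_zero_ne`); this is where weak stability enters. For small γ > 0 the
stable subspace is the kernel of a left eigenvector of the symbol. Expanded in the basis r_j, this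
eigenvector selects the outgoing mode as γ → 0 (`left_eigenvector_limit`), because the diagonal
entries of B_d⁻¹ in that basis are the inverse normal group velocities. Hence r_0 and r_2 lie in
E^s(β). Moreover, if y(γ) is chosen so that e + y(γ) r_1 remains in E^s, the coefficient of ∂_t is a
nonzero multiple of the limit of y(γ)/γ. Were it zero, B(e + y r_1) = y B r_1 would be o(γ), whereas
the factor γ + iσ bounds B on E^s from below by a multiple of γ; then e would vanish.

For existence, the equation is divided by this coefficient and an exponential in t is absorbed; the
data are extended across t = T by reflections and cut off in t. What remains is w + X w + q w ∂_θ w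
= f on the whole space, with f small. The field X is skew-adjoint, and v ∂_θ with v real contributes
to the H^s pairing a term bounded without loss of derivatives (`enorm_re_integral_symm_le`). With k
= m - 1 > (d + 1)/2, the operator is therefore coercive in H^{k+1} and strongly monotone in L² on a
small ball (`SmallData.gOp_mono`). Frequency truncations of the equation are solved by a relaxation
iteration (`SmallData.exists_trunc`); their solutions are bounded in H^{k+1} and Cauchy in L², and
the limit solves the equation (`SmallData.exists_solution`). The weights in θ are recovered by
applying the a priori estimate to θ^{p+1} w with cut-offs (`weighted_regularity`). Vanishing for t <
0 and uniqueness both follow from one energy identity (`eq_zero_of_energy`); uniqueness needs no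
smallness.

The fields X_φ of the incoming phases have x_d-component one and positive time component, so σ_i is
explicit along characteristics issued from the boundary (`transport`). Its uniqueness follows from
Green's formula by moving test functions along the field into t < 0 (`transport_unique`). -/

theorem hasWeakDirDeriv_iff {U : Opens (Fin k → ℝ)} {X : Fin k → ℝ} {f g : (Fin k → ℝ) → F} :
    HasWeakDirDeriv U X f g ↔ LocallyIntegrableOn f U ∧ LocallyIntegrableOn g U ∧
      ∀ φ : (Fin k → ℝ) → ℝ, ContDiff ℝ ∞ φ → HasCompactSupport φ → tsupport φ ⊆ U →
        ∫ x in (U : Set (Fin k → ℝ)), fderiv ℝ φ x X • f x =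
          -∫ x in (U : Set (Fin k → ℝ)), φ x • g x := by
  refine and_congr_right fun _ => and_congr_right fun _ => ⟨fun h φ h1 h2 h3 => ?_, fun h φ => ?_⟩
  · exact h ⟨φ, h1, h2, h3⟩
  · exact h φ φ.contDiff φ.hasCompactSupport φ.tsupport_subset

theorem hasWeakDeriv_iff {U : Opens (Fin k → ℝ)} {α : Fin k → ℕ} {f g : (Fin k → ℝ) → F} :
    HasWeakDeriv U α f g ↔ LocallyIntegrableOn f U ∧ LocallyIntegrableOn g U ∧
      ∀ φ : (Fin k → ℝ) → ℝ, ContDiff ℝ ∞ φ → HasCompactSupport φ → tsupport φ ⊆ U →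
        ∫ x in (U : Set (Fin k → ℝ)), multiDeriv α φ x • f x =
          (-1 : ℝ) ^ (∑ i, α i) • ∫ x in (U : Set (Fin k → ℝ)), φ x • g x := by
  refine and_congr_right fun _ => and_congr_right fun _ => ⟨fun h φ h1 h2 h3 => ?_, fun h φ => ?_⟩
  · exact h ⟨φ, h1, h2, h3⟩
  · exact h φ φ.contDiff φ.hasCompactSupport φ.tsupport_subset

theorem integrableOn_smul_of_tsupport_subset {U : Set (Fin k → ℝ)} {f : (Fin k → ℝ) → F}
    (hf : LocallyIntegrableOn f U) {φ : (Fin k → ℝ) → ℝ} (h1 : Continuous φ)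
    (h2 : HasCompactSupport φ) (h3 : tsupport φ ⊆ U) :
    Integrable (fun x => φ x • f x) (volume.restrict U) := by
  have h4 : IntegrableOn f (tsupport φ) := hf.integrableOn_compact_subset h3 h2
  have h5 : IntegrableOn (fun x => φ x • f x) (tsupport φ) :=
    h4.continuousOn_smul h1.continuousOn h2
  have h6 : Integrable (fun x => φ x • f x) := by
    rwa [integrableOn_iff_integrable_of_support_subset] at h5
    intro x hx
    apply subset_tsupport
    intro h
    exact hx (by simp [h])
  exact h6.restrict

theorem fderiv_apply_contDiff {φ : (Fin k → ℝ) → ℝ} (h1 : ContDiff ℝ ∞ φ) (X : Fin k → ℝ) :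
    ContDiff ℝ ∞ (fun x => fderiv ℝ φ x X) :=
  (h1.fderiv_right (m := ∞) (by simp)).clm_apply contDiff_const

theorem fderiv_apply_tsupport_subset (φ : (Fin k → ℝ) → ℝ) (X : Fin k → ℝ) :
    tsupport (fun x => fderiv ℝ φ x X) ⊆ tsupport φ :=
  (closure_mono fun x hx => by
    simp only [Function.mem_support] at hx ⊢
    intro h; exact hx (by simp [h])).trans (tsupport_fderiv_subset ℝ)

theorem fderiv_apply_hasCompactSupport {φ : (Fin k → ℝ) → ℝ} (h : HasCompactSupport φ)
    (X : Fin k → ℝ) : HasCompactSupport (fun x => fderiv ℝ φ x X) :=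
  h.mono' ((subset_tsupport _).trans (fderiv_apply_tsupport_subset φ X))


theorem MemLp.locallyIntegrableOn_opens {F : Type*} [NormedAddCommGroup F]
    {U : Opens (Fin k → ℝ)} {f : (Fin k → ℝ) → F}
    (hf : MemLp f 2 (volume.restrict (U : Set (Fin k → ℝ)))) : LocallyIntegrableOn f U := by
  have := hf.locallyIntegrable (by norm_num)
  rw [locallyIntegrableOn_iff U.isOpen.isLocallyClosed]
  intro K hK hc
  have h := this.integrableOn_isCompact hc
  rwa [IntegrableOn, Measure.restrict_restrict_of_subset hK] at h

namespace HasWeakDirDeriv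

variable {U : Opens (Fin k → ℝ)} {X Y : Fin k → ℝ} {f f' g g' : (Fin k → ℝ) → F}

theorem integrable_fderiv_smul (hf : LocallyIntegrableOn f U) {φ : (Fin k → ℝ) → ℝ}
    (h1 : ContDiff ℝ ∞ φ) (h2 : HasCompactSupport φ) (h3 : tsupport φ ⊆ U) :
    Integrable (fun x => fderiv ℝ φ x X • f x) (volume.restrict (U : Set (Fin k → ℝ))) :=
  integrableOn_smul_of_tsupport_subset hf (fderiv_apply_contDiff h1 X).continuous
    (fderiv_apply_hasCompactSupport h2 X) ((fderiv_apply_tsupport_subset φ X).trans h3)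

theorem congr (h : HasWeakDirDeriv U X f g)
    (hf : f =ᵐ[volume.restrict (U : Set (Fin k → ℝ))] f')
    (hg : g =ᵐ[volume.restrict (U : Set (Fin k → ℝ))] g') : HasWeakDirDeriv U X f' g' := by
  obtain ⟨h1, h2, h3⟩ := h
  refine ⟨h1.congr hf, h2.congr hg, fun φ => ?_⟩
  have e1 : ∫ x in (U : Set (Fin k → ℝ)), fderiv ℝ φ x X • f x =
      ∫ x in (U : Set (Fin k → ℝ)), fderiv ℝ φ x X • f' x :=
    integral_congr_ae (hf.mono fun x hx => by simp only [hx])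
  have e2 : ∫ x in (U : Set (Fin k → ℝ)), φ x • g x = ∫ x in (U : Set (Fin k → ℝ)), φ x • g' x :=
    integral_congr_ae (hg.mono fun x hx => by simp only [hx])
  rw [← e1, h3 φ, e2]

theorem unique [CompleteSpace F] (h : HasWeakDirDeriv U X f g) (h' : HasWeakDirDeriv U X f g') :
    g =ᵐ[volume.restrict (U : Set (Fin k → ℝ))] g' := by
  have key : ∀ᵐ x, x ∈ (U : Set (Fin k → ℝ)) → (g x - g' x) = 0 := by
    refine U.isOpen.ae_eq_zero_of_integral_contDiff_smul_eq_zero (h.2.1.sub h'.2.1) ?_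
    intro φ h1 h2 h3
    have e1 := (hasWeakDirDeriv_iff.1 h).2.2 φ h1 h2 h3
    have e2 := (hasWeakDirDeriv_iff.1 h').2.2 φ h1 h2 h3
    rw [e1, neg_inj] at e2
    have e3 : ∫ x in (U : Set (Fin k → ℝ)), φ x • (g x - g' x) = 0 := by
      simp only [smul_sub]
      rw [integral_sub (integrableOn_smul_of_tsupport_subset h.2.1 h1.continuous h2 h3)
        (integrableOn_smul_of_tsupport_subset h'.2.1 h1.continuous h2 h3), e2, sub_self]
    rwa [setIntegral_eq_integral_of_forall_compl_eq_zero] at e3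
    intro x hx
    rw [image_eq_zero_of_notMem_tsupport (fun hh => hx (h3 hh)), zero_smul]
  rw [Filter.EventuallyEq, ae_restrict_iff' U.isOpen.measurableSet]
  filter_upwards [key] with x hx hU using sub_eq_zero.1 (hx hU)

theorem add (h : HasWeakDirDeriv U X f g) (h' : HasWeakDirDeriv U X f' g') :
    HasWeakDirDeriv U X (fun x => f x + f' x) (fun x => g x + g' x) := by
  rw [hasWeakDirDeriv_iff] at h h' ⊢
  refine ⟨h.1.add h'.1, h.2.1.add h'.2.1, fun φ h1 h2 h3 => ?_⟩
  simp only [smul_add]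
  rw [integral_add (integrable_fderiv_smul h.1 h1 h2 h3) (integrable_fderiv_smul h'.1 h1 h2 h3),
    integral_add (integrableOn_smul_of_tsupport_subset h.2.1 h1.continuous h2 h3)
      (integrableOn_smul_of_tsupport_subset h'.2.1 h1.continuous h2 h3),
    h.2.2 φ h1 h2 h3, h'.2.2 φ h1 h2 h3, neg_add]

theorem clm_comp [CompleteSpace F] {F' : Type*} [NormedAddCommGroup F'] [NormedSpace ℝ F']
    [CompleteSpace F'] (L : F →L[ℝ] F') (h : HasWeakDirDeriv U X f g) :
    HasWeakDirDeriv U X (fun x => L (f x)) (fun x => L (g x)) := by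
  rw [hasWeakDirDeriv_iff] at h ⊢
  have aux : ∀ {u : (Fin k → ℝ) → F}, LocallyIntegrableOn u (U : Set (Fin k → ℝ)) →
      LocallyIntegrableOn (fun x => L (u x)) (U : Set (Fin k → ℝ)) := by
    intro u hu
    rw [locallyIntegrableOn_iff U.isOpen.isLocallyClosed] at hu ⊢
    exact fun K hK hc => L.integrable_comp (hu K hK hc)
  refine ⟨aux h.1, aux h.2.1, fun φ h1 h2 h3 => ?_⟩
  simp only [← L.map_smul]
  rw [L.integral_comp_comm (integrable_fderiv_smul h.1 h1 h2 h3),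
    L.integral_comp_comm (integrableOn_smul_of_tsupport_subset h.2.1 h1.continuous h2 h3),
    h.2.2 φ h1 h2 h3, map_neg]

theorem const_smul (c : ℝ) (h : HasWeakDirDeriv U X f g) :
    HasWeakDirDeriv U X (fun x => c • f x) (fun x => c • g x) := by
  rw [hasWeakDirDeriv_iff] at h ⊢
  refine ⟨h.1.smul c, h.2.1.smul c, fun φ h1 h2 h3 => ?_⟩
  simp only [smul_comm _ c]
  rw [integral_smul, integral_smul, h.2.2 φ h1 h2 h3, smul_neg]

theorem zero : HasWeakDirDeriv U X (fun _ => (0 : F)) (fun _ => 0) := by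
  rw [hasWeakDirDeriv_iff]
  exact ⟨locallyIntegrableOn_zero, locallyIntegrableOn_zero, by simp⟩

theorem add_dir (h : HasWeakDirDeriv U X f g) (h' : HasWeakDirDeriv U Y f g') :
    HasWeakDirDeriv U (X + Y) f (fun x => g x + g' x) := by
  rw [hasWeakDirDeriv_iff] at h h' ⊢
  refine ⟨h.1, h.2.1.add h'.2.1, fun φ h1 h2 h3 => ?_⟩
  simp only [map_add, add_smul, smul_add]
  rw [integral_add (integrable_fderiv_smul h.1 h1 h2 h3) (integrable_fderiv_smul h.1 h1 h2 h3),
    integral_add (integrableOn_smul_of_tsupport_subset h.2.1 h1.continuous h2 h3)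
      (integrableOn_smul_of_tsupport_subset h'.2.1 h1.continuous h2 h3),
    h.2.2 φ h1 h2 h3, h'.2.2 φ h1 h2 h3, neg_add]

theorem smul_dir (c : ℝ) (h : HasWeakDirDeriv U X f g) :
    HasWeakDirDeriv U (c • X) f (fun x => c • g x) := by
  rw [hasWeakDirDeriv_iff] at h ⊢
  refine ⟨h.1, h.2.1.smul c, fun φ h1 h2 h3 => ?_⟩
  simp only [map_smul, smul_eq_mul, mul_smul, smul_comm _ c]
  rw [integral_smul, integral_smul, h.2.2 φ h1 h2 h3, smul_neg]

theorem sum_dir (hf : LocallyIntegrableOn f U) {ι : Type*} (s : Finset ι) (Z : ι → Fin k → ℝ)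
    (c : ι → ℝ) (G : ι → (Fin k → ℝ) → F) (h : ∀ i ∈ s, HasWeakDirDeriv U (Z i) f (G i)) :
    HasWeakDirDeriv U (∑ i ∈ s, c i • Z i) f (fun x => ∑ i ∈ s, c i • G i x) := by
  classical
  induction s using Finset.induction_on with
  | empty =>
    rw [hasWeakDirDeriv_iff]
    exact ⟨hf, by simpa using locallyIntegrableOn_zero, by simp⟩
  | insert a s ha ih =>
    simp only [Finset.sum_insert ha]
    exact ((h a (Finset.mem_insert_self a s)).smul_dir (c a)).add_dir
      (ih fun i hi => h i (Finset.mem_insert_of_mem hi))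

theorem mono {V : Opens (Fin k → ℝ)} (hV : V ≤ U) (h : HasWeakDirDeriv U X f g) :
    HasWeakDirDeriv V X f g := by
  rw [hasWeakDirDeriv_iff] at h ⊢
  refine ⟨h.1.mono_set hV, h.2.1.mono_set hV, fun φ h1 h2 h3 => ?_⟩
  have key : ∀ (ψ : (Fin k → ℝ) → ℝ) (u : (Fin k → ℝ) → F), tsupport ψ ⊆ V →
      ∫ x in (V : Set (Fin k → ℝ)), ψ x • u x = ∫ x in (U : Set (Fin k → ℝ)), ψ x • u x := by
    intro ψ u hψ
    rw [setIntegral_eq_integral_of_forall_compl_eq_zero,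
      setIntegral_eq_integral_of_forall_compl_eq_zero]
    · intro x hx
      rw [image_eq_zero_of_notMem_tsupport (fun hh => hx (hV (hψ hh))), zero_smul]
    · intro x hx
      rw [image_eq_zero_of_notMem_tsupport (fun hh => hx (hψ hh)), zero_smul]
  rw [key _ _ ((fderiv_apply_tsupport_subset φ X).trans h3), key _ _ h3]
  exact h.2.2 φ h1 h2 (h3.trans hV)

/-- The product rule is shifted to the test side: the hypothesis is tested with φρ, which is again
smooth with compact support in U, and ρ itself needs no support or growth condition. -/
theorem smul_smooth {ρ : (Fin k → ℝ) → ℝ} (hρ : ContDiff ℝ ∞ ρ) (h : HasWeakDirDeriv U X f g) :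
    HasWeakDirDeriv U X (fun x => ρ x • f x) (fun x => ρ x • g x + fderiv ℝ ρ x X • f x) := by
  rw [hasWeakDirDeriv_iff] at h ⊢
  have l1 : ∀ {u : (Fin k → ℝ) → F} {r : (Fin k → ℝ) → ℝ},
      LocallyIntegrableOn u (U : Set (Fin k → ℝ)) → ContDiff ℝ ∞ r →
      LocallyIntegrableOn (fun x => r x • u x) (U : Set (Fin k → ℝ)) :=
    fun hu hr => hu.continuousOn_smul U.isOpen.isLocallyClosed hr.continuous.continuousOn
  have hρ' := fderiv_apply_contDiff hρ X
  refine ⟨l1 h.1 hρ, (l1 h.2.1 hρ).add (l1 h.1 hρ'), fun φ h1 h2 h3 => ?_⟩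
  have c1 : ContDiff ℝ ∞ (fun x => φ x * ρ x) := h1.mul hρ
  have c2 : HasCompactSupport (fun x => φ x * ρ x) := h2.mul_right
  have c3 : tsupport (fun x => φ x * ρ x) ⊆ U := (tsupport_mul_subset_left).trans h3
  have e := h.2.2 _ c1 c2 c3
  have d : ∀ x, fderiv ℝ (fun x => φ x * ρ x) x X = φ x * fderiv ℝ ρ x X + ρ x * fderiv ℝ φ x X := by
    intro x
    rw [fderiv_fun_mul (h1.differentiable (by simp) x) (hρ.differentiable (by simp) x)]
    simp
  simp only [d, add_smul, mul_smul] at e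
  have i1 : Integrable (fun x => φ x • fderiv ℝ ρ x X • f x)
      (volume.restrict (U : Set (Fin k → ℝ))) :=
    integrableOn_smul_of_tsupport_subset (l1 h.1 hρ') h1.continuous h2 h3
  have i2 : Integrable (fun x => ρ x • fderiv ℝ φ x X • f x)
      (volume.restrict (U : Set (Fin k → ℝ))) := by
    simp only [smul_comm (ρ _)]
    exact integrable_fderiv_smul (l1 h.1 hρ) h1 h2 h3
  have i3 : Integrable (fun x => φ x • ρ x • g x)
      (volume.restrict (U : Set (Fin k → ℝ))) :=
    integrableOn_smul_of_tsupport_subset (l1 h.2.1 hρ) h1.continuous h2 h3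
  rw [integral_add i1 i2] at e
  simp only [smul_add]
  rw [integral_add i3 i1]
  simp only [smul_comm (ρ _)] at e i2 i3 ⊢
  rw [neg_add, ← e]
  abel

theorem of_contDiff [CompleteSpace F] (hf : ContDiff ℝ 1 f) :
    HasWeakDirDeriv U X f (fun x => fderiv ℝ f x X) := by
  have hf' : Continuous (fun x => fderiv ℝ f x X) :=
    (hf.continuous_fderiv (by norm_num)).clm_apply continuous_const
  rw [hasWeakDirDeriv_iff]
  refine ⟨hf.continuous.locallyIntegrable.locallyIntegrableOn _,
    hf'.locallyIntegrable.locallyIntegrableOn _, fun φ h1 h2 h3 => ?_⟩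
  rw [setIntegral_eq_integral_of_forall_compl_eq_zero,
      setIntegral_eq_integral_of_forall_compl_eq_zero]
  · have := integral_smul_fderiv_eq_neg_fderiv_smul_of_integrable (μ := volume) (f := φ) (g := f)
      (v := X) ?_ ?_ ?_ (fun x _ => h1.differentiable (by simp) x)
      (fun x _ => hf.differentiable (by norm_num) x)
    · rw [this, neg_neg]
    · exact ((fderiv_apply_contDiff h1 X).continuous.smul hf.continuous).integrable_of_hasCompactSupport
        (fderiv_apply_hasCompactSupport h2 X).smul_right
    · exact (h1.continuous.smul hf').integrable_of_hasCompactSupport h2.smul_right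
    · exact (h1.continuous.smul hf.continuous).integrable_of_hasCompactSupport h2.smul_right
  · intro x hx
    rw [image_eq_zero_of_notMem_tsupport (fun hh => hx (h3 hh)), zero_smul]
  · intro x hx
    rw [image_eq_zero_of_notMem_tsupport
      (fun hh => hx (h3 (fderiv_apply_tsupport_subset φ X hh))), zero_smul]

end HasWeakDirDeriv

/-! ### Classical multi-derivatives -/

theorem fderiv_apply_comm {φ : (Fin k → ℝ) → ℝ} (h : ContDiff ℝ ∞ φ) (X Y : Fin k → ℝ) :
    (fun x => fderiv ℝ (fun y => fderiv ℝ φ y X) x Y) =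
      fun x => fderiv ℝ (fun y => fderiv ℝ φ y Y) x X := by
  funext x
  have hd : DifferentiableAt ℝ (fderiv ℝ φ) x :=
    (h.fderiv_right (m := ∞) (by simp)).differentiable (by simp) x
  have hs : IsSymmSndFDerivAt ℝ φ x := h.contDiffAt.isSymmSndFDerivAt (by simp only [minSmoothness_of_isRCLikeNormedField]; norm_cast)
  rw [fderiv_clm_apply hd (by fun_prop), fderiv_clm_apply hd (by fun_prop)]
  simpa using hs Y X

theorem iterate_fderiv_contDiff {φ : (Fin k → ℝ) → ℝ} (h : ContDiff ℝ ∞ φ) (X : Fin k → ℝ)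
    (n : ℕ) : ContDiff ℝ ∞ ((fun (χ : (Fin k → ℝ) → ℝ) x => fderiv ℝ χ x X)^[n] φ) := by
  induction n with
  | zero => exact h
  | succ n ih =>
    rw [Function.iterate_succ_apply']
    exact fderiv_apply_contDiff ih X

theorem iterate_fderiv_comm {φ : (Fin k → ℝ) → ℝ} (h : ContDiff ℝ ∞ φ) (X Y : Fin k → ℝ)
    (n : ℕ) : (fun (χ : (Fin k → ℝ) → ℝ) x => fderiv ℝ χ x X)^[n] (fun x => fderiv ℝ φ x Y) =
      fun x => fderiv ℝ ((fun (χ : (Fin k → ℝ) → ℝ) x => fderiv ℝ χ x X)^[n] φ) x Y := by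
  induction n with
  | zero => rfl
  | succ n ih =>
    rw [Function.iterate_succ_apply', Function.iterate_succ_apply', ih]
    exact fderiv_apply_comm (iterate_fderiv_contDiff h X n) Y X

/-- The iterated partial derivatives along the indices in a list. -/
def listDeriv (α : Fin k → ℕ) (l : List (Fin k)) (φ : (Fin k → ℝ) → ℝ) : (Fin k → ℝ) → ℝ :=
  l.foldr (fun i ψ => (fun (χ : (Fin k → ℝ) → ℝ) x => fderiv ℝ χ x (coordVec i))^[α i] ψ) φ

theorem listDeriv_contDiff (α : Fin k → ℕ) (l : List (Fin k)) {φ : (Fin k → ℝ) → ℝ}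
    (h : ContDiff ℝ ∞ φ) : ContDiff ℝ ∞ (listDeriv α l φ) := by
  induction l with
  | nil => exact h
  | cons a l ih => exact iterate_fderiv_contDiff ih _ _

theorem listDeriv_tsupport_subset (α : Fin k → ℕ) (l : List (Fin k)) (φ : (Fin k → ℝ) → ℝ) :
    tsupport (listDeriv α l φ) ⊆ tsupport φ := by
  induction l with
  | nil => exact subset_rfl
  | cons a l ih =>
    refine Set.Subset.trans ?_ ih
    change tsupport ((fun (χ : (Fin k → ℝ) → ℝ) x => fderiv ℝ χ x (coordVec a))^[α a]
      (listDeriv α l φ)) ⊆ _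
    induction α a with
    | zero => exact subset_rfl
    | succ n ih' =>
      rw [Function.iterate_succ_apply']
      exact (fderiv_apply_tsupport_subset _ _).trans ih'

theorem listDeriv_congr {α α' : Fin k → ℕ} {l : List (Fin k)} (h : ∀ i ∈ l, α i = α' i)
    (φ : (Fin k → ℝ) → ℝ) : listDeriv α l φ = listDeriv α' l φ := by
  induction l with
  | nil => rfl
  | cons a l ih =>
    simp only [listDeriv, List.foldr_cons] at ih ⊢
    rw [ih fun i hi => h i (List.mem_cons_of_mem a hi), h a List.mem_cons_self]

/-- The extra derivative appears at the position of i in the list and has to be moved outwards past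
the derivatives in the preceding indices. These commute with it by symmetry of second derivatives.
-/
theorem listDeriv_add_single (α : Fin k → ℕ) (i : Fin k) {l : List (Fin k)} (hl : l.Nodup)
    (hi : i ∈ l) {φ : (Fin k → ℝ) → ℝ} (h : ContDiff ℝ ∞ φ) :
    listDeriv (α + Pi.single i 1) l φ =
      fun x => fderiv ℝ (listDeriv α l φ) x (coordVec i) := by
  induction l with
  | nil => simp at hi
  | cons a l ih =>
    rw [List.nodup_cons] at hl
    by_cases hai : a = i
    · subst hai
      have e : listDeriv (α + Pi.single a 1) l φ = listDeriv α l φ := by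
        refine listDeriv_congr (fun j hj => ?_) φ
        have : j ≠ a := fun hh => hl.1 (hh ▸ hj)
        simp [this]
      change (fun (χ : (Fin k → ℝ) → ℝ) x => fderiv ℝ χ x (coordVec a))^[(α + Pi.single a 1 : Fin k → ℕ) a]
        (listDeriv (α + Pi.single a 1) l φ) = _
      rw [e]
      simp only [Pi.add_apply, Pi.single_eq_same, Function.iterate_succ_apply']
      rfl
    · have hil : i ∈ l := (List.mem_cons.1 hi).resolve_left (fun hh => hai hh.symm)
      change (fun (χ : (Fin k → ℝ) → ℝ) x => fderiv ℝ χ x (coordVec a))^[(α + Pi.single i 1 : Fin k → ℕ) a]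
        (listDeriv (α + Pi.single i 1) l φ) = _
      rw [ih hl.2 hil]
      simp only [Pi.add_apply, Pi.single_eq_of_ne hai, add_zero]
      exact iterate_fderiv_comm (listDeriv_contDiff α l h) _ _ _

theorem multiDeriv_add_single (α : Fin k → ℕ) (i : Fin k) {φ : (Fin k → ℝ) → ℝ}
    (h : ContDiff ℝ ∞ φ) :
    multiDeriv (α + Pi.single i 1) φ = fun x => fderiv ℝ (multiDeriv α φ) x (coordVec i) :=
  listDeriv_add_single α i (List.nodup_finRange k) (List.mem_finRange i) h

theorem multiDeriv_zero (φ : (Fin k → ℝ) → ℝ) : multiDeriv 0 φ = φ := by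
  have : ∀ l : List (Fin k), listDeriv 0 l φ = φ := by
    intro l
    induction l with
    | nil => rfl
    | cons a l ih => exact ih
  exact this _

theorem multiDeriv_contDiff (α : Fin k → ℕ) {φ : (Fin k → ℝ) → ℝ}
    (h : ContDiff ℝ ∞ φ) : ContDiff ℝ ∞ (multiDeriv α φ) := listDeriv_contDiff α _ h

theorem multiDeriv_tsupport_subset (α : Fin k → ℕ) (φ : (Fin k → ℝ) → ℝ) :
    tsupport (multiDeriv α φ) ⊆ tsupport φ := listDeriv_tsupport_subset α _ φ

theorem multiDeriv_hasCompactSupport (α : Fin k → ℕ) {φ : (Fin k → ℝ) → ℝ}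
    (h : HasCompactSupport φ) : HasCompactSupport (multiDeriv α φ) :=
  h.mono' ((subset_tsupport _).trans (multiDeriv_tsupport_subset α φ))

namespace HasWeakDeriv

variable {U : Opens (Fin k → ℝ)} {α : Fin k → ℕ} {f f' g g' h : (Fin k → ℝ) → F}

theorem unique [CompleteSpace F] (h : HasWeakDeriv U α f g) (h' : HasWeakDeriv U α f g') :
    g =ᵐ[volume.restrict (U : Set (Fin k → ℝ))] g' := by
  have key : ∀ᵐ x, x ∈ (U : Set (Fin k → ℝ)) → (g x - g' x) = 0 := by
    refine U.isOpen.ae_eq_zero_of_integral_contDiff_smul_eq_zero (h.2.1.sub h'.2.1) ?_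
    intro φ h1 h2 h3
    have e1 := (hasWeakDeriv_iff.1 h).2.2 φ h1 h2 h3
    have e2 := (hasWeakDeriv_iff.1 h').2.2 φ h1 h2 h3
    rw [e1] at e2
    replace e2 := (IsUnit.smul_left_cancel
      (isUnit_iff_ne_zero.2 (pow_ne_zero _ (by norm_num : (-1 : ℝ) ≠ 0)))).1 e2
    have e3 : ∫ x in (U : Set (Fin k → ℝ)), φ x • (g x - g' x) = 0 := by
      simp only [smul_sub]
      rw [integral_sub (integrableOn_smul_of_tsupport_subset h.2.1 h1.continuous h2 h3)
        (integrableOn_smul_of_tsupport_subset h'.2.1 h1.continuous h2 h3), e2, sub_self]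
    rwa [setIntegral_eq_integral_of_forall_compl_eq_zero] at e3
    intro x hx
    rw [image_eq_zero_of_notMem_tsupport (fun hh => hx (h3 hh)), zero_smul]
  rw [Filter.EventuallyEq, ae_restrict_iff' U.isOpen.measurableSet]
  filter_upwards [key] with x hx hU using sub_eq_zero.1 (hx hU)

theorem zero_self (hf : LocallyIntegrableOn f U) : HasWeakDeriv U 0 f f :=
  ⟨hf, hf, fun φ => by simp [multiDeriv_zero]⟩

theorem single_iff {i : Fin k} :
    HasWeakDeriv U (Pi.single i 1) f g ↔ HasWeakDirDeriv U (coordVec i) f g := by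
  rw [hasWeakDirDeriv_iff, hasWeakDeriv_iff]
  refine and_congr_right fun _ => and_congr_right fun _ => forall_congr' fun φ =>
    forall_congr' fun h1 => forall_congr' fun h2 => forall_congr' fun h3 => ?_
  have : multiDeriv (Pi.single i 1) φ = fun x => fderiv ℝ φ x (coordVec i) := by
    have := multiDeriv_add_single 0 i h1
    rwa [zero_add, multiDeriv_zero] at this
  rw [this]
  simp

/-- A derivative of a test function is again a test function, so one first-order derivative can be
peeled off a multi-index derivative. This connects the multi-index definition with the recursive
classes `SobBd`. -/
theorem iff_of_dirDeriv {i : Fin k} (hf : HasWeakDirDeriv U (coordVec i) f g)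
    (hh : LocallyIntegrableOn h U) :
    HasWeakDeriv U (α + Pi.single i 1) f h ↔ HasWeakDeriv U α g h := by
  rw [hasWeakDirDeriv_iff] at hf
  rw [hasWeakDeriv_iff, hasWeakDeriv_iff]
  refine ⟨fun ⟨_, _, h3⟩ => ⟨hf.2.1, hh, fun φ p1 p2 p3 => ?_⟩,
    fun ⟨_, _, h3⟩ => ⟨hf.1, hh, fun φ p1 p2 p3 => ?_⟩⟩
  · have e := h3 φ p1 p2 p3
    rw [multiDeriv_add_single α i p1, hf.2.2 _ (multiDeriv_contDiff α p1)
      (multiDeriv_hasCompactSupport α p2) ((multiDeriv_tsupport_subset α φ).trans p3)] at e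
    rw [← neg_inj, e]
    simp [Finset.sum_add_distrib, pow_succ]
  · have e := h3 φ p1 p2 p3
    rw [multiDeriv_add_single α i p1, hf.2.2 _ (multiDeriv_contDiff α p1)
      (multiDeriv_hasCompactSupport α p2) ((multiDeriv_tsupport_subset α φ).trans p3), e]
    simp [Finset.sum_add_distrib, pow_succ]

end HasWeakDeriv

end WeakCalculus
/-! ### Bounded Sobolev classes -/

section SobolevClass

open scoped ENNReal NNReal

variable {k : ℕ} {F : Type*} [NormedAddCommGroup F] [NormedSpace ℝ F]

/-- The inductive form of the Sobolev classes: all `θ^p f` with `p ≤ κ s` have `L²` norm at most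
`M`, and the first order weak derivatives are in the class of order `s - 1`. The class is
unweighted for `κ = 0`, and weighted for `κ = 1`. -/
def SobBd (κ : ℕ) (U : Opens (Fin (k + 1) → ℝ)) : ℕ → ℝ≥0∞ → ((Fin (k + 1) → ℝ) → F) → Prop
  | 0, M, f => MemLp f 2 (volume.restrict U) ∧ eLpNorm f 2 (volume.restrict U) ≤ M
  | s + 1, M, f => (∀ p ≤ κ * (s + 1),
      MemLp (fun x => x (Fin.last k) ^ p • f x) 2 (volume.restrict U) ∧
        eLpNorm (fun x => x (Fin.last k) ^ p • f x) 2 (volume.restrict U) ≤ M) ∧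
      ∀ i, ∃ g, HasWeakDirDeriv U (coordVec i) f g ∧ SobBd κ U s M g

namespace SobBd

variable {κ : ℕ} {U : Opens (Fin (k + 1) → ℝ)} {s : ℕ} {M M' : ℝ≥0∞}
  {f f' g : (Fin (k + 1) → ℝ) → F}

theorem weight (h : SobBd κ U s M f) {p : ℕ} (hp : p ≤ κ * s) :
    MemLp (fun x => x (Fin.last k) ^ p • f x) 2 (volume.restrict U) ∧
        eLpNorm (fun x => x (Fin.last k) ^ p • f x) 2 (volume.restrict U) ≤ M := by
  cases s with
  | zero =>
    obtain rfl : p = 0 := by simpa using hp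
    simpa [SobBd] using h
  | succ s => exact h.1 p hp

theorem memLp (h : SobBd κ U s M f) : MemLp f 2 (volume.restrict U) := by
  simpa using (h.weight (p := 0) (Nat.zero_le _)).1

theorem norm_le (h : SobBd κ U s M f) : eLpNorm f 2 (volume.restrict U) ≤ M := by
  simpa using (h.weight (p := 0) (Nat.zero_le _)).2

theorem zero_iff : SobBd κ U 0 M f ↔
    MemLp f 2 (volume.restrict U) ∧ eLpNorm f 2 (volume.restrict U) ≤ M := Iff.rfl

theorem congr (h : SobBd κ U s M f) (hf : f =ᵐ[volume.restrict (U : Set (Fin (k + 1) → ℝ))] f') :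
    SobBd κ U s M f' := by
  have aux : ∀ p : ℕ, (fun x => x (Fin.last k) ^ p • f x)
      =ᵐ[volume.restrict (U : Set (Fin (k + 1) → ℝ))] (fun x => x (Fin.last k) ^ p • f' x) :=
    fun p => hf.mono fun x hx => by simp only [hx]
  cases s with
  | zero => exact ⟨(memLp_congr_ae hf).1 h.1, (eLpNorm_congr_ae hf).symm.le.trans h.2⟩
  | succ s =>
    refine ⟨fun p hp => ⟨(memLp_congr_ae (aux p)).1 (h.1 p hp).1,
      (eLpNorm_congr_ae (aux p)).symm.le.trans (h.1 p hp).2⟩, fun i => ?_⟩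
    obtain ⟨g, hg, hg'⟩ := h.2 i
    exact ⟨g, hg.congr hf EventuallyEq.rfl, hg'⟩

theorem mono_bound (h : SobBd κ U s M f) (hM : M ≤ M') : SobBd κ U s M' f := by
  induction s generalizing f with
  | zero => exact ⟨h.1, h.2.trans hM⟩
  | succ s ih =>
    refine ⟨fun p hp => ⟨(h.1 p hp).1, (h.1 p hp).2.trans hM⟩, fun i => ?_⟩
    obtain ⟨g, hg, hg'⟩ := h.2 i
    exact ⟨g, hg, ih hg'⟩

theorem of_succ (h : SobBd κ U (s + 1) M f) : SobBd κ U s M f := by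
  induction s generalizing f with
  | zero => exact ⟨h.memLp, h.norm_le⟩
  | succ s ih =>
    refine ⟨fun p hp => h.1 p (hp.trans (by gcongr; simp)), fun i => ?_⟩
    obtain ⟨g, hg, hg'⟩ := h.2 i
    exact ⟨g, hg, ih hg'⟩

theorem mono_order {s' : ℕ} (h : SobBd κ U s M f) (hs : s' ≤ s) : SobBd κ U s' M f := by
  induction s, hs using Nat.le_induction with
  | base => exact h
  | succ s hs ih => exact ih h.of_succ

theorem unweighted (h : SobBd κ U s M f) : SobBd 0 U s M f := by
  induction s generalizing f with
  | zero => exact h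
  | succ s ih =>
    refine ⟨fun p hp => h.1 p (hp.trans (by simp)), fun i => ?_⟩
    obtain ⟨g, hg, hg'⟩ := h.2 i
    exact ⟨g, hg, ih hg'⟩

theorem zero (κ : ℕ) (U : Opens (Fin (k + 1) → ℝ)) (s : ℕ) (M : ℝ≥0∞) :
    SobBd κ U s M (fun _ => (0 : F)) := by
  induction s with
  | zero => exact ⟨by simp, by simp⟩
  | succ s ih =>
    exact ⟨fun p _ => by simp, fun i => ⟨_, HasWeakDirDeriv.zero, ih⟩⟩

theorem add (h : SobBd κ U s M f) (h' : SobBd κ U s M' f') :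
    SobBd κ U s (M + M') (fun x => f x + f' x) := by
  induction s generalizing f f' with
  | zero =>
    exact ⟨h.1.add h'.1, (eLpNorm_add_le h.1.1 h'.1.1 (by norm_num)).trans (add_le_add h.2 h'.2)⟩
  | succ s ih =>
    refine ⟨fun p hp => ?_, fun i => ?_⟩
    · simp only [smul_add]
      exact ⟨(h.1 p hp).1.add (h'.1 p hp).1, (eLpNorm_add_le (h.1 p hp).1.1 (h'.1 p hp).1.1
        (by norm_num)).trans (add_le_add (h.1 p hp).2 (h'.1 p hp).2)⟩
    · obtain ⟨g, hg, hg1⟩ := h.2 i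
      obtain ⟨g', hg', hg1'⟩ := h'.2 i
      exact ⟨_, hg.add hg', ih hg1 hg1'⟩

theorem clm_comp [CompleteSpace F] {F' : Type*} [NormedAddCommGroup F'] [NormedSpace ℝ F']
    [CompleteSpace F'] (L : F →L[ℝ] F') (h : SobBd κ U s M f) :
    SobBd κ U s (‖L‖₊ * M) (fun x => L (f x)) := by
  have aux : ∀ {u : (Fin (k + 1) → ℝ) → F}, MemLp u 2 (volume.restrict U) ∧
      eLpNorm u 2 (volume.restrict U) ≤ M → MemLp (fun x => L (u x)) 2 (volume.restrict U) ∧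
      eLpNorm (fun x => L (u x)) 2 (volume.restrict U) ≤ ‖L‖₊ * M := by
    intro u hu
    refine ⟨L.comp_memLp' hu.1, ?_⟩
    refine (eLpNorm_le_nnreal_smul_eLpNorm_of_ae_le_mul (c := ‖L‖₊)
      (Eventually.of_forall fun x => L.le_opNNNorm _) 2).trans ?_
    rw [ENNReal.smul_def, smul_eq_mul]
    gcongr
    exact hu.2
  induction s generalizing f with
  | zero => exact aux h
  | succ s ih =>
    refine ⟨fun p hp => ?_, fun i => ?_⟩
    · simpa only [map_smul] using aux (h.1 p hp)
    · obtain ⟨g, hg, hg'⟩ := h.2 i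
      exact ⟨_, hg.clm_comp L, ih hg'⟩

theorem const_smul (c : ℝ) (h : SobBd κ U s M f) :
    SobBd κ U s (‖c‖₊ * M) (fun x => c • f x) := by
  have aux : ∀ {u : (Fin (k + 1) → ℝ) → F}, MemLp u 2 (volume.restrict U) ∧
      eLpNorm u 2 (volume.restrict U) ≤ M → MemLp (fun x => c • u x) 2 (volume.restrict U) ∧
      eLpNorm (fun x => c • u x) 2 (volume.restrict U) ≤ ‖c‖₊ * M := by
    intro u hu
    refine ⟨hu.1.const_smul c, ?_⟩
    refine (eLpNorm_const_smul_le (c := c) (f := u)).trans ?_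
    gcongr
    · exact le_rfl
    · exact hu.2
  induction s generalizing f with
  | zero => exact aux h
  | succ s ih =>
    refine ⟨fun p hp => ?_, fun i => ?_⟩
    · simpa only [smul_comm c] using aux (h.1 p hp)
    · obtain ⟨g, hg, hg'⟩ := h.2 i
      exact ⟨_, hg.const_smul c, ih hg'⟩

theorem restrict {V : Opens (Fin (k + 1) → ℝ)} (hV : V ≤ U) (h : SobBd κ U s M f) :
    SobBd κ V s M f := by
  have aux : ∀ {u : (Fin (k + 1) → ℝ) → F}, MemLp u 2 (volume.restrict U) ∧
      eLpNorm u 2 (volume.restrict U) ≤ M → MemLp u 2 (volume.restrict V) ∧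
      eLpNorm u 2 (volume.restrict V) ≤ M := fun {u} hu =>
    have hm : volume.restrict (V : Set (Fin (k + 1) → ℝ)) ≤ volume.restrict U :=
      Measure.restrict_mono hV le_rfl
    ⟨hu.1.mono_measure hm, (eLpNorm_mono_measure u hm).trans hu.2⟩
  induction s generalizing f with
  | zero => exact aux h
  | succ s ih =>
    refine ⟨fun p hp => aux (h.1 p hp), fun i => ?_⟩
    obtain ⟨g, hg, hg'⟩ := h.2 i
    exact ⟨g, hg.mono hV, ih hg'⟩

theorem deriv [CompleteSpace F] (h : SobBd κ U (s + 1) M f) {i : Fin (k + 1)}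
    (hg : HasWeakDirDeriv U (coordVec i) f g) : SobBd κ U s M g := by
  obtain ⟨g', hg', h'⟩ := h.2 i
  exact h'.congr (hg'.unique hg)

end SobBd

/-- All partial derivatives of order at most `s` of `ρ` are bounded by `A`. -/
def BddSmooth : ℕ → ℝ≥0 → ((Fin k → ℝ) → ℝ) → Prop
  | 0, A, ρ => ∀ x, ‖ρ x‖₊ ≤ A
  | s + 1, A, ρ => (∀ x, ‖ρ x‖₊ ≤ A) ∧
      ∀ i, BddSmooth s A (fun x => fderiv ℝ ρ x (coordVec i))

theorem BddSmooth.le {s : ℕ} {A : ℝ≥0} {ρ : (Fin k → ℝ) → ℝ} (h : BddSmooth s A ρ) (x : Fin k → ℝ) :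
    ‖ρ x‖₊ ≤ A := by
  cases s with
  | zero => exact h x
  | succ s => exact h.1 x

theorem BddSmooth.of_succ {s : ℕ} {A : ℝ≥0} {ρ : (Fin k → ℝ) → ℝ} (h : BddSmooth (s + 1) A ρ) :
    BddSmooth s A ρ := by
  induction s generalizing ρ with
  | zero => exact h.1
  | succ s ih => exact ⟨h.1, fun i => ih (h.2 i)⟩

theorem BddSmooth.mono_bound {s : ℕ} {A A' : ℝ≥0} {ρ : (Fin k → ℝ) → ℝ} (h : BddSmooth s A ρ)
    (hA : A ≤ A') : BddSmooth s A' ρ := by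
  induction s generalizing ρ with
  | zero => exact fun x => (h x).trans hA
  | succ s ih => exact ⟨fun x => (h.1 x).trans hA, fun i => ih (h.2 i)⟩

theorem BddSmooth.const_mul {s : ℕ} {A : ℝ≥0} {ρ : (Fin k → ℝ) → ℝ} (c : ℝ)
    (hd : ContDiff ℝ ∞ ρ) (h : BddSmooth s A ρ) :
    BddSmooth s (‖c‖₊ * A) (fun x => c * ρ x) := by
  induction s generalizing ρ with
  | zero => intro x; rw [nnnorm_mul]; gcongr; exact h x
  | succ s ih =>
    refine ⟨fun x => ?_, fun i => ?_⟩
    · rw [nnnorm_mul]; gcongr; exact h.1 x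
    · have e : (fun x => fderiv ℝ (fun x => c * ρ x) x (coordVec i)) =
          fun x => c * fderiv ℝ ρ x (coordVec i) := by
        funext x
        rw [fderiv_const_mul (hd.differentiable (by simp) x)]
        simp
      rw [e]
      exact ih (fderiv_apply_contDiff hd _) (h.2 i)

/-- Each differentiation produces two terms by the product rule, whence the factor 2 ^ s. Both terms
carry the same constant, because `BddSmooth` bounds all derivatives of ρ by one A. -/
theorem SobBd.smul_smooth [CompleteSpace F] {κ : ℕ} {U : Opens (Fin (k + 1) → ℝ)} {s : ℕ}
    {M : ℝ≥0∞} {f : (Fin (k + 1) → ℝ) → F} {A : ℝ≥0} {ρ : (Fin (k + 1) → ℝ) → ℝ}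
    (hd : ContDiff ℝ ∞ ρ) (hρ : BddSmooth s A ρ) (h : SobBd κ U s M f) :
    SobBd κ U s (2 ^ s * (A * M)) (fun x => ρ x • f x) := by
  have aux : ∀ {u : (Fin (k + 1) → ℝ) → F} {s : ℕ} {ρ : (Fin (k + 1) → ℝ) → ℝ},
      ContDiff ℝ ∞ ρ → BddSmooth s A ρ → MemLp u 2 (volume.restrict U) ∧
      eLpNorm u 2 (volume.restrict U) ≤ M → MemLp (fun x => ρ x • u x) 2 (volume.restrict U) ∧
      eLpNorm (fun x => ρ x • u x) 2 (volume.restrict U) ≤ A * M := by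
    intro u s ρ hd hρ hu
    have hle : ∀ x, ‖ρ x • u x‖₊ ≤ A * ‖u x‖₊ := fun x => by
      rw [nnnorm_smul]
      gcongr
      exact hρ.le x
    refine ⟨hu.1.of_le_mul (c := A) (hd.continuous.aestronglyMeasurable.smul hu.1.1)
      (Eventually.of_forall fun x => by exact_mod_cast hle x), ?_⟩
    refine (eLpNorm_le_nnreal_smul_eLpNorm_of_ae_le_mul (c := A)
      (Eventually.of_forall hle) 2).trans ?_
    rw [ENNReal.smul_def, smul_eq_mul]
    gcongr
    exact hu.2
  induction s generalizing f ρ with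
  | zero =>
    rw [pow_zero, one_mul]
    exact aux hd hρ h
  | succ s ih =>
    have hpow : (A : ℝ≥0∞) * M ≤ 2 ^ (s + 1) * (A * M) := by
      conv_lhs => rw [← one_mul ((A : ℝ≥0∞) * M)]
      gcongr
      exact one_le_pow₀ (by norm_num)
    refine ⟨fun p hp => ?_, fun i => ?_⟩
    · have := aux hd hρ (h.1 p hp)
      simp only [smul_comm (ρ _)] at this
      exact ⟨this.1, this.2.trans hpow⟩
    · obtain ⟨g, hg, hg'⟩ := h.2 i
      refine ⟨_, hg.smul_smooth hd, ?_⟩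
      have := (ih hd hρ.of_succ hg').add (ih (fderiv_apply_contDiff hd _) (hρ.2 i) h.of_succ)
      refine this.mono_bound ?_
      rw [pow_succ, mul_comm (2 ^ s) 2, mul_assoc, two_mul]

theorem SobBd.smul_smooth_top [CompleteSpace F] {κ : ℕ} {U : Opens (Fin (k + 1) → ℝ)} {s : ℕ}
    {f : (Fin (k + 1) → ℝ) → F} {A : ℝ≥0} {ρ : (Fin (k + 1) → ℝ) → ℝ}
    (hd : ContDiff ℝ ∞ ρ) (hρ : BddSmooth s A ρ) (h : SobBd κ U s ⊤ f) :
    SobBd κ U s ⊤ (fun x => ρ x • f x) := (h.smul_smooth hd hρ).mono_bound le_top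

/-- A function of one coordinate with compact support has bounded derivatives. -/
theorem BddSmooth.of_coord (j : Fin k) (s : ℕ) {q : ℝ → ℝ} (hq : ContDiff ℝ ∞ q)
    (hc : HasCompactSupport q) : ∃ A, ∀ R : ℝ, 1 ≤ R →
      BddSmooth s A (fun x : Fin k → ℝ => q (R⁻¹ * x j)) := by
  induction s generalizing q with
  | zero =>
    obtain ⟨C, hC⟩ := hq.continuous.bounded_above_of_compact_support hc
    refine ⟨C.toNNReal, fun R _ x => ?_⟩
    rw [← norm_toNNReal]
    exact Real.toNNReal_le_toNNReal (hC _)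
  | succ s ih =>
    obtain ⟨C, hC⟩ := hq.continuous.bounded_above_of_compact_support hc
    have hq' : ContDiff ℝ ∞ (deriv q) := by
      have := hq.iterate_deriv 1
      simpa using this
    obtain ⟨A, hA⟩ := ih hq' hc.deriv
    refine ⟨max C.toNNReal A, fun R hR => ⟨fun x => ?_, fun i => ?_⟩⟩
    · rw [← norm_toNNReal]
      exact (Real.toNNReal_le_toNNReal (hC _)).trans (le_max_left _ _)
    · have e : ∀ x : Fin k → ℝ, HasFDerivAt (fun x : Fin k → ℝ => q (R⁻¹ * x j))
          ((deriv q (R⁻¹ * x j)) • (R⁻¹ • (ContinuousLinearMap.proj j : (Fin k → ℝ) →L[ℝ] ℝ))) x := by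
        intro x
        refine HasDerivAt.comp_hasFDerivAt x ((hq.differentiable (by simp) _).hasDerivAt) ?_
        exact (ContinuousLinearMap.proj j : (Fin k → ℝ) →L[ℝ] ℝ).hasFDerivAt.const_mul R⁻¹
      have e' : (fun x : Fin k → ℝ => fderiv ℝ (fun x : Fin k → ℝ => q (R⁻¹ * x j)) x (coordVec i))
          = fun x => (R⁻¹ * (coordVec i : Fin k → ℝ) j) * deriv q (R⁻¹ * x j) := by
        funext x
        rw [(e x).fderiv]
        simp [mul_comm]
      rw [e']
      have h0 : ContDiff ℝ ∞ (fun x : Fin k → ℝ => deriv q (R⁻¹ * x j)) :=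
        hq'.comp (contDiff_const.mul (contDiff_apply ℝ ℝ j))
      refine (BddSmooth.const_mul _ h0 (hA R hR)).mono_bound ?_
      refine le_trans ?_ (le_max_right _ _)
      -- The chain rule contributes the factor R⁻¹ ≤ 1; this makes the bound uniform over all
      -- dilations with R ≥ 1.
      have : ‖R⁻¹ * (coordVec i : Fin k → ℝ) j‖₊ ≤ 1 := by
        rw [nnnorm_mul]
        refine mul_le_one' ?_ ?_
        · rw [nnnorm_inv]
          refine inv_le_one_of_one_le₀ ?_
          rw [← NNReal.coe_le_coe, coe_nnnorm, Real.norm_of_nonneg (by linarith)]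
          exact hR
        · by_cases hij : j = i
          · subst hij; simp [coordVec]
          · simp [coordVec, hij]
      calc _ ≤ 1 * A := by gcongr
        _ = A := one_mul A

/-! ### Comparison with the multi-index definition -/

section MultiIndex

variable [CompleteSpace F] {U : Opens (Fin (k + 1) → ℝ)}

/-- Replacing α by α + e_i costs one unit of p + |α|, so the first derivatives inherit the
hypothesis at order s - 1 and the recursion closes. -/
theorem sobBd_of_hasWeakDeriv {s : ℕ} {M : ℝ≥0∞} {f : (Fin (k + 1) → ℝ) → F}
    (h : ∀ (p : ℕ) (α : Fin (k + 1) → ℕ), p + ∑ i, α i ≤ s →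
      ∃ g, HasWeakDeriv U α f g ∧
        MemLp (fun x => x (Fin.last k) ^ p • g x) 2 (volume.restrict U) ∧
        eLpNorm (fun x => x (Fin.last k) ^ p • g x) 2 (volume.restrict U) ≤ M) :
    SobBd 1 U s M f := by
  have base : ∀ p ≤ s, MemLp (fun x => x (Fin.last k) ^ p • f x) 2 (volume.restrict U) ∧
        eLpNorm (fun x => x (Fin.last k) ^ p • f x) 2 (volume.restrict U) ≤ M := by
    intro p hp
    obtain ⟨g, hg, hg1⟩ := h p 0 (by simpa using hp)
    have e := hg.unique (HasWeakDeriv.zero_self hg.1)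
    have e' : (fun x => x (Fin.last k) ^ p • g x)
      =ᵐ[volume.restrict (U : Set (Fin (k + 1) → ℝ))] (fun x => x (Fin.last k) ^ p • f x) :=
      e.mono fun x hx => by simp only [hx]
    rwa [memLp_congr_ae e', eLpNorm_congr_ae e'] at hg1
  induction s generalizing f with
  | zero => simpa [SobBd] using base 0 le_rfl
  | succ s ih =>
    refine ⟨fun p hp => base p (by simpa using hp), fun i => ?_⟩
    obtain ⟨g, hg, hg1⟩ := h 0 (Pi.single i 1) (by simp)
    have hg' := HasWeakDeriv.single_iff.1 hg
    have h2 : ∀ (p : ℕ) (α : Fin (k + 1) → ℕ), p + ∑ i, α i ≤ s →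
      ∃ g', HasWeakDeriv U α g g' ∧
        MemLp (fun x => x (Fin.last k) ^ p • g' x) 2 (volume.restrict U) ∧
        eLpNorm (fun x => x (Fin.last k) ^ p • g' x) 2 (volume.restrict U) ≤ M := by
      intro p α hpα
      obtain ⟨g', hg', hg1'⟩ := h p (α + Pi.single i 1) (by
        simp only [Pi.add_apply, Finset.sum_add_distrib, Finset.sum_pi_single',
          Finset.mem_univ, if_true]
        omega)
      exact ⟨g', (HasWeakDeriv.iff_of_dirDeriv (HasWeakDeriv.single_iff.1 hg) hg'.2.1).1 hg', hg1'⟩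
    refine ⟨g, hg', ih h2 fun p hp => ?_⟩
    obtain ⟨g2, hg2, hg3⟩ := h2 p 0 (by simpa using hp)
    have e := hg2.unique (HasWeakDeriv.zero_self hg2.1)
    have e' : (fun x => x (Fin.last k) ^ p • g2 x)
      =ᵐ[volume.restrict (U : Set (Fin (k + 1) → ℝ))] (fun x => x (Fin.last k) ^ p • g x) :=
      e.mono fun x hx => by simp only [hx]
    rwa [memLp_congr_ae e', eLpNorm_congr_ae e'] at hg3

theorem SobBd.hasWeakDeriv {s : ℕ} {M : ℝ≥0∞} {f : (Fin (k + 1) → ℝ) → F}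
    (h : SobBd 1 U s M f) (p : ℕ) (α : Fin (k + 1) → ℕ) (hp : p + ∑ i, α i ≤ s) :
    ∃ g, HasWeakDeriv U α f g ∧
      MemLp (fun x => x (Fin.last k) ^ p • g x) 2 (volume.restrict U) := by
  induction s generalizing f α with
  | zero =>
    obtain rfl : α = 0 := by
      funext i
      have := Finset.single_le_sum (f := α) (fun _ _ => Nat.zero_le _) (Finset.mem_univ i)
      simp only [Pi.zero_apply]; omega
    obtain rfl : p = 0 := by omega
    exact ⟨f, HasWeakDeriv.zero_self (MemLp.locallyIntegrableOn_opens h.memLp),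
      by simpa using h.memLp⟩
  | succ s ih =>
    by_cases hα : α = 0
    · subst hα
      exact ⟨f, HasWeakDeriv.zero_self (MemLp.locallyIntegrableOn_opens h.memLp),
        (h.weight (by simpa using hp)).1⟩
    · obtain ⟨i, hi⟩ := Function.ne_iff.1 hα
      obtain ⟨α', rfl⟩ : ∃ α' : Fin (k + 1) → ℕ, α = α' + Pi.single i 1 := by
        refine ⟨Function.update α i (α i - 1), funext fun j => ?_⟩
        rw [Pi.add_apply]
        by_cases hj : j = i
        · subst hj
          have hi' : α j ≠ 0 := hi
          rw [Function.update_self, Pi.single_eq_same]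
          omega
        · rw [Function.update_of_ne hj, Pi.single_eq_of_ne hj, add_zero]
      obtain ⟨g, hg, hg'⟩ := h.2 i
      obtain ⟨g', h1, h2⟩ := ih hg' α' (by
        simp only [Pi.add_apply, Finset.sum_add_distrib, Finset.sum_pi_single',
          Finset.mem_univ, if_true] at hp
        omega)
      exact ⟨g', (HasWeakDeriv.iff_of_dirDeriv hg h1.2.1).2 h1, h2⟩

theorem memGamma_iff {s : ℕ} {f : (Fin (k + 1) → ℝ) → F} :
    MemGamma U s f ↔ SobBd 1 U s ⊤ f ∧
      ∀ᵐ x ∂(volume.restrict (U : Set (Fin (k + 1) → ℝ))), x 0 < 0 → f x = 0 := by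
  refine and_congr_left fun _ => ⟨fun h => ?_, fun h p α hp => h.hasWeakDeriv p α hp⟩
  refine sobBd_of_hasWeakDeriv fun p α hp => ?_
  obtain ⟨g, h1, h2⟩ := h p α hp
  exact ⟨g, h1, h2, le_top⟩

/-- Every single L² norm is one term of the sum of nonnegative terms defining `normGamma`. The
representative chosen there agrees almost everywhere with the given derivative by uniqueness. -/
theorem MemGamma.sobBd_of_norm_le {s : ℕ} {f : (Fin (k + 1) → ℝ) → F} (h : MemGamma U s f) {δ : ℝ}
    (hδ : normGamma U s f ≤ δ) : SobBd 1 U s (ENNReal.ofReal δ) f := by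
  refine sobBd_of_hasWeakDeriv fun p α hp => ?_
  obtain ⟨g, h1, h2⟩ := h.1 p α hp
  refine ⟨g, h1, h2, ?_⟩
  have hw : HasWeakDeriv U α f (weakDeriv U α f) := by
    have hex : ∃ g, HasWeakDeriv U α f g := ⟨g, h1⟩
    rw [weakDeriv, dif_pos hex]
    exact hex.choose_spec
  have e : (fun x => x (Fin.last k) ^ p • weakDeriv U α f x)
      =ᵐ[volume.restrict (U : Set (Fin (k + 1) → ℝ))] (fun x => x (Fin.last k) ^ p • g x) :=
      (hw.unique h1).mono fun x hx => by simp only [hx]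
  rw [← ENNReal.ofReal_toReal h2.2.ne]
  refine ENNReal.ofReal_le_ofReal (le_trans ?_ hδ)
  rw [← eLpNorm_congr_ae e, normGamma]
  refine le_trans ?_ (Finset.single_le_sum (f := fun p => ∑ j ∈ Finset.range (s + 1 - p),
    ∑ α ∈ Finset.piAntidiag (Finset.univ : Finset (Fin (k + 1))) j,
      (eLpNorm (fun x => x (Fin.last k) ^ p • weakDeriv U α f x) 2 (volume.restrict U)).toReal)
      (fun _ _ => by positivity) (Finset.mem_range.2 (by omega : p < s + 1)))
  refine le_trans ?_ (Finset.single_le_sum (f := fun j =>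
    ∑ α ∈ Finset.piAntidiag (Finset.univ : Finset (Fin (k + 1))) j,
      (eLpNorm (fun x => x (Fin.last k) ^ p • weakDeriv U α f x) 2 (volume.restrict U)).toReal)
      (fun _ _ => by positivity) (Finset.mem_range.2 (by omega : ∑ i, α i < s + 1 - p)))
  exact Finset.single_le_sum (f := fun α =>
      (eLpNorm (fun x => x (Fin.last k) ^ p • weakDeriv U α f x) 2 (volume.restrict U)).toReal)
      (fun _ _ => by positivity) (Finset.mem_piAntidiag.2 ⟨rfl, fun _ _ => Finset.mem_univ _⟩)

end MultiIndex

end SobolevClass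
/-! ### Extension across the final time -/

section Extension

open scoped ENNReal NNReal

variable {k : ℕ} {F : Type*} [NormedAddCommGroup F] [NormedSpace ℝ F]

/-- The reflection `t ↦ T - r (t - T)` of the time coordinate. -/
def reflT (T r : ℝ) (x : Fin (k + 1) → ℝ) : Fin (k + 1) → ℝ :=
  Function.update x 0 (T - r * (x 0 - T))

theorem reflT_zero (T r : ℝ) (x : Fin (k + 1) → ℝ) : reflT T r x 0 = T - r * (x 0 - T) := by
  simp [reflT]

theorem reflT_of_ne (T r : ℝ) (x : Fin (k + 1) → ℝ) {i : Fin (k + 1)} (hi : i ≠ 0) :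
    reflT T r x i = x i := by
  simp [reflT, hi]

theorem reflT_reflT_inv (T : ℝ) {r : ℝ} (hr : r ≠ 0) (x : Fin (k + 1) → ℝ) :
    reflT T r (reflT T r⁻¹ x) = x := by
  funext i
  by_cases hi : i = 0
  · subst hi
    rw [reflT_zero, reflT_zero]
    field_simp
    ring
  · rw [reflT_of_ne _ _ _ hi, reflT_of_ne _ _ _ hi]

theorem reflT_contDiff (T r : ℝ) : ContDiff ℝ ∞ (reflT T r : (Fin (k + 1) → ℝ) → _) := by
  rw [contDiff_pi]
  intro i
  by_cases hi : i = 0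
  · subst hi
    simp only [reflT_zero]
    fun_prop
  · simp only [reflT_of_ne _ _ _ hi]
    fun_prop

/-- The reflection as a homeomorphism. -/
def reflHomeo (T : ℝ) {r : ℝ} (hr : r ≠ 0) : (Fin (k + 1) → ℝ) ≃ₜ (Fin (k + 1) → ℝ) where
  toFun := reflT T r
  invFun := reflT T r⁻¹
  left_inv x := by simpa using reflT_reflT_inv T (inv_ne_zero hr) x
  right_inv x := reflT_reflT_inv T hr x
  continuous_toFun := (reflT_contDiff T r).continuous
  continuous_invFun := (reflT_contDiff T r⁻¹).continuous

theorem reflT_measurableEmbedding (T : ℝ) {r : ℝ} (hr : r ≠ 0) :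
    MeasurableEmbedding (reflT T r : (Fin (k + 1) → ℝ) → _) :=
  (reflHomeo T hr).measurableEmbedding

theorem map_reflT_volume (T : ℝ) {r : ℝ} (hr : 0 < r) :
    Measure.map (reflT T r : (Fin (k + 1) → ℝ) → _) volume = ENNReal.ofReal r⁻¹ • volume := by
  set D : Fin (k + 1) → ℝ := Function.update 1 0 (-r) with hD
  set b : Fin (k + 1) → ℝ := Function.update 0 0 (T + r * T) with hb
  have hdet : (Matrix.diagonal D).det = -r := by
    rw [Matrix.det_diagonal, Fin.prod_univ_succ]
    simp [hD]
  have hcomp : (reflT T r : (Fin (k + 1) → ℝ) → _) =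
      (fun x => x + b) ∘ (Matrix.toLin' (Matrix.diagonal D)) := by
    funext x i
    simp only [Function.comp_apply, Matrix.toLin'_apply, Matrix.mulVec_diagonal, Pi.add_apply]
    by_cases hi : i = 0
    · subst hi
      simp [reflT_zero, hD, hb]
      ring
    · simp [reflT_of_ne _ _ _ hi, hD, hb, hi]
  have h1 := Real.smul_map_diagonal_volume_pi (D := D) (by rw [hdet]; exact neg_ne_zero.2 hr.ne')
  rw [hdet, abs_neg, abs_of_pos hr] at h1
  have hm : Measurable (Matrix.toLin' (Matrix.diagonal D)) :=
    (LinearMap.continuous_of_finiteDimensional _).measurable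
  have h2 : Measure.map (Matrix.toLin' (Matrix.diagonal D)) volume = ENNReal.ofReal r⁻¹ • volume := by
    conv_rhs => rw [← h1]
    rw [smul_smul, ← ENNReal.ofReal_mul (by positivity), inv_mul_cancel₀ hr.ne']
    simp
  rw [hcomp, ← Measure.map_map (by fun_prop) hm, h2, Measure.map_smul]
  congr 1
  exact map_add_right_eq_self volume b

theorem integral_comp_reflT (T : ℝ) {r : ℝ} (hr : 0 < r) (h : (Fin (k + 1) → ℝ) → F) :
    ∫ x, h (reflT T r x) = r⁻¹ • ∫ x, h x := by
  rw [← (reflT_measurableEmbedding T hr.ne').integral_map, map_reflT_volume T hr,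
    integral_smul_measure, ENNReal.toReal_ofReal (by positivity)]

theorem memLp_comp_reflT (T : ℝ) {r : ℝ} (hr : 1 ≤ r) {h : (Fin (k + 1) → ℝ) → F}
    (hh : MemLp h 2 volume) : MemLp (fun x => h (reflT T r x)) 2 volume ∧
      eLpNorm (fun x => h (reflT T r x)) 2 volume ≤ eLpNorm h 2 volume := by
  have hr0 : 0 < r := by linarith
  have hemb := reflT_measurableEmbedding (k := k) T hr0.ne'
  have hm := map_reflT_volume (k := k) T hr0
  have hle : Measure.map (reflT T r : (Fin (k + 1) → ℝ) → _) volume ≤ volume := by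
    rw [hm]
    intro s
    rw [Measure.smul_apply, smul_eq_mul]
    calc _ ≤ 1 * volume s := by
          gcongr
          rw [← ENNReal.ofReal_one]
          exact ENNReal.ofReal_le_ofReal (inv_le_one_of_one_le₀ hr)
      _ = volume s := one_mul _
  have e : eLpNorm (fun x => h (reflT T r x)) 2 volume =
      eLpNorm h 2 (Measure.map (reflT T r) volume) :=
    (hemb.eLpNorm_map_measure).symm
  refine ⟨(hemb.memLp_map_measure_iff).1 (hh.mono_measure hle), ?_⟩
  rw [e]
  exact eLpNorm_mono_measure _ hle

/-- The extension of a function on `{t < T}` by a combination of reflections. -/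
def extT (T : ℝ) (J : ℕ) (c : ℕ → ℝ) (f : (Fin (k + 1) → ℝ) → F) (x : Fin (k + 1) → ℝ) : F :=
  Set.indicator (timeSlab k T : Set (Fin (k + 1) → ℝ)) f x +
    ∑ j ∈ Finset.range J, c j •
      Set.indicator (timeSlab k T : Set (Fin (k + 1) → ℝ)) f (reflT T (j + 1) x)

theorem mem_timeSlab {T : ℝ} {x : Fin (k + 1) → ℝ} :
    x ∈ (timeSlab k T : Set (Fin (k + 1) → ℝ)) ↔ x 0 < T := Iff.rfl

theorem extT_of_lt {T : ℝ} {J : ℕ} {c : ℕ → ℝ} {f : (Fin (k + 1) → ℝ) → F} {x : Fin (k + 1) → ℝ}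
    (hx : x 0 < T) : extT T J c f x = f x := by
  have h0 : ∀ j : ℕ, reflT T (j + 1) x ∉ (timeSlab k T : Set (Fin (k + 1) → ℝ)) := by
    intro j
    rw [mem_timeSlab, reflT_zero]
    have : 0 ≤ ((j : ℝ) + 1) * (T - x 0) := mul_nonneg (by positivity) (by linarith)
    linarith
  rw [extT, Set.indicator_of_mem (mem_timeSlab.2 hx)]
  simp [Set.indicator_of_notMem (h0 _)]

theorem extT_memLp (T : ℝ) (J : ℕ) (c : ℕ → ℝ) {f : (Fin (k + 1) → ℝ) → F}
    (hf : MemLp f 2 (volume.restrict (timeSlab k T))) :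
    MemLp (extT T J c f) 2 volume ∧ eLpNorm (extT T J c f) 2 volume ≤
      (1 + ∑ j ∈ Finset.range J, ‖c j‖₊ : ℝ≥0) *
        eLpNorm f 2 (volume.restrict (timeSlab k T)) := by
  have hU := (timeSlab k T).isOpen.measurableSet
  have h0 : MemLp (Set.indicator (timeSlab k T : Set (Fin (k + 1) → ℝ)) f) 2 volume :=
    (memLp_indicator_iff_restrict hU).2 hf
  have e0 : eLpNorm (Set.indicator (timeSlab k T : Set (Fin (k + 1) → ℝ)) f) 2 volume =
    eLpNorm f 2 (volume.restrict (timeSlab k T)) := eLpNorm_indicator_eq_eLpNorm_restrict hU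
  have hj : ∀ j : ℕ, MemLp (fun x => c j •
      Set.indicator (timeSlab k T : Set (Fin (k + 1) → ℝ)) f (reflT T (j + 1) x)) 2 volume ∧
      eLpNorm (fun x => c j •
      Set.indicator (timeSlab k T : Set (Fin (k + 1) → ℝ)) f (reflT T (j + 1) x)) 2 volume ≤
      ‖c j‖₊ * eLpNorm f 2 (volume.restrict (timeSlab k T)) := by
    intro j
    have := memLp_comp_reflT T (r := j + 1) (by simp) h0
    refine ⟨this.1.const_smul (c j), (eLpNorm_const_smul_le (c := c j)
      (f := fun x => Set.indicator (timeSlab k T : Set (Fin (k + 1) → ℝ)) f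
        (reflT T (j + 1) x))).trans ?_⟩
    rw [← e0]
    gcongr
    · exact le_rfl
    · exact this.2
  have hsum := memLp_finsetSum (Finset.range J) (fun j _ => (hj j).1)
  refine ⟨h0.add hsum, (eLpNorm_add_le h0.1 hsum.1 (by norm_num)).trans ?_⟩
  rw [e0]
  push_cast
  rw [add_mul, one_mul, Finset.sum_mul]
  gcongr
  have hs2 : eLpNorm (∑ j ∈ Finset.range J, fun x => c j •
      Set.indicator (timeSlab k T : Set (Fin (k + 1) → ℝ)) f (reflT T (j + 1) x)) 2 volume ≤ _ :=
    eLpNorm_sum_le (fun j _ => (hj j).1.1) (by norm_num)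
  have e1 : (∑ j ∈ Finset.range J, fun x => c j •
      Set.indicator (timeSlab k T : Set (Fin (k + 1) → ℝ)) f (reflT T (j + 1) x)) =
      fun x => ∑ j ∈ Finset.range J, c j •
      Set.indicator (timeSlab k T : Set (Fin (k + 1) → ℝ)) f (reflT T (j + 1) x) := by
    funext x; simp
  rw [e1] at hs2
  exact hs2.trans (Finset.sum_le_sum fun j _ => (hj j).2)

theorem deriv_smoothTransition_bound : ∃ C : ℝ, 0 ≤ C ∧ ∀ t, |deriv Real.smoothTransition t| ≤ C ∧
    (t ∉ Set.Icc (0 : ℝ) 1 → deriv Real.smoothTransition t = 0) := by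
  have h0 : ∀ t, t ∉ Set.Icc (0 : ℝ) 1 → deriv Real.smoothTransition t = 0 := by
    intro t ht
    rw [Set.mem_Icc, not_and_or, not_le, not_le] at ht
    rcases ht with ht | ht
    · have : Real.smoothTransition =ᶠ[𝓝 t] fun _ => 0 := by
        filter_upwards [gt_mem_nhds ht] with x hx using Real.smoothTransition.zero_of_nonpos hx.le
      rw [this.deriv_eq]; simp
    · have : Real.smoothTransition =ᶠ[𝓝 t] fun _ => 1 := by
        filter_upwards [lt_mem_nhds ht] with x hx using Real.smoothTransition.one_of_one_le hx.le
      rw [this.deriv_eq]; simp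
  have hs : HasCompactSupport (deriv Real.smoothTransition) :=
    HasCompactSupport.intro isCompact_Icc h0
  have hc : Continuous (deriv Real.smoothTransition) :=
    (Real.smoothTransition.contDiff (n := 1)).continuous_deriv (by norm_num)
  obtain ⟨C, hC⟩ := hc.bounded_above_of_compact_support hs
  exact ⟨C, (norm_nonneg _).trans (hC 0), fun t => ⟨hC t, h0 t⟩⟩

/-- Integration by parts on a time slab, for test functions that need not vanish near the
final time. -/
theorem HasWeakDirDeriv.green_timeSlab {T : ℝ} {i : Fin (k + 1)} {f g : (Fin (k + 1) → ℝ) → F}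
    (h : HasWeakDirDeriv (timeSlab k T) (coordVec i) f g)
    (hf : MemLp f 2 (volume.restrict (timeSlab k T)))
    (hg : MemLp g 2 (volume.restrict (timeSlab k T)))
    {Φ : (Fin (k + 1) → ℝ) → ℝ} (h1 : ContDiff ℝ ∞ Φ) (h2 : HasCompactSupport Φ)
    (h3 : i ≠ 0 ∨ ∀ x, x 0 = T → Φ x = 0) :
    ∫ x in (timeSlab k T : Set (Fin (k + 1) → ℝ)), fderiv ℝ Φ x (coordVec i) • f x =
      -∫ x in (timeSlab k T : Set (Fin (k + 1) → ℝ)), Φ x • g x := by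
  set U : Set (Fin (k + 1) → ℝ) := ((timeSlab k T : Opens (Fin (k + 1) → ℝ)) :
    Set (Fin (k + 1) → ℝ)) with hUdef
  have hU : MeasurableSet U := (timeSlab k T).isOpen.measurableSet
  obtain ⟨C, hC0, hC⟩ := deriv_smoothTransition_bound
  obtain ⟨L, hL⟩ := h1.lipschitzWith_of_hasCompactSupport h2 (by simp)
  obtain ⟨B, hB⟩ := h1.continuous.bounded_above_of_compact_support h2
  obtain ⟨B', hB'⟩ := (fderiv_apply_contDiff h1 (coordVec i)).continuous.bounded_above_of_compact_support
    (fderiv_apply_hasCompactSupport h2 (coordVec i))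
  -- Cut-off near the final time: η n vanishes for n (T - t) ≤ 1 and equals 1 for n (T - t) ≥ 2, so
  -- η n Φ is an admissible test function on the slab.
  let η : ℕ → (Fin (k + 1) → ℝ) → ℝ := fun n x => Real.smoothTransition (n * (T - x 0) - 1)
  have hη : ∀ n, ContDiff ℝ ∞ (η n) := fun n =>
    Real.smoothTransition.contDiff.comp (by fun_prop)
  have hη1 : ∀ n x, |η n x| ≤ 1 := fun n x => by
    rw [abs_of_nonneg (Real.smoothTransition.nonneg _)]
    exact Real.smoothTransition.le_one _
  have hη' : ∀ n x, fderiv ℝ (η n) x (coordVec i) =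
      deriv Real.smoothTransition (n * (T - x 0) - 1) * (-(n * (coordVec i : Fin (k + 1) → ℝ) 0)) := by
    intro n x
    have hd : HasFDerivAt (fun x : Fin (k + 1) → ℝ => (n : ℝ) * (T - x 0) - 1)
        (-((n : ℝ) • (ContinuousLinearMap.proj 0 : (Fin (k + 1) → ℝ) →L[ℝ] ℝ))) x := by
      have := (((ContinuousLinearMap.proj 0 : (Fin (k + 1) → ℝ) →L[ℝ] ℝ).hasFDerivAt
        (x := x)).const_sub T).const_mul (n : ℝ) |>.sub_const 1
      simpa using this
    have := ((Real.smoothTransition.contDiff (n := 1)).differentiable (by norm_num)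
      ((n : ℝ) * (T - x 0) - 1)).hasDerivAt.comp_hasFDerivAt x hd
    rw [show η n = Real.smoothTransition ∘ fun x => (n : ℝ) * (T - x 0) - 1 from rfl, this.fderiv]
    simp
  -- The dangerous term: a time derivative of η n has size n on a layer of width of order 1/n. There
  -- Φ is O(1/n), being Lipschitz and zero on t = T. For i ≠ 0 the cut-off has no derivative in
  -- direction i.
  have hbound : ∀ n x, |Φ x * fderiv ℝ (η n) x (coordVec i)| ≤ 2 * L * C := by
    intro n x
    have hpos : 0 ≤ 2 * (L : ℝ) * C := by positivity
    rcases h3 with h3 | h3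
    · rw [hη']
      simpa [coordVec, Pi.single_eq_of_ne h3.symm] using hpos
    · rw [hη']
      by_cases hx : (n : ℝ) * (T - x 0) - 1 ∈ Set.Icc (0 : ℝ) 1
      · have hΦ : |Φ x| ≤ L * |T - x 0| := by
          have hz : Φ (Function.update x 0 T) = 0 := h3 _ (by simp)
          have := hL.dist_le_mul x (Function.update x 0 T)
          rw [hz, Real.dist_eq, sub_zero] at this
          refine this.trans ?_
          gcongr
          rw [dist_pi_le_iff (abs_nonneg _)]
          intro j
          by_cases hj : j = 0
          · subst hj; simp [Real.dist_eq, abs_sub_comm]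
          · simp [hj]
        have hnT : (n : ℝ) * |T - x 0| ≤ 2 := by
          rw [← Nat.abs_cast n, ← abs_mul, abs_of_nonneg (by linarith [hx.1])]
          linarith [hx.2]
        have hcv : |(coordVec i : Fin (k + 1) → ℝ) 0| ≤ 1 := by
          by_cases hi : (0 : Fin (k + 1)) = i
          · subst hi; simp [coordVec]
          · simp [coordVec, hi]
        rw [abs_mul, abs_mul, abs_neg, abs_mul, Nat.abs_cast]
        calc |Φ x| * (|deriv Real.smoothTransition (n * (T - x 0) - 1)| *
              (n * |(coordVec i : Fin (k + 1) → ℝ) 0|)) ≤ (L * |T - x 0|) * (C * (n * 1)) := by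
              gcongr
              exact (hC _).1
          _ = L * C * (n * |T - x 0|) := by ring
          _ ≤ L * C * 2 := by gcongr
          _ = 2 * L * C := by ring
      · rw [(hC _).2 hx]
        simpa using hpos
  have hK : ∀ {u : (Fin (k + 1) → ℝ) → F}, MemLp u 2 (volume.restrict U) → ∀ D : ℝ,
      Integrable (fun x => Set.indicator (tsupport Φ) (fun x => D * ‖u x‖) x) (volume.restrict U) := by
    intro u hu D
    have hmk : MeasurableSet (tsupport Φ) := (isClosed_tsupport _).measurableSet
    rw [integrable_indicator_iff hmk]
    have : IsFiniteMeasure ((volume.restrict U).restrict (tsupport Φ)) := by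
      rw [Measure.restrict_restrict hmk]
      exact ⟨by simpa using (measure_mono Set.inter_subset_left).trans_lt h2.measure_lt_top⟩
    have := (hu.restrict (tsupport Φ)).integrable (by norm_num)
    exact (this.norm.const_mul D)
  have hlim1 : ∀ x ∈ U, ∀ᶠ n : ℕ in atTop, 2 < (n : ℝ) * (T - x 0) - 1 := by
    intro x hx
    have hx' : 0 < T - x 0 := sub_pos.2 hx
    have : Tendsto (fun n : ℕ => (n : ℝ) * (T - x 0) - 1) atTop atTop :=
      tendsto_atTop_add_const_right _ (-1)
        (Tendsto.atTop_mul_const hx' tendsto_natCast_atTop_atTop)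
    exact this.eventually_gt_atTop 2
  have hη_one : ∀ x ∈ U, ∀ᶠ n in atTop, η n x = 1 := fun x hx =>
    (hlim1 x hx).mono fun n hn => Real.smoothTransition.one_of_one_le (by linarith)
  have hη_d : ∀ x ∈ U, ∀ᶠ n in atTop, fderiv ℝ (η n) x (coordVec i) = 0 := fun x hx =>
    (hlim1 x hx).mono fun n hn => by
      rw [hη', (hC _).2 (fun hh => by linarith [hh.2]), zero_mul]
  have eqn : ∀ n, ∫ x in U, fderiv ℝ (fun y => η n y * Φ y) x (coordVec i) • f x =
      -∫ x in U, (η n x * Φ x) • g x := by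
    intro n
    refine (hasWeakDirDeriv_iff.1 h).2.2 _ ((hη n).mul h1) h2.mul_left ?_
    have hcl : IsClosed {x : Fin (k + 1) → ℝ | 1 ≤ (n : ℝ) * (T - x 0)} :=
      isClosed_le continuous_const (by fun_prop)
    have hsub : tsupport (fun x => η n x * Φ x) ⊆ {x | 1 ≤ (n : ℝ) * (T - x 0)} := by
      refine closure_minimal (fun x hx => ?_) hcl
      by_contra hlt
      rw [Set.mem_ofPred_eq, not_le] at hlt
      exact hx (by simp only [η]; rw [Real.smoothTransition.zero_of_nonpos (by linarith), zero_mul])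
    intro x hx
    have h5 : 1 ≤ (n : ℝ) * (T - x 0) := hsub hx
    have h6 : 0 < T - x 0 := by
      by_contra h7
      have := mul_nonpos_of_nonneg_of_nonpos (Nat.cast_nonneg n) (not_lt.1 h7)
      linarith
    exact sub_pos.1 h6
  have fd : ∀ n x, fderiv ℝ (fun y => η n y * Φ y) x (coordVec i) =
      η n x * fderiv ℝ Φ x (coordVec i) + Φ x * fderiv ℝ (η n) x (coordVec i) := by
    intro n x
    rw [fderiv_fun_mul ((hη n).differentiable (by simp) x) (h1.differentiable (by simp) x)]
    simp
  have lim1 : Tendsto (fun n => ∫ x in U, fderiv ℝ (fun y => η n y * Φ y) x (coordVec i) • f x)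
      atTop (𝓝 (∫ x in U, fderiv ℝ Φ x (coordVec i) • f x)) := by
    refine tendsto_integral_of_dominated_convergence
      (fun x => Set.indicator (tsupport Φ) (fun x => (B' + 2 * L * C) * ‖f x‖) x) ?_ (hK hf _) ?_ ?_
    · intro n
      exact (fderiv_apply_contDiff ((hη n).mul h1) _).continuous.aestronglyMeasurable.smul hf.1
    · intro n
      refine Eventually.of_forall fun x => ?_
      by_cases hx : x ∈ tsupport Φ
      · rw [Set.indicator_of_mem hx, norm_smul, fd, Real.norm_eq_abs]
        gcongr
        refine (abs_add_le _ _).trans (add_le_add ?_ (hbound n x))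
        rw [abs_mul]
        calc _ ≤ 1 * B' := mul_le_mul (hη1 n x) (hB' x) (abs_nonneg _) zero_le_one
          _ = B' := one_mul _
      · rw [Set.indicator_of_notMem hx, fd, image_eq_zero_of_notMem_tsupport hx,
          image_eq_zero_of_notMem_tsupport
            (f := fun x => fderiv ℝ Φ x (coordVec i))
            (fun hh => hx (fderiv_apply_tsupport_subset Φ _ hh))]
        simp
    · rw [ae_restrict_iff' hU]
      refine Eventually.of_forall fun x hx => ?_
      refine tendsto_const_nhds.congr' ?_
      filter_upwards [hη_one x hx, hη_d x hx] with n e1 e2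
      rw [fd, e1, e2]
      simp
  have lim2 : Tendsto (fun n => -∫ x in U, (η n x * Φ x) • g x)
      atTop (𝓝 (-∫ x in U, Φ x • g x)) := by
    refine Tendsto.neg (tendsto_integral_of_dominated_convergence
      (fun x => Set.indicator (tsupport Φ) (fun x => B * ‖g x‖) x) ?_ (hK hg _) ?_ ?_)
    · intro n
      exact ((hη n).mul h1).continuous.aestronglyMeasurable.smul hg.1
    · intro n
      refine Eventually.of_forall fun x => ?_
      by_cases hx : x ∈ tsupport Φ
      · rw [Set.indicator_of_mem hx, norm_smul, Real.norm_eq_abs, abs_mul]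
        gcongr
        calc _ ≤ 1 * B := mul_le_mul (hη1 n x) (hB x) (abs_nonneg _) zero_le_one
          _ = B := one_mul _
      · rw [Set.indicator_of_notMem hx, image_eq_zero_of_notMem_tsupport hx]
        simp
    · rw [ae_restrict_iff' hU]
      refine Eventually.of_forall fun x hx => ?_
      refine tendsto_const_nhds.congr' ?_
      filter_upwards [hη_one x hx] with n e1
      rw [e1, one_mul]
  exact tendsto_nhds_unique lim1 (by simpa only [eqn] using lim2)

theorem fderiv_comp_reflT {Φ : (Fin (k + 1) → ℝ) → ℝ} (h1 : ContDiff ℝ ∞ Φ) (T r : ℝ)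
    (i : Fin (k + 1)) (x : Fin (k + 1) → ℝ) :
    fderiv ℝ (fun y => Φ (reflT T r y)) x (coordVec i) =
      (if i = 0 then -r else 1) * fderiv ℝ Φ (reflT T r x) (coordVec i) := by
  have hd : HasFDerivAt (reflT T r : (Fin (k + 1) → ℝ) → _)
      (ContinuousLinearMap.pi fun j => (if j = 0 then -r else 1) •
        (ContinuousLinearMap.proj j : (Fin (k + 1) → ℝ) →L[ℝ] ℝ)) x := by
    rw [hasFDerivAt_pi]
    intro j
    by_cases hj : j = 0
    · subst hj
      simp only [reflT_zero, if_true]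
      have := (((ContinuousLinearMap.proj 0 : (Fin (k + 1) → ℝ) →L[ℝ] ℝ).hasFDerivAt
        (x := x)).sub_const T).const_mul r |>.const_sub T
      refine (this.congr_fderiv (ContinuousLinearMap.ext fun v => ?_) :
        HasFDerivAt (fun y : Fin (k + 1) → ℝ => T - r * (y 0 - T)) _ x)
      simp
    · simp only [reflT_of_ne _ _ _ hj, if_neg hj, one_smul]
      exact (ContinuousLinearMap.proj j : (Fin (k + 1) → ℝ) →L[ℝ] ℝ).hasFDerivAt
  have := (h1.differentiable (by simp) (reflT T r x)).hasFDerivAt.comp x hd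
  rw [show (fun y => Φ (reflT T r y)) = Φ ∘ reflT T r from rfl, this.fderiv,
    ContinuousLinearMap.comp_apply, ← smul_eq_mul, ← map_smul]
  congr 1
  funext j
  by_cases hj : j = i
  · subst hj; by_cases h0 : j = 0 <;> simp [coordVec, h0]
  · by_cases h0 : j = 0
    · subst h0; simp [coordVec, hj]
    · simp [coordVec, hj, h0]

/-- A change of variables moves the reflections from f to the test function; the Jacobian of the
j-th one gives the factor (j + 1)⁻¹. Integrals against the extension become integrals on the slab
against a folded test function. -/
theorem integral_smul_extT (T : ℝ) (J : ℕ) (c : ℕ → ℝ) {f : (Fin (k + 1) → ℝ) → F}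
    (hf : MemLp f 2 (volume.restrict (timeSlab k T))) {Φ : (Fin (k + 1) → ℝ) → ℝ}
    (h1 : Continuous Φ) (h2 : HasCompactSupport Φ) :
    ∫ x, Φ x • extT T J c f x = ∫ x in (timeSlab k T : Set (Fin (k + 1) → ℝ)),
      (Φ x + ∑ j ∈ Finset.range J, (c j * ((j : ℝ) + 1)⁻¹) * Φ (reflT T ((j : ℝ) + 1)⁻¹ x)) • f x := by
  have hU := (timeSlab k T).isOpen.measurableSet
  have h0 : MemLp (Set.indicator (timeSlab k T : Set (Fin (k + 1) → ℝ)) f) 2 volume :=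
    (memLp_indicator_iff_restrict hU).2 hf
  set f₀ := Set.indicator (timeSlab k T : Set (Fin (k + 1) → ℝ)) f with hf₀
  have int : ∀ {u : (Fin (k + 1) → ℝ) → F} {Ψ : (Fin (k + 1) → ℝ) → ℝ}, MemLp u 2 volume →
      Continuous Ψ → HasCompactSupport Ψ → Integrable (fun x => Ψ x • u x) := by
    intro u Ψ hu hΨ hc
    have := integrableOn_smul_of_tsupport_subset (U := Set.univ)
      ((hu.locallyIntegrable (by norm_num)).locallyIntegrableOn _) hΨ hc (Set.subset_univ _)
    simpa using this
  have hcs : ∀ j : ℕ, HasCompactSupport (fun x => Φ (reflT T ((j : ℝ) + 1)⁻¹ x)) := fun j =>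
    h2.comp_homeomorph (reflHomeo T (r := ((j : ℝ) + 1)⁻¹) (by positivity))
  have hcr : ∀ j : ℕ, Continuous (fun x => Φ (reflT T ((j : ℝ) + 1)⁻¹ x)) := fun j =>
    h1.comp (reflT_contDiff _ _).continuous
  have i1 : ∀ j ∈ Finset.range J, Integrable (fun x => Φ x • c j • f₀ (reflT T ((j : ℝ) + 1) x)) :=
    fun j _ => int ((memLp_comp_reflT T (r := (j : ℝ) + 1) (by simp) h0).1.const_smul (c j)) h1 h2
  have i2 : ∀ j ∈ Finset.range J, Integrable (fun x =>
      ((c j * ((j : ℝ) + 1)⁻¹) * Φ (reflT T ((j : ℝ) + 1)⁻¹ x)) • f₀ x) := fun j _ =>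
    int h0 (continuous_const.mul (hcr j)) (hcs j).mul_left
  have e1 : ∀ x, Set.indicator (timeSlab k T : Set (Fin (k + 1) → ℝ)) (fun x =>
      (Φ x + ∑ j ∈ Finset.range J, (c j * ((j : ℝ) + 1)⁻¹) * Φ (reflT T ((j : ℝ) + 1)⁻¹ x)) • f x) x =
      Φ x • f₀ x + ∑ j ∈ Finset.range J,
        ((c j * ((j : ℝ) + 1)⁻¹) * Φ (reflT T ((j : ℝ) + 1)⁻¹ x)) • f₀ x := by
    intro x
    rw [hf₀]
    by_cases hx : x ∈ (timeSlab k T : Set (Fin (k + 1) → ℝ))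
    · rw [Set.indicator_of_mem hx, Set.indicator_of_mem hx, add_smul, Finset.sum_smul]
    · rw [Set.indicator_of_notMem hx, Set.indicator_of_notMem hx]; simp
  rw [← integral_indicator hU]
  simp only [e1]
  simp only [extT, smul_add, Finset.smul_sum]
  rw [integral_add (int h0 h1 h2) (integrable_finsetSum _ i1),
    integral_add (int h0 h1 h2) (integrable_finsetSum _ i2),
    integral_finsetSum _ i1, integral_finsetSum _ i2]
  congr 1
  refine Finset.sum_congr rfl fun j _ => ?_
  have hr : (0 : ℝ) < (j : ℝ) + 1 := by positivity
  have := integral_comp_reflT T hr (fun y => (c j * Φ (reflT T ((j : ℝ) + 1)⁻¹ y)) • f₀ y)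
  have e2 : ∀ x : Fin (k + 1) → ℝ, reflT T ((j : ℝ) + 1)⁻¹ (reflT T ((j : ℝ) + 1) x) = x := by
    intro x
    simpa using reflT_reflT_inv T (inv_ne_zero hr.ne') x
  simp only [e2] at this
  calc _ = ∫ x, (c j * Φ x) • f₀ (reflT T ((j : ℝ) + 1) x) := by
        congr 1; funext x; rw [smul_smul, mul_comm]
    _ = _ := this
    _ = _ := by
        rw [← integral_smul]
        congr 1; funext x
        rw [smul_smul]; congr 1; ring

/-- After folding, differentiating the extension amounts to Green's formula on the slab for the
folded test function. A time derivative multiplies the j-th coefficient by -(j + 1); the zeroth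
moment condition makes the folded function vanish on t = T, so no boundary term arises. -/
theorem HasWeakDirDeriv.extT {T : ℝ} {J : ℕ} {c d : ℕ → ℝ} {i : Fin (k + 1)}
    {f g : (Fin (k + 1) → ℝ) → F} (h : HasWeakDirDeriv (timeSlab k T) (coordVec i) f g)
    (hf : MemLp f 2 (volume.restrict (timeSlab k T)))
    (hg : MemLp g 2 (volume.restrict (timeSlab k T)))
    (hcd : ∀ j : ℕ, d j = (if i = 0 then -((j : ℝ) + 1) else 1) * c j)
    (hc : i ≠ 0 ∨ ∑ j ∈ Finset.range J, c j = 1) :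
    HasWeakDirDeriv ⊤ (coordVec i) (_root_.extT T J c f) (_root_.extT T J d g) := by
  rw [hasWeakDirDeriv_iff]
  refine ⟨((extT_memLp T J c hf).1.locallyIntegrable (by norm_num)).locallyIntegrableOn _,
    ((extT_memLp T J d hg).1.locallyIntegrable (by norm_num)).locallyIntegrableOn _,
    fun φ h1 h2 _ => ?_⟩
  simp only [Opens.coe_top, Measure.restrict_univ]
  rw [integral_smul_extT T J c hf (fderiv_apply_contDiff h1 _).continuous
    (fderiv_apply_hasCompactSupport h2 _), integral_smul_extT T J d hg h1.continuous h2]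
  have hcs : ∀ j : ℕ, HasCompactSupport
      (fun x => (d j * ((j : ℝ) + 1)⁻¹) * φ (reflT T ((j : ℝ) + 1)⁻¹ x)) := fun j =>
    (h2.comp_homeomorph (reflHomeo T (r := ((j : ℝ) + 1)⁻¹) (by positivity))).mul_left
  have hcr : ∀ j : ℕ, ContDiff ℝ ∞ (fun x => φ (reflT T ((j : ℝ) + 1)⁻¹ x)) := fun j =>
    h1.comp (reflT_contDiff _ _)
  have s1 : ContDiff ℝ ∞ (fun x => ∑ j ∈ Finset.range J,
      (d j * ((j : ℝ) + 1)⁻¹) * φ (reflT T ((j : ℝ) + 1)⁻¹ x)) :=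
    ContDiff.sum fun j _ => contDiff_const.mul (hcr j)
  have s2 : HasCompactSupport (fun x => ∑ j ∈ Finset.range J,
      (d j * ((j : ℝ) + 1)⁻¹) * φ (reflT T ((j : ℝ) + 1)⁻¹ x)) := by
    have := Finset.sum_induction (s := Finset.range J) (fun j x =>
      (d j * ((j : ℝ) + 1)⁻¹) * φ (reflT T ((j : ℝ) + 1)⁻¹ x)) HasCompactSupport
      (fun _ _ => HasCompactSupport.add) HasCompactSupport.zero (fun j _ => hcs j)
    convert this using 1
    funext x; simp
  -- On t = T every reflection is the identity, and the folded function is (1 + ∑ d_j / (j + 1)) φ =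
  -- (1 - ∑ c_j) φ = 0.
  have hz : i ≠ 0 ∨ ∀ x : Fin (k + 1) → ℝ, x 0 = T → φ x + ∑ j ∈ Finset.range J,
      (d j * ((j : ℝ) + 1)⁻¹) * φ (reflT T ((j : ℝ) + 1)⁻¹ x) = 0 := by
    by_cases hi : i = 0
    · right
      intro x hx
      replace hc := hc.resolve_left (not_not.2 hi)
      have hfix : ∀ j : ℕ, reflT T ((j : ℝ) + 1)⁻¹ x = x := by
        intro j
        funext l
        by_cases hl : l = 0
        · subst hl; rw [reflT_zero, hx]; ring
        · rw [reflT_of_ne _ _ _ hl]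
      simp only [hfix, ← Finset.sum_mul]
      have : ∑ j ∈ Finset.range J, d j * ((j : ℝ) + 1)⁻¹ = -1 := by
        refine Eq.trans ?_ (congrArg Neg.neg hc)
        rw [← Finset.sum_neg_distrib]
        refine Finset.sum_congr rfl fun j _ => ?_
        have : (j : ℝ) + 1 ≠ 0 := by positivity
        rw [hcd, if_pos hi]
        field_simp
      rw [this]; ring
    · exact Or.inl hi
  have key := h.green_timeSlab hf hg (h1.add s1) (h2.add s2) hz
  rw [← key]
  congr 1
  funext x
  congr 1
  have e1 : fderiv ℝ (fun x => φ x + ∑ j ∈ Finset.range J,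
      (d j * ((j : ℝ) + 1)⁻¹) * φ (reflT T ((j : ℝ) + 1)⁻¹ x)) x (coordVec i) =
      fderiv ℝ φ x (coordVec i) + ∑ j ∈ Finset.range J,
        (d j * ((j : ℝ) + 1)⁻¹) * ((if i = 0 then -((j : ℝ) + 1)⁻¹ else 1) *
          fderiv ℝ φ (reflT T ((j : ℝ) + 1)⁻¹ x) (coordVec i)) := by
    rw [fderiv_fun_add (h1.differentiable (by simp) x) (s1.differentiable (by simp) x),
      fderiv_fun_sum fun j _ => ((contDiff_const.mul (hcr j)).differentiable (by simp) x)]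
    simp only [add_apply, sum_apply]
    congr 1
    refine Finset.sum_congr rfl fun j _ => ?_
    rw [fderiv_const_mul ((hcr j).differentiable (by simp) x), smul_apply,
      fderiv_comp_reflT h1, smul_eq_mul]
  refine Eq.trans ?_ e1.symm
  congr 1
  refine Finset.sum_congr rfl fun j _ => ?_
  have hj : (j : ℝ) + 1 ≠ 0 := by positivity
  rw [hcd]
  split_ifs
  · field_simp
  · ring

/-- The moment conditions for p < s + 1 on c give those for p < s on the coefficients -(j + 1) c_j
of the time derivative, so induction on the order applies. The weights are unaffected: reflections
leave θ fixed, the last coordinate being different from time. -/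
theorem SobBd.extT {κ : ℕ} (T : ℝ) (J s : ℕ) (c : ℕ → ℝ)
    (hc : ∀ p < s, ∑ j ∈ Finset.range J, c j * (-((j : ℝ) + 1)) ^ p = 1) :
    ∃ C : ℝ≥0, ∀ (M : ℝ≥0∞) (f : (Fin (k + 2) → ℝ) → F), SobBd κ (timeSlab (k + 1) T) s M f →
      SobBd κ ⊤ s (C * M) (_root_.extT T J c f) := by
  have aux : ∀ (c : ℕ → ℝ) (M : ℝ≥0∞) (u : (Fin (k + 2) → ℝ) → F),
      MemLp u 2 (volume.restrict (timeSlab (k + 1) T)) ∧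
      eLpNorm u 2 (volume.restrict (timeSlab (k + 1) T)) ≤ M →
      MemLp (_root_.extT T J c u) 2 (volume.restrict ((⊤ : Opens (Fin (k + 2) → ℝ)) : Set _)) ∧
      eLpNorm (_root_.extT T J c u) 2
        (volume.restrict ((⊤ : Opens (Fin (k + 2) → ℝ)) : Set _)) ≤
        (1 + ∑ j ∈ Finset.range J, ‖c j‖₊ : ℝ≥0) * M := by
    intro c M u hu
    rw [Opens.coe_top, Measure.restrict_univ]
    obtain ⟨h1, h2⟩ := extT_memLp T J c hu.1
    exact ⟨h1, h2.trans (by gcongr; exact hu.2)⟩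
  induction s generalizing c with
  | zero => exact ⟨_, fun M f hf => aux c M f hf⟩
  | succ s ih =>
    have hc1 : ∀ p < s, ∑ j ∈ Finset.range J, c j * (-((j : ℝ) + 1)) ^ p = 1 :=
      fun p hp => hc p (by omega)
    obtain ⟨C1, hC1⟩ := ih c hc1
    obtain ⟨C2, hC2⟩ := ih (fun j => -((j : ℝ) + 1) * c j) (fun p hp => by
      refine Eq.trans (Finset.sum_congr rfl fun j _ => ?_) (hc (p + 1) (by omega))
      ring)
    refine ⟨(1 + ∑ j ∈ Finset.range J, ‖c j‖₊) + (C1 + C2), fun M f hf => ⟨fun p hp => ?_,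
      fun i => ?_⟩⟩
    · obtain ⟨h1, h2⟩ := aux c M _ (hf.1 p hp)
      have e : _root_.extT T J c (fun x : Fin (k + 2) → ℝ => x (Fin.last (k + 1)) ^ p • f x) =
          fun x => x (Fin.last (k + 1)) ^ p • _root_.extT T J c f x := by
        funext x
        have hl : Fin.last (k + 1) ≠ 0 := Fin.last_pos.ne'
        simp only [_root_.extT, smul_add, Finset.smul_sum]
        congr 1
        · by_cases hx : x ∈ (timeSlab (k + 1) T : Set (Fin (k + 2) → ℝ))
          · rw [Set.indicator_of_mem hx, Set.indicator_of_mem hx]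
          · rw [Set.indicator_of_notMem hx, Set.indicator_of_notMem hx, smul_zero]
        · refine Finset.sum_congr rfl fun j _ => ?_
          by_cases hx : reflT T (j + 1) x ∈ (timeSlab (k + 1) T : Set (Fin (k + 2) → ℝ))
          · rw [Set.indicator_of_mem hx, Set.indicator_of_mem hx, reflT_of_ne _ _ _ hl, smul_comm]
          · rw [Set.indicator_of_notMem hx, Set.indicator_of_notMem hx, smul_zero, smul_zero]
      rw [e] at h1 h2
      exact ⟨h1, h2.trans (mul_le_mul' (by exact_mod_cast le_self_add) le_rfl)⟩
    · obtain ⟨g, hg, hg'⟩ := hf.2 i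
      by_cases hi : i = 0
      · refine ⟨_, hg.extT (c := c) (d := fun j => -((j : ℝ) + 1) * c j) (J := J) hf.memLp hg'.memLp
          (fun j => by rw [if_pos hi]) (Or.inr (by simpa using hc 0 (by omega))), ?_⟩
        refine (hC2 M g hg').mono_bound ?_
        exact mul_le_mul' (by exact_mod_cast le_add_self.trans le_add_self) le_rfl
      · refine ⟨_, hg.extT (c := c) (d := c) (J := J) hf.memLp hg'.memLp
          (fun j => by rw [if_neg hi, one_mul]) (Or.inl hi), ?_⟩
        refine (hC1 M g hg').mono_bound ?_
        exact mul_le_mul' (by exact_mod_cast le_self_add.trans le_add_self) le_rfl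

/-- A Vandermonde system with the distinct nodes -1, …, -s. -/
theorem exists_reflection_coeffs (s : ℕ) : ∃ c : ℕ → ℝ,
    ∀ p < s, ∑ j ∈ Finset.range s, c j * (-((j : ℝ) + 1)) ^ p = 1 := by
  set V : Matrix (Fin s) (Fin s) ℝ := Matrix.vandermonde (fun j : Fin s => -((j : ℝ) + 1)) with hV
  have hdet : IsUnit V.det := by
    rw [isUnit_iff_ne_zero, hV, Matrix.det_vandermonde_ne_zero_iff]
    intro a b hab
    have : (a : ℝ) = b := by simpa using hab
    exact Fin.ext (by exact_mod_cast this)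
  set w : Fin s → ℝ := Matrix.vecMul 1 V⁻¹ with hw
  have hwV : Matrix.vecMul w V = 1 := by
    rw [hw, Matrix.vecMul_vecMul, Matrix.nonsing_inv_mul _ hdet, Matrix.vecMul_one]
  refine ⟨fun j => if h : j < s then w ⟨j, h⟩ else 0, fun p hp => ?_⟩
  have := congrFun hwV ⟨p, hp⟩
  rw [Matrix.vecMul, dotProduct] at this
  rw [Finset.sum_range]
  simpa [hV, Matrix.vandermonde_apply] using this

theorem SobBd.exists_extension (κ k : ℕ) (T : ℝ) (s : ℕ) : ∃ C : ℝ≥0, ∀ (M : ℝ≥0∞)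
    (f : (Fin (k + 2) → ℝ) → F), SobBd κ (timeSlab (k + 1) T) s M f →
      ∃ g, SobBd κ ⊤ s (C * M) g ∧ ∀ x, x 0 < T → g x = f x := by
  obtain ⟨c, hc⟩ := exists_reflection_coeffs s
  obtain ⟨C, hC⟩ := SobBd.extT (k := k) (F := F) (κ := κ) T s s c hc
  exact ⟨C, fun M f hf => ⟨_, hC M f hf, fun x hx => extT_of_lt hx⟩⟩

end Extension
/-! ### The Fourier transform of square integrable functions -/

open scoped FourierTransform SchwartzMap LineDeriv ENNReal NNReal ComplexConjugate

variable {N : ℕ}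

/-- `u` is the Fourier transform of the square integrable function `f`. -/
structure IsFourier (f : (Fin N → ℝ) → ℂ) (u : EuclideanSpace ℝ (Fin N) → ℂ) : Prop where
  memLp_left : MemLp f 2 volume
  memLp_right : MemLp u 2 volume
  pairing : ∀ φ : 𝓢(EuclideanSpace ℝ (Fin N), ℂ),
    ∫ x : EuclideanSpace ℝ (Fin N), 𝓕 φ x * f x.ofLp = ∫ ξ, φ ξ * u ξ

theorem MemLp.comp_ofLp {F : Type*} [NormedAddCommGroup F] {f : (Fin N → ℝ) → F} {p : ℝ≥0∞}
    (hf : MemLp f p volume) :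
    MemLp (fun x : EuclideanSpace ℝ (Fin N) => f x.ofLp) p volume :=
  hf.comp_measurePreserving (PiLp.volume_preserving_ofLp (Fin N))

theorem MemLp.comp_toLp {F : Type*} [NormedAddCommGroup F] {f : EuclideanSpace ℝ (Fin N) → F}
    {p : ℝ≥0∞} (hf : MemLp f p volume) :
    MemLp (fun x : Fin N → ℝ => f (WithLp.toLp 2 x)) p volume :=
  hf.comp_measurePreserving (PiLp.volume_preserving_toLp (Fin N))

theorem eLpNorm_comp_ofLp {F : Type*} [NormedAddCommGroup F] {f : (Fin N → ℝ) → F} {p : ℝ≥0∞}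
    (hf : AEStronglyMeasurable f volume) :
    eLpNorm (fun x : EuclideanSpace ℝ (Fin N) => f x.ofLp) p volume = eLpNorm f p volume :=
  eLpNorm_comp_measurePreserving hf (PiLp.volume_preserving_ofLp (Fin N))

theorem SchwartzMap.integrable_mul_of_memLp {E : Type*} [NormedAddCommGroup E]
    [InnerProductSpace ℝ E] [FiniteDimensional ℝ E] [MeasurableSpace E] [BorelSpace E]
    (φ : 𝓢(E, ℂ)) {u : E → ℂ} (hu : MemLp u 2 volume) :
    Integrable (fun ξ => φ ξ * u ξ) volume :=
  (φ.memLp 2 volume).integrable_mul hu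

/-- The L² Fourier transform is compatible with that of tempered distributions, and an L² class is
determined by its distribution. The pairing in `IsFourier` is therefore equivalent to an identity in
L², which gives access to Plancherel and inversion. -/
theorem isFourier_iff {f : (Fin N → ℝ) → ℂ} {u : EuclideanSpace ℝ (Fin N) → ℂ}
    (hf : MemLp f 2 volume) (hu : MemLp u 2 volume) :
    IsFourier f u ↔ 𝓕 ((MemLp.comp_ofLp hf).toLp _) = hu.toLp _ := by
  have key : (∀ φ : 𝓢(EuclideanSpace ℝ (Fin N), ℂ),
      ∫ x : EuclideanSpace ℝ (Fin N), 𝓕 φ x * f x.ofLp = ∫ ξ, φ ξ * u ξ) ↔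
      ∀ φ : 𝓢(EuclideanSpace ℝ (Fin N), ℂ),
        Lp.toTemperedDistribution (𝓕 ((MemLp.comp_ofLp hf).toLp _)) φ =
          Lp.toTemperedDistribution (hu.toLp _) φ := by
    refine forall_congr' fun φ => ?_
    rw [← Lp.fourier_toTemperedDistribution_eq, TemperedDistribution.fourier_apply,
      Lp.toTemperedDistribution_apply, Lp.toTemperedDistribution_apply]
    have e1 : ∫ x, (𝓕 φ) x • ((MemLp.comp_ofLp hf).toLp _) x =
        ∫ x : EuclideanSpace ℝ (Fin N), 𝓕 φ x * f x.ofLp := by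
      refine integral_congr_ae ?_
      filter_upwards [(MemLp.comp_ofLp hf).coeFn_toLp] with x hx
      rw [hx, smul_eq_mul]
    have e2 : ∫ x, φ x • (hu.toLp _) x = ∫ ξ, φ ξ * u ξ := by
      refine integral_congr_ae ?_
      filter_upwards [hu.coeFn_toLp] with x hx
      rw [hx, smul_eq_mul]
    rw [e1, e2]
  constructor
  · intro h
    have h3 := LinearMap.ker_eq_bot.1 (Lp.ker_toTemperedDistributionCLM_eq_bot (F := ℂ)
      (p := 2) (μ := (volume : Measure (EuclideanSpace ℝ (Fin N)))))
    refine h3 ?_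
    ext φ
    exact key.1 h.pairing φ
  · intro h
    exact ⟨hf, hu, key.2 fun φ => by rw [h]⟩

theorem exists_isFourier {f : (Fin N → ℝ) → ℂ} (hf : MemLp f 2 volume) : ∃ u, IsFourier f u := by
  set g := 𝓕 ((MemLp.comp_ofLp hf).toLp _) with hg
  refine ⟨g, (isFourier_iff hf (Lp.memLp g)).2 ?_⟩
  rw [Lp.toLp_coeFn]

theorem exists_isFourier_inv {u : EuclideanSpace ℝ (Fin N) → ℂ} (hu : MemLp u 2 volume) :
    ∃ f, IsFourier f u := by
  set g := 𝓕⁻ (hu.toLp _) with hg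
  have h1 : MemLp (fun x : Fin N → ℝ => g (WithLp.toLp 2 x)) 2 volume :=
    MemLp.comp_toLp (Lp.memLp g)
  refine ⟨_, (isFourier_iff h1 hu).2 ?_⟩
  have : (MemLp.comp_ofLp h1).toLp _ = g := by
    simp only [WithLp.toLp_ofLp, Lp.toLp_coeFn]
  rw [this, hg]
  exact FourierTransform.fourier_fourierInv_eq _

namespace IsFourier

variable {f f' g : (Fin N → ℝ) → ℂ} {u u' w : EuclideanSpace ℝ (Fin N) → ℂ}

theorem eLpNorm_eq (h : IsFourier f u) : eLpNorm u 2 volume = eLpNorm f 2 volume := by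
  have h1 := (isFourier_iff h.1 h.2).1 h
  have h2 := Lp.norm_fourier_eq ((MemLp.comp_ofLp h.1).toLp _)
  rw [h1, Lp.norm_toLp, Lp.norm_toLp, eLpNorm_comp_ofLp h.1.1] at h2
  exact (ENNReal.toReal_eq_toReal_iff' h.2.2.ne h.1.2.ne).1 h2

theorem add (h : IsFourier f u) (h' : IsFourier f' u') :
    IsFourier (fun x => f x + f' x) (fun ξ => u ξ + u' ξ) := by
  refine ⟨h.1.add h'.1, h.2.add h'.2, fun φ => ?_⟩
  simp only [mul_add]
  rw [integral_add, integral_add, h.3, h'.3]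
  · exact φ.integrable_mul_of_memLp h.2
  · exact φ.integrable_mul_of_memLp h'.2
  · exact (𝓕 φ).integrable_mul_of_memLp (MemLp.comp_ofLp h.1)
  · exact (𝓕 φ).integrable_mul_of_memLp (MemLp.comp_ofLp h'.1)

theorem const_mul (c : ℂ) (h : IsFourier f u) :
    IsFourier (fun x => c * f x) (fun ξ => c * u ξ) := by
  refine ⟨h.1.const_mul c, h.2.const_mul c, fun φ => ?_⟩
  simp only [mul_left_comm _ c, integral_const_mul, h.3]

theorem sub (h : IsFourier f u) (h' : IsFourier f' u') :
    IsFourier (fun x => f x - f' x) (fun ξ => u ξ - u' ξ) := by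
  simpa [sub_eq_add_neg] using h.add (h'.const_mul (-1))

theorem congr (h : IsFourier f u) (hf : f =ᵐ[volume] f') (hu : u =ᵐ[volume] u') :
    IsFourier f' u' := by
  refine ⟨h.1.ae_eq hf, h.2.ae_eq hu, fun φ => ?_⟩
  have e1 : ∫ x : EuclideanSpace ℝ (Fin N), 𝓕 φ x * f' x.ofLp =
      ∫ x : EuclideanSpace ℝ (Fin N), 𝓕 φ x * f x.ofLp := by
    refine integral_congr_ae ?_
    filter_upwards [(PiLp.volume_preserving_ofLp (Fin N)).quasiMeasurePreserving.ae_eq_comp hf]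
      with x hx
    simp only [Function.comp] at hx
    rw [hx]
  have e2 : ∫ ξ, φ ξ * u' ξ = ∫ ξ, φ ξ * u ξ := by
    refine integral_congr_ae ?_
    filter_upwards [hu] with x hx
    rw [hx]
  rw [e1, e2, h.3]

theorem unique_right (h : IsFourier f u) (h' : IsFourier f u') : u =ᵐ[volume] u' := by
  have h1 := (h.sub h').eLpNorm_eq
  simp only [sub_self, eLpNorm_zero'] at h1
  have h2 := (eLpNorm_eq_zero_iff (h.sub h').2.1 (by norm_num)).1 h1
  filter_upwards [h2] with x hx
  exact sub_eq_zero.1 hx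

theorem unique_left (h : IsFourier f u) (h' : IsFourier f' u) : f =ᵐ[volume] f' := by
  have h1 := (h.sub h').eLpNorm_eq
  simp only [sub_self, eLpNorm_zero'] at h1
  have h2 := (eLpNorm_eq_zero_iff (h.sub h').1.1 (by norm_num)).1 h1.symm
  filter_upwards [h2] with x hx
  exact sub_eq_zero.1 hx

end IsFourier

variable {N : ℕ}

/-- The integral of an integrable weak derivative of an integrable function vanishes. -/
theorem HasWeakDirDeriv.integral_eq_zero {F : Type*} [NormedAddCommGroup F] [NormedSpace ℝ F]
    {X : Fin N → ℝ} {f g : (Fin N → ℝ) → F} (h : HasWeakDirDeriv ⊤ X f g)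
    (hf : Integrable f) (hg : Integrable g) : ∫ x, g x = 0 := by
  let b : ContDiffBump (0 : Fin N → ℝ) := ⟨1, 2, one_pos, one_lt_two⟩
  -- Dilated bumps: φ n tends to 1 while its gradient is O(1/n), so f drops out of the limit
  -- identity.
  let φ : ℕ → (Fin N → ℝ) → ℝ := fun n x => b (((n : ℝ) + 1)⁻¹ • x)
  have hpos : ∀ n : ℕ, (0 : ℝ) < (n + 1 : ℝ)⁻¹ := fun n => by positivity
  have hs : ∀ n, ContDiff ℝ ∞ (φ n) := fun n =>
    b.contDiff.comp (contDiff_const_smul _)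
  have hc : ∀ n, HasCompactSupport (φ n) := fun n =>
    b.hasCompactSupport.comp_smul (hpos n).ne'
  have hd : ∀ n x, fderiv ℝ (φ n) x X = (n + 1 : ℝ)⁻¹ * fderiv ℝ b ((n + 1 : ℝ)⁻¹ • x) X := by
    intro n x
    have : HasFDerivAt (φ n) _ x :=
      ((b.contDiff (n := 1)).differentiable (by simp) _).hasFDerivAt.comp x
        ((hasFDerivAt_id x).const_smul (n + 1 : ℝ)⁻¹)
    rw [this.fderiv]
    simp
  obtain ⟨C, hC⟩ := (fderiv_apply_contDiff (b.contDiff (n := (⊤ : ℕ∞))) X).continuous.bounded_above_of_compact_support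
    (fderiv_apply_hasCompactSupport b.hasCompactSupport X)
  rw [hasWeakDirDeriv_iff] at h
  have e : ∀ n, ∫ x, fderiv ℝ (φ n) x X • f x = -∫ x, φ n x • g x := fun n => by
    simpa using h.2.2 (φ n) (hs n) (hc n) (by simp)
  have l1 : Tendsto (fun n => ∫ x, fderiv ℝ (φ n) x X • f x) atTop (𝓝 (∫ _ : Fin N → ℝ, (0 : F))) := by
    refine tendsto_integral_of_dominated_convergence (fun x => C * ‖f x‖) (fun n => ?_)
      (hf.norm.const_mul _) (fun n => ?_) ?_
    · exact (((fderiv_apply_contDiff (hs n) X).continuous.aestronglyMeasurable).smul hf.1)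
    · refine Eventually.of_forall fun x => ?_
      rw [norm_smul]
      refine mul_le_mul_of_nonneg_right ?_ (norm_nonneg _)
      rw [hd, norm_mul]
      refine le_trans (mul_le_of_le_one_left (norm_nonneg _) ?_) (hC _)
      rw [Real.norm_of_nonneg (hpos n).le]
      exact inv_le_one_of_one_le₀ (by simp)
    · refine Eventually.of_forall fun x => ?_
      have : Tendsto (fun n : ℕ => fderiv ℝ (φ n) x X) atTop (𝓝 0) := by
        refine squeeze_zero_norm (a := fun n : ℕ => 1 / ((n : ℝ) + 1) * C) (fun n => ?_) ?_
        · rw [hd, norm_mul, Real.norm_of_nonneg (hpos n).le, one_div]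
          exact mul_le_mul_of_nonneg_left (hC _) (hpos n).le
        · simpa using (tendsto_one_div_add_atTop_nhds_zero_nat (𝕜 := ℝ)).mul_const C
      simpa using this.smul_const (f x)
  have l2 : Tendsto (fun n => ∫ x, φ n x • g x) atTop (𝓝 (∫ x, g x)) := by
    refine tendsto_integral_of_dominated_convergence (fun x => ‖g x‖) (fun n => ?_)
      hg.norm (fun n => ?_) ?_
    · exact (((hs n).continuous.aestronglyMeasurable).smul hg.1)
    · refine Eventually.of_forall fun x => ?_
      rw [norm_smul]
      refine mul_le_of_le_one_left (norm_nonneg _) ?_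
      rw [Real.norm_of_nonneg b.nonneg]
      exact b.le_one
    · refine Eventually.of_forall fun x => ?_
      have l3 : Tendsto (fun n : ℕ => ((n : ℝ) + 1)⁻¹ • x) atTop (𝓝 0) := by
        simpa using (tendsto_one_div_add_atTop_nhds_zero_nat (𝕜 := ℝ)).smul_const x
      have l4 := (b.continuous.tendsto 0).comp l3
      rw [b.one_of_mem_closedBall (by simp [b.rIn_pos.le])] at l4
      simpa using l4.smul_const (g x)
  simp only [e, integral_zero] at l1
  have := tendsto_nhds_unique l1 l2.neg
  simpa using this.symm

theorem fderiv_re_apply {ψ : (Fin N → ℝ) → ℂ} (h : ContDiff ℝ ∞ ψ) (x X : Fin N → ℝ) :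
    fderiv ℝ (fun y => (ψ y).re) x X = (fderiv ℝ ψ x X).re := by
  have := (Complex.reCLM.hasFDerivAt (x := ψ x)).comp x
    (h.differentiable (by simp) x).hasFDerivAt
  rw [show (fun y => (ψ y).re) = Complex.reCLM ∘ ψ from rfl, this.fderiv]
  rfl

theorem fderiv_im_apply {ψ : (Fin N → ℝ) → ℂ} (h : ContDiff ℝ ∞ ψ) (x X : Fin N → ℝ) :
    fderiv ℝ (fun y => (ψ y).im) x X = (fderiv ℝ ψ x X).im := by
  have := (Complex.imCLM.hasFDerivAt (x := ψ x)).comp x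
    (h.differentiable (by simp) x).hasFDerivAt
  rw [show (fun y => (ψ y).im) = Complex.imCLM ∘ ψ from rfl, this.fderiv]
  rfl

/-- Test functions in the definition of the weak derivative of a square integrable function can be
complex valued and need not have compact support. -/
theorem HasWeakDirDeriv.integral_fderiv_mul {X : Fin N → ℝ} {f g : (Fin N → ℝ) → ℂ}
    (h : HasWeakDirDeriv ⊤ X f g) (hf : MemLp f 2) (hg : MemLp g 2) {ψ : (Fin N → ℝ) → ℂ}
    (h1 : ContDiff ℝ ∞ ψ) (h2 : MemLp ψ 2) (h3 : MemLp (fun x => fderiv ℝ ψ x X) 2) :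
    ∫ x, fderiv ℝ ψ x X * f x = -∫ x, ψ x * g x := by
  -- For real ρ the product ρ f is integrable with integrable weak derivative ρ g + (∂_X ρ) f, whose
  -- integral is zero. The complex case follows from real and imaginary parts.
  have key : ∀ ρ : (Fin N → ℝ) → ℝ, ContDiff ℝ ∞ ρ → MemLp (fun x => (ρ x : ℂ)) 2 →
      MemLp (fun x => ((fderiv ℝ ρ x X : ℝ) : ℂ)) 2 →
      ∫ x, ((fderiv ℝ ρ x X : ℝ) : ℂ) * f x + (ρ x : ℂ) * g x = 0 := by
    intro ρ r1 r2 r3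
    have r4 := h.smul_smooth r1
    simp only [Complex.real_smul] at r4
    have := r4.integral_eq_zero (r2.integrable_mul hf)
      ((r2.integrable_mul hg).add (r3.integrable_mul hf))
    rw [← this]
    refine integral_congr_ae (Eventually.of_forall fun x => ?_)
    ring
  have hre : ContDiff ℝ ∞ (fun x => (ψ x).re) := Complex.reCLM.contDiff.comp h1
  have him : ContDiff ℝ ∞ (fun x => (ψ x).im) := Complex.imCLM.contDiff.comp h1
  have k1 := key _ hre h2.re.ofReal (by
    simp only [fderiv_re_apply h1]; exact h3.re.ofReal)
  have k2 := key _ him h2.im.ofReal (by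
    simp only [fderiv_im_apply h1]; exact h3.im.ofReal)
  simp only [fderiv_re_apply h1] at k1
  simp only [fderiv_im_apply h1] at k2
  have i1 := (h3.re.ofReal (K := ℂ)).integrable_mul hf
  have i2 := (h2.re.ofReal (K := ℂ)).integrable_mul hg
  have i3 := (h3.im.ofReal (K := ℂ)).integrable_mul hf
  have i4 := (h2.im.ofReal (K := ℂ)).integrable_mul hg
  have e : ∫ x, (fderiv ℝ ψ x X * f x + ψ x * g x) = 0 := by
    have : (fun x => fderiv ℝ ψ x X * f x + ψ x * g x) = fun x =>
        ((((fderiv ℝ ψ x X).re : ℝ) : ℂ) * f x + (((ψ x).re : ℝ) : ℂ) * g x) +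
        Complex.I * ((((fderiv ℝ ψ x X).im : ℝ) : ℂ) * f x + (((ψ x).im : ℝ) : ℂ) * g x) := by
      funext x
      conv_lhs => rw [← Complex.re_add_im (fderiv ℝ ψ x X), ← Complex.re_add_im (ψ x)]
      ring
    rw [this, integral_add, integral_const_mul, k1, k2]
    · simp
    · exact i1.add i2
    · exact (i3.add i4).const_mul _
  have e' := integral_add (h3.integrable_mul hf) (h2.integrable_mul hg)
  simp only [Pi.mul_apply] at e'
  rw [e'] at e
  exact eq_neg_of_add_eq_zero_left e

/-- The pairing of a frequency with a direction. -/
def freqPair (X : Fin N → ℝ) (ξ : EuclideanSpace ℝ (Fin N)) : ℝ := inner ℝ ξ (WithLp.toLp 2 X)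

theorem freqPair_eq (X : Fin N → ℝ) (ξ : EuclideanSpace ℝ (Fin N)) :
    freqPair X ξ = ∑ i, ξ i * X i := by
  simp [freqPair, PiLp.inner_apply, mul_comm]

theorem freqPair_continuous (X : Fin N → ℝ) : Continuous (freqPair X) :=
  continuous_id.inner continuous_const

theorem norm_freqPair_le (X : Fin N → ℝ) (ξ : EuclideanSpace ℝ (Fin N)) :
    |freqPair X ξ| ≤ ‖WithLp.toLp 2 X‖ * ‖ξ‖ := by
  rw [mul_comm]; exact abs_real_inner_le_norm _ _

theorem MemLp.ae_eq_zero_of_schwartz {u : EuclideanSpace ℝ (Fin N) → ℂ}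
    (hu : LocallyIntegrable u) (h : ∀ φ : 𝓢(EuclideanSpace ℝ (Fin N), ℂ), ∫ ξ, φ ξ * u ξ = 0) :
    u =ᵐ[volume] 0 := by
  refine ae_eq_zero_of_integral_contDiff_smul_eq_zero hu fun g hg hc => ?_
  have hg₁ : HasCompactSupport (Complex.ofRealCLM ∘ g) := hc.comp_left rfl
  have hg₂ : ContDiff ℝ ∞ (Complex.ofRealCLM ∘ g) := by fun_prop
  simpa [Complex.real_smul] using h (hg₁.toSchwartzMap hg₂)

theorem integral_comp_ofLp (F : (Fin N → ℝ) → ℂ) :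
    ∫ x : EuclideanSpace ℝ (Fin N), F x.ofLp = ∫ x, F x :=
  (PiLp.volume_preserving_ofLp (Fin N)).integral_comp
    (MeasurableEquiv.toLp 2 (Fin N → ℝ)).symm.measurableEmbedding _

theorem fderiv_comp_toLp (ψ : 𝓢(EuclideanSpace ℝ (Fin N), ℂ)) (x X : Fin N → ℝ) :
    fderiv ℝ (fun y : Fin N → ℝ => ψ (WithLp.toLp 2 y)) x X =
      ∂_{WithLp.toLp 2 X} ψ (WithLp.toLp 2 x) := by
  have := (ψ.differentiableAt (x := WithLp.toLp 2 x)).hasFDerivAt.comp x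
    (PiLp.continuousLinearEquiv 2 ℝ (fun _ : Fin N => ℝ)).symm.toContinuousLinearMap.hasFDerivAt
  rw [SchwartzMap.lineDerivOp_apply_eq_fderiv]
  change fderiv ℝ (ψ ∘ (PiLp.continuousLinearEquiv 2 ℝ (fun _ : Fin N => ℝ)).symm) x X = _
  erw [this.fderiv]
  rfl

theorem lineDeriv_fourier_apply (φ : 𝓢(EuclideanSpace ℝ (Fin N), ℂ)) (X : Fin N → ℝ) :
    ∃ χ : 𝓢(EuclideanSpace ℝ (Fin N), ℂ), ∂_{WithLp.toLp 2 X} (𝓕 φ) = 𝓕 χ ∧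
      ∀ ξ, χ ξ = -(2 * Real.pi * Complex.I * freqPair X ξ) * φ ξ := by
  refine ⟨_, SchwartzMap.lineDerivOp_fourier_eq φ _, fun ξ => ?_⟩
  have : (inner ℝ · (WithLp.toLp 2 X) : EuclideanSpace ℝ (Fin N) → ℝ).HasTemperateGrowth := by
    fun_prop
  rw [_root_.smul_apply, SchwartzMap.smulLeftCLM_apply_apply this]
  simp only [smul_eq_mul, Complex.real_smul, freqPair]
  ring

/-- Weak derivatives correspond to multiplication by the frequency. -/
theorem IsFourier.hasWeakDirDeriv_iff {X : Fin N → ℝ} {f g : (Fin N → ℝ) → ℂ}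
    {u w : EuclideanSpace ℝ (Fin N) → ℂ} (hf : IsFourier f u) (hg : IsFourier g w) :
    HasWeakDirDeriv ⊤ X f g ↔
      w =ᵐ[volume] fun ξ => 2 * Real.pi * Complex.I * freqPair X ξ * u ξ := by
  have hloc : ∀ {v : (Fin N → ℝ) → ℂ}, MemLp v 2 volume →
      LocallyIntegrableOn v ((⊤ : Opens (Fin N → ℝ)) : Set (Fin N → ℝ)) := fun hv =>
    (hv.locallyIntegrable (by norm_num)).locallyIntegrableOn _
  have main : ∀ φ : 𝓢(EuclideanSpace ℝ (Fin N), ℂ),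
      ∫ ξ, φ ξ * (2 * Real.pi * Complex.I * freqPair X ξ * u ξ) =
        -∫ x : EuclideanSpace ℝ (Fin N), ∂_{WithLp.toLp 2 X} (𝓕 φ) x * f x.ofLp := by
    intro φ
    obtain ⟨χ, h1, h2⟩ := lineDeriv_fourier_apply φ X
    rw [h1, hf.3, ← integral_neg]
    refine integral_congr_ae (Eventually.of_forall fun ξ => ?_)
    simp only [h2]
    ring
  have hli : LocallyIntegrable
      (fun ξ => 2 * Real.pi * Complex.I * freqPair X ξ * u ξ) volume := by
    have : LocallyIntegrable u volume := hf.2.locallyIntegrable (by norm_num)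
    rw [← locallyIntegrableOn_univ] at this ⊢
    refine this.continuousOn_mul ?_ isOpen_univ.isLocallyClosed
    have := freqPair_continuous X
    fun_prop
  have hwl : LocallyIntegrable w volume := hg.2.locallyIntegrable (by norm_num)
  constructor
  · intro h
    have : (fun ξ => w ξ - 2 * Real.pi * Complex.I * freqPair X ξ * u ξ) =ᵐ[volume] 0 := by
      refine MemLp.ae_eq_zero_of_schwartz (hwl.sub hli) fun φ => ?_
      obtain ⟨χ, h1, h2⟩ := lineDeriv_fourier_apply φ X
      have i1 := φ.integrable_mul_of_memLp hg.2
      have i2 : Integrable (fun ξ => φ ξ * (2 * Real.pi * Complex.I * freqPair X ξ * u ξ)) := by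
        refine (χ.integrable_mul_of_memLp hf.2).neg.congr (Eventually.of_forall fun ξ => ?_)
        simp only [Pi.neg_apply, h2]
        ring
      simp only [mul_sub]
      rw [integral_sub i1 i2, main, ← hg.3, sub_neg_eq_add]
      have hψ : ContDiff ℝ ∞ (fun y : Fin N → ℝ => 𝓕 φ (WithLp.toLp 2 y)) :=
        ((𝓕 φ).smooth ⊤).comp
          (PiLp.continuousLinearEquiv 2 ℝ (fun _ : Fin N => ℝ)).symm.contDiff
      have := h.integral_fderiv_mul hf.1 hg.1 hψ (MemLp.comp_toLp ((𝓕 φ).memLp 2 volume)) (by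
        simp only [fderiv_comp_toLp]
        exact MemLp.comp_toLp ((∂_{WithLp.toLp 2 X} (𝓕 φ)).memLp 2 volume))
      simp only [fderiv_comp_toLp] at this
      rw [← integral_comp_ofLp, ← integral_comp_ofLp] at this
      simp only [WithLp.toLp_ofLp] at this
      rw [this, add_neg_cancel]
    filter_upwards [this] with ξ hξ
    exact sub_eq_zero.1 hξ
  · intro h
    rw [_root_.hasWeakDirDeriv_iff]
    refine ⟨hloc hf.1, hloc hg.1, fun ρ h1 h2 _ => ?_⟩
    have hc : HasCompactSupport
        (fun x : EuclideanSpace ℝ (Fin N) => ((ρ x.ofLp : ℝ) : ℂ)) :=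
      (h2.comp_homeomorph (PiLp.continuousLinearEquiv 2 ℝ
        (fun _ : Fin N => ℝ)).toHomeomorph).comp_left (g := Complex.ofReal) rfl
    have hs : ContDiff ℝ ∞ (fun x : EuclideanSpace ℝ (Fin N) => ((ρ x.ofLp : ℝ) : ℂ)) :=
      Complex.ofRealCLM.contDiff.comp
        (h1.comp (PiLp.continuousLinearEquiv 2 ℝ (fun _ : Fin N => ℝ)).contDiff)
    -- A test function is the Fourier transform of the Schwartz function 𝓕⁻ ψ, so the identities on
    -- the Fourier side can be read backwards.
    set ψ := hc.toSchwartzMap hs with hψ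
    have e0 : ∀ x, ψ (WithLp.toLp 2 x) = ((ρ x : ℝ) : ℂ) := fun x => rfl
    have e1 : 𝓕 (𝓕⁻ ψ) = ψ := FourierTransform.fourier_fourierInv_eq ψ
    have m1 := main (𝓕⁻ ψ)
    have m2 := hg.3 (𝓕⁻ ψ)
    rw [e1] at m1 m2
    have m3 : ∫ ξ, (𝓕⁻ ψ) ξ * w ξ =
        ∫ ξ, (𝓕⁻ ψ) ξ * (2 * Real.pi * Complex.I * freqPair X ξ * u ξ) := by
      refine integral_congr_ae ?_
      filter_upwards [h] with ξ hξ
      rw [hξ]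
    rw [← m2, m1] at m3
    have k1 := integral_comp_ofLp fun x => ψ (WithLp.toLp 2 x) * g x
    have k2 := integral_comp_ofLp fun x =>
      fderiv ℝ (fun y : Fin N → ℝ => ψ (WithLp.toLp 2 y)) x X * f x
    simp only [fderiv_comp_toLp, WithLp.toLp_ofLp] at k1 k2
    rw [k1, k2] at m3
    have e2 : ∀ x, ∂_{WithLp.toLp 2 X} ψ (WithLp.toLp 2 x) = ((fderiv ℝ ρ x X : ℝ) : ℂ) := by
      intro x
      rw [← fderiv_comp_toLp]
      have := (Complex.ofRealCLM.hasFDerivAt (x := ρ x)).comp x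
        (h1.differentiable (by simp) x).hasFDerivAt
      simp only [e0]
      rw [show (fun y => ((ρ y : ℝ) : ℂ)) = Complex.ofRealCLM ∘ ρ from rfl, this.fderiv]
      rfl
    simp only [e0, e2] at m3
    simp only [Opens.coe_top, Measure.restrict_univ, Complex.real_smul]
    rw [m3, neg_neg]
/-! ### Convolution inequalities -/

section Conv

variable {V : Type*} [NormedAddCommGroup V] [InnerProductSpace ℝ V] [FiniteDimensional ℝ V]
  [MeasurableSpace V] [BorelSpace V]

theorem lintegral_mul_le_eLpNorm_two {A B : V → ℝ≥0∞} (hA : AEMeasurable A) (hB : AEMeasurable B) :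
    ∫⁻ x, A x * B x ≤ eLpNorm A 2 volume * eLpNorm B 2 volume := by
  have h := ENNReal.lintegral_mul_le_Lp_mul_Lq volume Real.HolderConjugate.two_two hA hB
  simpa [eLpNorm_eq_lintegral_rpow_enorm_toReal (by norm_num : (2 : ℝ≥0∞) ≠ 0)
    (by norm_num : (2 : ℝ≥0∞) ≠ ⊤)] using h

theorem AEMeasurable.comp_sub_const {B : V → ℝ≥0∞} (hB : AEMeasurable B) (η : V) :
    AEMeasurable fun ξ => B (ξ - η) :=
  hB.comp_quasiMeasurePreserving (measurePreserving_sub_right volume η).quasiMeasurePreserving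

theorem AEMeasurable.comp_const_sub {B : V → ℝ≥0∞} (hB : AEMeasurable B) (ξ : V) :
    AEMeasurable fun η => B (ξ - η) :=
  hB.comp_quasiMeasurePreserving (Measure.measurePreserving_sub_left volume ξ).quasiMeasurePreserving

theorem eLpNorm_comp_sub_const {B : V → ℝ≥0∞} (hB : AEMeasurable B) (η : V) :
    eLpNorm (fun ξ => B (ξ - η)) 2 volume = eLpNorm B 2 volume :=
  eLpNorm_comp_measurePreserving hB.aestronglyMeasurable (measurePreserving_sub_right volume η)

theorem eLpNorm_comp_const_sub {B : V → ℝ≥0∞} (hB : AEMeasurable B) (ξ : V) :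
    eLpNorm (fun η => B (ξ - η)) 2 volume = eLpNorm B 2 volume :=
  eLpNorm_comp_measurePreserving hB.aestronglyMeasurable (Measure.measurePreserving_sub_left volume ξ)

theorem AEMeasurable.conv_kernel {B : V → ℝ≥0∞} (hB : AEMeasurable B) :
    AEMeasurable (fun p : V × V => B (p.1 - p.2)) (volume.prod volume) :=
  hB.comp_quasiMeasurePreserving (quasiMeasurePreserving_sub_of_right_invariant volume volume)

/-- The trilinear form `∫∫ A(ξ) B(ξ - η) C(η)`. -/
def trilin (A B C : V → ℝ≥0∞) : ℝ≥0∞ := ∫⁻ ξ, ∫⁻ η, A ξ * B (ξ - η) * C η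

variable {A B C : V → ℝ≥0∞}

theorem trilin_integrand (hA : AEMeasurable A) (hB : AEMeasurable B) (hC : AEMeasurable C) :
    AEMeasurable (fun p : V × V => A p.1 * B (p.1 - p.2) * C p.2) (volume.prod volume) :=
  (hA.comp_fst.mul hB.conv_kernel).mul hC.comp_snd

/-- Young's inequality in trilinear form: the variable of the L¹ factor is integrated last, and the
other two factors are handled by Cauchy–Schwarz and translation invariance. -/
theorem trilin_le_right (hA : AEMeasurable A) (hB : AEMeasurable B) (hC : AEMeasurable C) :
    trilin A B C ≤ eLpNorm A 2 volume * eLpNorm B 2 volume * ∫⁻ η, C η := by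
  rw [trilin, lintegral_lintegral_swap (trilin_integrand hA hB hC), ← lintegral_const_mul'' _ hC]
  refine lintegral_mono fun η => ?_
  have e := lintegral_mul_const'' (μ := volume) (C η) (hA.mul (hB.comp_sub_const η))
  simp only [Pi.mul_apply] at e
  rw [e]
  refine mul_le_mul_left ?_ _
  rw [← eLpNorm_comp_sub_const hB η]
  exact lintegral_mul_le_eLpNorm_two hA (hB.comp_sub_const η)

theorem trilin_le_left (hA : AEMeasurable A) (hB : AEMeasurable B) (hC : AEMeasurable C) :
    trilin A B C ≤ (∫⁻ ξ, A ξ) * eLpNorm B 2 volume * eLpNorm C 2 volume := by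
  rw [trilin, mul_assoc, ← lintegral_mul_const'' _ hA]
  refine lintegral_mono fun ξ => ?_
  simp only [mul_assoc]
  have e := lintegral_const_mul'' (μ := volume) (A ξ) ((hB.comp_const_sub ξ).mul hC)
  simp only [Pi.mul_apply] at e
  rw [e]
  refine mul_le_mul_right ?_ _
  rw [← eLpNorm_comp_const_sub hB ξ]
  exact lintegral_mul_le_eLpNorm_two (hB.comp_const_sub ξ) hC

/-- The substitution η ↦ ξ - η exchanges the second and third factors. -/
theorem trilin_le_mid (hA : AEMeasurable A) (hB : AEMeasurable B) (hC : AEMeasurable C) :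
    trilin A B C ≤ eLpNorm A 2 volume * (∫⁻ ζ, B ζ) * eLpNorm C 2 volume := by
  have e : trilin A B C = trilin A C B := by
    rw [trilin, trilin]
    refine lintegral_congr fun ξ => ?_
    rw [← lintegral_sub_left_eq_self (fun η => A ξ * B (ξ - η) * C η) ξ]
    refine lintegral_congr fun η => ?_
    rw [sub_sub_cancel]; ring
  rw [e]
  refine (trilin_le_right hA hC hB).trans (le_of_eq ?_)
  ring

theorem trilin_eq (hB : AEMeasurable B) (hC : AEMeasurable C) :
    trilin A B C = ∫⁻ ξ, A ξ * ∫⁻ η, B (ξ - η) * C η := by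
  refine lintegral_congr fun ξ => ?_
  simp only [mul_assoc]
  exact lintegral_const_mul'' _ ((hB.comp_const_sub ξ).mul hC)

theorem aemeasurable_conv (hB : AEMeasurable B) (hC : AEMeasurable C) :
    AEMeasurable fun ξ => ∫⁻ η, B (ξ - η) * C η :=
  (hB.conv_kernel.mul hC.comp_snd).lintegral_prod_right'

/-- An `L²` bound by duality. -/
theorem eLpNorm_two_le_of_forall {H : V → ℝ≥0∞} (hH : AEMeasurable H) {K : ℝ≥0∞}
    (h : ∀ A : V → ℝ≥0∞, AEMeasurable A → ∫⁻ x, A x * H x ≤ eLpNorm A 2 volume * K) :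
    eLpNorm H 2 volume ≤ K := by
  -- The bounded truncations of H on balls have finite L² norm. Testing with G n gives ‖G n‖² ≤ ‖G
  -- n‖ K, where one may divide; monotone convergence removes the truncation.
  set G : ℕ → V → ℝ≥0∞ := fun n => (Metric.ball 0 n).indicator fun x => min (H x) n with hG
  have hGm : ∀ n, AEMeasurable (G n) := fun n =>
    (hH.min aemeasurable_const).indicator Metric.isOpen_ball.measurableSet
  have hGH : ∀ n x, G n x ≤ H x := fun n x =>
    (Set.indicator_le_self _ _ _).trans (min_le_left _ _)
  have hsq : ∀ W : V → ℝ≥0∞, eLpNorm W 2 volume ^ 2 = ∫⁻ x, W x ^ 2 := fun W => by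
    have := eLpNorm_nnreal_pow_eq_lintegral (μ := volume) (f := W) (p := 2) (by norm_num)
    simpa using this
  have hfin : ∀ n, eLpNorm (G n) 2 volume ≠ ⊤ := fun n => by
    have : eLpNorm (G n) 2 volume ^ 2 < ⊤ := by
      rw [hsq]
      refine lt_of_le_of_lt (lintegral_mono fun x => show _ ≤
        (Metric.ball (0 : V) n).indicator (fun _ => (n : ℝ≥0∞) ^ 2) x from ?_) ?_
      · simp only [hG, Set.indicator]
        split_ifs
        · gcongr; exact min_le_right _ _
        · simp
      · rw [lintegral_indicator Metric.isOpen_ball.measurableSet, lintegral_const,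
          Measure.restrict_apply_univ]
        exact ENNReal.mul_lt_top (by simp) measure_ball_lt_top
    exact fun h => by simp [h] at this
  have hle : ∀ n, eLpNorm (G n) 2 volume ≤ K := fun n => by
    by_cases h0 : eLpNorm (G n) 2 volume = 0
    · simp [h0]
    refine (ENNReal.mul_le_mul_iff_right h0 (hfin n)).1 ?_
    rw [← pow_two, hsq]
    refine le_trans (lintegral_mono fun x => ?_) (h _ (hGm n))
    rw [pow_two]
    exact mul_le_mul_right (hGH n x) _
  have hmono : ∀ x, Monotone fun n => G n x := fun x n n' hn => by
    simp only [hG, Set.indicator, Metric.mem_ball, dist_zero_right]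
    have : (n : ℝ) ≤ n' := by exact_mod_cast hn
    split_ifs with h1 h2
    · exact min_le_min le_rfl (by exact_mod_cast hn)
    · exact absurd (h1.trans_le this) h2
    · exact zero_le
    · exact le_rfl
  have hlim : ∀ x, Tendsto (fun n => G n x) atTop (𝓝 (H x)) := fun x => by
    have : Tendsto (fun n : ℕ => min (H x) n) atTop (𝓝 (H x)) := by
      simpa using (tendsto_const_nhds (x := H x)).min ENNReal.tendsto_nat_nhds_top
    refine this.congr' ?_
    obtain ⟨n0, hn0⟩ := exists_nat_gt ‖x‖
    filter_upwards [eventually_ge_atTop n0] with n hn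
    have : (n0 : ℝ) ≤ n := by exact_mod_cast hn
    simp [hG, hn0.trans_le this]
  have hs := lintegral_tendsto_of_tendsto_of_monotone (μ := volume) (f := fun n x => G n x ^ 2)
    (F := fun x => H x ^ 2) (fun n => (hGm n).pow_const 2)
    (Eventually.of_forall fun x n n' hn => by have := hmono x hn; dsimp at this ⊢; gcongr)
    (Eventually.of_forall fun x => (ENNReal.continuous_pow 2).continuousAt.tendsto.comp (hlim x))
  have := le_of_tendsto' hs (b := K ^ 2) fun n => by rw [← hsq]; gcongr; exact hle n
  rw [← hsq] at this
  exact (ENNReal.pow_le_pow_left_iff two_ne_zero).1 this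

theorem eLpNorm_conv_le_mid (hB : AEMeasurable B) (hC : AEMeasurable C) :
    eLpNorm (fun ξ => ∫⁻ η, B (ξ - η) * C η) 2 volume ≤
      (∫⁻ ζ, B ζ) * eLpNorm C 2 volume := by
  refine eLpNorm_two_le_of_forall (aemeasurable_conv hB hC) fun A hA => ?_
  rw [← trilin_eq hB hC, ← mul_assoc]
  exact trilin_le_mid hA hB hC

theorem eLpNorm_conv_le_right (hB : AEMeasurable B) (hC : AEMeasurable C) :
    eLpNorm (fun ξ => ∫⁻ η, B (ξ - η) * C η) 2 volume ≤
      eLpNorm B 2 volume * ∫⁻ ζ, C ζ := by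
  refine eLpNorm_two_le_of_forall (aemeasurable_conv hB hC) fun A hA => ?_
  rw [← trilin_eq hB hC, ← mul_assoc]
  exact trilin_le_right hA hB hC

/-- The convolution `∫ v(ξ - η) u(η) dη`. -/
def cv (v u : V → ℂ) (ξ : V) : ℂ := ∫ η, v (ξ - η) * u η

variable {v u : V → ℂ}

theorem enorm_cv_le (ξ : V) : ‖cv v u ξ‖ₑ ≤ ∫⁻ η, ‖v (ξ - η)‖ₑ * ‖u η‖ₑ := by
  refine (enorm_integral_le_lintegral_enorm _).trans (le_of_eq ?_)
  simp only [enorm_mul]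

theorem aestronglyMeasurable_cv_integrand (hv : AEStronglyMeasurable v) (hu : AEStronglyMeasurable u) :
    AEStronglyMeasurable (fun p : V × V => v (p.1 - p.2) * u p.2) (volume.prod volume) :=
  (hv.comp_quasiMeasurePreserving
    (quasiMeasurePreserving_sub_of_right_invariant volume volume)).mul hu.comp_snd

theorem aestronglyMeasurable_cv (hv : AEStronglyMeasurable v) (hu : AEStronglyMeasurable u) :
    AEStronglyMeasurable (cv v u) :=
  (aestronglyMeasurable_cv_integrand hv hu).integral_prod_right'

theorem cv_congr {v' u' : V → ℂ} (hv : v =ᵐ[volume] v') (hu : u =ᵐ[volume] u') :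
    cv v u = cv v' u' := by
  funext ξ
  refine integral_congr_ae ?_
  filter_upwards [hu, (Measure.measurePreserving_sub_left volume ξ).quasiMeasurePreserving.ae_eq_comp hv]
    with η h1 h2
  simp only [Function.comp] at h2
  rw [h1, h2]

theorem cv_comm_form (ξ : V) : cv v u ξ = ∫ η, v η * u (ξ - η) := by
  rw [cv, ← integral_sub_left_eq_self (fun η => v (ξ - η) * u η) volume ξ]
  simp only [sub_sub_cancel]

theorem memLp_cv (hv : Integrable v) (hu : MemLp u 2 volume) : MemLp (cv v u) 2 volume := by
  refine ⟨aestronglyMeasurable_cv hv.1 hu.1, lt_of_le_of_lt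
    (eLpNorm_mono_enorm (g := fun ξ => ∫⁻ η, ‖v (ξ - η)‖ₑ * ‖u η‖ₑ) fun ξ => ?_) ?_⟩
  · simpa using enorm_cv_le ξ
  · refine (eLpNorm_conv_le_mid (B := fun η => ‖v η‖ₑ) (C := fun η => ‖u η‖ₑ)
      hv.1.enorm hu.1.enorm).trans_lt (ENNReal.mul_lt_top hv.2 ?_)
    simpa [eLpNorm_enorm] using hu.2

theorem integrable_cv_integrand (hv : MemLp v 2 volume) (hu : MemLp u 2 volume) (ξ : V) :
    Integrable fun η => v (ξ - η) * u η :=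
  (hv.comp_measurePreserving (Measure.measurePreserving_sub_left volume ξ)).integrable_mul hu

end Conv
-- Products and complex conjugation under the Fourier transform
section FourierProduct

variable {N : ℕ}

/-- The frequency space. -/
abbrev Freq (N : ℕ) := EuclideanSpace ℝ (Fin N)

theorem norm_fourierChar (t : ℝ) : ‖(Real.fourierChar t : ℂ)‖ = 1 := Circle.norm_coe _

theorem fourierInv_apply_toLp (v : Freq N → ℂ) (x : Freq N) :
    𝓕⁻ v x = ∫ η, (Real.fourierChar (inner ℝ η x) : ℂ) * v η := by
  rw [Real.fourierInv_eq]
  rfl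

theorem norm_fourierInv_le (v : Freq N → ℂ) (x : Freq N) : ‖𝓕⁻ v x‖ ≤ ∫ η, ‖v η‖ := by
  rw [fourierInv_apply_toLp]
  refine (norm_integral_le_integral_norm _).trans (le_of_eq ?_)
  simp only [norm_mul, norm_fourierChar, one_mul]

theorem continuous_fourierInv {v : Freq N → ℂ} (hv : Integrable v) : Continuous (𝓕⁻ v) := by
  rw [show 𝓕⁻ v = fun x => 𝓕 v (-x) from funext fun x => Real.fourierInv_eq_fourier_neg v x]
  exact (VectorFourier.fourierIntegral_continuous Real.continuous_fourierChar
    (by exact continuous_inner) hv).comp continuous_neg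

theorem fourierChar_integrand_integrable {v g : Freq N → ℂ} (hv : Integrable v) (hg : Integrable g) :
    Integrable (fun p : Freq N × Freq N => g p.1 * ((Real.fourierChar (inner ℝ p.2 p.1) : ℂ) * v p.2))
      (volume.prod volume) := by
  have h := hg.mul_prod hv
  have hc : Continuous fun p : Freq N × Freq N => (Real.fourierChar (inner ℝ p.2 p.1) : ℂ) :=
    continuous_subtype_val.comp (Real.continuous_fourierChar.comp
      (continuous_snd.inner continuous_fst))
  refine ((h.bdd_mul (c := 1) hc.aestronglyMeasurable
    (Eventually.of_forall fun p => (norm_fourierChar _).le)).congr (Eventually.of_forall fun p => ?_))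
  dsimp only
  ring

theorem integral_mul_fourierInv {v g : Freq N → ℂ} (hv : Integrable v) (hg : Integrable g) :
    ∫ x, g x * 𝓕⁻ v x = ∫ η, v η * ∫ x, (Real.fourierChar (inner ℝ η x) : ℂ) * g x := by
  simp only [fourierInv_apply_toLp, ← integral_const_mul]
  rw [integral_integral_swap (fourierChar_integrand_integrable hv hg)]
  refine integral_congr_ae (Eventually.of_forall fun η => ?_)
  refine integral_congr_ae (Eventually.of_forall fun x => ?_)
  dsimp only
  ring

theorem fourierChar_mul_fourier (φ : 𝓢(Freq N, ℂ)) (η x : Freq N) :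
    (Real.fourierChar (inner ℝ η x) : ℂ) * 𝓕 φ x =
      𝓕 (SchwartzMap.compSubConstCLM ℂ (-η) φ) x := by
  rw [SchwartzMap.fourier_coe, SchwartzMap.fourier_coe, Real.fourier_eq, Real.fourier_eq,
    ← integral_const_mul, ← integral_sub_right_eq_self (fun ξ => _) (-η)]
  refine integral_congr_ae (Eventually.of_forall fun ξ => ?_)
  simp only [SchwartzMap.compSubConstCLM_apply, Circle.smul_def, smul_eq_mul, sub_neg_eq_add]
  rw [inner_add_left, neg_add, AddChar.map_add_eq_mul, AddChar.map_neg_eq_inv]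
  push_cast
  have : (Real.fourierChar (inner ℝ η x) : ℂ) ≠ 0 := Circle.coe_ne_zero _
  rw [AddChar.map_neg_eq_inv (Real.fourierChar) (inner ℝ η x)]
  push_cast
  field_simp

variable {f g : (Fin N → ℝ) → ℂ} {u v : Freq N → ℂ}

/-- Fubini after a translation; absolute convergence is the trilinear Young inequality with φ and u
in L² and v in L¹. -/
theorem integral_compSub_mul {φ : 𝓢(Freq N, ℂ)} (hu : MemLp u 2 volume) (hv : Integrable v) :
    ∫ η, v η * ∫ ξ, φ (ξ + η) * u ξ = ∫ ξ, φ ξ * cv v u ξ := by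
  have e1 : ∀ η, ∫ ξ, φ (ξ + η) * u ξ = ∫ ξ, φ ξ * u (ξ - η) := fun η => by
    rw [← integral_sub_right_eq_self (fun ξ => φ (ξ + η) * u ξ) η]
    simp only [sub_add_cancel]
  simp only [e1, cv_comm_form, ← integral_const_mul]
  rw [integral_integral_swap]
  · refine integral_congr_ae (Eventually.of_forall fun η => ?_)
    refine integral_congr_ae (Eventually.of_forall fun x => ?_)
    dsimp only
    ring
  · have hm : AEStronglyMeasurable (fun p : Freq N × Freq N => v p.1 * (φ p.2 * u (p.2 - p.1)))
        (volume.prod volume) := by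
      refine hv.1.comp_fst.mul (φ.continuous.aestronglyMeasurable.comp_snd.mul ?_)
      exact (hu.1.comp_quasiMeasurePreserving
        (quasiMeasurePreserving_sub_of_right_invariant volume volume)).comp_quasiMeasurePreserving
        Measure.measurePreserving_swap.quasiMeasurePreserving
    refine ⟨hm, ?_⟩
    rw [HasFiniteIntegral]
    change ∫⁻ p : Freq N × Freq N, ‖v p.1 * (φ p.2 * u (p.2 - p.1))‖ₑ ∂_ < _
    rw [lintegral_prod_symm _ hm.enorm]
    have h1 := trilin_le_right (A := fun ξ => ‖φ ξ‖ₑ) (B := fun ξ => ‖u ξ‖ₑ)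
      (C := fun ξ => ‖v ξ‖ₑ) φ.continuous.aestronglyMeasurable.enorm hu.1.enorm hv.1.enorm
    rw [eLpNorm_enorm, eLpNorm_enorm] at h1
    refine lt_of_eq_of_lt ?_ (h1.trans_lt (ENNReal.mul_lt_top
      (ENNReal.mul_lt_top (φ.memLp 2 volume).2 hu.2) hv.2))
    refine lintegral_congr fun ξ => lintegral_congr fun η => ?_
    simp only [enorm_mul]
    ring

/-- Both sides are tested against ψ = 𝓕 (𝓕⁻ ψ). For integrable u, Fubini turns the pairing with the
inversion integral into a pairing of u with 𝓕⁻ ψ, which is what the definition gives for f. -/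
theorem isFourier_unique_of_integrable (h : IsFourier f u) (hu : Integrable u) :
    f =ᵐ[volume] fun x => 𝓕⁻ u (WithLp.toLp 2 x) := by
  have h0 : (fun x : Freq N => f x.ofLp - 𝓕⁻ u x) =ᵐ[volume] 0 := by
    have hl1 : LocallyIntegrable (fun x : Freq N => f x.ofLp) :=
      (MemLp.comp_ofLp h.1).locallyIntegrable (by norm_num)
    have hl2 : LocallyIntegrable (𝓕⁻ u) := (continuous_fourierInv hu).locallyIntegrable
    refine MemLp.ae_eq_zero_of_schwartz (hl1.sub hl2) fun ψ => ?_
    have e1 : 𝓕 (𝓕⁻ ψ) = ψ := FourierTransform.fourier_fourierInv_eq ψ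
    have i1 := ψ.integrable_mul_of_memLp (MemLp.comp_ofLp h.1)
    have i2 : Integrable (fun x => ψ x * 𝓕⁻ u x) :=
      ψ.integrable.mul_bdd (c := ∫ η, ‖u η‖) (continuous_fourierInv hu).aestronglyMeasurable
        (Eventually.of_forall fun x => norm_fourierInv_le u x)
    simp only [mul_sub]
    rw [integral_sub i1 i2, integral_mul_fourierInv hu ψ.integrable, sub_eq_zero]
    have := h.3 (𝓕⁻ ψ)
    rw [e1] at this
    rw [this]
    refine integral_congr_ae (Eventually.of_forall fun η => ?_)
    dsimp only
    rw [mul_comm, SchwartzMap.fourierInv_coe, fourierInv_apply_toLp]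
    simp only [real_inner_comm]
  have := (PiLp.volume_preserving_toLp (Fin N)).quasiMeasurePreserving.ae_eq_comp h0
  filter_upwards [this] with x hx
  exact sub_eq_zero.1 hx

/-- As v is integrable, g is a superposition of characters. Multiplication by a character translates
the Schwartz function on the other side, and integrating these translations against v yields the
convolution. -/
theorem IsFourier.mul (hg : IsFourier g v) (hv : Integrable v) (hf : IsFourier f u) :
    IsFourier (fun x => g x * f x) (cv v u) := by
  have e := isFourier_unique_of_integrable hg hv
  refine IsFourier.congr (f := fun x => 𝓕⁻ v (WithLp.toLp 2 x) * f x) (u := cv v u) ?_ ?_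
    EventuallyEq.rfl
  swap
  · filter_upwards [e] with x hx
    rw [hx]
  have hc : Continuous fun x : Fin N → ℝ => 𝓕⁻ v (WithLp.toLp 2 x) :=
    (continuous_fourierInv hv).comp
      (PiLp.continuousLinearEquiv 2 ℝ (fun _ : Fin N => ℝ)).symm.continuous
  refine ⟨?_, memLp_cv hv hf.2, fun φ => ?_⟩
  · exact hf.1.of_le_mul (c := ∫ η, ‖v η‖) (hc.aestronglyMeasurable.mul hf.1.1)
      (Eventually.of_forall fun x => by
        rw [norm_mul]; gcongr; exact norm_fourierInv_le v _)
  · have i1 := (𝓕 φ).integrable_mul_of_memLp (MemLp.comp_ofLp hf.1)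
    rw [← integral_compSub_mul hf.2 hv]
    simp only [WithLp.toLp_ofLp]
    have e1 : ∀ x : Freq N, 𝓕 φ x * (𝓕⁻ v x * f x.ofLp) = 𝓕 φ x * f x.ofLp * 𝓕⁻ v x := fun x => by ring
    simp only [e1]
    rw [integral_mul_fourierInv hv i1]
    refine integral_congr_ae (Eventually.of_forall fun η => ?_)
    dsimp only
    congr 1
    have := hf.3 (SchwartzMap.compSubConstCLM ℂ (-η) φ)
    simp only [← fourierChar_mul_fourier, SchwartzMap.compSubConstCLM_apply, sub_neg_eq_add] at this
    rw [← this]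
    refine integral_congr_ae (Eventually.of_forall fun x => ?_)
    dsimp only
    ring

theorem IsFourier.conj (h : IsFourier f u) :
    IsFourier (fun x => conj (f x)) (fun ξ => conj (u (-ξ))) := by
  have hm : MemLp (fun ξ => u (-ξ)) 2 volume :=
    h.2.comp_measurePreserving (Measure.measurePreserving_neg volume)
  refine ⟨h.1.star, hm.star, fun φ => ?_⟩
  set ψ : 𝓢(Freq N, ℂ) := SchwartzMap.compCLMOfContinuousLinearEquiv ℝ (ContinuousLinearEquiv.neg ℝ)
    (φ.postcompCLM (Complex.conjCLE : ℂ →L[ℝ] ℂ)) with hψ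
  have e0 : ∀ ξ, ψ ξ = conj (φ (-ξ)) := fun ξ => rfl
  have e1 : ∀ x, 𝓕 ψ x = conj (𝓕 φ x) := fun x => by
    rw [SchwartzMap.fourier_coe, SchwartzMap.fourier_coe, Real.fourier_eq, Real.fourier_eq,
      ← integral_conj, ← integral_neg_eq_self]
    refine integral_congr_ae (Eventually.of_forall fun ξ => ?_)
    simp only [e0, Circle.smul_def, smul_eq_mul, map_mul, neg_neg, inner_neg_left]
    rw [AddChar.map_neg_eq_inv, Circle.coe_inv_eq_conj, Complex.conj_conj]
  have := congrArg conj (h.3 ψ)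
  rw [← integral_conj, ← integral_conj] at this
  simp only [map_mul, e1, e0, Complex.conj_conj] at this
  rw [this, ← integral_neg_eq_self]
  simp only [neg_neg]

/-- The Fourier transform of a real function. -/
def ConjSymm (u : Freq N → ℂ) : Prop := ∀ᵐ ξ, u (-ξ) = conj (u ξ)

theorem IsFourier.conjSymm (h : IsFourier f u) (hf : ∀ᵐ x, conj (f x) = f x) : ConjSymm u := by
  filter_upwards [(h.conj.congr hf EventuallyEq.rfl).unique_right h] with ξ hξ
  rw [← hξ, Complex.conj_conj]

theorem ConjSymm.isReal (hu : ConjSymm u) (h : IsFourier f u) : ∀ᵐ x, conj (f x) = f x := by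
  refine (h.conj.congr EventuallyEq.rfl ?_).unique_left h
  filter_upwards [hu] with ξ hξ
  rw [hξ, Complex.conj_conj]

end FourierProduct
/-! ### Weighted norms on the Fourier side -/

section Weights

variable {N : ℕ}

/-- The weight `1 + |ξ|`. -/
def jn (ξ : Freq N) : ℝ≥0 := 1 + ‖ξ‖₊

/-- The weighted modulus `(1 + |ξ|)^s |u(ξ)|`. -/
def wA (s : ℕ) (u : Freq N → ℂ) (ξ : Freq N) : ℝ≥0∞ := (jn ξ ^ s : ℝ≥0) * ‖u ξ‖ₑ

/-- The Sobolev norm of order `s` of a function with Fourier transform `u`. -/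
def wn (s : ℕ) (u : Freq N → ℂ) : ℝ≥0∞ := eLpNorm (wA s u) 2 volume

/-- The inverse weight `(1 + |ξ|)^{-k}`. -/
def jinv (k : ℕ) (ξ : Freq N) : ℝ≥0∞ := ((jn ξ ^ k)⁻¹ : ℝ≥0)

theorem one_le_jn (ξ : Freq N) : 1 ≤ jn ξ := le_self_add

theorem continuous_jn : Continuous (jn : Freq N → ℝ≥0) := continuous_const.add continuous_nnnorm

theorem jn_neg (ξ : Freq N) : jn (-ξ) = jn ξ := by simp [jn]

theorem measurable_jn_pow (s : ℕ) : Measurable fun ξ : Freq N => ((jn ξ ^ s : ℝ≥0) : ℝ≥0∞) :=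
  ((continuous_jn.pow s).measurable).coe_nnreal_ennreal

theorem measurable_jinv (k : ℕ) : Measurable (jinv k : Freq N → ℝ≥0∞) :=
  ((continuous_jn.pow k).measurable.inv).coe_nnreal_ennreal

theorem aemeasurable_wA {u : Freq N → ℂ} (hu : AEStronglyMeasurable u) (s : ℕ) :
    AEMeasurable (wA s u) :=
  (measurable_jn_pow s).aemeasurable.mul hu.enorm

theorem wn_zero (u : Freq N → ℂ) : wn 0 u = eLpNorm u 2 volume := by
  have : wA 0 u = fun ξ => ‖u ξ‖ₑ := by funext ξ; simp [wA]
  rw [wn, this, eLpNorm_enorm]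

theorem wn_congr {u w : Freq N → ℂ} (h : u =ᵐ[volume] w) (s : ℕ) : wn s u = wn s w := by
  refine eLpNorm_congr_ae ?_
  filter_upwards [h] with ξ hξ
  rw [wA, wA, hξ]

theorem wA_mono {s s' : ℕ} (h : s ≤ s') (u : Freq N → ℂ) (ξ : Freq N) : wA s u ξ ≤ wA s' u ξ := by
  refine mul_le_mul_left ?_ _
  exact_mod_cast pow_le_pow_right₀ (one_le_jn ξ) h

theorem wn_mono {s s' : ℕ} (h : s ≤ s') (u : Freq N → ℂ) : wn s u ≤ wn s' u :=
  eLpNorm_mono_enorm fun ξ => wA_mono h u ξ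

theorem wn_le_of_bound {u w : Freq N → ℂ} {s s' : ℕ} {c : ℝ≥0}
    (h : ∀ᵐ ξ, wA s u ξ ≤ c * wA s' w ξ) : wn s u ≤ c * wn s' w := by
  have := eLpNorm_le_nnreal_smul_eLpNorm_of_ae_le_mul' (μ := volume) (f := wA s u) (g := wA s' w)
    (c := c) (by simpa using h) 2
  simpa [wn, ENNReal.smul_def] using this

theorem memLp_of_wn {u : Freq N → ℂ} {s : ℕ} (hm : AEStronglyMeasurable u) (h : wn s u < ⊤) :
    MemLp u 2 volume := by
  refine ⟨hm, ?_⟩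
  rw [← wn_zero]
  exact (wn_mono (Nat.zero_le s) u).trans_lt h

theorem wn_add_le {u w : Freq N → ℂ} (hu : AEStronglyMeasurable u) (hw : AEStronglyMeasurable w)
    (s : ℕ) : wn s (fun ξ => u ξ + w ξ) ≤ wn s u + wn s w := by
  refine le_trans (eLpNorm_mono_enorm (g := wA s u + wA s w) fun ξ => ?_)
    (eLpNorm_add_le (aemeasurable_wA hu s).aestronglyMeasurable
      (aemeasurable_wA hw s).aestronglyMeasurable (by norm_num))
  simp only [enorm_eq_self, Pi.add_apply, wA, ← mul_add]
  gcongr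
  exact enorm_add_le _ _

theorem wn_const_mul (c : ℂ) (u : Freq N → ℂ) (s : ℕ) :
    wn s (fun ξ => c * u ξ) ≤ ‖c‖₊ * wn s u := by
  refine wn_le_of_bound (Eventually.of_forall fun ξ => le_of_eq ?_)
  simp only [wA, enorm_mul, ← enorm_eq_nnnorm]
  ring

theorem wn_neg (u : Freq N → ℂ) (s : ℕ) : wn s (fun ξ => -u ξ) = wn s u := by
  have : wA s (fun ξ => -u ξ) = wA s u := by funext ξ; simp [wA]
  rw [wn, this, wn]

theorem wn_sub_le {u w : Freq N → ℂ} (hu : AEStronglyMeasurable u) (hw : AEStronglyMeasurable w)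
    (s : ℕ) : wn s (fun ξ => u ξ - w ξ) ≤ wn s u + wn s w := by
  have h := wn_add_le hu hw.neg s
  rw [show (-w) = fun ξ => -w ξ from rfl, wn_neg] at h
  simpa only [sub_eq_add_neg] using h

/-- The `L²` norm of the inverse weight. -/
def jconst (N k : ℕ) : ℝ≥0∞ := eLpNorm (jinv k : Freq N → ℝ≥0∞) 2 volume

theorem jconst_lt_top {k : ℕ} (hk : (N : ℝ) < 2 * k) : jconst N k < ⊤ := by
  have h := finite_integral_one_add_norm (E := Freq N) (μ := volume) (r := 2 * (k : ℝ)) (by simpa using hk)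
  have hsq : jconst N k ^ 2 = ∫⁻ ξ : Freq N, jinv k ξ ^ 2 := by
    have := eLpNorm_nnreal_pow_eq_lintegral (μ := volume) (f := (jinv k : Freq N → ℝ≥0∞)) (p := 2)
      (by norm_num)
    simpa [jconst] using this
  have : jconst N k ^ 2 < ⊤ := by
    rw [hsq]
    refine lt_of_eq_of_lt (lintegral_congr fun ξ => ?_) h
    have h1 : (0 : ℝ) < 1 + ‖ξ‖ := by positivity
    rw [Real.rpow_neg h1.le, show (2 : ℝ) * k = ((k * 2 : ℕ) : ℝ) by push_cast; ring,
      Real.rpow_natCast, jinv, ← ENNReal.coe_pow, ENNReal.ofReal]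
    congr 1
    ext
    rw [Real.coe_toNNReal _ (by positivity)]
    simp [jn, pow_mul]
  by_contra hh
  rw [not_lt, top_le_iff] at hh
  simp [hh] at this

theorem lintegral_jn_mul_le {u : Freq N → ℂ} (hu : AEStronglyMeasurable u) (k : ℕ) :
    ∫⁻ ξ, jn ξ * ‖u ξ‖ₑ ≤ jconst N k * wn (k + 1) u := by
  refine le_trans (le_of_eq (lintegral_congr fun ξ => ?_))
    (lintegral_mul_le_eLpNorm_two (measurable_jinv k).aemeasurable (aemeasurable_wA hu (k + 1)))
  rw [wA, jinv, ← mul_assoc, ← ENNReal.coe_mul, pow_succ, inv_mul_cancel_left₀]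
  exact (pow_pos (zero_lt_one.trans_le (one_le_jn ξ)) _).ne'

theorem integrable_of_wn {u : Freq N → ℂ} {k : ℕ} (hk : (N : ℝ) < 2 * k)
    (hm : AEStronglyMeasurable u) (h : wn (k + 1) u < ⊤) : Integrable u := by
  refine ⟨hm, lt_of_le_of_lt (lintegral_mono fun ξ => ?_) ((lintegral_jn_mul_le hm k).trans_lt
    (ENNReal.mul_lt_top (jconst_lt_top hk) h))⟩
  exact le_mul_of_one_le_left' (ENNReal.one_le_coe_iff.2 (one_le_jn ξ))

/-- Here a, b are the weights of the output and input frequencies and c that of their difference. If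
c ≤ b, then a ≤ 2b. Otherwise a ≤ 2c, and the power c ^ s is paid by c ^ (k + 1), leaving the factor
b ^ (-k), square integrable when 2k exceeds the dimension. -/
theorem pow_kernel_bound {a b c : ℝ} (ha : 1 ≤ a) (hb : 1 ≤ b) (hc : 1 ≤ c) (hab : a ≤ b + c)
    {s k : ℕ} (hs : s ≤ k + 1) :
    a ^ s ≤ 2 ^ (k + 1) * (b ^ s * (c + c ^ (k + 1) * (b ^ k)⁻¹)) := by
  have hb0 : 0 < b := by linarith
  have hc0 : 0 < c := by linarith
  have h2 : (2 : ℝ) ^ s ≤ 2 ^ (k + 1) := pow_le_pow_right₀ (by norm_num) hs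
  rcases le_total c b with h | h
  · calc a ^ s ≤ (2 * b) ^ s := pow_le_pow_left₀ (by linarith) (by linarith) s
      _ = 2 ^ s * (b ^ s * 1) := by rw [mul_pow, mul_one]
      _ ≤ 2 ^ (k + 1) * (b ^ s * (c + c ^ (k + 1) * (b ^ k)⁻¹)) := by
        gcongr
        exact le_add_of_le_of_nonneg hc (by positivity)
  · have h3 : c ^ s * b ^ k ≤ b ^ s * c ^ (k + 1) := by
      obtain ⟨j, hj⟩ := Nat.exists_eq_add_of_le hs
      calc c ^ s * b ^ k ≤ c ^ s * b ^ (k + 1) := by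
            gcongr
            exact Nat.le_succ k
        _ = b ^ s * (c ^ s * b ^ j) := by rw [hj, pow_add]; ring
        _ ≤ b ^ s * (c ^ s * c ^ j) := by gcongr
        _ = b ^ s * c ^ (k + 1) := by rw [hj, pow_add]
    calc a ^ s ≤ (2 * c) ^ s := pow_le_pow_left₀ (by linarith) (by linarith) s
      _ = 2 ^ s * (c ^ s * b ^ k * (b ^ k)⁻¹) := by
        rw [mul_pow, mul_assoc, mul_inv_cancel₀ (by positivity), mul_one]
      _ ≤ 2 ^ (k + 1) * (b ^ s * c ^ (k + 1) * (b ^ k)⁻¹) := by gcongr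
      _ ≤ 2 ^ (k + 1) * (b ^ s * (c + c ^ (k + 1) * (b ^ k)⁻¹)) := by
        rw [mul_assoc (b ^ s)]
        gcongr
        linarith

/-- If a ≥ 2c, then a and b are comparable; writing the difference as (a^{2s} - b^{2s}) q - b^{2s}
(p - q), each term contains a factor c in place of a full derivative. If a < 2c and s > 0, no
cancellation is needed: both terms are at most L a^{2s} b, and the excess powers are transferred to
c. -/
theorem symm_kernel_bound_aux {a b c p q L : ℝ} (hb : 1 ≤ b) (hc : 1 ≤ c)
    (hba : b ≤ a) (hab : a ≤ b + c) (hL : 0 ≤ L) (hp : |p| ≤ L * a) (hq : |q| ≤ L * b)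
    (hpq : |p - q| ≤ L * c) {s k : ℕ} (hs : s ≤ k + 1) :
    |a ^ (2 * s) * q - b ^ (2 * s) * p| ≤
      (2 * k + 3) * 2 ^ (k + 2) * L * (a ^ s * b ^ s * (c + c ^ (k + 1) * (b ^ k)⁻¹)) := by
  have ha : 1 ≤ a := hb.trans hba
  have hb0 : 0 < b := by linarith
  have hc0 : 0 < c := by linarith
  have ha0 : 0 < a := by linarith
  have hsr : (s : ℝ) ≤ k + 1 := by exact_mod_cast hs
  by_cases h : 2 * c ≤ a
  · have h1 : |a ^ (2 * s) - b ^ (2 * s)| * a ≤ c * (2 * s) * a ^ (2 * s) := by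
      rcases Nat.eq_zero_or_pos s with rfl | hs0
      · simp
      have := abs_pow_sub_pow_le a b (2 * s)
      rw [abs_of_nonneg ha0.le, abs_of_nonneg hb0.le, max_eq_left hba,
        abs_of_nonneg (sub_nonneg.2 hba)] at this
      calc _ ≤ ((a - b) * ((2 * s : ℕ) : ℝ) * a ^ (2 * s - 1)) * a := by gcongr
        _ = (a - b) * (2 * s) * (a ^ (2 * s - 1) * a) := by push_cast; ring
        _ = (a - b) * (2 * s) * a ^ (2 * s) := by
          rw [← pow_succ, Nat.sub_add_cancel (by omega)]
        _ ≤ c * (2 * s) * a ^ (2 * s) := by gcongr; linarith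
    have h2 : a ^ (2 * s) ≤ 2 ^ (k + 1) * (a ^ s * b ^ s) := by
      calc a ^ (2 * s) = a ^ s * a ^ s := by rw [two_mul, pow_add]
        _ ≤ a ^ s * (2 * b) ^ s := by gcongr; linarith
        _ = 2 ^ s * (a ^ s * b ^ s) := by rw [mul_pow]; ring
        _ ≤ _ := by gcongr; norm_num
    have e : a ^ (2 * s) * q - b ^ (2 * s) * p =
        (a ^ (2 * s) - b ^ (2 * s)) * q - b ^ (2 * s) * (p - q) := by ring
    calc _ ≤ |a ^ (2 * s) - b ^ (2 * s)| * |q| + b ^ (2 * s) * |p - q| := by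
          rw [e]
          refine (abs_sub _ _).trans ?_
          rw [abs_mul, abs_mul, abs_of_nonneg (by positivity : 0 ≤ b ^ (2 * s))]
      _ ≤ |a ^ (2 * s) - b ^ (2 * s)| * (L * a) + a ^ (2 * s) * (L * c) := by
        gcongr
        exact hq.trans (by gcongr)
      _ = L * (|a ^ (2 * s) - b ^ (2 * s)| * a) + a ^ (2 * s) * (L * c) := by ring
      _ ≤ L * (c * (2 * s) * a ^ (2 * s)) + a ^ (2 * s) * (L * c) := by gcongr
      _ = (2 * s + 1) * L * c * a ^ (2 * s) := by ring
      _ ≤ (2 * k + 3) * L * c * (2 ^ (k + 1) * (a ^ s * b ^ s)) := by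
        gcongr ?_ * L * c * ?_
        · linarith
      _ = (2 * k + 3) * 2 ^ (k + 1) * L * (a ^ s * b ^ s * c) := by ring
      _ ≤ _ := by
        gcongr
        · norm_num
        · norm_num
        · exact le_add_of_nonneg_right (by positivity)
  · rw [not_le] at h
    rcases Nat.eq_zero_or_pos s with rfl | hs0
    · simp only [mul_zero, pow_zero, one_mul]
      rw [abs_sub_comm]
      calc |p - q| ≤ L * c := hpq
        _ = 1 * L * c := by ring
        _ ≤ _ := by
          gcongr
          · exact one_le_mul_of_one_le_of_one_le (by linarith [(Nat.cast_nonneg k : (0 : ℝ) ≤ k)])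
              (one_le_pow₀ (by norm_num))
          · exact le_add_of_nonneg_right (by positivity)
    have h1 : b ^ (2 * s) * a ≤ a ^ (2 * s) * b := by
      calc b ^ (2 * s) * a = b ^ (2 * s - 1) * b * a := by
            rw [← pow_succ, Nat.sub_add_cancel (by omega)]
        _ ≤ a ^ (2 * s - 1) * b * a := by gcongr
        _ = a ^ (2 * s - 1) * a * b := by ring
        _ = _ := by rw [← pow_succ, Nat.sub_add_cancel (by omega)]
    have h2 : a ^ s * b ^ (k + 1) ≤ 2 ^ (k + 1) * (b ^ s * c ^ (k + 1)) := by
      obtain ⟨j, hj⟩ := Nat.exists_eq_add_of_le hs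
      calc a ^ s * b ^ (k + 1) = b ^ s * (a ^ s * b ^ j) := by rw [hj, pow_add]; ring
        _ ≤ b ^ s * (a ^ s * a ^ j) := by gcongr
        _ = b ^ s * a ^ (k + 1) := by rw [hj, pow_add]
        _ ≤ b ^ s * (2 * c) ^ (k + 1) := by gcongr
        _ = _ := by rw [mul_pow]; ring
    have h3 : a ^ (2 * s) * b ≤ 2 ^ (k + 1) * (a ^ s * b ^ s * (c ^ (k + 1) * (b ^ k)⁻¹)) := by
      calc a ^ (2 * s) * b = a ^ s * (a ^ s * b ^ (k + 1)) * (b ^ k)⁻¹ := by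
            rw [two_mul, pow_add, pow_succ b k]; field_simp
        _ ≤ a ^ s * (2 ^ (k + 1) * (b ^ s * c ^ (k + 1))) * (b ^ k)⁻¹ := by gcongr
        _ = _ := by ring
    calc _ ≤ a ^ (2 * s) * |q| + b ^ (2 * s) * |p| := by
          refine (abs_sub _ _).trans ?_
          rw [abs_mul, abs_mul, abs_of_nonneg (by positivity : 0 ≤ b ^ (2 * s)),
            abs_of_nonneg (by positivity : 0 ≤ a ^ (2 * s))]
      _ ≤ a ^ (2 * s) * (L * b) + b ^ (2 * s) * (L * a) := by gcongr
      _ = L * (a ^ (2 * s) * b + b ^ (2 * s) * a) := by ring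
      _ ≤ L * (2 * (2 ^ (k + 1) * (a ^ s * b ^ s * (c ^ (k + 1) * (b ^ k)⁻¹)))) := by
        gcongr; linarith
      _ = 1 * 2 ^ (k + 2) * L * (a ^ s * b ^ s * (c ^ (k + 1) * (b ^ k)⁻¹)) := by ring
      _ ≤ _ := by
        gcongr
        · linarith [(Nat.cast_nonneg k : (0 : ℝ) ≤ k)]
        · linarith

/-- The kernel estimate behind the symmetrisation of a first order operator. -/
theorem symm_kernel_bound {a b c p q L : ℝ} (ha : 1 ≤ a) (hb : 1 ≤ b) (hc : 1 ≤ c)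
    (hab : a ≤ b + c) (hba : b ≤ a + c) (hL : 0 ≤ L) (hp : |p| ≤ L * a) (hq : |q| ≤ L * b)
    (hpq : |p - q| ≤ L * c) {s k : ℕ} (hs : s ≤ k + 1) :
    |a ^ (2 * s) * q - b ^ (2 * s) * p| ≤ (2 * k + 3) * 2 ^ (k + 2) * L *
      (a ^ s * b ^ s * (c + c ^ (k + 1) * (b ^ k)⁻¹ + c ^ (k + 1) * (a ^ k)⁻¹)) := by
  rcases le_total b a with h | h
  · refine (symm_kernel_bound_aux hb hc h hab hL hp hq hpq hs).trans ?_
    gcongr _ * (_ * ?_)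
    exact le_add_of_nonneg_right (by positivity)
  · rw [abs_sub_comm]
    refine (symm_kernel_bound_aux ha hc h hba hL hq hp (by rwa [abs_sub_comm]) hs).trans ?_
    rw [mul_comm (b ^ s)]
    gcongr _ * (_ * ?_)
    have : 0 ≤ c ^ (k + 1) * (b ^ k)⁻¹ := by positivity
    linarith

end Weights
-- Product and commutator estimates in Sobolev norms
section Estimates

variable {N : ℕ}

/-- One Young inequality for each term of the kernel. The bare factor c puts v in a weighted L¹
space; in the other two terms v stays in L² and the decaying weight puts C, respectively A, in L¹.
-/
theorem trilin_weight_le {A C : Freq N → ℝ≥0∞} (hA : AEMeasurable A) (hC : AEMeasurable C)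
    {v : Freq N → ℂ} (hv : AEStronglyMeasurable v) (k : ℕ) :
    ∫⁻ ξ, ∫⁻ η, A ξ * ((jn (ξ - η) + jn (ξ - η) ^ (k + 1) * (jn η ^ k)⁻¹ +
        jn (ξ - η) ^ (k + 1) * (jn ξ ^ k)⁻¹ : ℝ≥0) * ‖v (ξ - η)‖ₑ) * C η ≤
      3 * (jconst N k * wn (k + 1) v) * (eLpNorm A 2 volume * eLpNorm C 2 volume) := by
  have hW := aemeasurable_wA hv (k + 1)
  have hJ := (measurable_jinv (N := N) k).aemeasurable (μ := volume)
  have hB : AEMeasurable fun ξ => (jn ξ : ℝ≥0∞) * ‖v ξ‖ₑ :=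
    (continuous_jn.measurable.coe_nnreal_ennreal).aemeasurable.mul hv.enorm
  have e : ∀ ξ η, A ξ * ((jn (ξ - η) + jn (ξ - η) ^ (k + 1) * (jn η ^ k)⁻¹ +
        jn (ξ - η) ^ (k + 1) * (jn ξ ^ k)⁻¹ : ℝ≥0) * ‖v (ξ - η)‖ₑ) * C η =
      (A ξ * (jn (ξ - η) * ‖v (ξ - η)‖ₑ) * C η +
        A ξ * wA (k + 1) v (ξ - η) * (jinv k η * C η)) +
        A ξ * jinv k ξ * wA (k + 1) v (ξ - η) * C η := by
    intro ξ η
    simp only [wA, jinv]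
    push_cast
    ring
  have t1 := trilin_integrand hA hB hC
  have t2 : AEMeasurable (fun p : Freq N × Freq N =>
      A p.1 * wA (k + 1) v (p.1 - p.2) * (jinv k p.2 * C p.2)) (volume.prod volume) :=
    trilin_integrand hA hW (hJ.mul hC)
  have t3 : AEMeasurable (fun p : Freq N × Freq N =>
      A p.1 * jinv k p.1 * wA (k + 1) v (p.1 - p.2) * C p.2) (volume.prod volume) :=
    trilin_integrand (hA.mul hJ) hW hC
  have m : ∀ {G : Freq N × Freq N → ℝ≥0∞}, AEMeasurable G (volume.prod volume) →
      ∫⁻ p, G p ∂(volume.prod volume) = ∫⁻ ξ, ∫⁻ η, G (ξ, η) := fun hG => lintegral_prod _ hG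
  have add3 : ∀ {F G H : Freq N × Freq N → ℝ≥0∞}, AEMeasurable F (volume.prod volume) →
      AEMeasurable G (volume.prod volume) →
      ∫⁻ p, F p + G p + H p ∂(volume.prod volume) = ∫⁻ p, F p ∂(volume.prod volume) +
        ∫⁻ p, G p ∂(volume.prod volume) + ∫⁻ p, H p ∂(volume.prod volume) := by
    intro F G H hF hG
    have := lintegral_add_left' (hF.add hG) H
    simp only [Pi.add_apply] at this
    rw [this, lintegral_add_left' hF]
  simp only [e]
  rw [← m (G := fun p => (A p.1 * (jn (p.1 - p.2) * ‖v (p.1 - p.2)‖ₑ) * C p.2 +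
        A p.1 * wA (k + 1) v (p.1 - p.2) * (jinv k p.2 * C p.2)) +
        A p.1 * jinv k p.1 * wA (k + 1) v (p.1 - p.2) * C p.2) ((t1.add t2).add t3),
    add3 t1 t2, m t1, m t2, m t3]
  have b1 := trilin_le_mid hA hB hC
  have b2 := trilin_le_right hA hW (hJ.mul hC)
  have b3 := trilin_le_left (hA.mul hJ) hW hC
  have c1 := lintegral_jn_mul_le hv k
  have c2 := lintegral_mul_le_eLpNorm_two hJ hC
  have c3 := lintegral_mul_le_eLpNorm_two hA hJ
  calc _ ≤ eLpNorm A 2 volume * (jconst N k * wn (k + 1) v) * eLpNorm C 2 volume +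
        eLpNorm A 2 volume * wn (k + 1) v * (jconst N k * eLpNorm C 2 volume) +
        (eLpNorm A 2 volume * jconst N k) * wn (k + 1) v * eLpNorm C 2 volume := by
        refine add_le_add (add_le_add (b1.trans ?_) (b2.trans ?_)) (b3.trans ?_)
        · gcongr
        · exact mul_le_mul_right c2 _
        · refine mul_le_mul_left (mul_le_mul_left c3 _) _
    _ = _ := by ring

/-- The constant in the kernel estimates. -/
def kc (k : ℕ) : ℝ≥0 := (2 * k + 3) * 2 ^ (k + 2)

theorem jn_le_add (ξ η : Freq N) : jn ξ ≤ jn η + jn (ξ - η) := by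
  have : ‖ξ‖₊ ≤ ‖η‖₊ + ‖ξ - η‖₊ := by
    simpa using nnnorm_add_le η (ξ - η)
  simp only [jn]
  calc 1 + ‖ξ‖₊ ≤ 1 + (‖η‖₊ + ‖ξ - η‖₊) := by gcongr
    _ ≤ _ := by
      rw [show 1 + ‖η‖₊ + (1 + ‖ξ - η‖₊) = 1 + (‖η‖₊ + ‖ξ - η‖₊) + 1 by ring]
      exact le_self_add

theorem jn_pow_le {s k : ℕ} (hs : s ≤ k + 1) (ξ η : Freq N) :
    jn ξ ^ s ≤ kc k * (jn η ^ s * (jn (ξ - η) + jn (ξ - η) ^ (k + 1) * (jn η ^ k)⁻¹)) := by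
  have h := pow_kernel_bound (a := jn ξ) (b := jn η) (c := jn (ξ - η)) (one_le_jn _) (one_le_jn _)
    (one_le_jn _) (by exact_mod_cast jn_le_add ξ η) hs
  have h2 : (2 : ℝ) ^ (k + 1) ≤ (kc k : ℝ) := by
    rw [kc]
    push_cast
    calc (2 : ℝ) ^ (k + 1) = 1 * 2 ^ (k + 1) := by ring
      _ ≤ (2 * k + 3) * 2 ^ (k + 2) := by
        gcongr
        · linarith [(Nat.cast_nonneg k : (0 : ℝ) ≤ k)]
        · norm_num
        · norm_num
  have h3 := h.trans (mul_le_mul_of_nonneg_right h2 (by positivity))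
  exact_mod_cast h3

theorem lintegral_weight_pow_le {A C : Freq N → ℝ≥0∞} (hA : AEMeasurable A) (hC : AEMeasurable C)
    {v : Freq N → ℂ} (hv : AEStronglyMeasurable v) {s k : ℕ} (hs : s ≤ k + 1) :
    ∫⁻ ξ, ∫⁻ η, A ξ * (jn ξ ^ s : ℝ≥0) * ‖v (ξ - η)‖ₑ * C η ≤
      kc k * (3 * (jconst N k * wn (k + 1) v) *
        (eLpNorm A 2 volume * eLpNorm (fun η => (jn η ^ s : ℝ≥0) * C η) 2 volume)) := by
  have hC' : AEMeasurable fun η => (jn η ^ s : ℝ≥0) * C η :=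
    (measurable_jn_pow s).aemeasurable.mul hC
  refine le_trans ?_ (mul_le_mul_right (trilin_weight_le hA hC' hv k) _)
  rw [← lintegral_const_mul' _ _ ENNReal.coe_ne_top]
  refine lintegral_mono fun ξ => ?_
  dsimp only
  rw [← lintegral_const_mul' _ _ ENNReal.coe_ne_top]
  refine lintegral_mono fun η => ?_
  have h1 : (jn ξ ^ s : ℝ≥0) ≤ kc k * ((jn (ξ - η) + jn (ξ - η) ^ (k + 1) * (jn η ^ k)⁻¹ +
      jn (ξ - η) ^ (k + 1) * (jn ξ ^ k)⁻¹) * jn η ^ s) := by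
    refine (jn_pow_le hs ξ η).trans ?_
    rw [mul_comm (jn η ^ s)]
    gcongr _ * (?_ * _)
    exact le_self_add
  calc A ξ * (jn ξ ^ s : ℝ≥0) * ‖v (ξ - η)‖ₑ * C η
      ≤ A ξ * (kc k * ((jn (ξ - η) + jn (ξ - η) ^ (k + 1) * (jn η ^ k)⁻¹ +
        jn (ξ - η) ^ (k + 1) * (jn ξ ^ k)⁻¹) * jn η ^ s) : ℝ≥0) * ‖v (ξ - η)‖ₑ * C η := by
        gcongr
    _ = _ := by
      push_cast
      ring

/-- H^{k+1} acts on H^s by multiplication for 0 ≤ s ≤ k + 1: the L² norm is computed by duality and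
the weight of the output is distributed by `pow_kernel_bound`. -/
theorem wn_cv_le {v u : Freq N → ℂ} (hv : AEStronglyMeasurable v) (hu : AEStronglyMeasurable u)
    {s k : ℕ} (hs : s ≤ k + 1) :
    wn s (cv v u) ≤ kc k * (3 * (jconst N k * wn (k + 1) v)) * wn s u := by
  refine eLpNorm_two_le_of_forall (aemeasurable_wA (aestronglyMeasurable_cv hv hu) s)
    fun A hA => ?_
  have h := lintegral_weight_pow_le hA hu.enorm hv hs
  calc _ ≤ ∫⁻ ξ, ∫⁻ η, A ξ * (jn ξ ^ s : ℝ≥0) * ‖v (ξ - η)‖ₑ * ‖u η‖ₑ := by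
        refine lintegral_mono fun ξ => ?_
        simp only [wA, mul_assoc]
        have e := lintegral_const_mul'' (μ := volume) (A ξ * (jn ξ ^ s : ℝ≥0))
          ((AEMeasurable.comp_const_sub hv.enorm ξ).mul hu.enorm)
        simp only [Pi.mul_apply, mul_assoc] at e
        rw [e]
        gcongr
        exact enorm_cv_le ξ
    _ ≤ _ := h
    _ = eLpNorm A 2 volume * (kc k * (3 * (jconst N k * wn (k + 1) v)) * wn s u) := by
      rw [show wn s u = eLpNorm (fun η => (jn η ^ s : ℝ≥0) * ‖u η‖ₑ) 2 volume from rfl]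
      ring

/-- The symbol `2π ξ · X` of the derivative along `X`, up to the factor `i`. -/
def dsym (X : Fin N → ℝ) (ξ : Freq N) : ℝ := 2 * Real.pi * freqPair X ξ

/-- The Lipschitz constant of the symbol. -/
def dlip (X : Fin N → ℝ) : ℝ≥0 := 2 * NNReal.pi * ‖WithLp.toLp 2 X‖₊

theorem continuous_dsym (X : Fin N → ℝ) : Continuous (dsym X) :=
  continuous_const.mul (freqPair_continuous X)

theorem dsym_sub (X : Fin N → ℝ) (ξ η : Freq N) : dsym X (ξ - η) = dsym X ξ - dsym X η := by
  simp only [dsym, freqPair, inner_sub_left]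
  ring

theorem abs_dsym_le (X : Fin N → ℝ) (ξ : Freq N) : |dsym X ξ| ≤ dlip X * jn ξ := by
  have h := norm_freqPair_le X ξ
  have hp := Real.pi_pos
  rw [dsym, abs_mul, abs_of_nonneg (by positivity : 0 ≤ 2 * Real.pi)]
  simp only [dlip, jn]
  push_cast
  rw [NNReal.coe_real_pi]
  calc _ ≤ 2 * Real.pi * (‖WithLp.toLp 2 X‖ * ‖ξ‖) := by gcongr
    _ = 2 * Real.pi * ‖WithLp.toLp 2 X‖ * ‖ξ‖ := by ring
    _ ≤ 2 * Real.pi * ‖WithLp.toLp 2 X‖ * (1 + ‖ξ‖) := by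
      gcongr
      linarith

theorem dsym_neg (X : Fin N → ℝ) (ξ : Freq N) : dsym X (-ξ) = -dsym X ξ := by
  simp [dsym, freqPair, inner_neg_left]

theorem nnnorm_dsym_le (X : Fin N → ℝ) (ξ : Freq N) : ‖dsym X ξ‖₊ ≤ dlip X * jn ξ := by
  have := abs_dsym_le X ξ
  exact_mod_cast this

/-- The derivative along `X` on the Fourier side. -/
def dmul (X : Fin N → ℝ) (u : Freq N → ℂ) (ξ : Freq N) : ℂ := Complex.I * dsym X ξ * u ξ

theorem aestronglyMeasurable_dmul (X : Fin N → ℝ) {u : Freq N → ℂ} (hu : AEStronglyMeasurable u) :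
    AEStronglyMeasurable (dmul X u) :=
  (continuous_const.mul (Complex.continuous_ofReal.comp
    (continuous_dsym X))).aestronglyMeasurable.mul hu

theorem enorm_dmul_le (X : Fin N → ℝ) (u : Freq N → ℂ) (ξ : Freq N) :
    ‖dmul X u ξ‖ₑ ≤ dlip X * (jn ξ * ‖u ξ‖ₑ) := by
  rw [dmul, enorm_mul, enorm_mul, ← mul_assoc]
  refine mul_le_mul_left ?_ _
  have := nnnorm_dsym_le X ξ
  simp only [enorm_eq_nnnorm, Complex.nnnorm_I, Complex.nnnorm_real, ENNReal.coe_one, one_mul]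
  exact_mod_cast this

theorem wn_dmul_le (X : Fin N → ℝ) (u : Freq N → ℂ) (s : ℕ) :
    wn s (dmul X u) ≤ dlip X * wn (s + 1) u := by
  refine wn_le_of_bound (Eventually.of_forall fun ξ => ?_)
  simp only [wA]
  refine (mul_le_mul_right (enorm_dmul_le X u ξ) _).trans (le_of_eq ?_)
  rw [pow_succ]
  push_cast
  ring

/-- The symmetrised quadratic form of the first order operator `v ∂_X` is bounded without loss
of derivatives. -/
theorem enorm_re_integral_symm_le (X : Fin N → ℝ) {v u : Freq N → ℂ} {s k : ℕ} (hs : s ≤ k + 1)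
    (hk : (N : ℝ) < 2 * k) (hv : AEStronglyMeasurable v) (hu : AEStronglyMeasurable u)
    (hvs : ConjSymm v) (hvn : wn (k + 1) v < ⊤) (hun : wn (s + 1) u < ⊤) :
    ‖(∫ ξ, conj (u ξ) * ((jn ξ : ℝ) ^ (2 * s) : ℝ) * cv v (dmul X u) ξ).re‖ₑ ≤
      kc k * dlip X * (3 * (jconst N k * wn (k + 1) v)) * wn s u ^ 2 := by
  set G : Freq N × Freq N → ℂ := fun p => conj (u p.1) * ((jn p.1 : ℝ) ^ (2 * s) : ℝ) *
    (v (p.1 - p.2) * dmul X u p.2) with hG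
  have hGm : AEStronglyMeasurable G (volume.prod volume) := by
    refine AEStronglyMeasurable.mul ?_ ?_
    · have h1 : AEStronglyMeasurable
          (fun ξ : Freq N => conj (u ξ) * (((jn ξ : ℝ) ^ (2 * s) : ℝ) : ℂ)) volume :=
        hu.star.mul (Complex.continuous_ofReal.comp ((NNReal.continuous_coe.comp
          continuous_jn).pow _)).aestronglyMeasurable
      exact h1.comp_fst
    · exact aestronglyMeasurable_cv_integrand hv (aestronglyMeasurable_dmul X hu)
  -- The norm of order s + 1 of u is used here only qualitatively, to justify Fubini; it does not
  -- enter the final bound.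
  have hGi : Integrable G (volume.prod volume) := by
    refine ⟨hGm, ?_⟩
    rw [HasFiniteIntegral, lintegral_prod _ hGm.enorm]
    have hd := (aestronglyMeasurable_dmul X hu).enorm
    have h1 := lintegral_weight_pow_le (aemeasurable_wA hu s) hd hv hs
    refine lt_of_le_of_lt (lintegral_mono fun ξ => lintegral_mono fun η => ?_)
      (h1.trans_lt ?_)
    · simp only [hG, enorm_mul, wA]
      rw [show ‖conj (u ξ)‖ₑ = ‖u ξ‖ₑ from RCLike.enorm_conj _]
      have : ‖(((jn ξ : ℝ) ^ (2 * s) : ℝ) : ℂ)‖ₑ = ((jn ξ ^ s * jn ξ ^ s : ℝ≥0) : ℝ≥0∞) := by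
        rw [enorm_eq_nnnorm]
        congr 1
        ext
        simp [two_mul, pow_add]
      rw [this]
      push_cast
      exact le_of_eq (by ring)
    · refine ENNReal.mul_lt_top ENNReal.coe_lt_top (ENNReal.mul_lt_top (ENNReal.mul_lt_top
        (by norm_num) (ENNReal.mul_lt_top (jconst_lt_top hk) hvn)) (ENNReal.mul_lt_top
        ((wn_mono (Nat.le_succ s) u).trans_lt hun) ?_))
      exact (wn_dmul_le X u s).trans_lt (ENNReal.mul_lt_top ENNReal.coe_lt_top hun)
  have e1 : ∫ ξ, conj (u ξ) * ((jn ξ : ℝ) ^ (2 * s) : ℝ) * cv v (dmul X u) ξ =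
      ∫ p, G p ∂(volume.prod volume) := by
    rw [integral_prod _ hGi]
    refine integral_congr_ae (Eventually.of_forall fun ξ => ?_)
    simp only [hG, cv, ← integral_const_mul]
  set I := ∫ p, G p ∂(volume.prod volume) with hI
  have hGs : Integrable (fun p => G p.swap) (volume.prod volume) := hGi.swap
  have hGc : Integrable (fun p => conj (G p.swap)) (volume.prod volume) := by
    simpa using! (Complex.conjCLE.toContinuousLinearMap.integrable_comp hGs)
  -- Twice the real part is the integral of G plus the conjugate of its transpose. Since v is the
  -- transform of a real function and the symbol of ∂_X is odd and imaginary, the two halves combine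
  -- into the difference a^{2s} q - b^{2s} p bounded by `symm_kernel_bound`.
  have e2 : ((2 * I.re : ℝ) : ℂ) = ∫ p, (G p + conj (G p.swap)) ∂(volume.prod volume) := by
    rw [integral_add hGi hGc, integral_conj,
      show ∫ p, G p.swap ∂(volume.prod volume) = I from integral_prod_swap G, ← hI,
      Complex.add_conj]
  have hsym : ∀ᵐ p : Freq N × Freq N ∂(volume.prod volume),
      v (p.2 - p.1) = conj (v (p.1 - p.2)) := by
    have := (quasiMeasurePreserving_sub_of_right_invariant (volume : Measure (Freq N))
      (volume : Measure (Freq N))).ae hvs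
    filter_upwards [this] with p hp
    rw [← hp, neg_sub]
  have hb : ∀ᵐ p : Freq N × Freq N ∂(volume.prod volume), ‖G p + conj (G p.swap)‖ₑ ≤
      (kc k * dlip X : ℝ≥0) * (wA s u p.1 * ((jn (p.1 - p.2) +
        jn (p.1 - p.2) ^ (k + 1) * (jn p.2 ^ k)⁻¹ +
        jn (p.1 - p.2) ^ (k + 1) * (jn p.1 ^ k)⁻¹ : ℝ≥0) * ‖v (p.1 - p.2)‖ₑ) * wA s u p.2) := by
    filter_upwards [hsym] with p hp
    obtain ⟨ξ, η⟩ := p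
    have e3 : G (ξ, η) + conj (G (ξ, η).swap) = Complex.I * (conj (u ξ) * u η * v (ξ - η)) *
        (((jn ξ : ℝ) ^ (2 * s) * dsym X η - (jn η : ℝ) ^ (2 * s) * dsym X ξ : ℝ) : ℂ) := by
      simp only [hG, Prod.swap_prod_mk, dmul, map_mul, hp, Complex.conj_conj, Complex.conj_I,
        Complex.conj_ofReal]
      push_cast
      ring
    have hc : jn ξ ≤ jn η + jn (ξ - η) := jn_le_add ξ η
    have hc' : jn η ≤ jn ξ + jn (ξ - η) := by
      have := jn_le_add η ξ
      rwa [← neg_sub ξ η, jn_neg] at this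
    have hkb := symm_kernel_bound (a := jn ξ) (b := jn η) (c := jn (ξ - η)) (one_le_jn _)
      (one_le_jn _) (one_le_jn _) (by exact_mod_cast hc) (by exact_mod_cast hc')
      (dlip X).coe_nonneg (abs_dsym_le X ξ) (abs_dsym_le X η)
      (by rw [← dsym_sub]; exact abs_dsym_le X _) hs
    have hkb' : ‖((jn ξ : ℝ) ^ (2 * s) * dsym X η - (jn η : ℝ) ^ (2 * s) * dsym X ξ : ℝ)‖₊ ≤
        kc k * dlip X * (jn ξ ^ s * jn η ^ s * (jn (ξ - η) +
        jn (ξ - η) ^ (k + 1) * (jn η ^ k)⁻¹ +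
        jn (ξ - η) ^ (k + 1) * (jn ξ ^ k)⁻¹)) := by
      rw [← NNReal.coe_le_coe, coe_nnnorm, Real.norm_eq_abs]
      refine hkb.trans (le_of_eq ?_)
      simp only [kc]
      push_cast
      ring
    rw [e3, enorm_mul, enorm_mul, enorm_mul, enorm_mul,
      show ‖conj (u ξ)‖ₑ = ‖u ξ‖ₑ from RCLike.enorm_conj _]
    simp only [wA]
    rw [show ‖Complex.I‖ₑ = 1 by simp [enorm_eq_nnnorm], one_mul]
    calc _ ≤ ‖u ξ‖ₑ * ‖u η‖ₑ * ‖v (ξ - η)‖ₑ * ((kc k * dlip X * (jn ξ ^ s * jn η ^ s * (jn (ξ - η) +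
        jn (ξ - η) ^ (k + 1) * (jn η ^ k)⁻¹ +
        jn (ξ - η) ^ (k + 1) * (jn ξ ^ k)⁻¹)) : ℝ≥0) : ℝ≥0∞) := by
          refine mul_le_mul_right ?_ _
          rw [enorm_eq_nnnorm, Complex.nnnorm_real]
          exact_mod_cast hkb'
      _ = _ := by
        push_cast
        ring
  have hfin : ‖(2 * I.re : ℝ)‖ₑ ≤ kc k * dlip X * (3 * (jconst N k * wn (k + 1) v)) * wn s u ^ 2 := by
    have h5 : ‖(2 * I.re : ℝ)‖ₑ = ‖((2 * I.re : ℝ) : ℂ)‖ₑ := by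
      rw [enorm_eq_nnnorm, enorm_eq_nnnorm, Complex.nnnorm_real]
    rw [h5, e2]
    refine (enorm_integral_le_lintegral_enorm _).trans ((lintegral_mono_ae hb).trans ?_)
    rw [lintegral_const_mul' _ _ ENNReal.coe_ne_top]
    refine (mul_le_mul_right (lintegral_prod_le _) _).trans ?_
    refine (mul_le_mul_right (trilin_weight_le (aemeasurable_wA hu s) (aemeasurable_wA hu s)
      hv k) _).trans (le_of_eq ?_)
    rw [wn]
    push_cast
    rw [pow_two]
    simp only [wn]
    ring
  rw [e1]
  refine le_trans ?_ hfin
  rw [enorm_mul]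
  refine le_mul_of_one_le_left' ?_
  rw [enorm_eq_nnnorm]
  norm_num

end Estimates
-- Sobolev norms and inner products on the Fourier side
section Hilbert

variable {N : ℕ}

/-- The functions of finite Sobolev norm on the Fourier side. -/
def InH (s : ℕ) (u : Freq N → ℂ) : Prop := AEStronglyMeasurable u volume ∧ wn s u < ⊤

/-- The Sobolev norm as a real number. -/
def hn (s : ℕ) (u : Freq N → ℂ) : ℝ := (wn s u).toReal

theorem hn_nonneg (s : ℕ) (u : Freq N → ℂ) : 0 ≤ hn s u := ENNReal.toReal_nonneg

theorem hn_congr {u w : Freq N → ℂ} (h : u =ᵐ[volume] w) (s : ℕ) : hn s u = hn s w := by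
  rw [hn, wn_congr h, hn]

namespace InH

variable {u v w : Freq N → ℂ} {s s' k : ℕ}

theorem memLp (h : InH s u) : MemLp u 2 volume := memLp_of_wn h.1 h.2

theorem zero_iff : InH 0 u ↔ MemLp u 2 volume := by
  rw [InH, wn_zero]; rfl

theorem ofReal_hn (h : InH s u) : ENNReal.ofReal (hn s u) = wn s u := ENNReal.ofReal_toReal h.2.ne

theorem mono (h : InH s' u) (hs : s ≤ s') : InH s u := ⟨h.1, (wn_mono hs u).trans_lt h.2⟩

theorem hn_mono (h : InH s' u) (hs : s ≤ s') : hn s u ≤ hn s' u :=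
  ENNReal.toReal_mono h.2.ne (wn_mono hs u)

theorem congr (h : InH s u) (hw : u =ᵐ[volume] w) : InH s w :=
  ⟨h.1.congr hw, by rw [← wn_congr hw]; exact h.2⟩

theorem add (h : InH s u) (h' : InH s w) : InH s (fun ξ => u ξ + w ξ) :=
  ⟨h.1.add h'.1, (wn_add_le h.1 h'.1 s).trans_lt (ENNReal.add_lt_top.2 ⟨h.2, h'.2⟩)⟩

theorem sub (h : InH s u) (h' : InH s w) : InH s (fun ξ => u ξ - w ξ) :=
  ⟨h.1.sub h'.1, (wn_sub_le h.1 h'.1 s).trans_lt (ENNReal.add_lt_top.2 ⟨h.2, h'.2⟩)⟩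

theorem const_mul (h : InH s u) (c : ℂ) : InH s (fun ξ => c * u ξ) :=
  ⟨h.1.const_mul c, (wn_const_mul c u s).trans_lt (ENNReal.mul_lt_top ENNReal.coe_lt_top h.2)⟩

theorem dmul (h : InH (s + 1) u) (X : Fin N → ℝ) : InH s (_root_.dmul X u) :=
  ⟨aestronglyMeasurable_dmul X h.1,
    (wn_dmul_le X u s).trans_lt (ENNReal.mul_lt_top ENNReal.coe_lt_top h.2)⟩

theorem of_bound (hm : AEStronglyMeasurable u volume) (h : InH s' w) {c : ℝ≥0}
    (hc : ∀ᵐ ξ, wA s u ξ ≤ c * wA s' w ξ) : InH s u ∧ hn s u ≤ c * hn s' w := by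
  have h1 := wn_le_of_bound hc
  refine ⟨⟨hm, h1.trans_lt (ENNReal.mul_lt_top ENNReal.coe_lt_top h.2)⟩, ?_⟩
  have := ENNReal.toReal_mono (ENNReal.mul_lt_top ENNReal.coe_lt_top h.2).ne h1
  simpa [hn] using this

theorem hn_add_le (h : InH s u) (h' : InH s w) : hn s (fun ξ => u ξ + w ξ) ≤ hn s u + hn s w := by
  rw [hn, hn, hn, ← ENNReal.toReal_add h.2.ne h'.2.ne]
  exact ENNReal.toReal_mono (ENNReal.add_lt_top.2 ⟨h.2, h'.2⟩).ne (wn_add_le h.1 h'.1 s)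

theorem hn_sub_le (h : InH s u) (h' : InH s w) : hn s (fun ξ => u ξ - w ξ) ≤ hn s u + hn s w := by
  rw [hn, hn, hn, ← ENNReal.toReal_add h.2.ne h'.2.ne]
  exact ENNReal.toReal_mono (ENNReal.add_lt_top.2 ⟨h.2, h'.2⟩).ne (wn_sub_le h.1 h'.1 s)

theorem hn_dmul_le (h : InH (s + 1) u) (X : Fin N → ℝ) :
    hn s (_root_.dmul X u) ≤ dlip X * hn (s + 1) u := by
  have := ENNReal.toReal_mono (ENNReal.mul_lt_top ENNReal.coe_lt_top h.2).ne (wn_dmul_le X u s)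
  simpa [hn] using this

end InH

theorem hn_sub_comm (s : ℕ) (u w : Freq N → ℂ) :
    hn s (fun ξ => u ξ - w ξ) = hn s (fun ξ => w ξ - u ξ) := by
  rw [hn, ← wn_neg]
  simp only [neg_sub]
  rfl

theorem hn_zero_fun (s : ℕ) : hn s (fun _ : Freq N => (0 : ℂ)) = 0 := by
  have : wA s (fun _ : Freq N => (0 : ℂ)) = 0 := by funext ξ; simp [wA]
  simp [hn, wn, this]

/-- The constant of the product estimate. -/
def pc (N k : ℕ) : ℝ := kc k * (3 * (jconst N k).toReal)

theorem pc_nonneg (N k : ℕ) : 0 ≤ pc N k := by unfold pc; positivity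

theorem InH.cv {v u : Freq N → ℂ} {s k : ℕ} (hk : (N : ℝ) < 2 * k) (hs : s ≤ k + 1)
    (hv : InH (k + 1) v) (hu : InH s u) :
    InH s (cv v u) ∧ hn s (_root_.cv v u) ≤ pc N k * hn (k + 1) v * hn s u := by
  have hj := jconst_lt_top hk
  have h1 := wn_cv_le hv.1 hu.1 hs
  have h2 : (kc k : ℝ≥0∞) * (3 * (jconst N k * wn (k + 1) v)) * wn s u < ⊤ :=
    ENNReal.mul_lt_top (ENNReal.mul_lt_top ENNReal.coe_lt_top (ENNReal.mul_lt_top (by norm_num)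
      (ENNReal.mul_lt_top hj hv.2))) hu.2
  refine ⟨⟨aestronglyMeasurable_cv hv.1 hu.1, h1.trans_lt h2⟩, ?_⟩
  have := ENNReal.toReal_mono h2.ne h1
  rw [hn]
  refine this.trans (le_of_eq ?_)
  simp only [ENNReal.toReal_mul, ENNReal.coe_toReal, hn, pc, ENNReal.toReal_ofNat]
  ring

/-- The coefficient v is only in L², so the derivative of u must be bounded: its transform is in L¹
because u has order k + 1. The lemma serves for differences of solutions, which are controlled in L²
only. -/
theorem hn_cv_le_integral {v u : Freq N → ℂ} {k : ℕ} (hk : (N : ℝ) < 2 * k)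
    (hv : InH 0 v) (hu : InH (k + 1) u) (X : Fin N → ℝ) :
    InH 0 (cv v (dmul X u)) ∧
      hn 0 (cv v (dmul X u)) ≤ hn 0 v * (dlip X * ((jconst N k).toReal * hn (k + 1) u)) := by
  have hj := jconst_lt_top hk
  have hd := aestronglyMeasurable_dmul X hu.1
  have h0 : ∫⁻ ξ, ‖dmul X u ξ‖ₑ ≤ dlip X * (jconst N k * wn (k + 1) u) := by
    refine (lintegral_mono fun ξ => enorm_dmul_le X u ξ).trans ?_
    rw [lintegral_const_mul' _ _ ENNReal.coe_ne_top]
    exact mul_le_mul_right (lintegral_jn_mul_le hu.1 k) _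
  have h1 : wn 0 (cv v (dmul X u)) ≤ wn 0 v * (dlip X * (jconst N k * wn (k + 1) u)) := by
    rw [wn_zero, wn_zero]
    refine (eLpNorm_mono_enorm (g := fun ξ => ∫⁻ η, ‖v (ξ - η)‖ₑ * ‖dmul X u η‖ₑ)
      fun ξ => ?_).trans ((eLpNorm_conv_le_right (B := fun η => ‖v η‖ₑ)
        (C := fun η => ‖dmul X u η‖ₑ) hv.1.enorm hd.enorm).trans ?_)
    · simpa using enorm_cv_le ξ
    · rw [eLpNorm_enorm]
      gcongr
  have h2 : wn 0 v * (dlip X * (jconst N k * wn (k + 1) u)) < ⊤ :=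
    ENNReal.mul_lt_top hv.2 (ENNReal.mul_lt_top ENNReal.coe_lt_top (ENNReal.mul_lt_top hj hu.2))
  refine ⟨⟨aestronglyMeasurable_cv hv.1 hd, h1.trans_lt h2⟩, ?_⟩
  have := ENNReal.toReal_mono h2.ne h1
  simpa [hn] using this

/-- The integrand of the Sobolev inner product. -/
def ipi (s : ℕ) (u w : Freq N → ℂ) (ξ : Freq N) : ℂ := conj (u ξ) * ((jn ξ : ℝ) ^ (2 * s) : ℝ) * w ξ

/-- The real Sobolev inner product on the Fourier side. -/
def ip (s : ℕ) (u w : Freq N → ℂ) : ℝ := (∫ ξ, ipi s u w ξ).re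

theorem enorm_ipi (s : ℕ) (u w : Freq N → ℂ) (ξ : Freq N) :
    ‖ipi s u w ξ‖ₑ = wA s u ξ * wA s w ξ := by
  rw [ipi, enorm_mul, enorm_mul, show ‖conj (u ξ)‖ₑ = ‖u ξ‖ₑ from RCLike.enorm_conj _]
  have : ‖(((jn ξ : ℝ) ^ (2 * s) : ℝ) : ℂ)‖ₑ = ((jn ξ ^ s * jn ξ ^ s : ℝ≥0) : ℝ≥0∞) := by
    rw [enorm_eq_nnnorm]
    congr 1
    ext
    simp [two_mul, pow_add]
  rw [this, wA, wA]
  push_cast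
  ring

variable {u w w' : Freq N → ℂ} {s : ℕ}

theorem integrable_ipi (hu : InH s u) (hw : InH s w) :
    Integrable (ipi s u w) ∧ ∫⁻ ξ, ‖ipi s u w ξ‖ₑ ≤ wn s u * wn s w := by
  have h1 : ∫⁻ ξ, ‖ipi s u w ξ‖ₑ ≤ wn s u * wn s w := by
    simp only [enorm_ipi]
    exact lintegral_mul_le_eLpNorm_two (aemeasurable_wA hu.1 s) (aemeasurable_wA hw.1 s)
  refine ⟨⟨?_, h1.trans_lt (ENNReal.mul_lt_top hu.2 hw.2)⟩, h1⟩
  exact (hu.1.star.mul (Complex.continuous_ofReal.comp ((NNReal.continuous_coe.comp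
          continuous_jn).pow _)).aestronglyMeasurable).mul hw.1

theorem abs_ip_le (hu : InH s u) (hw : InH s w) : |ip s u w| ≤ hn s u * hn s w := by
  obtain ⟨h1, h2⟩ := integrable_ipi hu hw
  refine (Complex.abs_re_le_norm _).trans ((norm_integral_le_lintegral_norm _).trans ?_)
  rw [hn, hn, ← ENNReal.toReal_mul]
  refine ENNReal.toReal_mono (ENNReal.mul_lt_top hu.2 hw.2).ne ?_
  simpa only [ofReal_norm] using h2

theorem ip_add (hu : InH s u) (hw : InH s w) (hw' : InH s w') :
    ip s u (fun ξ => w ξ + w' ξ) = ip s u w + ip s u w' := by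
  have : ipi s u (fun ξ => w ξ + w' ξ) = fun ξ => ipi s u w ξ + ipi s u w' ξ := by
    funext ξ; simp only [ipi]; ring
  rw [ip, this, integral_add (integrable_ipi hu hw).1 (integrable_ipi hu hw').1, Complex.add_re]
  rfl

theorem ip_sub (hu : InH s u) (hw : InH s w) (hw' : InH s w') :
    ip s u (fun ξ => w ξ - w' ξ) = ip s u w - ip s u w' := by
  have : ipi s u (fun ξ => w ξ - w' ξ) = fun ξ => ipi s u w ξ - ipi s u w' ξ := by
    funext ξ; simp only [ipi]; ring
  rw [ip, this, integral_sub (integrable_ipi hu hw).1 (integrable_ipi hu hw').1, Complex.sub_re]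
  rfl

theorem ip_congr (h : ∀ᵐ ξ, conj (u ξ) * w ξ = conj (u ξ) * w' ξ) : ip s u w = ip s u w' := by
  rw [ip, ip]
  congr 1
  refine integral_congr_ae ?_
  filter_upwards [h] with ξ hξ
  simp only [ipi, mul_right_comm _ _ (w ξ), mul_right_comm _ _ (w' ξ), hξ]

theorem ip_comm (u w : Freq N → ℂ) : ip s u w = ip s w u := by
  rw [ip, ip, ← Complex.conj_re, ← integral_conj]
  congr 2
  funext ξ
  simp only [ipi, map_mul, Complex.conj_conj, Complex.conj_ofReal]
  ring

theorem ip_self (hu : InH s u) : ip s u u = hn s u ^ 2 := by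
  have hsq : wn s u ^ 2 = ∫⁻ ξ, wA s u ξ ^ 2 := by
    have := eLpNorm_nnreal_pow_eq_lintegral (μ := volume) (f := wA s u) (p := 2) (by norm_num)
    simpa [wn] using this
  have e : ipi s u u = fun ξ => (((jn ξ : ℝ) ^ (2 * s) * ‖u ξ‖ ^ 2 : ℝ) : ℂ) := by
    funext ξ
    have := Complex.conj_mul' (u ξ)
    simp only [ipi]
    rw [mul_right_comm, this]
    push_cast
    ring
  rw [ip, e, integral_complex_ofReal, Complex.ofReal_re, integral_eq_lintegral_of_nonneg_ae]
  · rw [hn, ← ENNReal.toReal_pow, hsq]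
    congr 1
    refine lintegral_congr fun ξ => ?_
    rw [wA, ENNReal.ofReal_mul (by positivity), mul_pow, ENNReal.ofReal_pow (norm_nonneg _),
      ofReal_norm, ← ENNReal.coe_pow, ← pow_mul, mul_comm s 2]
    congr 1
    rw [ENNReal.ofReal]
    congr 1
    ext
    rw [Real.coe_toNNReal _ (by positivity)]
    simp
  · exact Eventually.of_forall fun ξ => by positivity
  · refine AEStronglyMeasurable.mul ?_ (hu.1.norm.pow 2)
    exact ((NNReal.continuous_coe.comp continuous_jn).pow _).aestronglyMeasurable

/-- The symbol is purely imaginary, so ∂_X is skew-adjoint in every Sobolev inner product. -/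
theorem ip_dmul_self (X : Fin N → ℝ) (u : Freq N → ℂ) : ip s u (dmul X u) = 0 := by
  have e : ipi s u (dmul X u) = fun ξ =>
      Complex.I * (((jn ξ : ℝ) ^ (2 * s) * dsym X ξ * ‖u ξ‖ ^ 2 : ℝ) : ℂ) := by
    funext ξ
    have := Complex.conj_mul' (u ξ)
    simp only [ipi, dmul]
    push_cast
    rw [← this]
    ring
  rw [ip, e, integral_const_mul, integral_complex_ofReal]
  simp

theorem hn_sub_smul_sq (hu : InH s u) (hw : InH s w) (t : ℝ) :
    hn s (fun ξ => u ξ - t * w ξ) ^ 2 = hn s u ^ 2 - 2 * t * ip s u w + t ^ 2 * hn s w ^ 2 := by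
  have htw := hw.const_mul t
  have h := hu.sub htw
  have e1 : ∀ z : Freq N → ℂ, ip s z (fun ξ => t * w ξ) = t * ip s z w := by
    intro z
    have : ipi s z (fun ξ => t * w ξ) = fun ξ => (t : ℂ) * ipi s z w ξ := by
      funext ξ; simp only [ipi]; ring
    rw [ip, this, integral_const_mul, Complex.re_ofReal_mul]
    rfl
  rw [← ip_self h, ip_sub h hu htw, e1, ip_comm _ u, ip_comm _ w, ip_sub hu hu htw,
    ip_sub hw hu htw, e1, e1, ip_self hu, ip_self hw, ip_comm w u]
  ring

theorem abs_ip_cv_dmul_le {k : ℕ} (hk : (N : ℝ) < 2 * k) (hs : s ≤ k + 1) (X : Fin N → ℝ)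
    {v : Freq N → ℂ} (hv : InH (k + 1) v) (hvs : ConjSymm v) (hu : InH (s + 1) u) :
    |ip s u (cv v (dmul X u))| ≤ pc N k * dlip X * hn (k + 1) v * hn s u ^ 2 := by
  have h := enorm_re_integral_symm_le X hs hk hv.1 hu.1 hvs hv.2 hu.2
  have hf : (kc k : ℝ≥0∞) * dlip X * (3 * (jconst N k * wn (k + 1) v)) * wn s u ^ 2 < ⊤ :=
    ENNReal.mul_lt_top (ENNReal.mul_lt_top (ENNReal.mul_lt_top ENNReal.coe_lt_top
      ENNReal.coe_lt_top) (ENNReal.mul_lt_top (by norm_num)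
      (ENNReal.mul_lt_top (jconst_lt_top hk) hv.2)))
      (ENNReal.pow_lt_top (hu.mono (Nat.le_succ s)).2)
  have h2 := ENNReal.toReal_mono hf.ne h
  rw [toReal_enorm, Real.norm_eq_abs] at h2
  refine h2.trans (le_of_eq ?_)
  simp only [ENNReal.toReal_mul, ENNReal.coe_toReal, hn, pc, ENNReal.toReal_pow,
    ENNReal.toReal_ofNat]
  ring

/-- Cauchy–Schwarz for the weights 1 and (1 + |ξ|)². This interpolation upgrades L² convergence of a
bounded sequence to H¹ convergence. -/
theorem hn_one_sq_le (hu : InH 2 u) : hn 1 u ^ 2 ≤ hn 0 u * hn 2 u := by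
  have h0 := hu.mono (Nat.zero_le 2)
  have hsq : wn 1 u ^ 2 = ∫⁻ ξ, wA 1 u ξ ^ 2 := by
    have := eLpNorm_nnreal_pow_eq_lintegral (μ := volume) (f := wA 1 u) (p := 2) (by norm_num)
    simpa [wn] using this
  rw [hn, hn, hn, ← ENNReal.toReal_pow, ← ENNReal.toReal_mul]
  refine ENNReal.toReal_mono (ENNReal.mul_lt_top h0.2 hu.2).ne ?_
  rw [hsq]
  refine le_trans (le_of_eq (lintegral_congr fun ξ => ?_)) (lintegral_mul_le_eLpNorm_two
    (aemeasurable_wA hu.1 0) (aemeasurable_wA hu.1 2))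
  simp only [wA]
  push_cast
  ring

end Hilbert
-- The linear operator 1 + X + v ∂_Y and limits of bounded sequences
section Solve

variable {N : ℕ}

theorem ConjSymm.sub {u w : Freq N → ℂ} (hu : ConjSymm u) (hw : ConjSymm w) :
    ConjSymm fun ξ => u ξ - w ξ := by
  filter_upwards [hu, hw] with ξ h1 h2
  rw [h1, h2, map_sub]

theorem ConjSymm.add {u w : Freq N → ℂ} (hu : ConjSymm u) (hw : ConjSymm w) :
    ConjSymm fun ξ => u ξ + w ξ := by
  filter_upwards [hu, hw] with ξ h1 h2
  rw [h1, h2, map_add]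

theorem ConjSymm.real_mul {u : Freq N → ℂ} (hu : ConjSymm u) (t : ℝ) :
    ConjSymm fun ξ => t * u ξ := by
  filter_upwards [hu] with ξ h1
  rw [h1, map_mul, Complex.conj_ofReal]

theorem ConjSymm.dmul {u : Freq N → ℂ} (hu : ConjSymm u) (X : Fin N → ℝ) :
    ConjSymm (dmul X u) := by
  filter_upwards [hu] with ξ h1
  simp only [_root_.dmul, h1, dsym_neg, map_mul, Complex.conj_I, Complex.conj_ofReal]
  push_cast
  ring

theorem ConjSymm.cv {v u : Freq N → ℂ} (hv : ConjSymm v) (hu : ConjSymm u) :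
    ConjSymm (cv v u) := by
  refine Eventually.of_forall fun ξ => ?_
  rw [_root_.cv, _root_.cv, ← integral_conj, ← integral_neg_eq_self]
  refine integral_congr_ae ?_
  filter_upwards [hu, (Measure.measurePreserving_sub_left volume ξ).quasiMeasurePreserving.ae hv]
    with η h1 h2
  rw [h1, map_mul, ← h2, sub_neg_eq_add, neg_sub, sub_eq_neg_add, neg_add_eq_sub]

/-- The restriction of a function to a ball. -/
def trunc (R : ℕ) (u : Freq N → ℂ) : Freq N → ℂ := (Metric.ball 0 R).indicator u

theorem ConjSymm.trunc {u : Freq N → ℂ} (hu : ConjSymm u) (R : ℕ) : ConjSymm (trunc R u) := by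
  filter_upwards [hu] with ξ h1
  simp only [_root_.trunc, Set.indicator, Metric.mem_ball, dist_zero_right, norm_neg]
  split_ifs
  · exact h1
  · simp

theorem wA_trunc_le (R s : ℕ) (u : Freq N → ℂ) (ξ : Freq N) :
    wA s (trunc R u) ξ ≤ ((1 + R : ℝ≥0) ^ s : ℝ≥0) * wA 0 u ξ := by
  simp only [wA, trunc, Set.indicator, Metric.mem_ball, dist_zero_right]
  split_ifs with h
  · rw [pow_zero, ENNReal.coe_one, one_mul]
    gcongr
    rw [jn]
    gcongr
    rw [← NNReal.coe_le_coe]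
    simpa using h.le
  · simp

theorem InH.trunc {u : Freq N → ℂ} (hu : InH 0 u) (R s : ℕ) :
    InH s (trunc R u) ∧ hn s (_root_.trunc R u) ≤ (1 + R : ℝ) ^ s * hn 0 u := by
  have := InH.of_bound (hu.1.indicator (s := Metric.ball 0 (R : ℝ))
    Metric.isOpen_ball.measurableSet) hu
    (Eventually.of_forall fun ξ => wA_trunc_le R s u ξ)
  simpa using! this

theorem hn_trunc_le {u : Freq N → ℂ} {s : ℕ} (hu : InH s u) (R : ℕ) :
    hn s (trunc R u) ≤ hn s u := by
  have := (InH.of_bound (c := 1) (s := s) (hu.1.indicator (s := Metric.ball 0 (R : ℝ))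
    Metric.isOpen_ball.measurableSet) hu
    (Eventually.of_forall fun ξ => ?_)).2
  · simpa using! this
  · simp only [wA, Set.indicator, ENNReal.coe_one, one_mul]
    split_ifs
    · exact le_rfl
    · simp

theorem dist_toLp {u w : Freq N → ℂ} (hu : MemLp u 2 volume) (hw : MemLp w 2 volume) :
    dist (hu.toLp u) (hw.toLp w) = hn 0 (fun ξ => u ξ - w ξ) := by
  rw [dist_eq_norm, ← MemLp.toLp_sub, Lp.norm_toLp, hn, wn_zero]
  rfl

theorem wn_eq_eLpNorm (s : ℕ) (u : Freq N → ℂ) :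
    wn s u = eLpNorm (fun ξ => ((((jn ξ : ℝ) ^ s : ℝ) : ℂ) * u ξ)) 2 volume := by
  refine eLpNorm_congr_enorm_ae (Eventually.of_forall fun ξ => ?_)
  rw [enorm_eq_self, wA, enorm_mul]
  congr 1
  rw [enorm_eq_nnnorm]
  congr 1
  ext
  simp

/-- A subsequence converges almost everywhere. Along it the H^s bound survives by Fatou, and the
symmetry and the zero set pass to the limit pointwise; convergence in H^s itself is not needed. -/
theorem exists_limit {u : ℕ → Freq N → ℂ} {s : ℕ} {δ : ℝ} {Z : Set (Freq N)}
    (hu : ∀ n, InH s (u n)) (hb : ∀ n, hn s (u n) ≤ δ) (hs : ∀ n, ConjSymm (u n))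
    (hZ : ∀ n, ∀ᵐ ξ, ξ ∈ Z → u n ξ = 0)
    (hC : CauchySeq fun n => (hu n).memLp.toLp (u n)) :
    ∃ w, InH s w ∧ hn s w ≤ δ ∧ ConjSymm w ∧ (∀ᵐ ξ, ξ ∈ Z → w ξ = 0) ∧
      Tendsto (fun n => hn 0 fun ξ => u n ξ - w ξ) atTop (𝓝 0) := by
  obtain ⟨w, hw⟩ := cauchySeq_tendsto_of_complete hC
  obtain ⟨ns, -, hns⟩ := (tendstoInMeasure_of_tendsto_Lp hw).exists_seq_tendsto_ae
  have hae : ∀ᵐ ξ, Tendsto (fun i => u (ns i) ξ) atTop (𝓝 (w ξ)) := by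
    have h2 : ∀ᵐ ξ, ∀ i, ((hu (ns i)).memLp.toLp (u (ns i)) : Freq N → ℂ) ξ = u (ns i) ξ :=
      ae_all_iff.2 fun i => (hu (ns i)).memLp.coeFn_toLp
    filter_upwards [hns, h2] with ξ h1 h2
    exact h1.congr h2
  have hwm := (Lp.memLp w).1
  have hδ : 0 ≤ δ := (hn_nonneg _ _).trans (hb 0)
  have hwn : wn s w ≤ ENNReal.ofReal δ := by
    rw [wn_eq_eLpNorm]
    refine Lp.eLpNorm_le_of_ae_tendsto (u := atTop)
      (f := fun i ξ => ((((jn ξ : ℝ) ^ s : ℝ) : ℂ) * u (ns i) ξ))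
      (Eventually.of_forall fun i => ?_) (fun i => ?_) ?_
    · rw [← wn_eq_eLpNorm, ← (hu _).ofReal_hn]
      exact ENNReal.ofReal_le_ofReal (hb _)
    · exact (Complex.continuous_ofReal.comp ((NNReal.continuous_coe.comp
          continuous_jn).pow _)).aestronglyMeasurable.mul (hu _).1
    · filter_upwards [hae] with ξ h1
      exact h1.const_mul _
  refine ⟨w, ⟨hwm, hwn.trans_lt ENNReal.ofReal_lt_top⟩, ?_, ?_, ?_, ?_⟩
  · exact ENNReal.toReal_le_of_le_ofReal hδ hwn
  · have h3 := (Measure.measurePreserving_neg (volume : Measure (Freq N))).quasiMeasurePreserving.ae hae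
    filter_upwards [hae, h3, ae_all_iff.2 fun i => hs (ns i)] with ξ h1 h2 h4
    refine tendsto_nhds_unique h2 ?_
    simp only [h4]
    exact (Complex.continuous_conj.tendsto _).comp h1
  · filter_upwards [hae, ae_all_iff.2 fun i => hZ (ns i)] with ξ h1 h2 h3
    refine tendsto_nhds_unique h1 ?_
    simp only [h2 _ h3]
    exact tendsto_const_nhds
  · rw [tendsto_iff_dist_tendsto_zero] at hw
    refine hw.congr fun n => ?_
    have : w = (Lp.memLp w).toLp w := (Lp.toLp_coeFn w _).symm
    conv_lhs => rw [this]
    rw [dist_toLp]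

theorem cv_sub_right {v u w : Freq N → ℂ} (hv : MemLp v 2 volume) (hu : MemLp u 2 volume)
    (hw : MemLp w 2 volume) (ξ : Freq N) :
    cv v (fun η => u η - w η) ξ = cv v u ξ - cv v w ξ := by
  simp only [cv, mul_sub]
  exact integral_sub (integrable_cv_integrand hv hu ξ) (integrable_cv_integrand hv hw ξ)

theorem cv_sub_left {v u w : Freq N → ℂ} (hv : MemLp v 2 volume) (hu : MemLp u 2 volume)
    (hw : MemLp w 2 volume) (ξ : Freq N) :
    cv (fun η => u η - w η) v ξ = cv u v ξ - cv w v ξ := by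
  simp only [cv, sub_mul]
  exact integral_sub (integrable_cv_integrand hu hv ξ) (integrable_cv_integrand hw hv ξ)

/-- The first order operator `1 + X + v ∂_Y` on the Fourier side. -/
def tOp (X Y : Fin N → ℝ) (v u : Freq N → ℂ) (ξ : Freq N) : ℂ :=
  u ξ + dmul X u ξ + cv v (dmul Y u) ξ

variable {k s : ℕ} {X Y : Fin N → ℝ}

theorem InH.tOp {v u : Freq N → ℂ} (hk : (N : ℝ) < 2 * k) (hs : s ≤ k + 1)
    (hv : InH (k + 1) v) (hu : InH (s + 1) u) : InH s (tOp X Y v u) :=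
  ((hu.mono (Nat.le_succ s)).add (hu.dmul X)).add (InH.cv hk hs hv (hu.dmul Y)).1

/-- The term X is skew and drops out, and the symmetrised estimate bounds v ∂_Y by a multiple of the
norm of v, so the zero order term 1 wins for small v. -/
theorem ip_tOp_ge {v u : Freq N → ℂ} (hk : (N : ℝ) < 2 * k) (hs : s ≤ k + 1)
    (hv : InH (k + 1) v) (hvs : ConjSymm v) (hu : InH (s + 1) u) :
    (1 - pc N k * dlip Y * hn (k + 1) v) * hn s u ^ 2 ≤ ip s u (tOp X Y v u) := by
  have hu' := hu.mono (Nat.le_succ s)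
  have h1 := abs_ip_cv_dmul_le hk hs Y hv hvs hu
  unfold tOp
  rw [ip_add hu' (hu'.add (hu.dmul X)) (InH.cv hk hs hv (hu.dmul Y)).1,
    ip_add hu' hu' (hu.dmul X), ip_self hu', ip_dmul_self]
  linarith [(abs_le.1 h1).1]

/-- The a priori estimate for `1 + X + v ∂_Y` with a small coefficient. -/
theorem hn_le_of_tOp {v u F : Freq N → ℂ} (hk : (N : ℝ) < 2 * k) (hs : s ≤ k + 1)
    (hv : InH (k + 1) v) (hvs : ConjSymm v) (hsm : pc N k * dlip Y * hn (k + 1) v ≤ 1 / 2)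
    (hu : InH (s + 1) u) (hF : tOp X Y v u =ᵐ[volume] F) : hn s u ≤ 2 * hn s F := by
  have hu' := hu.mono (Nat.le_succ s)
  have h1 := ip_tOp_ge (X := X) (Y := Y) hk hs hv hvs hu
  have hT : InH s (tOp X Y v u) := InH.tOp hk hs hv hu
  have h2 := (abs_le.1 (abs_ip_le hu' hT)).2
  rw [hn_congr hF] at h2
  have h3 : 1 / 2 * hn s u ^ 2 ≤ hn s u * hn s F := by
    refine le_trans ?_ (h1.trans h2)
    gcongr
    linarith
  rcases (hn_nonneg s u).eq_or_lt with h0 | h0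
  · rw [← h0]; have := hn_nonneg s F; positivity
  · have : 1 / 2 * hn s u ≤ hn s F := by
      refine le_of_mul_le_mul_left ?_ h0
      linarith
    linarith

/-- A bounded linear operator which preserves Fourier transforms of real functions. -/
structure RealOp (k : ℕ) (q : ℝ) (Q : (Freq N → ℂ) → Freq N → ℂ) : Prop where
  nonneg : 0 ≤ q
  low : ∀ u, InH 0 u → InH 0 (Q u) ∧ hn 0 (Q u) ≤ q * hn 0 u
  high : ∀ u, InH (k + 1) u → InH (k + 1) (Q u) ∧ hn (k + 1) (Q u) ≤ q * hn (k + 1) u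
  sub : ∀ u w, InH 0 u → InH 0 w → Q (fun ξ => u ξ - w ξ) =ᵐ[volume] fun ξ => Q u ξ - Q w ξ
  symm : ∀ u, InH 0 u → ConjSymm u → ConjSymm (Q u)

end Solve
-- Monotonicity of the quasilinear operator and the relaxation step
section Nonlinear

variable {N : ℕ} {k : ℕ} {q δ : ℝ} {Q : (Freq N → ℂ) → Freq N → ℂ} {X Y : Fin N → ℝ}
  {f u u' : Freq N → ℂ}

/-- The nonlinear operator `u + X u + (Q u) ∂_Y u - f` on the Fourier side. -/
def gOp (X Y : Fin N → ℝ) (Q : (Freq N → ℂ) → Freq N → ℂ) (f u : Freq N → ℂ) (ξ : Freq N) : ℂ :=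
  tOp X Y (Q u) u ξ - f ξ

/-- The closed set in which the equation is solved. -/
structure Adm (k : ℕ) (δ : ℝ) (u : Freq N → ℂ) : Prop where
  inH : InH (k + 1) u
  le : hn (k + 1) u ≤ δ
  symm : ConjSymm u

/-- The smallness conditions under which the equation is solvable. -/
structure SmallData (k : ℕ) (q δ : ℝ) (Q : (Freq N → ℂ) → Freq N → ℂ) (Y : Fin N → ℝ)
    (f : Freq N → ℂ) : Prop where
  dim : (N : ℝ) < 2 * k
  realOp : RealOp k q Q
  pos : 0 < δ
  first : pc N k * dlip Y * (q * δ) ≤ 1 / 4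
  second : q * (dlip Y * ((jconst N k).toReal * δ)) ≤ 1 / 4
  data : Adm k (δ / 4) f

theorem trunc_eq {R : ℕ} (hs : ∀ᵐ ξ, ξ ∈ (Metric.ball (0 : Freq N) R)ᶜ → u ξ = 0) :
    u =ᵐ[volume] trunc R u := by
  filter_upwards [hs] with ξ hξ
  by_cases hm : ξ ∈ Metric.ball (0 : Freq N) R
  · simp [trunc, Set.indicator_of_mem hm]
  · rw [trunc, Set.indicator_of_notMem hm, hξ hm]

theorem ip_trunc {R s : ℕ} (hs : ∀ᵐ ξ, ξ ∈ (Metric.ball (0 : Freq N) R)ᶜ → u ξ = 0)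
    (w : Freq N → ℂ) : ip s u (trunc R w) = ip s u w := by
  refine ip_congr ?_
  filter_upwards [hs] with ξ hξ
  by_cases hm : ξ ∈ Metric.ball (0 : Freq N) R
  · rw [trunc, Set.indicator_of_mem hm]
  · rw [hξ hm]; simp

namespace SmallData

theorem one_le (h : SmallData k q δ Q Y f) : 1 ≤ k := by
  have := h.dim
  have h2 : (0 : ℝ) < 2 * k := lt_of_le_of_lt (Nat.cast_nonneg N) this
  have h3 : (0 : ℝ) < k := by linarith
  exact_mod_cast h3

theorem Q_low (h : SmallData k q δ Q Y f) (hu : Adm k δ u) : InH 0 (Q u) := (h.realOp.low u (hu.inH.mono (Nat.zero_le _))).1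

theorem Q_symm (h : SmallData k q δ Q Y f) (hu : Adm k δ u) : ConjSymm (Q u) :=
  h.realOp.symm u (hu.inH.mono (Nat.zero_le _)) hu.symm

theorem Q_small (h : SmallData k q δ Q Y f) (hu : Adm k δ u) : pc N k * dlip Y * hn (k + 1) (Q u) ≤ 1 / 4 := by
  refine le_trans ?_ h.first
  have := (h.realOp.high u hu.inH).2
  have h2 := hu.le
  have h3 := pc_nonneg N k
  have h4 := h.realOp.nonneg
  refine mul_le_mul_of_nonneg_left (this.trans ?_) (mul_nonneg h3 (dlip Y).coe_nonneg)
  gcongr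

theorem inH_gOp (h : SmallData k q δ Q Y f) {s : ℕ} (hs : s ≤ k + 1) (hu : Adm k δ u) (hu' : InH (s + 1) u) :
    InH s (gOp X Y Q f u) :=
  (InH.tOp h.dim hs (h.realOp.high u hu.inH).1 hu').sub (h.data.inH.mono hs)

theorem inH_gOp_zero (h : SmallData k q δ Q Y f) (hu : Adm k δ u) : InH 0 (gOp X Y Q f u) :=
  h.inH_gOp (Nat.zero_le _) hu (hu.inH.mono (by omega))

/-- The difference is split so that the derivative of u - u' carries the smooth coefficient Q u,
while the rough coefficient Q (u - u') multiplies a derivative of u' alone. -/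
theorem gOp_sub (h : SmallData k q δ Q Y f) (hu : Adm k δ u) (hu' : Adm k δ u') :
    (fun ξ => gOp X Y Q f u ξ - gOp X Y Q f u' ξ) = fun ξ =>
      tOp X Y (Q u) (fun η => u η - u' η) ξ + cv (Q fun η => u η - u' η) (dmul Y u') ξ := by
  have i0 := hu.inH.mono (Nat.zero_le _)
  have i0' := hu'.inH.mono (Nat.zero_le _)
  have m1 : MemLp (dmul Y u) 2 volume := (hu.inH.dmul Y).memLp
  have m2 : MemLp (dmul Y u') 2 volume := (hu'.inH.dmul Y).memLp
  rw [cv_congr (h.realOp.sub u u' i0 i0') EventuallyEq.rfl]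
  funext ξ
  have e : dmul Y (fun η => u η - u' η) = fun η => dmul Y u η - dmul Y u' η := by
    funext η; simp only [dmul]; ring
  rw [cv_sub_left m2 (h.Q_low hu).memLp (h.Q_low hu').memLp, tOp, e,
    cv_sub_right (h.Q_low hu).memLp m1 m2]
  simp only [gOp, tOp, dmul]
  ring

/-- The derivative of u' is bounded by a multiple of δ, so an L² bound of the coefficient suffices;
the condition `second` makes the resulting constant 1/4. -/
theorem hn_cv_Q_le (h : SmallData k q δ Q Y f) (hd : InH 0 u) (hu' : Adm k δ u') :
    InH 0 (cv (Q u) (dmul Y u')) ∧ hn 0 (cv (Q u) (dmul Y u')) ≤ 1 / 4 * hn 0 u := by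
  obtain ⟨h1, h2⟩ := h.realOp.low u hd
  obtain ⟨h3, h4⟩ := hn_cv_le_integral h.dim h1 hu'.inH Y
  refine ⟨h3, h4.trans ?_⟩
  have h5 := h.second
  have h6 := hn_nonneg 0 u
  have h7 := h.realOp.nonneg
  calc _ ≤ (q * hn 0 u) * (dlip Y * ((jconst N k).toReal * δ)) := by
        refine mul_le_mul h2 (mul_le_mul_of_nonneg_left (mul_le_mul_of_nonneg_left hu'.le
          ENNReal.toReal_nonneg) (dlip Y).coe_nonneg) (mul_nonneg (dlip Y).coe_nonneg
          (mul_nonneg ENNReal.toReal_nonneg (hn_nonneg _ _))) (mul_nonneg h7 h6)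
    _ = (q * (dlip Y * ((jconst N k).toReal * δ))) * hn 0 u := by ring
    _ ≤ _ := by gcongr

/-- Strong monotonicity. -/
theorem gOp_mono (h : SmallData k q δ Q Y f) (hu : Adm k δ u) (hu' : Adm k δ u') :
    1 / 2 * hn 0 (fun ξ => u ξ - u' ξ) ^ 2 ≤
      ip 0 (fun ξ => u ξ - u' ξ) (fun ξ => gOp X Y Q f u ξ - gOp X Y Q f u' ξ) := by
  have hd := hu.inH.sub hu'.inH
  have hd0 := hd.mono (Nat.zero_le _)
  have hd1 := hd.mono (show 0 + 1 ≤ k + 1 by omega)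
  have hQ := (h.realOp.high u hu.inH).1
  have h1 := ip_tOp_ge (X := X) (Y := Y) h.dim (Nat.zero_le _) hQ (h.Q_symm hu) hd1
  obtain ⟨h2, h3⟩ := h.hn_cv_Q_le hd0 hu'
  have h4 := (abs_le.1 (abs_ip_le hd0 h2)).1
  have h5 := h.Q_small hu
  rw [h.gOp_sub hu hu', ip_add hd0 (InH.tOp h.dim (Nat.zero_le _) hQ hd1) h2]
  have h6 := hn_nonneg 0 (fun ξ => u ξ - u' ξ)
  -- The constant is 1 - 1/4 - 1/4: one quarter from the transport term and one from the variation
  -- of the coefficient.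
  nlinarith [mul_le_mul_of_nonneg_left h3 h6, sq_nonneg (hn 0 (fun ξ => u ξ - u' ξ))]

/-- One derivative is lost, from H¹ to L². On functions supported in the frequency ball of radius R
the loss costs a factor 1 + R, which the step size of the iteration absorbs. -/
theorem gOp_lip (h : SmallData k q δ Q Y f) (hu : Adm k δ u) (hu' : Adm k δ u') :
    hn 0 (fun ξ => gOp X Y Q f u ξ - gOp X Y Q f u' ξ) ≤
      (2 + dlip X) * hn 1 (fun ξ => u ξ - u' ξ) := by
  have hd := hu.inH.sub hu'.inH
  have hd0 := hd.mono (Nat.zero_le _)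
  have hd1 := hd.mono (show 0 + 1 ≤ k + 1 by omega)
  have hQ := (h.realOp.high u hu.inH).1
  obtain ⟨h2, h3⟩ := h.hn_cv_Q_le hd0 hu'
  obtain ⟨h4, h5⟩ := InH.cv h.dim (Nat.zero_le _) hQ (hd1.dmul Y)
  have h6 := hd1.hn_dmul_le X
  have h7 := hd1.hn_dmul_le Y
  have h8 := hd1.hn_mono (Nat.zero_le _)
  have h9 := h.Q_small hu
  rw [h.gOp_sub hu hu']
  have e1 := (InH.tOp (X := X) (Y := Y) h.dim (Nat.zero_le _) hQ hd1).hn_add_le h2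
  have e2 := (hd0.add (hd1.dmul X)).hn_add_le h4
  have e3 := hd0.hn_add_le (hd1.dmul X)
  have e4 : hn 0 (cv (Q u) (dmul Y fun ξ => u ξ - u' ξ)) ≤ 1 / 4 * hn 1 (fun ξ => u ξ - u' ξ) := by
    have hp := mul_nonneg (pc_nonneg N k) (hn_nonneg (k + 1) (Q u))
    refine h5.trans ((mul_le_mul_of_nonneg_left h7 hp).trans ?_)
    calc _ = (pc N k * dlip Y * hn (k + 1) (Q u)) * hn 1 (fun ξ => u ξ - u' ξ) := by ring
      _ ≤ _ := by gcongr; exact hn_nonneg _ _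
  have e5 : hn 0 (tOp X Y (Q u) fun η => u η - u' η) ≤
      hn 0 (fun ξ => (u ξ - u' ξ) + dmul X (fun η => u η - u' η) ξ) +
        hn 0 (cv (Q u) (dmul Y fun ξ => u ξ - u' ξ)) := e2
  simp only [zero_add] at h8 h6
  linarith [hn_nonneg 1 (fun ξ => u ξ - u' ξ)]

theorem adm_zero (h : SmallData k q δ Q Y f) : Adm k δ (fun _ : Freq N => (0 : ℂ)) := by
  have h0 : wA (k + 1) (fun _ : Freq N => (0 : ℂ)) = 0 := by funext ξ; simp [wA]
  refine ⟨⟨aestronglyMeasurable_const, ?_⟩, ?_, Eventually.of_forall fun _ => by simp⟩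
  · simp [wn, h0]
  · rw [hn_zero_fun]; exact h.pos.le

theorem hn_gOp_le (h : SmallData k q δ Q Y f) (hu : Adm k δ u) : hn 0 (gOp X Y Q f u) ≤ (3 + dlip X) * δ := by
  have h1 := h.gOp_lip (X := X) hu h.adm_zero
  have e : gOp X Y Q f (fun _ => 0) = fun ξ => -f ξ := by
    funext ξ; simp [gOp, tOp, dmul, cv]
  have h2 := hu.inH.hn_mono (show 1 ≤ k + 1 by omega)
  have hz := h.inH_gOp_zero (X := X) h.adm_zero
  have h3 := ((h.inH_gOp_zero (X := X) hu).sub hz).hn_add_le hz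
  simp only [sub_add_cancel, sub_zero] at h3 h1
  have h4 : hn 0 (gOp X Y Q f fun _ => 0) ≤ δ / 4 := by
    rw [e, hn, wn_neg]
    exact (h.data.inH.hn_mono (Nat.zero_le _)).trans h.data.le
  have h5 : (2 + (dlip X : ℝ)) * hn 1 u ≤ (2 + dlip X) * δ := by
    gcongr
    exact h2.trans hu.le
  have := h.pos
  refine h3.trans ?_
  linarith

theorem conjSymm_gOp (h : SmallData k q δ Q Y f) (hu : Adm k δ u) : ConjSymm (gOp X Y Q f u) :=
  (((hu.symm.add (hu.symm.dmul X)).add ((h.Q_symm hu).cv (hu.symm.dmul Y))).sub h.data.symm)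

/-- The truncated iteration map preserves the admissible set. -/
theorem adm_step (h : SmallData k q δ Q Y f) {R : ℕ} {t : ℝ} (ht : 0 < t) (ht2 : t ≤ 1 / 2)
    (ht3 : t * ((1 + R) ^ (k + 1) * ((3 + dlip X) * δ)) ^ 2 ≤ δ ^ 2) (hu : Adm k δ u)
    (hs : ∀ᵐ ξ, ξ ∈ (Metric.ball (0 : Freq N) R)ᶜ → u ξ = 0) :
    Adm k δ (fun ξ => u ξ - t * trunc R (gOp X Y Q f u) ξ) := by
  have hg := h.inH_gOp_zero (X := X) hu
  obtain ⟨h1, h2⟩ := hg.trunc R (k + 1)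
  -- Frequency support in a ball gives every order of regularity; coercivity at the top order k + 1
  -- requires order k + 2 qualitatively.
  have hul : InH (k + 2) u := ((hu.inH.mono (Nat.zero_le _)).trunc R (k + 2)).1.congr (trunc_eq hs).symm
  have hgl := h.inH_gOp (X := X) le_rfl hu hul
  refine ⟨hu.inH.sub (h1.const_mul t), ?_, hu.symm.sub (((h.conjSymm_gOp hu).trunc R).real_mul t)⟩
  have hd := h.pos
  refine (sq_le_sq₀ (hn_nonneg _ _) hd.le).1 ?_
  rw [hn_sub_smul_sq hu.inH h1, ip_trunc hs]
  have hQ := (h.realOp.high u hu.inH).1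
  have h3 := ip_tOp_ge (X := X) (Y := Y) h.dim le_rfl hQ (h.Q_symm hu) hul
  have h4 := h.Q_small hu
  have h5 : ip (k + 1) u (gOp X Y Q f u) = ip (k + 1) u (tOp X Y (Q u) u) - ip (k + 1) u f := by
    unfold gOp
    exact ip_sub hu.inH (InH.tOp h.dim le_rfl hQ hul) h.data.inH
  have h6 := (abs_le.1 (abs_ip_le hu.inH h.data.inH)).2
  have h7 := h.data.le
  have h8 := hn_nonneg (k + 1) u
  have h9 := hu.le
  have h10 : hn (k + 1) (trunc R (gOp X Y Q f u)) ^ 2 ≤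
      ((1 + R) ^ (k + 1) * ((3 + dlip X) * δ)) ^ 2 := by
    refine pow_le_pow_left₀ (hn_nonneg _ _) (h2.trans ?_) 2
    gcongr
    exact h.hn_gOp_le hu
  have h11 : 3 / 4 * hn (k + 1) u ^ 2 - hn (k + 1) u * (δ / 4) ≤ ip (k + 1) u (gOp X Y Q f u) := by
    rw [h5]
    nlinarith [mul_le_mul_of_nonneg_left h7 h8, sq_nonneg (hn (k + 1) u)]
  have h12 := mul_le_mul_of_nonneg_left h11 (by positivity : 0 ≤ 2 * t)
  have h13 := mul_le_mul_of_nonneg_left h10 (sq_nonneg t)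
  have h14 := mul_le_mul_of_nonneg_left ht3 ht.le
  -- Expanding the square gives at most (1 - 3t/2)‖u‖² + (t/2) δ ‖u‖ + t δ². With ‖u‖ ≤ δ this is at
  -- most δ², since -3/2 + 1/2 + 1 = 0.
  have h15 : (1 - 3 / 2 * t) * hn (k + 1) u ^ 2 ≤ (1 - 3 / 2 * t) * δ ^ 2 := by
    gcongr
    linarith
  have h16 : t * δ * hn (k + 1) u ≤ t * δ * δ := by gcongr
  nlinarith

/-- Gradient-descent contraction for a strongly monotone Lipschitz map: monotonicity gains t in the
square and the quadratic remainder costs at most t/2, and 1 - t/2 ≤ (1 - t/4)². -/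
theorem contract_step (h : SmallData k q δ Q Y f) {R : ℕ} {t : ℝ} (ht : 0 < t) (ht2 : t ≤ 1 / 2)
    (ht3 : t * ((2 + dlip X) * (1 + R)) ^ 2 ≤ 1 / 2) (hu : Adm k δ u) (hu' : Adm k δ u')
    (hs : ∀ᵐ ξ, ξ ∈ (Metric.ball (0 : Freq N) R)ᶜ → u ξ = 0)
    (hs' : ∀ᵐ ξ, ξ ∈ (Metric.ball (0 : Freq N) R)ᶜ → u' ξ = 0) :
    hn 0 (fun ξ => (u ξ - t * trunc R (gOp X Y Q f u) ξ) -
      (u' ξ - t * trunc R (gOp X Y Q f u') ξ)) ≤ (1 - t / 4) * hn 0 (fun ξ => u ξ - u' ξ) := by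
  set d : Freq N → ℂ := fun ξ => u ξ - u' ξ with hd
  set G : Freq N → ℂ := fun ξ => gOp X Y Q f u ξ - gOp X Y Q f u' ξ with hG
  have hds : ∀ᵐ ξ, ξ ∈ (Metric.ball (0 : Freq N) R)ᶜ → d ξ = 0 := by
    filter_upwards [hs, hs'] with ξ h1 h2 h3
    simp only [hd, h1 h3, h2 h3, sub_zero]
  have hd0 : InH 0 d := (hu.inH.sub hu'.inH).mono (Nat.zero_le _)
  have hG0 : InH 0 G := (h.inH_gOp_zero hu).sub (h.inH_gOp_zero hu')
  have e : (fun ξ => (u ξ - t * trunc R (gOp X Y Q f u) ξ) -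
      (u' ξ - t * trunc R (gOp X Y Q f u') ξ)) = fun ξ => d ξ - t * trunc R G ξ := by
    funext ξ
    simp only [hd, hG, trunc, Set.indicator]
    split_ifs <;> ring
  have hr : 0 ≤ (1 - t / 4) * hn 0 d := mul_nonneg (by linarith) (hn_nonneg _ _)
  refine (sq_le_sq₀ (hn_nonneg _ _) hr).1 ?_
  rw [e, hn_sub_smul_sq hd0 (hG0.trunc R 0).1, ip_trunc hds]
  have h1 := h.gOp_mono (X := X) hu hu'
  have h2 := h.gOp_lip (X := X) hu hu'
  have h3 : hn 1 d ≤ (1 + R) * hn 0 d := by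
    rw [hn_congr (trunc_eq hds)]
    simpa using (hd0.trunc R 1).2
  have h4 : hn 0 (trunc R G) ≤ (2 + dlip X) * (1 + R) * hn 0 d := by
    refine (hn_trunc_le hG0 R).trans (h2.trans ?_)
    rw [mul_assoc]
    gcongr
  have h5 := pow_le_pow_left₀ (hn_nonneg _ _) h4 2
  rw [mul_pow] at h5
  have h6 := mul_le_mul_of_nonneg_left h5 (sq_nonneg t)
  have h7 := mul_le_mul_of_nonneg_right (mul_le_mul_of_nonneg_left ht3 ht.le) (sq_nonneg (hn 0 d))
  have h8 := mul_le_mul_of_nonneg_left h1 (by positivity : 0 ≤ 2 * t)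
  nlinarith [sq_nonneg (t * hn 0 d)]

end SmallData

end Nonlinear
-- Solution of the quasilinear equation by frequency truncation
section Solve

variable {N : ℕ} {k : ℕ} {q δ : ℝ} {Q : (Freq N → ℂ) → Freq N → ℂ} {X Y : Fin N → ℝ}
  {f u u' : Freq N → ℂ}

theorem InH.ae_zero_of_hn {u : Freq N → ℂ} (h : InH 0 u) (h0 : hn 0 u = 0) : u =ᵐ[volume] 0 := by
  have h1 := h.ofReal_hn
  rw [h0, ENNReal.ofReal_zero, wn_zero] at h1
  exact (eLpNorm_eq_zero_iff h.1 two_ne_zero).1 h1.symm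

theorem InH.hn_triangle {a b c : Freq N → ℂ} {s : ℕ} (ha : InH s a) (hb : InH s b) (hc : InH s c) :
    hn s (fun ξ => a ξ - c ξ) ≤ hn s (fun ξ => a ξ - b ξ) + hn s (fun ξ => b ξ - c ξ) := by
  have := (ha.sub hb).hn_add_le (hb.sub hc)
  simpa using this

namespace SmallData

theorem exists_step_size {δ C₀ C₁ : ℝ} (hδ : 0 < δ) :
    ∃ t : ℝ, 0 < t ∧ t ≤ 1 / 2 ∧ t * C₀ ^ 2 ≤ δ ^ 2 ∧ t * C₁ ^ 2 ≤ 1 / 2 := by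
  have hδ2 : 0 < δ ^ 2 := by positivity
  have hp : 0 < 2 + C₀ ^ 2 / δ ^ 2 + 2 * C₁ ^ 2 := by positivity
  have h0 : 0 ≤ C₀ ^ 2 / δ ^ 2 := by positivity
  have h1 : 0 ≤ C₁ ^ 2 := by positivity
  refine ⟨1 / (2 + C₀ ^ 2 / δ ^ 2 + 2 * C₁ ^ 2), by positivity, ?_, ?_, ?_⟩
  · exact one_div_le_one_div_of_le two_pos (by linarith)
  · rw [one_div, inv_mul_le_iff₀ hp]
    have : C₀ ^ 2 / δ ^ 2 * δ ^ 2 = C₀ ^ 2 := by field_simp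
    nlinarith
  · rw [one_div, inv_mul_le_iff₀ hp]
    linarith

/-- Iteration of u ↦ u - t Π_R G(u) from 0, with Π_R the truncation. The step t is small enough,
depending on R, to preserve the ball of radius δ in H^{k+1} and to contract in L²; the L² limit
remains in the ball and is a fixed point. -/
theorem exists_trunc (h : SmallData k q δ Q Y f) (R : ℕ) :
    ∃ u, Adm k δ u ∧ (∀ᵐ ξ, ξ ∈ (Metric.ball (0 : Freq N) R)ᶜ → u ξ = 0) ∧
      trunc R (gOp X Y Q f u) =ᵐ[volume] 0 := by
  obtain ⟨t, ht, ht2, ht3, ht4⟩ := exists_step_size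
    (C₀ := (1 + R) ^ (k + 1) * ((3 + dlip X) * δ)) (C₁ := (2 + dlip X) * (1 + R)) h.pos
  set st : (Freq N → ℂ) → Freq N → ℂ := fun u ξ => u ξ - t * trunc R (gOp X Y Q f u) ξ with hst
  let it : ℕ → Freq N → ℂ := fun n => st^[n] fun _ => 0
  have it_succ (n : ℕ) : it (n + 1) = st (it n) := Function.iterate_succ_apply' ..
  have hsupp : ∀ u : Freq N → ℂ, (∀ᵐ ξ, ξ ∈ (Metric.ball (0 : Freq N) R)ᶜ → u ξ = 0) →
      ∀ᵐ ξ, ξ ∈ (Metric.ball (0 : Freq N) R)ᶜ → st u ξ = 0 := by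
    intro u hu
    filter_upwards [hu] with ξ h1 h2
    simp only [hst, h1 h2, trunc, Set.indicator_of_notMem h2, mul_zero, sub_zero]
  have inv : ∀ n, Adm k δ (it n) ∧ ∀ᵐ ξ, ξ ∈ (Metric.ball (0 : Freq N) R)ᶜ → it n ξ = 0 := by
    intro n
    induction n with
    | zero => exact ⟨h.adm_zero, Eventually.of_forall fun _ _ => rfl⟩
    | succ n ih =>
      rw [it_succ]
      exact ⟨h.adm_step ht ht2 ht3 ih.1 ih.2, hsupp _ ih.2⟩
  have hL : ∀ n, InH (k + 1) (it n) := fun n => (inv n).1.inH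
  have hcauchy : CauchySeq fun n => (hL n).memLp.toLp (it n) := by
    refine cauchySeq_of_le_geometric (1 - t / 4) (hn 0 fun ξ => it 0 ξ - it 1 ξ) (by linarith) ?_
    intro n
    rw [dist_toLp]
    induction n with
    | zero => simp
    | succ n ih =>
      have h1 := h.contract_step ht ht2 ht4 (inv n).1 (inv (n + 1)).1 (inv n).2 (inv (n + 1)).2
      have h2 := mul_le_mul_of_nonneg_left ih (show 0 ≤ 1 - t / 4 by linarith)
      rw [it_succ (n + 1), it_succ n] at *
      refine h1.trans (h2.trans (le_of_eq ?_))
      ring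
  obtain ⟨w, hw, hwle, hws, hwz, hlim⟩ := exists_limit hL (fun n => (inv n).1.le)
    (fun n => (inv n).1.symm) (fun n => (inv n).2) hcauchy
  have hA : Adm k δ w := ⟨hw, hwle, hws⟩
  refine ⟨w, hA, hwz, ?_⟩
  have hT : InH 0 (trunc R (gOp X Y Q f w)) := ((h.inH_gOp_zero hA).trunc R 0).1
  have i0 : ∀ n, InH 0 (it n) := fun n => (hL n).mono (Nat.zero_le _)
  have w0 := hw.mono (Nat.zero_le _)
  have hsw : InH 0 (st w) := w0.sub (hT.const_mul t)
  -- The limit is compared with its image through the iterate n + 1, so the contraction estimate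
  -- replaces continuity of the step map.
  have hle : ∀ n, hn 0 (fun ξ => st w ξ - w ξ) ≤
      hn 0 (fun ξ => it n ξ - w ξ) + hn 0 (fun ξ => it (n + 1) ξ - w ξ) := by
    intro n
    refine (hsw.hn_triangle (i0 (n + 1)) w0).trans (add_le_add ?_ le_rfl)
    rw [it_succ]
    have h1 := h.contract_step ht ht2 ht4 hA (inv n).1 hwz (inv n).2
    rw [hn_sub_comm 0 w] at h1
    refine h1.trans ?_
    have := hn_nonneg 0 fun ξ => it n ξ - w ξ
    nlinarith
  have h0 : hn 0 (fun ξ => st w ξ - w ξ) ≤ 0 := by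
    refine ge_of_tendsto' (f := fun n => hn 0 (fun ξ => it n ξ - w ξ) +
      hn 0 (fun ξ => it (n + 1) ξ - w ξ)) (x := atTop) ?_ hle
    simpa using hlim.add (hlim.comp (tendsto_add_atTop_nat 1))
  have h1 := (hsw.sub w0).ae_zero_of_hn (le_antisymm h0 (hn_nonneg _ _))
  filter_upwards [h1] with ξ h2
  simp only [hst, Pi.zero_apply, sub_sub_cancel_left, neg_eq_zero, mul_eq_zero,
    Complex.ofReal_eq_zero] at h2
  exact h2.resolve_left ht.ne'

theorem ip_zero_right {s : ℕ} (u : Freq N → ℂ) : ip s u (fun _ => 0) = 0 := by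
  simp [ip, ipi]

/-- The tail of an admissible function is small. -/
theorem hn_sub_trunc_le {u : Freq N → ℂ} (hu : InH 1 u) (n : ℕ) :
    (n : ℝ) * hn 0 (fun ξ => u ξ - trunc n u ξ) ≤ hn 1 u := by
  have hm : InH 1 (fun ξ => ((n : ℝ) : ℂ) * (u ξ - trunc n u ξ)) :=
    (hu.sub ((hu.mono (Nat.zero_le 1)).trunc n 1).1).const_mul _
  have h1 := InH.of_bound (s := 0) (c := 1) hm.1 hu (Eventually.of_forall fun ξ => by
    simp only [wA, pow_zero, pow_one, ENNReal.coe_one, one_mul]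
    by_cases hξ : ξ ∈ Metric.ball (0 : Freq N) n
    · simp [trunc, Set.indicator_of_mem hξ]
    · rw [trunc, Set.indicator_of_notMem hξ, sub_zero, enorm_mul]
      gcongr
      rw [enorm_eq_nnnorm]
      norm_cast
      have : (n : ℝ) ≤ ‖ξ‖ := by simpa using hξ
      rw [← NNReal.coe_le_coe]
      simp only [jn, NNReal.coe_add, NNReal.coe_one, coe_nnnorm]
      norm_num
      linarith)
  have h2 := h1.2
  have h3 : hn 0 (fun ξ => ((n : ℝ) : ℂ) * (u ξ - trunc n u ξ)) =
      n * hn 0 (fun ξ => u ξ - trunc n u ξ) := by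
    simp only [hn, wn_zero]
    have := eLpNorm_const_smul ((n : ℝ) : ℂ) (fun ξ => u ξ - trunc n u ξ) 2 volume
    rw [show (fun ξ => ((n : ℝ) : ℂ) * (u ξ - trunc n u ξ)) =
      ((n : ℝ) : ℂ) • fun ξ => u ξ - trunc n u ξ from rfl, this, ENNReal.toReal_mul]
    simp
  rw [h3] at h2
  simpa using h2

/-- The truncated solutions v_n are Cauchy in L². For n ≤ m the residual of v_m is orthogonal to v_n
- v_m, and the residual of v_n pairs only with the frequencies of v_n - v_m beyond n, which are
O(1/n) in L² by the uniform bound. Monotonicity turns this into convergence, and interpolation into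
H¹ convergence, enough to pass to the limit in the equation. -/
theorem exists_solution (h : SmallData k q δ Q Y f) :
    ∃ u, Adm k δ u ∧ gOp X Y Q f u =ᵐ[volume] 0 := by
  choose v hv hsupp hzero using h.exists_trunc (X := X)
  have hk := h.one_le
  have hδ := h.pos
  have hL : ∀ n, InH (k + 1) (v n) := fun n => (hv n).inH
  set C : ℝ := (3 + dlip X) * δ with hC
  have hCpos : 0 ≤ C := by positivity
  have key : ∀ n m, n ≤ m → n * hn 0 (fun ξ => v n ξ - v m ξ) ^ 2 ≤ 4 * C * δ := by
    intro n m hnm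
    set d : Freq N → ℂ := fun ξ => v n ξ - v m ξ with hd
    have hdI : InH (k + 1) d := (hL n).sub (hL m)
    have hd0 : InH 0 d := hdI.mono (Nat.zero_le _)
    have gn := h.inH_gOp_zero (X := X) (hv n)
    have gm := h.inH_gOp_zero (X := X) (hv m)
    have h1 := h.gOp_mono (X := X) (hv n) (hv m)
    rw [ip_sub hd0 gn gm] at h1
    have hdz : ∀ᵐ ξ, ξ ∈ (Metric.ball (0 : Freq N) m)ᶜ → d ξ = 0 := by
      filter_upwards [hsupp n, hsupp m] with ξ h2 h3 h4
      simp only [hd, h3 h4, sub_zero]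
      exact h2 fun h5 => h4 (Metric.ball_subset_ball (by exact_mod_cast hnm) h5)
    have h2 : ip 0 d (gOp X Y Q f (v m)) = 0 := by
      rw [← ip_trunc hdz, ip_congr (w' := fun _ => 0), ip_zero_right]
      filter_upwards [hzero m] with ξ h3
      rw [h3]; simp
    have h3 : ip 0 d (gOp X Y Q f (v n)) =
        ip 0 (fun ξ => d ξ - trunc n d ξ) (gOp X Y Q f (v n)) := by
      rw [ip_comm, ip_comm _ (gOp X Y Q f (v n))]
      refine ip_congr ?_
      filter_upwards [hzero n] with ξ h4
      by_cases hξ : ξ ∈ Metric.ball (0 : Freq N) n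
      · simp only [trunc, Set.indicator_of_mem hξ, Pi.zero_apply] at h4
        rw [h4]; simp
      · simp [trunc, Set.indicator_of_notMem hξ]
    have h4 := (abs_le.1 (abs_ip_le (hd0.sub (hd0.trunc n 0).1) gn)).2
    rw [← h3] at h4
    have h5 := h.hn_gOp_le (X := X) (hv n)
    have h6 := hn_sub_trunc_le (hdI.mono (show 1 ≤ k + 1 by omega)) n
    have h7 : hn 1 d ≤ 2 * δ := by
      refine (hdI.hn_mono (show 1 ≤ k + 1 by omega)).trans (((hL n).hn_sub_le (hL m)).trans ?_)
      linarith [(hv n).le, (hv m).le]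
    have h8 : n * (hn 0 (fun ξ => d ξ - trunc n d ξ) * hn 0 (gOp X Y Q f (v n))) ≤ 2 * δ * C := by
      rw [← mul_assoc]
      exact mul_le_mul (h6.trans h7) h5 (hn_nonneg _ _) (by positivity)
    rw [h2, sub_zero] at h1
    have h9 := mul_le_mul_of_nonneg_left (h1.trans h4) (Nat.cast_nonneg (α := ℝ) n)
    linarith
  have hcauchy : CauchySeq fun n => (hL n).memLp.toLp (v n) := by
    refine Metric.cauchySeq_iff'.2 fun ε hε => ?_
    obtain ⟨n, hn1⟩ := exists_nat_gt (4 * C * δ / ε ^ 2)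
    refine ⟨n, fun m hm => ?_⟩
    rw [dist_comm, dist_toLp]
    by_contra! hc
    have h1 := key n m hm
    have h2 : ε ^ 2 ≤ hn 0 (fun ξ => v n ξ - v m ξ) ^ 2 := by gcongr
    have h3 : 4 * C * δ < n * ε ^ 2 := (div_lt_iff₀ (by positivity)).1 hn1
    have h4 := mul_le_mul_of_nonneg_left h2 (Nat.cast_nonneg (α := ℝ) n)
    linarith
  obtain ⟨u, hu, hule, hus, -, hlim⟩ := exists_limit (Z := ∅) hL (fun n => (hv n).le)
    (fun n => (hv n).symm) (fun n => Eventually.of_forall fun _ h => h.elim) hcauchy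
  have hA : Adm k δ u := ⟨hu, hule, hus⟩
  refine ⟨u, hA, ?_⟩
  have hG := h.inH_gOp_zero (X := X) hA
  -- Interpolation between L² convergence and the H² bound, which is contained in the H^{k+1} bound
  -- since k ≥ 1.
  have hlim1 : Tendsto (fun n => hn 1 (fun ξ => v n ξ - u ξ)) atTop (𝓝 0) := by
    have h1 : ∀ n, hn 1 (fun ξ => v n ξ - u ξ) ≤
        Real.sqrt (hn 0 (fun ξ => v n ξ - u ξ) * (2 * δ)) := by
      intro n
      have hdI := (hL n).sub hu
      refine Real.le_sqrt_of_sq_le ((hn_one_sq_le (hdI.mono (by omega))).trans ?_)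
      refine mul_le_mul_of_nonneg_left ?_ (hn_nonneg _ _)
      refine (hdI.hn_mono (show 2 ≤ k + 1 by omega)).trans (((hL n).hn_sub_le hu).trans ?_)
      linarith [(hv n).le]
    refine squeeze_zero (fun _ => hn_nonneg _ _) h1 ?_
    have := (hlim.mul_const (2 * δ)).sqrt
    simpa using this
  -- Once n ≥ R the residual of v_n vanishes on the ball of radius R, so there the residual of u
  -- equals a difference of residuals, controlled by the H¹ distance.
  have hzr : ∀ R : ℕ, trunc R (gOp X Y Q f u) =ᵐ[volume] 0 := by
    intro R
    have hT := (hG.trunc R 0).1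
    refine hT.ae_zero_of_hn (le_antisymm ?_ (hn_nonneg _ _))
    refine ge_of_tendsto (f := fun n => (2 + dlip X) * hn 1 (fun ξ => v n ξ - u ξ)) (x := atTop)
      (by simpa using hlim1.const_mul _) ?_
    filter_upwards [eventually_ge_atTop R] with n hn'
    have h1 := h.gOp_lip (X := X) (hv n) hA
    have h2 := hn_trunc_le ((h.inH_gOp_zero (X := X) (hv n)).sub hG) R
    refine le_trans (le_of_eq ?_) (h2.trans h1)
    rw [hn, hn, ← wn_neg]
    congr 1
    refine wn_congr ?_ 0
    filter_upwards [hzero n] with ξ h3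
    by_cases hξ : ξ ∈ Metric.ball (0 : Freq N) R
    · have h4 := Metric.ball_subset_ball (show (R : ℝ) ≤ n by exact_mod_cast hn') hξ
      simp only [trunc, Set.indicator_of_mem h4, Pi.zero_apply] at h3
      simp [trunc, Set.indicator_of_mem hξ, h3]
    · simp [trunc, Set.indicator_of_notMem hξ]
  filter_upwards [ae_all_iff.2 hzr] with ξ h1
  obtain ⟨R, hR⟩ := exists_nat_gt ‖ξ‖
  have h2 := h1 R
  rwa [trunc, Set.indicator_of_mem (by simpa using hR)] at h2

end SmallData

end Solve
-- Weak derivatives versus weights on the Fourier side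
section Bridge

variable {N K : ℕ}

/-- The norm of ξ is at most the sum of its coordinates in modulus, and the symbol 2π ξ_i of a
derivative dominates ξ_i. -/
theorem wA_succ_le {u : Freq N → ℂ} {s : ℕ} (w : Fin N → Freq N → ℂ) {ξ : Freq N}
    (h : ∀ i, w i ξ = dmul (coordVec i) u ξ) :
    wA (s + 1) u ξ ≤ wA s u ξ + ∑ i, wA s (w i) ξ := by
  have h1 : jn ξ * ‖u ξ‖₊ ≤ ‖u ξ‖₊ + ∑ i, ‖w i ξ‖₊ := by
    have h2 : ‖ξ‖₊ ≤ ∑ i, ‖ξ i‖₊ := by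
      have := norm_sum_le Finset.univ fun i => ξ i • EuclideanSpace.single i (1 : ℝ)
      have e : ∑ i, ξ i • EuclideanSpace.single i (1 : ℝ) = ξ := by
        ext j; simp [Finset.sum_apply, Pi.single_apply]
      rw [e] at this
      simpa [norm_smul, ← NNReal.coe_le_coe] using this
    have h3 : ∀ i, ‖ξ i‖₊ * ‖u ξ‖₊ ≤ ‖w i ξ‖₊ := by
      intro i
      have e : dsym (coordVec i) ξ = 2 * Real.pi * ξ i := by
        simp [dsym, freqPair_eq, coordVec, Pi.single_apply]
      rw [h i, dmul, nnnorm_mul, nnnorm_mul, e]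
      refine mul_le_mul_left ?_ ‖u ξ‖₊
      rw [← NNReal.coe_le_coe]
      simp only [NNReal.coe_mul, coe_nnnorm, Complex.norm_I, one_mul, Complex.norm_real,
        norm_mul, Real.norm_eq_abs, abs_of_pos Real.pi_pos, abs_two]
      nlinarith [Real.pi_gt_three, abs_nonneg (ξ i)]
    calc jn ξ * ‖u ξ‖₊ = ‖u ξ‖₊ + ‖ξ‖₊ * ‖u ξ‖₊ := by rw [jn]; ring
      _ ≤ ‖u ξ‖₊ + (∑ i, ‖ξ i‖₊) * ‖u ξ‖₊ := by gcongr
      _ ≤ _ := by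
        rw [Finset.sum_mul]
        gcongr with i
        exact h3 i
  simp only [wA, enorm_eq_nnnorm]
  norm_cast
  rw [pow_succ, mul_assoc, ← Finset.mul_sum, ← mul_add]
  gcongr

theorem dmul_eq (X : Fin N → ℝ) (u : Freq N → ℂ) :
    dmul X u = fun ξ => 2 * Real.pi * Complex.I * freqPair X ξ * u ξ := by
  funext ξ
  simp only [dmul, dsym]
  push_cast
  ring

theorem IsFourier.hasWeakDirDeriv_iff_dmul {X : Fin N → ℝ} {f g : (Fin N → ℝ) → ℂ}
    {u w : Freq N → ℂ} (hf : IsFourier f u) (hg : IsFourier g w) :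
    HasWeakDirDeriv ⊤ X f g ↔ w =ᵐ[volume] dmul X u := by
  rw [hf.hasWeakDirDeriv_iff hg, dmul_eq]

theorem restrict_top : volume.restrict ((⊤ : Opens (Fin N → ℝ)) : Set (Fin N → ℝ)) = volume := by
  simp

theorem SobBd.wn_le {s : ℕ} : ∀ {M : ℝ≥0∞} {f : (Fin (K + 1) → ℝ) → ℂ}
    {u : Freq (K + 1) → ℂ}, SobBd 0 ⊤ s M f → IsFourier f u → wn s u ≤ ((K + 2 : ℕ) ^ s : ℝ≥0∞) * M := by
  induction s with
  | zero =>
    intro M f u h hu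
    rw [wn_zero, hu.eLpNorm_eq]
    simpa using h.norm_le
  | succ s ih =>
    intro M f u h hu
    choose g hg hs using h.2
    have hm : ∀ i, MemLp (g i) 2 volume := fun i => by simpa using (hs i).memLp
    choose w hw using fun i => exists_isFourier (hm i)
    have h1 : ∀ᵐ ξ, ∀ i, w i ξ = dmul (coordVec i) u ξ :=
      ae_all_iff.2 fun i => (hu.hasWeakDirDeriv_iff_dmul (hw i)).1 (hg i)
    have hsum : ∀ T : Finset (Fin (K + 1)), eLpNorm (fun ξ => wA s u ξ + ∑ i ∈ T, wA s (w i) ξ) 2 volume ≤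
        wn s u + ∑ i ∈ T, wn s (w i) := by
      intro T
      induction T using Finset.induction_on with
      | empty => simp [wn]
      | insert i T hi ih =>
        have e : (fun ξ => wA s u ξ + ∑ j ∈ insert i T, wA s (w j) ξ) =
            (fun ξ => wA s u ξ + ∑ j ∈ T, wA s (w j) ξ) + wA s (w i) := by
          funext ξ
          rw [Finset.sum_insert hi, Pi.add_apply]; ring
        rw [e, Finset.sum_insert hi]
        refine (eLpNorm_add_le ?_ ?_ one_le_two).trans ?_
        · exact ((aemeasurable_wA hu.memLp_right.1 s).add
            (Finset.aemeasurable_fun_sum T fun j _ => aemeasurable_wA (hw j).memLp_right.1 s)).aestronglyMeasurable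
        · exact (aemeasurable_wA (hw i).memLp_right.1 s).aestronglyMeasurable
        · calc _ ≤ (wn s u + ∑ j ∈ T, wn s (w j)) + wn s (w i) := by gcongr; rfl
            _ = _ := by ring
    have h2 : wn (s + 1) u ≤ wn s u + ∑ i, wn s (w i) := by
      refine le_trans (eLpNorm_mono_enorm_ae ?_) (hsum Finset.univ)
      filter_upwards [h1] with ξ h3
      exact wA_succ_le w h3
    refine h2.trans ?_
    calc _ ≤ ((K + 2 : ℕ) ^ s : ℝ≥0∞) * M + ∑ _i : Fin (K + 1), ((K + 2 : ℕ) ^ s : ℝ≥0∞) * M := by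
          gcongr with i
          · exact ih h.of_succ hu
          · exact ih (hs i) (hw i)
      _ = _ := by
        rw [Finset.sum_const, Finset.card_univ, Fintype.card_fin, nsmul_eq_mul, pow_succ]
        push_cast
        ring

/-- A bound for the symbols of the coordinate derivatives. -/
def dbound (N : ℕ) : ℝ≥0 := 1 + ∑ i : Fin N, dlip (coordVec i)

theorem sobBd_of_wn {s : ℕ} : ∀ {M : ℝ≥0∞} {f : (Fin (K + 1) → ℝ) → ℂ}
    {u : Freq (K + 1) → ℂ}, IsFourier f u → wn s u ≤ M → wn s u < ⊤ →
      SobBd 0 ⊤ s ((dbound (K + 1) ^ s : ℝ≥0) * M) f := by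
  induction s with
  | zero =>
    intro M f u hu h _
    rw [SobBd.zero_iff, restrict_top]
    refine ⟨hu.memLp_left, ?_⟩
    rw [wn_zero, hu.eLpNorm_eq] at h
    simpa using h
  | succ s ih =>
    intro M f u hu h ht
    have hd : 1 ≤ dbound (K + 1) := le_add_of_nonneg_right zero_le
    refine ⟨fun p hp => ?_, fun i => ?_⟩
    · obtain rfl : p = 0 := by omega
      simp only [pow_zero, one_smul, restrict_top]
      refine ⟨hu.memLp_left, ?_⟩
      rw [← hu.eLpNorm_eq, ← wn_zero]
      refine (wn_mono (Nat.zero_le (s + 1)) u).trans (h.trans ?_)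
      refine le_mul_of_one_le_left' ?_
      exact_mod_cast one_le_pow₀ hd
    · have hI : InH (s + 1) u := ⟨hu.memLp_right.1, ht⟩
      have hdI := hI.dmul (coordVec i)
      obtain ⟨g, hg⟩ := exists_isFourier_inv hdI.memLp
      refine ⟨g, (hu.hasWeakDirDeriv_iff_dmul hg).2 EventuallyEq.rfl, ?_⟩
      have h2 : wn s (dmul (coordVec i) u) ≤ dbound (K + 1) * M := by
        refine (wn_dmul_le _ u s).trans ?_
        gcongr
        exact (Finset.single_le_sum (f := fun i : Fin (K + 1) => dlip (coordVec i))
          (fun _ _ => zero_le) (Finset.mem_univ i)).trans (le_add_of_nonneg_left zero_le)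
      have := ih hg h2 hdI.2
      rwa [← mul_assoc, ← ENNReal.coe_mul, ← pow_succ] at this

theorem IsFourier.sobBd {s : ℕ} {f : (Fin (K + 1) → ℝ) → ℂ} {u : Freq (K + 1) → ℂ}
    (h : IsFourier f u) (hu : InH s u) : SobBd 0 ⊤ s ⊤ f :=
  (sobBd_of_wn h le_top hu.2).mono_bound le_top

/-- A function with enough Sobolev regularity has a `C¹` representative. -/
theorem IsFourier.exists_contDiff {k : ℕ} (hk : (N : ℝ) < 2 * k) {f : (Fin N → ℝ) → ℂ}
    {u : Freq N → ℂ} (h : IsFourier f u) (hu : InH (k + 1) u) :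
    ∃ g : (Fin N → ℝ) → ℂ, ContDiff ℝ 1 g ∧ f =ᵐ[volume] g ∧
      (∀ x, ‖g x‖ ≤ (jconst N k).toReal * hn (k + 1) u) ∧
      ∀ X x, ‖fderiv ℝ g x X‖ ≤ dlip X * ((jconst N k).toReal * hn (k + 1) u) := by
  have hi : Integrable u := integrable_of_wn hk hu.1 hu.2
  have hJ : ∫⁻ ξ, jn ξ * ‖u ξ‖ₑ < ⊤ := lt_of_le_of_lt (lintegral_jn_mul_le hu.1 k)
    (ENNReal.mul_lt_top (jconst_lt_top hk) hu.2)
  have hJr : (∫⁻ ξ, jn ξ * ‖u ξ‖ₑ).toReal ≤ (jconst N k).toReal * hn (k + 1) u := by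
    rw [hn, ← ENNReal.toReal_mul]
    exact ENNReal.toReal_mono (ENNReal.mul_lt_top (jconst_lt_top hk) hu.2).ne
      (lintegral_jn_mul_le hu.1 k)
  -- Finite first moment of u: the decay (1 + |ξ|)^{-k} is square integrable, so order k + 1 makes
  -- (1 + |ξ|) u integrable.
  have hcd : ContDiff ℝ 1 (𝓕⁻ u) := by
    have e : 𝓕⁻ u = fun x => 𝓕 u (-x) := by
      funext x; exact Real.fourierInv_eq_fourier_neg u x
    rw [e]
    refine (Real.contDiff_fourier fun n hn' => ?_).comp contDiff_neg
    have hn1 : n ≤ 1 := by exact_mod_cast hn'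
    refine ⟨((continuous_norm.pow n).aestronglyMeasurable).mul hi.1.norm, ?_⟩
    refine lt_of_le_of_lt (lintegral_mono fun ξ => ?_) hJ
    rw [enorm_mul, enorm_pow, enorm_norm, enorm_norm]
    gcongr
    rw [enorm_eq_nnnorm]
    norm_cast
    interval_cases n
    · simpa using one_le_jn ξ
    · simp [jn]
  have hg : ContDiff ℝ 1 fun x : Fin N → ℝ => 𝓕⁻ u (WithLp.toLp 2 x) :=
    hcd.comp (PiLp.continuousLinearEquiv 2 ℝ fun _ : Fin N => ℝ).symm.contDiff
  have hfg := isFourier_unique_of_integrable h hi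
  refine ⟨_, hg, hfg, fun x => (norm_fourierInv_le u _).trans ?_, fun X => ?_⟩
  · rw [integral_norm_eq_lintegral_enorm hi.1]
    refine (ENNReal.toReal_mono hJ.ne (lintegral_mono fun ξ => ?_)).trans hJr
    exact le_mul_of_one_le_left' (ENNReal.one_le_coe_iff.2 (one_le_jn ξ))
  · have hdI : InH k (dmul X u) := hu.dmul X
    have hdm := aestronglyMeasurable_dmul X hu.1
    have hdle : ∫⁻ ξ, ‖dmul X u ξ‖ₑ ≤ dlip X * ∫⁻ ξ, jn ξ * ‖u ξ‖ₑ := by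
      rw [← lintegral_const_mul' _ _ ENNReal.coe_ne_top]
      exact lintegral_mono fun ξ => enorm_dmul_le X u ξ
    have hdt : dlip X * ∫⁻ ξ, jn ξ * ‖u ξ‖ₑ < ⊤ := ENNReal.mul_lt_top ENNReal.coe_lt_top hJ
    have hdi : Integrable (dmul X u) := ⟨hdm, lt_of_le_of_lt hdle hdt⟩
    obtain ⟨f', hf'⟩ := exists_isFourier_inv hdI.memLp
    -- The classical derivative is identified with the weak one, whose transform is integrable; the
    -- sup bound of the inversion integral then applies to it.
    have h1 : HasWeakDirDeriv ⊤ X f f' := (h.hasWeakDirDeriv_iff_dmul hf').2 EventuallyEq.rfl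
    have h2 := (HasWeakDirDeriv.of_contDiff (U := ⊤) (X := X) hg)
    have h3 := (h1.congr (by rw [restrict_top]; exact hfg) EventuallyEq.rfl).unique h2
    rw [restrict_top] at h3
    have h4 := h3.symm.trans (isFourier_unique_of_integrable hf' hdi)
    have h5 := (Continuous.ae_eq_iff_eq volume ((hg.continuous_fderiv one_ne_zero).clm_apply
      continuous_const) ((continuous_fourierInv hdi).comp (PiLp.continuous_toLp 2 _))).1 h4
    intro x
    rw [congrFun h5 x]
    refine (norm_fourierInv_le _ _).trans ?_
    rw [integral_norm_eq_lintegral_enorm hdm]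
    refine (ENNReal.toReal_mono hdt.ne hdle).trans ?_
    rw [ENNReal.toReal_mul]
    exact mul_le_mul_of_nonneg_left hJr (dlip X).coe_nonneg

open Classical in
/-- Multiplication by `q`, on the Fourier side. -/
def fourierMul (q : (Fin N → ℝ) → ℝ) (u : Freq N → ℂ) : Freq N → ℂ :=
  if h : ∃ f v, IsFourier f u ∧ IsFourier (fun x => q x • f x) v then h.choose_spec.choose else 0

/-- The function chosen in the definition is immaterial: two functions with the same transform agree
almost everywhere, hence so do their multiples by q. -/
theorem IsFourier.fourierMul {q : (Fin N → ℝ) → ℝ} (hq : Continuous q) {A : ℝ≥0}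
    (hA : ∀ x, ‖q x‖₊ ≤ A) {f : (Fin N → ℝ) → ℂ} {u : Freq N → ℂ} (h : IsFourier f u) :
    IsFourier (fun x => q x • f x) (_root_.fourierMul q u) := by
  have hm : MemLp (fun x => q x • f x) 2 volume :=
    h.memLp_left.of_le_mul (c := A) (hq.aestronglyMeasurable.smul h.memLp_left.1)
      (Eventually.of_forall fun x => by
        rw [norm_smul]; gcongr; exact hA x)
  obtain ⟨v, hv⟩ := exists_isFourier hm
  have hex : ∃ f v, IsFourier f u ∧ IsFourier (fun x => q x • f x) v := ⟨f, v, h, hv⟩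
  have h1 := hex.choose_spec.choose_spec
  rw [_root_.fourierMul, dif_pos hex]
  refine h1.2.congr ?_ EventuallyEq.rfl
  filter_upwards [h1.1.unique_left h] with x hx
  rw [hx]

/-- The constant in the bound for multiplication operators. -/
def mulConst (K s : ℕ) (A : ℝ≥0) : ℝ :=
  ((K + 2 : ℕ) : ℝ) ^ s * (2 ^ s * (A * (dbound (K + 1) : ℝ) ^ s))

theorem mulConst_nonneg (K s : ℕ) (A : ℝ≥0) : 0 ≤ mulConst K s A := by
  unfold mulConst; positivity

/-- The bound is proved in physical space by the product rule, so only bounded derivatives of q are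
needed and no integrability of its Fourier transform. -/
theorem InH.fourierMul {s : ℕ} {q : (Fin (K + 1) → ℝ) → ℝ} (hq : ContDiff ℝ ∞ q) {A : ℝ≥0}
    (hA : BddSmooth s A q) (h0 : ∀ x, ‖q x‖₊ ≤ A) {u : Freq (K + 1) → ℂ} (hu : InH s u) :
    InH s (fourierMul q u) ∧ hn s (_root_.fourierMul q u) ≤ mulConst K s A * hn s u := by
  obtain ⟨f, hf⟩ := exists_isFourier_inv hu.memLp
  have h1 := hf.fourierMul hq.continuous h0
  have h2 := ((sobBd_of_wn hf le_rfl hu.2).smul_smooth hq hA).wn_le h1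
  have h3 : ((K + 2 : ℕ) ^ s : ℝ≥0∞) * (2 ^ s *
      (A * ((dbound (K + 1) ^ s : ℝ≥0) * wn s u))) < ⊤ := by
    refine ENNReal.mul_lt_top (ENNReal.pow_lt_top (ENNReal.natCast_lt_top _))
      (ENNReal.mul_lt_top (ENNReal.pow_lt_top ENNReal.ofNat_lt_top)
      (ENNReal.mul_lt_top ENNReal.coe_lt_top (ENNReal.mul_lt_top ENNReal.coe_lt_top hu.2)))
  refine ⟨⟨h1.memLp_right.1, h2.trans_lt h3⟩, (ENNReal.toReal_mono h3.ne h2).trans_eq ?_⟩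
  simp only [ENNReal.toReal_mul, ENNReal.toReal_pow, ENNReal.toReal_natCast, ENNReal.coe_toReal,
    ENNReal.toReal_ofNat, NNReal.coe_pow, hn, mulConst]
  ring

theorem realOp_fourierMul (k : ℕ) {q : (Fin (K + 1) → ℝ) → ℝ} (hq : ContDiff ℝ ∞ q) {A : ℝ≥0}
    (hA : BddSmooth (k + 1) A q) : RealOp k (mulConst K (k + 1) A) (fourierMul q) := by
  have hB : ((1 : ℝ) ≤ dbound (K + 1)) := by exact_mod_cast le_add_of_nonneg_right zero_le
  refine ⟨mulConst_nonneg _ _ _, ?_, fun u hu => hu.fourierMul hq hA hA.le, ?_, ?_⟩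
  · intro u hu
    obtain ⟨f, hf⟩ := exists_isFourier_inv hu.memLp
    have h1 := hf.fourierMul hq.continuous hA.le
    refine ⟨InH.zero_iff.2 h1.memLp_right, ?_⟩
    have h2 : wn 0 (fourierMul q u) ≤ A * wn 0 u := by
      rw [wn_zero, wn_zero, h1.eLpNorm_eq, hf.eLpNorm_eq]
      refine eLpNorm_le_nnreal_smul_eLpNorm_of_ae_le_mul (Eventually.of_forall fun x => ?_) 2
      rw [nnnorm_smul]; gcongr; exact hA.le x
    have h3 := ENNReal.toReal_mono (ENNReal.mul_lt_top ENNReal.coe_lt_top hu.2).ne h2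
    rw [ENNReal.toReal_mul] at h3
    refine h3.trans (mul_le_mul_of_nonneg_right ?_ (hn_nonneg _ _))
    have e1 : (1 : ℝ) ≤ ((K + 2 : ℕ) : ℝ) ^ (k + 1) := one_le_pow₀ (by push_cast; linarith [Nat.cast_nonneg (α := ℝ) K])
    have e2 : (1 : ℝ) ≤ 2 ^ (k + 1) := one_le_pow₀ one_le_two
    have e3 : (1 : ℝ) ≤ (dbound (K + 1) : ℝ) ^ (k + 1) := one_le_pow₀ hB
    have e0 : (0 : ℝ) ≤ A := A.coe_nonneg
    calc (A : ℝ) ≤ A * (dbound (K + 1) : ℝ) ^ (k + 1) := le_mul_of_one_le_right e0 e3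
      _ ≤ 2 ^ (k + 1) * (A * (dbound (K + 1) : ℝ) ^ (k + 1)) :=
        le_mul_of_one_le_left (by positivity) e2
      _ ≤ _ := le_mul_of_one_le_left (by positivity) e1
  · intro u w hu hw
    obtain ⟨f, hf⟩ := exists_isFourier_inv hu.memLp
    obtain ⟨g, hg⟩ := exists_isFourier_inv hw.memLp
    refine ((hf.sub hg).fourierMul hq.continuous hA.le).unique_right ?_
    refine ((hf.fourierMul hq.continuous hA.le).sub (hg.fourierMul hq.continuous hA.le)).congr ?_
      EventuallyEq.rfl
    exact Eventually.of_forall fun x => (smul_sub _ _ _).symm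
  · intro u hu hs
    obtain ⟨f, hf⟩ := exists_isFourier_inv hu.memLp
    refine (hf.fourierMul hq.continuous hA.le).conjSymm ?_
    filter_upwards [hs.isReal hf] with x hx
    rw [Complex.real_smul, map_mul, hx, Complex.conj_ofReal]

/-- Each level of the recursion imposes finitely many finite L² norms; their sum is a common bound.
-/
theorem SobBd.exists_finite {F : Type*} [NormedAddCommGroup F] [NormedSpace ℝ F] {κ s : ℕ}
    {U : Opens (Fin (K + 1) → ℝ)} : ∀ {f : (Fin (K + 1) → ℝ) → F}, SobBd κ U s ⊤ f →
      ∃ M : ℝ≥0, SobBd κ U s M f := by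
  induction s with
  | zero =>
    intro f h
    exact ⟨_, SobBd.zero_iff.2 ⟨h.memLp, (ENNReal.coe_toNNReal h.memLp.2.ne).ge⟩⟩
  | succ s ih =>
    intro f h
    choose g hg hs using h.2
    choose M hM using fun i => ih (hs i)
    refine ⟨∑ p ∈ Finset.range (κ * (s + 1) + 1),
      (eLpNorm (fun x => x (Fin.last K) ^ p • f x) 2 (volume.restrict U)).toNNReal + ∑ i, M i,
      fun p hp => ⟨(h.weight hp).1, ?_⟩, fun i => ⟨g i, hg i, (hM i).mono_bound ?_⟩⟩
    · rw [← ENNReal.coe_toNNReal (h.weight hp).1.2.ne]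
      refine ENNReal.coe_le_coe.2 (le_trans ?_ (le_add_of_nonneg_right zero_le))
      exact Finset.single_le_sum (f := fun p => (eLpNorm (fun x => x (Fin.last K) ^ p • f x) 2
        (volume.restrict U)).toNNReal) (fun _ _ => zero_le) (Finset.mem_range.2 (by omega))
    · refine ENNReal.coe_le_coe.2 (le_trans ?_ (le_add_of_nonneg_left zero_le))
      exact Finset.single_le_sum (f := M) (fun _ _ => zero_le) (Finset.mem_univ i)

theorem SobBd.exists_inH {s : ℕ} {f : (Fin (K + 1) → ℝ) → ℂ} (h : SobBd 0 ⊤ s ⊤ f) :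
    ∃ u, IsFourier f u ∧ InH s u := by
  obtain ⟨M, hM⟩ := h.exists_finite
  have hm := h.memLp
  rw [restrict_top] at hm
  obtain ⟨u, hu⟩ := exists_isFourier hm
  refine ⟨u, hu, hu.memLp_right.1, (hM.wn_le hu).trans_lt ?_⟩
  exact ENNReal.mul_lt_top (ENNReal.pow_lt_top (ENNReal.natCast_lt_top _)) ENNReal.coe_lt_top

theorem IsFourier.deriv {X : Fin N → ℝ} {f g : (Fin N → ℝ) → ℂ} {u : Freq N → ℂ}
    (hf : IsFourier f u) (h : HasWeakDirDeriv ⊤ X f g) (hg : MemLp g 2 volume) :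
    IsFourier g (dmul X u) := by
  obtain ⟨w, hw⟩ := exists_isFourier hg
  exact hw.congr EventuallyEq.rfl ((hf.hasWeakDirDeriv_iff_dmul hw).1 h)

end Bridge
-- Propagation of the weights in θ
section Weights

variable {N K : ℕ}

theorem fderiv_comp_coord {g : ℝ → ℝ} (hg : ContDiff ℝ ∞ g) (j : Fin N) (x X : Fin N → ℝ) :
    fderiv ℝ (fun y : Fin N → ℝ => g (y j)) x X = deriv g (x j) * X j := by
  have h : HasFDerivAt (fun y : Fin N → ℝ => g (y j))
      (deriv g (x j) • (ContinuousLinearMap.proj j : (Fin N → ℝ) →L[ℝ] ℝ)) x :=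
    HasDerivAt.comp_hasFDerivAt x ((hg.differentiable (by simp) _).hasDerivAt)
      (ContinuousLinearMap.proj j : (Fin N → ℝ) →L[ℝ] ℝ).hasFDerivAt
  rw [h.fderiv]
  simp

theorem contDiff_comp_coord {g : ℝ → ℝ} (hg : ContDiff ℝ ∞ g) (j : Fin N) :
    ContDiff ℝ ∞ fun y : Fin N → ℝ => g (y j) :=
  hg.comp (contDiff_apply ℝ ℝ j)

theorem HasWeakDirDeriv.smul_pow {F : Type*} [NormedAddCommGroup F] [NormedSpace ℝ F]
    {U : Opens (Fin (K + 1) → ℝ)} {i : Fin (K + 1)}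
    {f g : (Fin (K + 1) → ℝ) → F} (h : HasWeakDirDeriv U (coordVec i) f g) (p : ℕ) :
    HasWeakDirDeriv U (coordVec i) (fun x => x (Fin.last K) ^ p • f x)
      (fun x => x (Fin.last K) ^ p • g x +
        (p * (coordVec i : Fin (K + 1) → ℝ) (Fin.last K)) • x (Fin.last K) ^ (p - 1) • f x) := by
  have hp : ContDiff ℝ ∞ fun t : ℝ => t ^ p := contDiff_id.pow p
  refine (h.smul_smooth (contDiff_comp_coord hp (Fin.last K))).congr EventuallyEq.rfl
    (Eventually.of_forall fun x => ?_)
  simp only [fderiv_comp_coord hp, deriv_pow_field, smul_smul]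
  ring_nf

theorem SobBd.smul_pow {F : Type*} [NormedAddCommGroup F] [NormedSpace ℝ F] [CompleteSpace F]
    {U : Opens (Fin (K + 1) → ℝ)} {s : ℕ} : ∀ {p : ℕ}
    {f : (Fin (K + 1) → ℝ) → F}, SobBd 1 U (s + p) ⊤ f →
    SobBd 0 U s ⊤ (fun x => x (Fin.last K) ^ p • f x) := by
  induction s with
  | zero =>
    intro p f h
    exact SobBd.zero_iff.2 ⟨(h.weight (p := p) (by omega)).1, le_top⟩
  | succ s ih =>
    intro p f h
    refine ⟨fun p' hp' => ?_, fun i => ?_⟩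
    · obtain rfl : p' = 0 := by omega
      simpa using (h.weight (p := p) (by omega)).1
    · rw [show s + 1 + p = (s + p) + 1 by ring] at h
      obtain ⟨g, hg, hs⟩ := h.2 i
      refine ⟨_, hg.smul_pow p, ?_⟩
      have h1 := ih (p := p - 1) (h.mono_order (show s + (p - 1) ≤ s + p + 1 by omega))
      exact ((ih hs).add (h1.const_smul _)).mono_bound le_top

/-- The commutator of ∂_i with θ^p is a multiple of θ^{p-1}: it loses one weight but no derivative,
so the unweighted classes of order s - p for θ^p f add up to the weighted class. -/
theorem SobBd.of_weights {F : Type*} [NormedAddCommGroup F] [NormedSpace ℝ F] [CompleteSpace F]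
    {U : Opens (Fin (K + 1) → ℝ)} {s : ℕ} : ∀ {f : (Fin (K + 1) → ℝ) → F},
    (∀ p ≤ s, SobBd 0 U (s - p) ⊤ (fun x => x (Fin.last K) ^ p • f x)) → SobBd 1 U s ⊤ f := by
  induction s with
  | zero =>
    intro f h
    have := h 0 le_rfl
    simpa [SobBd.zero_iff] using this
  | succ s ih =>
    intro f h
    refine ⟨fun p hp => ⟨(h p (by omega)).memLp, le_top⟩, fun i => ?_⟩
    have h0 := h 0 (Nat.zero_le _)
    simp only [pow_zero, one_smul, Nat.sub_zero] at h0
    obtain ⟨g, hg, hs⟩ := h0.2 i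
    refine ⟨g, hg, ih fun p hp => ?_⟩
    have h1 := h p (by omega)
    rw [show s + 1 - p = (s - p) + 1 by omega] at h1
    have h2 := h1.deriv (hg.smul_pow p)
    have h3 := ((h (p - 1) (by omega)).mono_order (show s - p ≤ _ by omega)).const_smul
      (-(p * (coordVec i : Fin (K + 1) → ℝ) (Fin.last K)))
    refine ((h2.add h3).congr (Eventually.of_forall fun x => ?_)).mono_bound le_top
    simp only [neg_smul, add_neg_cancel_right]

/-- A function all of whose cut-offs are bounded in a Sobolev space belongs to it. -/
theorem exists_isFourier_of_cutoff {s : ℕ} {C : ℝ} {g : (Fin N → ℝ) → ℂ}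
    (hg : AEStronglyMeasurable g volume) {χ : ℕ → (Fin N → ℝ) → ℝ}
    (hχ1 : ∀ n x, ‖χ n x‖ ≤ 1) (hχ : ∀ x, ∀ᶠ n in atTop, χ n x = 1) {z : ℕ → Freq N → ℂ}
    (hz : ∀ n, IsFourier (fun x => χ n x • g x) (z n)) (hI : ∀ n, InH s (z n))
    (hC : ∀ n, hn s (z n) ≤ C) (hs : ∀ n, ConjSymm (z n)) :
    ∃ w, IsFourier g w ∧ InH s w := by
  have hlim : ∀ x, Tendsto (fun n => χ n x • g x) atTop (𝓝 (g x)) := fun x =>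
    tendsto_const_nhds.congr' (by
      filter_upwards [hχ x] with n h1
      rw [h1, one_smul])
  have hle : ∀ n, eLpNorm (fun x => χ n x • g x) 2 volume ≤ ENNReal.ofReal C := by
    intro n
    rw [← (hz n).eLpNorm_eq, ← wn_zero]
    refine (wn_mono (Nat.zero_le s) _).trans ?_
    rw [← (hI n).ofReal_hn]
    exact ENNReal.ofReal_le_ofReal (hC n)
  have hgL : MemLp g 2 volume := ⟨hg, by
    exact lt_of_le_of_lt (Lp.eLpNorm_le_of_ae_tendsto (Eventually.of_forall hle)
      (fun n => (hz n).memLp_left.1) (Eventually.of_forall hlim)) ENNReal.ofReal_lt_top⟩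
  obtain ⟨w, hw⟩ := exists_isFourier hgL
  have hfin : ∫⁻ x, (2 * ‖g x‖ₑ) ^ (2 : ℝ) ≠ ⊤ := by
    have h1 := (eLpNorm_lt_top_iff_lintegral_rpow_enorm_lt_top two_ne_zero ENNReal.ofNat_ne_top).1
      (hgL.const_smul (2 : ℂ)).2
    refine ne_of_lt ?_
    simpa [enorm_smul, enorm_eq_nnnorm] using h1
  have hconv : Tendsto (fun n => eLpNorm (fun x => χ n x • g x - g x) 2 volume) atTop (𝓝 0) := by
    have h1 : Tendsto (fun n => ∫⁻ x, ‖χ n x • g x - g x‖ₑ ^ (2 : ℝ)) atTop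
        (𝓝 (∫⁻ _x : Fin N → ℝ, 0)) := by
      refine tendsto_lintegral_of_dominated_convergence' (fun x => (2 * ‖g x‖ₑ) ^ (2 : ℝ))
        (fun n => (((hz n).memLp_left.1.sub hg).enorm.pow_const _)) (fun n => ?_) hfin ?_
      · refine Eventually.of_forall fun x => ?_
        simp only
        gcongr
        refine (enorm_sub_le).trans ?_
        rw [two_mul, enorm_smul]
        gcongr
        refine mul_le_of_le_one_left' ?_
        rw [enorm_eq_nnnorm]
        exact_mod_cast hχ1 n x
      · refine Eventually.of_forall fun x => tendsto_const_nhds.congr' ?_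
        filter_upwards [hχ x] with n h1
        rw [h1, one_smul, sub_self, enorm_zero, ENNReal.zero_rpow_of_pos two_pos]
    have h2 := (ENNReal.continuous_rpow_const (y := 1 / 2)).continuousAt.tendsto.comp h1
    simp only [lintegral_zero, ENNReal.zero_rpow_of_pos (show (0 : ℝ) < 1 / 2 by norm_num)] at h2
    refine h2.congr fun n => ?_
    rw [eLpNorm_eq_lintegral_rpow_enorm_toReal two_ne_zero ENNReal.ofNat_ne_top]
    simp
  have hd : Tendsto (fun n => dist ((hI n).memLp.toLp (z n)) (hw.memLp_right.toLp w)) atTop (𝓝 0) := by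
    have h1 := (ENNReal.tendsto_toReal ENNReal.zero_ne_top).comp hconv
    refine h1.congr fun n => ?_
    rw [dist_toLp, hn, wn_zero, ((hz n).sub hw).eLpNorm_eq]
    rfl
  have hcs := (tendsto_iff_dist_tendsto_zero.2 hd).cauchySeq
  -- The cut-offs converge in L² and are bounded in H^s, so their limit lies in H^s; it coincides
  -- with w almost everywhere.
  obtain ⟨w', hw', -, -, -, hl⟩ := exists_limit (Z := ∅) hI hC hs
    (fun n => Eventually.of_forall fun _ h => h.elim) hcs
  refine ⟨w', hw.congr EventuallyEq.rfl ?_, hw'⟩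
  have w0 : InH 0 w := InH.zero_iff.2 hw.memLp_right
  have w0' : InH 0 w' := hw'.mono (Nat.zero_le _)
  have hz0 : hn 0 (fun ξ => w ξ - w' ξ) ≤ 0 := by
    refine ge_of_tendsto' (f := fun n => hn 0 (fun ξ => z n ξ - w ξ) + hn 0 (fun ξ => z n ξ - w' ξ))
      (x := atTop) ?_ fun n => ?_
    · simp only [dist_toLp] at hd
      simpa using hd.add hl
    · rw [hn_sub_comm 0 (z n) w]
      exact w0.hn_triangle ((hI n).mono (Nat.zero_le _)) w0'
  filter_upwards [(w0.sub w0').ae_zero_of_hn (le_antisymm hz0 (hn_nonneg _ _))] with ξ h1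
  exact sub_eq_zero.1 h1

/-- The cut-off functions in the last variable. -/
def bump : ContDiffBump (0 : ℝ) := ⟨1, 2, one_pos, one_lt_two⟩

theorem bump_contDiff : ContDiff ℝ ∞ bump := bump.contDiff

/-- The derivative has the form κ(t/R) t^p with a fixed profile κ of compact support. Commuting ∂_θ
with the cut-off weight thus lowers the power of θ by one, uniformly in R. -/
theorem deriv_pow_mul_bump (p : ℕ) (R t : ℝ) :
    deriv (fun t => t ^ (p + 1) * bump (R⁻¹ * t)) t =
      ((p + 1) * bump (R⁻¹ * t) + (R⁻¹ * t) * deriv bump (R⁻¹ * t)) * t ^ p := by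
  have h1 : HasDerivAt (fun t : ℝ => bump (R⁻¹ * t)) (deriv bump (R⁻¹ * t) * R⁻¹) t := by
    have h2 : HasDerivAt (fun t : ℝ => R⁻¹ * t) R⁻¹ t := by
      simpa using (hasDerivAt_id t).const_mul R⁻¹
    exact (bump_contDiff.differentiable (by simp) _).hasDerivAt.comp t h2
  rw [((hasDerivAt_pow (p + 1) t).fun_mul h1).deriv]
  simp only [Nat.add_sub_cancel]
  push_cast
  ring

/-- Induction on p, multiplying the equation by θ^{p+1} χ(θ/R). The field X commutes with this
factor since it has no θ-component. The commutator with v ∂_θ is v κ(θ/R) θ^p w, controlled by the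
previous step. The a priori estimate is then uniform in R, and R → ∞ gives θ^{p+1} w of order k - p.
-/
theorem weighted_regularity {k : ℕ} (hk : ((K + 1 : ℕ) : ℝ) < 2 * k) {X : Fin (K + 1) → ℝ}
    (hX : X (Fin.last K) = 0) {v w f wX wY : (Fin (K + 1) → ℝ) → ℂ} {v' : Freq (K + 1) → ℂ}
    (hv : IsFourier v v') (hvI : InH (k + 1) v') (hvs : ConjSymm v')
    (hsm : pc (K + 1) k * dlip (coordVec (Fin.last K) : Fin (K + 1) → ℝ) * hn (k + 1) v' ≤ 1 / 2)
    (hw : SobBd 0 ⊤ (k + 1) ⊤ w) (hwr : ∀ᵐ x, conj (w x) = w x)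
    (hwX : HasWeakDirDeriv ⊤ X w wX) (hwY : HasWeakDirDeriv ⊤ (coordVec (Fin.last K)) w wY)
    (hwXL : MemLp wX 2 volume) (hwYL : MemLp wY 2 volume)
    (heq : (fun x => w x + wX x + v x * wY x) =ᵐ[volume] f)
    (hf : SobBd 1 ⊤ (k + 1) ⊤ f) : SobBd 1 ⊤ (k + 1) ⊤ w := by
  have hk1 : 1 ≤ k := by
    have h3 : (0 : ℝ) < k := by
      have : (0 : ℝ) ≤ ((K + 1 : ℕ) : ℝ) := Nat.cast_nonneg _
      linarith
    exact_mod_cast h3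
  have hvi : Integrable v' := integrable_of_wn hk hvI.1 hvI.2
  have hwm : AEStronglyMeasurable w volume := by
    have := hw.memLp.1
    rwa [restrict_top] at this
  refine SobBd.of_weights fun p hp => ?_
  induction p with
  | zero => simpa using hw
  | succ p ih =>
    specialize ih (by omega)
    set s := k - p with hs
    rw [show k + 1 - p = s + 1 by omega] at ih
    rw [show k + 1 - (p + 1) = s by omega]
    have hsk : s ≤ k + 1 := by omega
    have hpL : MemLp (fun x => x (Fin.last K) ^ p • w x) 2 volume := by
      simpa using ih.memLp
    obtain ⟨u, hu, huI⟩ := ih.exists_inH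
    replace huI := huI.mono (Nat.le_succ s)
    have hfp : SobBd 0 ⊤ s ⊤ (fun x => x (Fin.last K) ^ (p + 1) • f x) :=
      SobBd.smul_pow (hf.mono_order (by omega))
    obtain ⟨φ, hφ, hφI⟩ := hfp.exists_inH
    obtain ⟨hcI, -⟩ := InH.cv hk hsk hvI huI
    have hvu := hv.mul hvi hu
    set κ : ℝ → ℝ := fun t => (p + 1) * bump t + t * deriv bump t with hκ
    have hdb : ContDiff ℝ ∞ (deriv bump) := by
      have := bump_contDiff.iterate_deriv 1
      simpa using this
    have hκc : ContDiff ℝ ∞ κ := (contDiff_const.mul bump_contDiff).add (contDiff_id.mul hdb)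
    have hκs : HasCompactSupport κ :=
      (bump.hasCompactSupport.mul_left).add bump.hasCompactSupport.deriv.mul_left
    obtain ⟨A₁, hA₁⟩ := BddSmooth.of_coord (Fin.last K) s bump_contDiff bump.hasCompactSupport
    obtain ⟨A₂, hA₂⟩ := BddSmooth.of_coord (Fin.last K) s hκc hκs
    have hR : ∀ n : ℕ, (1 : ℝ) ≤ (n : ℝ) + 1 := fun n => by linarith [Nat.cast_nonneg (α := ℝ) n]
    have hcomp : ∀ {g : ℝ → ℝ} (n : ℕ), ContDiff ℝ ∞ g →
        ContDiff ℝ ∞ fun x : Fin (K + 1) → ℝ => g (((n : ℝ) + 1)⁻¹ * x (Fin.last K)) :=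
      fun n hg => hg.comp (contDiff_const.mul (contDiff_apply ℝ ℝ (Fin.last K)))
    set χ : ℕ → (Fin (K + 1) → ℝ) → ℝ := fun n x => bump (((n : ℝ) + 1)⁻¹ * x (Fin.last K)) with hχ
    have key : ∀ n, ∃ z, IsFourier (fun x => χ n x • x (Fin.last K) ^ (p + 1) • w x) z ∧ InH s z ∧
        ConjSymm z ∧ hn s z ≤
          2 * (mulConst K s A₁ * hn s φ + mulConst K s A₂ * hn s (cv v' u)) := by
      intro n
      set G : ℝ → ℝ := fun t => t ^ (p + 1) * bump (((n : ℝ) + 1)⁻¹ * t) with hG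
      have hGc : ContDiff ℝ ∞ G := (contDiff_id.pow _).mul
        (bump_contDiff.comp (contDiff_const.mul contDiff_id))
      have hGs : HasCompactSupport G := by
        refine HasCompactSupport.mul_left ?_
        exact bump.hasCompactSupport.comp_homeomorph
          (Homeomorph.mulLeft₀ ((n : ℝ) + 1)⁻¹ (inv_ne_zero (by linarith [hR n])))
      have hρ := contDiff_comp_coord hGc (Fin.last K)
      obtain ⟨A, hA⟩ := BddSmooth.of_coord (Fin.last K) (k + 1) hGc hGs
      have hA' : BddSmooth (k + 1) A (fun x : Fin (K + 1) → ℝ => G (x (Fin.last K))) := by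
        simpa using hA 1 le_rfl
      have eZ : (fun x : Fin (K + 1) → ℝ => G (x (Fin.last K)) • w x) =
          fun x => χ n x • x (Fin.last K) ^ (p + 1) • w x := by
        funext x
        simp only [hG, hχ, smul_smul]
        rw [mul_comm]
      obtain ⟨z, hz, hzI⟩ := (hw.smul_smooth_top hρ hA').exists_inH
      have hbL : ∀ {g : (Fin (K + 1) → ℝ) → ℂ}, MemLp g 2 volume →
          MemLp (fun x => G (x (Fin.last K)) • g x) 2 volume := fun {g} hg =>
        hg.of_le_mul (c := A) (hρ.continuous.aestronglyMeasurable.smul hg.1)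
          (Eventually.of_forall fun x => by
            rw [norm_smul]; gcongr; exact hA'.le x)
      have hZX := hwX.smul_smooth hρ
      have hZY := hwY.smul_smooth hρ
      simp only [fderiv_comp_coord hGc, hX, mul_zero, zero_smul, add_zero] at hZX
      simp only [fderiv_comp_coord hGc, coordVec, Pi.single_eq_same, mul_one] at hZY
      have hdG : ∀ t, deriv G t = κ (((n : ℝ) + 1)⁻¹ * t) * t ^ p := deriv_pow_mul_bump p _
      have hκn : MemLp (fun x => κ (((n : ℝ) + 1)⁻¹ * x (Fin.last K)) •
          x (Fin.last K) ^ p • w x) 2 volume :=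
        hpL.of_le_mul (c := A₂) ((hcomp n hκc).continuous.aestronglyMeasurable.smul hpL.1)
          (Eventually.of_forall fun x => by
            rw [norm_smul]; gcongr; exact (hA₂ _ (hR n)).le x)
      have hZYL : MemLp (fun x => G (x (Fin.last K)) • wY x + deriv G (x (Fin.last K)) • w x) 2
          volume := by
        refine (hbL hwYL).add (hκn.ae_eq (Eventually.of_forall fun x => ?_))
        simp only [hdG, smul_smul]
      have hT : IsFourier (fun x => G (x (Fin.last K)) • w x + G (x (Fin.last K)) • wX x +
          v x * (G (x (Fin.last K)) • wY x + deriv G (x (Fin.last K)) • w x))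
          (tOp X (coordVec (Fin.last K)) v' z) :=
        (hz.add (hz.deriv hZX (hbL hwXL))).add (hv.mul hvi (hz.deriv hZY hZYL))
      have hF₁ := hφ.fourierMul (hcomp n bump_contDiff).continuous (hA₁ _ (hR n)).le
      have hF₂ := hvu.fourierMul (hcomp n hκc).continuous (hA₂ _ (hR n)).le
      obtain ⟨i1, b1⟩ := hφI.fourierMul (hcomp n bump_contDiff) (hA₁ _ (hR n)) (hA₁ _ (hR n)).le
      obtain ⟨i2, b2⟩ := hcI.fourierMul (hcomp n hκc) (hA₂ _ (hR n)) (hA₂ _ (hR n)).le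
      have hFe := hT.congr (f' := fun x => χ n x • x (Fin.last K) ^ (p + 1) • f x +
          κ (((n : ℝ) + 1)⁻¹ * x (Fin.last K)) • (v x * x (Fin.last K) ^ p • w x)) (by
        filter_upwards [heq] with x hx
        rw [← hx]
        simp only [hdG]
        simp only [hχ, hG, Complex.real_smul]
        push_cast
        ring) EventuallyEq.rfl
      have hzs : ConjSymm z := by
        refine hz.conjSymm ?_
        filter_upwards [hwr] with x hx
        rw [Complex.real_smul, map_mul, hx, Complex.conj_ofReal]
      -- The estimate needs the cut-off function to have order s + 1, which holds because w has
      -- order k + 1; the bound obtained involves only quantities uniform in n.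
      have hle := hn_le_of_tOp hk hsk hvI hvs hsm (hzI.mono (by omega))
        (hFe.unique_right (hF₁.add hF₂))
      rw [eZ] at hz
      refine ⟨z, hz, hzI.mono (by omega), hzs, hle.trans ?_⟩
      have := i1.hn_add_le i2
      linarith
    choose z hz hzI hzs hzC using key
    have hχ1 : ∀ n x, ‖χ n x‖ ≤ 1 := fun n x => by
      rw [Real.norm_of_nonneg bump.nonneg]
      exact bump.le_one
    have hχ2 : ∀ x, ∀ᶠ n in atTop, χ n x = 1 := fun x => by
      obtain ⟨n₀, hn₀⟩ := exists_nat_gt |x (Fin.last K)|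
      filter_upwards [eventually_ge_atTop n₀] with n hn'
      refine bump.one_of_mem_closedBall ?_
      have h1 : (n₀ : ℝ) ≤ n := by exact_mod_cast hn'
      have h2 : (0 : ℝ) < (n : ℝ) + 1 := by linarith [hR n]
      rw [mem_closedBall_zero_iff, Real.norm_eq_abs, abs_mul, abs_inv, abs_of_pos h2]
      change _ ≤ (1 : ℝ)
      rw [inv_mul_le_iff₀ h2]
      linarith
    obtain ⟨ψ, hψ, hψI⟩ := exists_isFourier_of_cutoff
      (((continuous_apply (Fin.last K)).pow (p + 1)).aestronglyMeasurable.smul hwm) hχ1 hχ2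
      hz hzI hzC hzs
    exact hψ.sobBd hψI

end Weights
-- The model equation on the whole space, in physical variables
section RealSolution

variable {K k : ℕ}

theorem fderiv_re_comp {N : ℕ} {g : (Fin N → ℝ) → ℂ} (hg : ContDiff ℝ 1 g) (x X : Fin N → ℝ) :
    fderiv ℝ (fun y => (g y).re) x X = (fderiv ℝ g x X).re := by
  have h := (Complex.reCLM.hasFDerivAt (x := g x)).comp x
    ((hg.differentiable one_ne_zero) x).hasFDerivAt
  exact congrArg (fun L => L X) h.fderiv

theorem contDiff_re_comp {N : ℕ} {g : (Fin N → ℝ) → ℂ} (hg : ContDiff ℝ 1 g) :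
    ContDiff ℝ 1 fun y => (g y).re :=
  Complex.reCLM.contDiff.comp hg

theorem SobBd.ofReal {κ s : ℕ} {U : Opens (Fin (K + 1) → ℝ)} {M : ℝ≥0∞}
    {f : (Fin (K + 1) → ℝ) → ℝ} (h : SobBd κ U s M f) : SobBd κ U s M (fun x => (f x : ℂ)) := by
  have := h.clm_comp Complex.ofRealCLM
  rw [show ‖Complex.ofRealCLM‖₊ = 1 from NNReal.eq Complex.ofRealCLM_norm] at this
  simpa using this

theorem SobBd.re {κ s : ℕ} {U : Opens (Fin (K + 1) → ℝ)}
    {f : (Fin (K + 1) → ℝ) → ℂ} (h : SobBd κ U s ⊤ f) : SobBd κ U s ⊤ (fun x => (f x).re) :=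
  (h.clm_comp Complex.reCLM).mono_bound le_top

theorem SobBd.exists_contDiff (hk : ((K + 1 : ℕ) : ℝ) < 2 * k) {f : (Fin (K + 1) → ℝ) → ℝ}
    (h : SobBd 0 ⊤ (k + 1) ⊤ f) :
    ∃ g : (Fin (K + 1) → ℝ) → ℝ, ContDiff ℝ 1 g ∧ f =ᵐ[volume] g ∧ (∃ C, ∀ x, |g x| ≤ C) ∧
      ∀ X, ∃ C, ∀ x, |fderiv ℝ g x X| ≤ C := by
  obtain ⟨u, hu, hI⟩ := h.ofReal.exists_inH
  obtain ⟨g, hg, hfg, hb, hd⟩ := hu.exists_contDiff hk hI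
  refine ⟨fun x => (g x).re, contDiff_re_comp hg, ?_,
    ⟨_, fun x => (Complex.abs_re_le_norm _).trans (hb x)⟩,
    fun X => ⟨dlip X * ((jconst (K + 1) k).toReal * hn (k + 1) u), fun x => ?_⟩⟩
  · filter_upwards [hfg] with x hx
    rw [← hx, Complex.ofReal_re]
  · rw [fderiv_re_comp hg]
    exact (Complex.abs_re_le_norm _).trans (hd X x)

/-- Solvability of `w + X w + q w ∂_θ w = f` for small `f`. -/
theorem exists_global_solution (hk : ((K + 1 : ℕ) : ℝ) < 2 * k) {X : Fin (K + 1) → ℝ}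
    (hX : X (Fin.last K) = 0) {q : (Fin (K + 1) → ℝ) → ℝ} (hq : ContDiff ℝ ∞ q) {A : ℝ≥0}
    (hA : BddSmooth (k + 1) A q) :
    ∃ δ : ℝ≥0, 0 < δ ∧ ∀ f : (Fin (K + 1) → ℝ) → ℝ, SobBd 1 ⊤ (k + 1) δ f →
      ∃ w : (Fin (K + 1) → ℝ) → ℝ, ContDiff ℝ 1 w ∧ SobBd 1 ⊤ (k + 1) ⊤ w ∧
        (∀ᵐ x, w x + fderiv ℝ w x X + q x * w x * fderiv ℝ w x (coordVec (Fin.last K)) = f x) ∧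
        ∀ x, |fderiv ℝ (fun y => q y * w y) x (coordVec (Fin.last K))| ≤ 1 / 4 := by
  set Y : Fin (K + 1) → ℝ := coordVec (Fin.last K) with hY
  set q₀ := mulConst K (k + 1) A with hq₀
  set J := (jconst (K + 1) k).toReal with hJ
  have hp0 : 0 ≤ pc (K + 1) k * dlip Y * q₀ :=
    mul_nonneg (mul_nonneg (pc_nonneg _ _) (dlip Y).coe_nonneg) (mulConst_nonneg _ _ _)
  have hp1 : 0 ≤ q₀ * dlip Y * J :=
    mul_nonneg (mul_nonneg (mulConst_nonneg _ _ _) (dlip Y).coe_nonneg) ENNReal.toReal_nonneg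
  -- With δ' = 1 / D both smallness conditions hold with the bound 1/4.
  set D := 4 * (1 + pc (K + 1) k * dlip Y * q₀ + q₀ * dlip Y * J) with hD
  have hDp : 0 < D := by linarith
  set δ' := D⁻¹ with hδ'
  have hδD : δ' * D = 1 := inv_mul_cancel₀ hDp.ne'
  have hδ'p : 0 < δ' := inv_pos.2 hDp
  -- The factor lost in passing from the physical Sobolev bound to the Fourier norm; the threshold
  -- for f is divided by it in advance.
  set E : ℝ≥0 := ((K + 2 : ℕ) : ℝ≥0) ^ (k + 1) with hE
  have hEp : 0 < E := by positivity
  refine ⟨(δ' / 4).toNNReal / E, by positivity, fun f hf => ?_⟩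
  obtain ⟨φ, hφ, hφI⟩ := (hf.unweighted.mono_bound le_top).ofReal.exists_inH
  have hφle : hn (k + 1) φ ≤ δ' / 4 := by
    have h1 := hf.unweighted.ofReal.wn_le hφ
    have h2 : ((K + 2 : ℕ) ^ (k + 1) : ℝ≥0∞) * (((δ' / 4).toNNReal / E : ℝ≥0) : ℝ≥0∞) =
        ENNReal.ofReal (δ' / 4) := by
      rw [show ((K + 2 : ℕ) ^ (k + 1) : ℝ≥0∞) = (E : ℝ≥0∞) by rw [hE]; push_cast; rfl,
        ← ENNReal.coe_mul, mul_div_cancel₀ _ hEp.ne']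
      rfl
    rw [h2] at h1
    exact ENNReal.toReal_le_of_le_ofReal (by positivity) h1
  have hφs : ConjSymm φ := hφ.conjSymm (Eventually.of_forall fun x => Complex.conj_ofReal _)
  have hS : SmallData k q₀ δ' (fourierMul q) Y φ := by
    refine ⟨hk, realOp_fourierMul k hq hA, hδ'p, ?_, ?_, ⟨hφI, hφle, hφs⟩⟩
    · have : pc (K + 1) k * dlip Y * (q₀ * δ') = δ' * (pc (K + 1) k * dlip Y * q₀) := by ring
      rw [this]
      nlinarith
    · have : q₀ * (dlip Y * (J * δ')) = δ' * (q₀ * dlip Y * J) := by ring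
      rw [← hJ, this]
      nlinarith
  obtain ⟨u, hu, hsol⟩ := hS.exists_solution (X := X)
  obtain ⟨W, hW⟩ := exists_isFourier_inv hu.inH.memLp
  have hWr := hu.symm.isReal hW
  have hQ := hW.fourierMul hq.continuous hA.le
  obtain ⟨hQI, hQle⟩ := hS.realOp.high u hu.inH
  have hQs := hS.Q_symm hu
  have hQi : Integrable (fourierMul q u) := integrable_of_wn hk hQI.1 hQI.2
  obtain ⟨g, hg, hWg, -, -⟩ := hW.exists_contDiff hk hu.inH
  have hd : ∀ Z : Fin (K + 1) → ℝ, ∃ WZ : (Fin (K + 1) → ℝ) → ℂ, IsFourier WZ (dmul Z u) ∧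
      HasWeakDirDeriv ⊤ Z W WZ ∧ ∀ᵐ x, WZ x = fderiv ℝ g x Z := by
    intro Z
    obtain ⟨WZ, hWZ⟩ := exists_isFourier_inv (hu.inH.dmul Z).memLp
    have h1 := (hW.hasWeakDirDeriv_iff_dmul hWZ).2 EventuallyEq.rfl
    refine ⟨WZ, hWZ, h1, ?_⟩
    have h2 := (h1.congr (by rw [restrict_top]; exact hWg) EventuallyEq.rfl).unique
      (HasWeakDirDeriv.of_contDiff hg)
    rwa [restrict_top] at h2
  obtain ⟨WX, hWX, hWXd, eX⟩ := hd X
  obtain ⟨WY, hWY, hWYd, eY⟩ := hd Y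
  have heq : (fun x => W x + WX x + (q x • W x) * WY x) =ᵐ[volume] fun x => (f x : ℂ) := by
    refine IsFourier.unique_left ((hW.add hWX).add (hQ.mul hQi hWY)) (hφ.congr EventuallyEq.rfl ?_)
    filter_upwards [hsol] with ξ hξ
    exact (sub_eq_zero.1 hξ).symm
  have hreg := weighted_regularity hk hX hQ hQI hQs ((hS.Q_small hu).trans (by norm_num))
    (hW.sobBd hu.inH) hWr hWXd hWYd hWX.memLp_left hWY.memLp_left heq
    (hf.ofReal.mono_bound le_top)
  -- Reality is first known almost everywhere, from the conjugation symmetry of u, and then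
  -- everywhere by continuity of g.
  have hgr : ∀ x, ((g x).re : ℂ) = g x := by
    refine fun x => congrFun ((Continuous.ae_eq_iff_eq volume (Complex.continuous_ofReal.comp
      (Complex.continuous_re.comp hg.continuous)) hg.continuous).1 ?_) x
    filter_upwards [hWr, hWg] with x h1 h2
    simp only [Function.comp]
    rw [← h2]
    exact Complex.conj_eq_iff_re.1 h1
  refine ⟨fun x => (g x).re, contDiff_re_comp hg, hreg.re.congr ?_, ?_, fun x => ?_⟩
  · rw [restrict_top]
    filter_upwards [hWg] with x hx
    rw [hx]
  · filter_upwards [heq, eX, eY, hWg] with x h1 h2 h3 h4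
    rw [fderiv_re_comp hg, fderiv_re_comp hg, ← h2, ← h3]
    have h5 := congrArg Complex.re h1
    have h6 : (W x).im = 0 := by rw [h4, ← hgr x, Complex.ofReal_im]
    simp only [Complex.add_re, Complex.mul_re, Complex.real_smul, Complex.ofReal_re,
      Complex.ofReal_im, Complex.mul_im, h6] at h5
    rw [← h4]
    linarith
  -- The product q w has a C¹ representative of its own, and the second smallness condition is
  -- exactly the bound 1/4 of its ∂_θ derivative.
  · obtain ⟨g₂, hg₂, hWg₂, -, hb⟩ := hQ.exists_contDiff hk hQI
    have e : (fun y => q y * (g y).re) = fun y => (g₂ y).re := by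
      refine (Continuous.ae_eq_iff_eq volume (hq.continuous.mul
        (Complex.continuous_re.comp hg.continuous)) (Complex.continuous_re.comp hg₂.continuous)).1 ?_
      filter_upwards [hWg, hWg₂] with y h1 h2
      change q y * (g y).re = (g₂ y).re
      rw [← h2, ← h1, Complex.real_smul, Complex.re_ofReal_mul]
    rw [e, fderiv_re_comp hg₂]
    refine (Complex.abs_re_le_norm _).trans ((hb Y x).trans ?_)
    refine le_trans ?_ hS.second
    calc _ ≤ dlip Y * (J * (q₀ * δ')) := by
          refine mul_le_mul_of_nonneg_left (mul_le_mul_of_nonneg_left (hQle.trans ?_)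
            ENNReal.toReal_nonneg) (dlip Y).coe_nonneg
          exact mul_le_mul_of_nonneg_left hu.le (mulConst_nonneg _ _ _)
      _ = _ := by ring

end RealSolution
-- Energy identity and vanishing in the past
section Energy

variable {K : ℕ}

theorem HasWeakDirDeriv.of_coords {N : ℕ} {F : Type*} [NormedAddCommGroup F] [NormedSpace ℝ F]
    {U : Opens (Fin N → ℝ)} {f : (Fin N → ℝ) → F} {g : Fin N → (Fin N → ℝ) → F}
    (hf : LocallyIntegrableOn f U) (h : ∀ i, HasWeakDirDeriv U (coordVec i) f (g i))
    (X : Fin N → ℝ) : HasWeakDirDeriv U X f (fun x => ∑ i, X i • g i x) := by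
  have h1 := HasWeakDirDeriv.sum_dir hf Finset.univ (fun i => coordVec i) X g fun i _ => h i
  convert h1 using 1
  ext j
  simp [coordVec, Finset.sum_apply, Pi.single_apply]

theorem SobBd.memLp_fderiv {s : ℕ} {z : (Fin (K + 1) → ℝ) → ℝ} (hz : ContDiff ℝ 1 z)
    (h : SobBd 0 ⊤ (s + 1) ⊤ z) (X : Fin (K + 1) → ℝ) :
    MemLp (fun x => fderiv ℝ z x X) 2 volume := by
  choose g hg hs using h.2
  have h1 := (HasWeakDirDeriv.of_coords (hg 0).1 hg X).unique
    (HasWeakDirDeriv.of_contDiff (X := X) hz)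
  rw [restrict_top] at h1
  have h2 : ∀ i, MemLp (g i) 2 volume := fun i => by simpa using (hs i).memLp
  exact MemLp.ae_eq h1 (memLp_finsetSum _ fun i _ => (h2 i).const_smul (X i))

theorem HasWeakDirDeriv.ae_eq_fderiv {N : ℕ} {U : Opens (Fin N → ℝ)} {X : Fin N → ℝ}
    {f g z : (Fin N → ℝ) → ℝ} (h : HasWeakDirDeriv U X f g)
    (hf : f =ᵐ[volume.restrict (U : Set (Fin N → ℝ))] z) (hz : ContDiff ℝ 1 z) :
    g =ᵐ[volume.restrict (U : Set (Fin N → ℝ))] fun x => fderiv ℝ z x X :=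
  (h.congr hf EventuallyEq.rfl).unique (HasWeakDirDeriv.of_contDiff hz)

/-- The energy estimate: uniqueness for `X z + h ∂_Y z = -κ z` in the past. -/
theorem eq_zero_of_energy {X Y : Fin (K + 1) → ℝ} {z h κ : (Fin (K + 1) → ℝ) → ℝ} {T₀ C : ℝ}
    (hX : X 0 = 1) (hY : Y 0 = 0) (hz : ContDiff ℝ 1 z) (hzL : SobBd 0 ⊤ 1 ⊤ z)
    (hh : ContDiff ℝ 1 h) (hC : ∀ x, |h x| ≤ C) (hC' : ∀ x, |fderiv ℝ h x Y| ≤ C)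
    (hκ : ∀ x, 1 ≤ 2 * κ x - fderiv ℝ h x Y)
    (heq : ∀ᵐ x, x 0 < T₀ → fderiv ℝ z x X + h x * fderiv ℝ z x Y = -κ x * z x) :
    ∀ x, x 0 < T₀ → z x = 0 := by
  -- The weight is nonincreasing in t and zero after T₀. Only the region t < T₀, where the equation
  -- holds, contributes, and the derivative of ψ along X has a favourable sign.
  set ψ : (Fin (K + 1) → ℝ) → ℝ := fun x => Real.smoothTransition (T₀ - x 0) with hψ
  have hs1 : ContDiff ℝ ∞ fun t => Real.smoothTransition (T₀ - t) :=
    Real.smoothTransition.contDiff.comp (contDiff_const.sub contDiff_id)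
  have hψc : ContDiff ℝ ∞ ψ := contDiff_comp_coord hs1 0
  obtain ⟨C₁, hC₁0, hC₁⟩ := deriv_smoothTransition_bound
  have hdψ : ∀ x Z, fderiv ℝ ψ x Z = -(deriv Real.smoothTransition (T₀ - x 0)) * Z 0 := by
    intro x Z
    rw [hψ, fderiv_comp_coord hs1]
    congr 1
    rw [deriv_comp_const_sub]
  have hzL2 : MemLp z 2 volume := by simpa using hzL.memLp
  have hzX := hzL.memLp_fderiv hz X
  have hzY := hzL.memLp_fderiv hz Y
  have hψb : ∀ x, ‖ψ x‖ ≤ 1 := fun x => by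
    rw [Real.norm_of_nonneg (Real.smoothTransition.nonneg _)]
    exact Real.smoothTransition.le_one _
  have hsq : Integrable fun x => z x * z x := hzL2.integrable_mul hzL2
  have hzzX : Integrable fun x => z x * fderiv ℝ z x X := hzL2.integrable_mul hzX
  have hzzY : Integrable fun x => z x * fderiv ℝ z x Y := hzL2.integrable_mul hzY
  have cψ := hψc.continuous
  have ch := hh.continuous
  have chY : Continuous fun x => fderiv ℝ h x Y :=
    (hh.continuous_fderiv one_ne_zero).clm_apply continuous_const
  have cs : Continuous fun x : Fin (K + 1) → ℝ => deriv Real.smoothTransition (T₀ - x 0) :=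
    ((Real.smoothTransition.contDiff (n := 1)).continuous_deriv le_rfl).comp
      (continuous_const.sub (continuous_apply 0))
  have dz := fun x => (hz.differentiable one_ne_zero x).hasFDerivAt
  have dh := fun x => (hh.differentiable one_ne_zero x).hasFDerivAt
  have dψ := fun x => (hψc.differentiable (by simp) x).hasFDerivAt
  have hψ1 : ContDiff ℝ 1 ψ := hψc.of_le (by exact_mod_cast le_top)
  -- The integrals of ∂_X (ψ z²) and ∂_Y (ψ h z²) vanish. Adding them and inserting the equation
  -- bounds the integral of ψ z² by zero; since Y has no time component, ψ is not differentiated in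
  -- the second.
  have e1 := HasWeakDirDeriv.integral_eq_zero (HasWeakDirDeriv.of_contDiff (U := ⊤) (X := X)
    (hψ1.mul (hz.mul hz)))
  have e2 := HasWeakDirDeriv.integral_eq_zero (HasWeakDirDeriv.of_contDiff (U := ⊤) (X := Y)
    ((hψ1.mul hh).mul (hz.mul hz)))
  have f1 : ∀ x, fderiv ℝ (fun x => ψ x * (z x * z x)) x X =
      -(deriv Real.smoothTransition (T₀ - x 0)) * (z x * z x) + 2 * (ψ x * (z x * fderiv ℝ z x X)) := by
    intro x
    rw [((dψ x).fun_mul ((dz x).fun_mul (dz x))).fderiv]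
    simp only [add_apply, smul_apply, smul_eq_mul, hdψ, hX]
    ring
  have f2 : ∀ x, fderiv ℝ (fun x => ψ x * h x * (z x * z x)) x Y =
      ψ x * (fderiv ℝ h x Y * (z x * z x)) + 2 * (ψ x * (h x * (z x * fderiv ℝ z x Y))) := by
    intro x
    rw [(((dψ x).fun_mul (dh x)).fun_mul ((dz x).fun_mul (dz x))).fderiv]
    simp only [add_apply, smul_apply, smul_eq_mul, hdψ, hY]
    ring
  have bd : ∀ {u v : (Fin (K + 1) → ℝ) → ℝ} {D : ℝ}, Continuous u → (∀ x, ‖u x‖ ≤ D) →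
      Integrable v → Integrable fun x => u x * v x := fun hu hb hv =>
    hv.bdd_mul hu.aestronglyMeasurable (Eventually.of_forall hb)
  have i0 := bd cψ hψb hsq
  have ihz : Integrable fun x => h x * (z x * z x) := bd ch hC hsq
  have i1 : Integrable fun x => fderiv ℝ (fun x => ψ x * (z x * z x)) x X := by
    simp only [f1]
    refine (bd (D := C₁) cs.neg (fun x => ?_) hsq).add ((bd cψ hψb hzzX).const_mul 2)
    rw [Pi.neg_apply, norm_neg]
    exact (hC₁ _).1
  have i2 : Integrable fun x => fderiv ℝ (fun x => ψ x * h x * (z x * z x)) x Y := by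
    simp only [f2]
    exact (bd cψ hψb (bd chY hC' hsq)).add ((bd cψ hψb (bd ch hC hzzY)).const_mul 2)
  have j2 : Integrable fun x => ψ x * h x * (z x * z x) := by
    simpa only [mul_assoc] using bd cψ hψb ihz
  have hzero : ∫ x, ψ x * (z x * z x) ≤ 0 := by
    have h1 : ∫ x, (fderiv ℝ (fun x => ψ x * (z x * z x)) x X +
        fderiv ℝ (fun x => ψ x * h x * (z x * z x)) x Y) = 0 := by
      rw [integral_add i1 i2]
      have a1 := e1 i0 i1
      have a2 := e2 j2 i2
      linarith
    have h2 : ∫ x, ψ x * (z x * z x) ≤ ∫ x, -(fderiv ℝ (fun x => ψ x * (z x * z x)) x X +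
        fderiv ℝ (fun x => ψ x * h x * (z x * z x)) x Y) := by
      refine integral_mono_ae i0 (i1.add i2).neg ?_
      filter_upwards [heq] with x hx
      simp only [f1, f2]
      have hm : 0 ≤ deriv Real.smoothTransition (T₀ - x 0) :=
        Real.smoothTransition.monotone.deriv_nonneg
      have hz2 := mul_self_nonneg (z x)
      rcases lt_or_ge (x 0) T₀ with ht | ht
      · have h3 := hx ht
        have h4 : 0 ≤ ψ x := Real.smoothTransition.nonneg _
        have h5 : 2 * (ψ x * (z x * fderiv ℝ z x X)) + 2 * (ψ x * (h x * (z x * fderiv ℝ z x Y))) =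
            -(2 * κ x) * (ψ x * (z x * z x)) := by
          linear_combination (2 * ψ x * z x) * h3
        have h6 : 0 ≤ (2 * κ x - fderiv ℝ h x Y - 1) * (ψ x * (z x * z x)) :=
          mul_nonneg (by linarith [hκ x]) (mul_nonneg h4 hz2)
        nlinarith [mul_nonneg hm hz2]
      · have h4 : ψ x = 0 := Real.smoothTransition.zero_of_nonpos (by linarith)
        rw [h4]
        nlinarith [mul_nonneg hm hz2]
    rw [integral_neg, h1] at h2
    simpa using h2
  have hnn : ∀ x, 0 ≤ ψ x * (z x * z x) := fun x =>
    mul_nonneg (Real.smoothTransition.nonneg _) (mul_self_nonneg _)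
  have hae := (integral_eq_zero_iff_of_nonneg hnn i0).1 (le_antisymm hzero (integral_nonneg hnn))
  have hall := (Continuous.ae_eq_iff_eq volume (cψ.mul (hz.continuous.mul hz.continuous))
    continuous_const).1 hae
  intro x hx
  have h1 : ψ x * (z x * z x) = 0 := congrFun hall x
  have h2 : ψ x ≠ 0 := (Real.smoothTransition.pos_of_pos (by linarith)).ne'
  simpa [h2] using h1

end Energy
-- The Burgers-type equation on the boundary
section BoundaryEquation

variable {n k : ℕ}

theorem SobBd.bounded_of_contDiff {K : ℕ} (hk : ((K + 1 : ℕ) : ℝ) < 2 * k)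
    {f : (Fin (K + 1) → ℝ) → ℝ} (h : SobBd 0 ⊤ (k + 1) ⊤ f) (hf : ContDiff ℝ 1 f) :
    (∃ C, ∀ x, |f x| ≤ C) ∧ ∀ X, ∃ C, ∀ x, |fderiv ℝ f x X| ≤ C := by
  obtain ⟨g, hg, hfg, h1, h2⟩ := h.exists_contDiff hk
  obtain rfl := (Continuous.ae_eq_iff_eq volume hf.continuous hg.continuous).1 hfg
  exact ⟨h1, h2⟩

/-- The cut-off function `e^{μ t} χ(t)` in time, with `χ = 1` on `[-T, T + 2]`. -/
def timeCut (T μ t : ℝ) : ℝ :=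
  Real.exp (μ * t) * (⟨|T| + 2, |T| + 3, by positivity, by linarith⟩ : ContDiffBump (0 : ℝ)) t

theorem timeCut_contDiff (T μ : ℝ) : ContDiff ℝ ∞ (timeCut T μ) :=
  (contDiff_const.mul contDiff_id).exp.mul (ContDiffBump.contDiff _)

theorem timeCut_compact (T μ : ℝ) : HasCompactSupport (timeCut T μ) :=
  (ContDiffBump.hasCompactSupport _).mul_left

theorem timeCut_eq {T μ t : ℝ} (h1 : -1 < t) (h2 : t < T + 1) :
    timeCut T μ t = Real.exp (μ * t) := by
  have : |t| ≤ |T| + 2 := abs_le.2 ⟨by linarith [abs_nonneg T], by linarith [le_abs_self T]⟩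
  rw [timeCut, ContDiffBump.one_of_mem_closedBall, mul_one]
  rwa [mem_closedBall_zero_iff, Real.norm_eq_abs]

theorem timeCut_bddSmooth (N s : ℕ) (T μ : ℝ) :
    ∃ A, BddSmooth s A fun x : Fin (N + 1) → ℝ => timeCut T μ (x 0) := by
  obtain ⟨A, hA⟩ := BddSmooth.of_coord (0 : Fin (N + 1)) s (timeCut_contDiff T μ)
    (timeCut_compact T μ)
  exact ⟨A, by simpa using hA 1 le_rfl⟩

theorem fderiv_exp_mul {N : ℕ} {z : (Fin (N + 1) → ℝ) → ℝ} (hz : ContDiff ℝ 1 z) (μ : ℝ)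
    (x Z : Fin (N + 1) → ℝ) : fderiv ℝ (fun y : Fin (N + 1) → ℝ => Real.exp (μ * y 0) * z y) x Z =
      Real.exp (μ * x 0) * (fderiv ℝ z x Z + μ * Z 0 * z x) := by
  have h1 : ContDiff ℝ ∞ fun t : ℝ => Real.exp (μ * t) := (contDiff_const.mul contDiff_id).exp
  have h2 := ((contDiff_comp_coord h1 (0 : Fin (N + 1))).differentiable (by simp) x).hasFDerivAt
  rw [(h2.fun_mul (hz.differentiable one_ne_zero x).hasFDerivAt).fderiv]
  have h3 : deriv (fun t => Real.exp (μ * t)) (x 0) = Real.exp (μ * x 0) * μ := by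
    have := ((hasDerivAt_id (x 0)).const_mul μ).exp.deriv
    simpa using this
  simp only [add_apply, smul_apply, smul_eq_mul, fderiv_comp_coord h1, h3]
  ring

/-- If `z` vanishes in `t < 0`, then `e^{μ t} χ(t) z = e^{μ t} z` in `t < T + 1`. -/
theorem timeCut_mul_eventuallyEq {N : ℕ} {z : (Fin (N + 1) → ℝ) → ℝ} {T μ : ℝ}
    (h0 : ∀ x, x 0 < 0 → z x = 0) {x : Fin (N + 1) → ℝ} (hx : x 0 < T) :
    (fun y : Fin (N + 1) → ℝ => timeCut T μ (y 0) * z y) =ᶠ[𝓝 x]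
      fun y => Real.exp (μ * y 0) * z y := by
  have : ∀ᶠ y : Fin (N + 1) → ℝ in 𝓝 x, y 0 < T :=
    (continuous_apply (0 : Fin (N + 1))).continuousAt.eventually_lt_const hx
  filter_upwards [this] with y hy
  rcases lt_or_ge (y 0) 0 with h | h
  · rw [h0 y h, mul_zero, mul_zero]
  · rw [timeCut_eq (by linarith) (by linarith)]

theorem ae_restrict_slab {N : ℕ} {T : ℝ} {p : (Fin (N + 1) → ℝ) → Prop} :
    (∀ᵐ x ∂(volume.restrict (timeSlab N T : Set (Fin (N + 1) → ℝ))), p x) ↔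
      ∀ᵐ x, x 0 < T → p x :=
  ae_restrict_iff' (timeSlab N T).isOpen.measurableSet

/-- The substitution a = e^{λt} w with λ = 1 - c/c₀ turns the equation, divided by c₀ e^{λt}, into w
+ X' w + q w ∂_θ w = f with zero order coefficient exactly 1. The exponentials are cut off in time;
this is invisible for 0 ≤ t < T, and for t < 0 the data and the solution vanish. -/
theorem exists_boundary_solution (hk : ((n + 2 : ℕ) : ℝ) < 2 * k) {X : Fin (n + 2) → ℝ}
    (hX0 : X 0 ≠ 0) (hX : X (Fin.last (n + 1)) = 0) (c d T : ℝ) (hT : 0 < T) :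
    ∃ δ : ℝ≥0, 0 < δ ∧ ∀ g : (Fin (n + 2) → ℝ) → ℝ, SobBd 1 (timeSlab (n + 1) T) (k + 1) δ g →
      (∀ᵐ x, x 0 < T → x 0 < 0 → g x = 0) →
      ∃ a : (Fin (n + 2) → ℝ) → ℝ, ContDiff ℝ 1 a ∧ SobBd 1 ⊤ (k + 1) ⊤ a ∧
        (∀ x, x 0 < 0 → a x = 0) ∧ ∀ᵐ x, x 0 < T →
          fderiv ℝ a x X + c * a x + 2 * d * a x * fderiv ℝ a x (coordVec (Fin.last (n + 1))) =
            g x := by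
  set c₀ := X 0 with hc₀
  set X' : Fin (n + 2) → ℝ := c₀⁻¹ • X with hX'
  set lam : ℝ := 1 - c / c₀ with hlam
  set Y : Fin (n + 2) → ℝ := coordVec (Fin.last (n + 1)) with hY
  set q : (Fin (n + 2) → ℝ) → ℝ := fun x => 2 * (d / c₀) * timeCut T lam (x 0) with hq
  have hqc : ContDiff ℝ ∞ q :=
    contDiff_const.mul (contDiff_comp_coord (timeCut_contDiff T lam) 0)
  obtain ⟨A₀, hA₀⟩ := timeCut_bddSmooth (n + 1) (k + 1) T lam
  have hqA := BddSmooth.const_mul (2 * (d / c₀))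
    (contDiff_comp_coord (timeCut_contDiff T lam) 0) hA₀
  obtain ⟨δ₁, hδ₁, hsolve⟩ := exists_global_solution hk (X := X')
    (by rw [hX', Pi.smul_apply, hX, smul_zero]) hqc hqA
  obtain ⟨C, hC⟩ := SobBd.exists_extension (F := ℝ) 1 n T (k + 1)
  obtain ⟨A₁, hA₁⟩ := timeCut_bddSmooth (n + 1) (k + 1) T (-lam)
  have hfc : ContDiff ℝ ∞ fun x : Fin (n + 2) → ℝ => c₀⁻¹ * timeCut T (-lam) (x 0) :=
    contDiff_const.mul (contDiff_comp_coord (timeCut_contDiff T (-lam)) 0)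
  have hfA := BddSmooth.const_mul c₀⁻¹
    (contDiff_comp_coord (timeCut_contDiff T (-lam)) (0 : Fin (n + 2))) hA₁
  -- The total loss from extending g across T and multiplying by the cut-off exponential; dividing
  -- by L + 1 brings f below the threshold of the whole-space problem.
  set L : ℝ≥0 := 2 ^ (k + 1) * (‖c₀⁻¹‖₊ * A₁ * C) with hL
  refine ⟨δ₁ / (L + 1), by positivity, fun g hg hg0 => ?_⟩
  obtain ⟨Eg, hEg, hEgg⟩ := hC _ g hg
  set f : (Fin (n + 2) → ℝ) → ℝ := fun x => (c₀⁻¹ * timeCut T (-lam) (x 0)) • Eg x with hf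
  have hfS : SobBd 1 ⊤ (k + 1) δ₁ f := by
    refine (hEg.smul_smooth hfc hfA).mono_bound ?_
    have h1 : L * (δ₁ / (L + 1)) ≤ δ₁ := by
      rw [mul_div_assoc', div_le_iff₀ (by positivity), mul_comm]
      gcongr
      exact le_add_of_nonneg_right zero_le
    refine le_trans (le_of_eq ?_) (ENNReal.coe_le_coe.2 h1)
    rw [hL]
    push_cast
    ring
  obtain ⟨w, hwc, hwS, hweq, hwb⟩ := hsolve f hfS
  have hw0 := hwS.unweighted
  obtain ⟨⟨Cw, hCw⟩, -⟩ := hw0.bounded_of_contDiff hk hwc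
  have hX'0 : X' 0 = 1 := inv_mul_cancel₀ hX0
  have hY0 : Y 0 = 0 := by
    rw [hY, coordVec, Pi.single_eq_of_ne]
    exact (Fin.last_pos).ne
  set A := ‖2 * (d / c₀)‖₊ * A₀ with hA
  -- Causality: for t < 0 the right-hand side is zero, and the energy estimate with T₀ = 0, κ = 1
  -- and h = q w applies because 2 - 1/4 ≥ 1.
  have hwz : ∀ x, x 0 < 0 → w x = 0 := by
    refine eq_zero_of_energy (X := X') (Y := Y) (h := fun x => q x * w x) (κ := fun _ => 1)
      (C := max (A * Cw) (1 / 4)) hX'0 hY0 hwc (hw0.mono_order (by omega))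
      ((hqc.of_le (by exact_mod_cast le_top)).mul hwc) (fun x => ?_)
      (fun x => (hwb x).trans (le_max_right _ _)) (fun x => ?_) ?_
    · rw [abs_mul]
      refine le_trans (mul_le_mul (hqA.le x) (hCw x) (abs_nonneg _) A.coe_nonneg) (le_max_left _ _)
    · have := (abs_le.1 (hwb x)).2
      linarith
    · filter_upwards [hweq, hg0] with x h1 h2 h3
      have h4 : f x = 0 := by
        rw [hf]
        simp only
        rw [hEgg x (h3.trans hT), h2 (h3.trans hT) h3, smul_zero]
      rw [h4] at h1
      linarith
  have hac : ContDiff ℝ ∞ fun x : Fin (n + 2) → ℝ => timeCut T lam (x 0) :=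
    contDiff_comp_coord (timeCut_contDiff T lam) 0
  refine ⟨fun x => timeCut T lam (x 0) * w x, (hac.of_le (by exact_mod_cast le_top)).mul hwc,
    hwS.smul_smooth_top hac hA₀, fun x hx => by simp [hwz x hx], ?_⟩
  filter_upwards [hweq, hg0] with x h1 h2 h3
  have hev := timeCut_mul_eventuallyEq (μ := lam) hwz h3
  rw [hev.fderiv_eq, hev.eq_of_nhds, fderiv_exp_mul hwc, fderiv_exp_mul hwc]
  rcases lt_or_ge (x 0) 0 with h4 | h4
  · have h5 : w =ᶠ[𝓝 x] fun _ => 0 := by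
      filter_upwards [(continuous_apply (0 : Fin (n + 2))).continuousAt.eventually_lt_const h4]
        with y hy using hwz y hy
    rw [h2 h3 h4, h5.fderiv_eq, hwz x h4]
    simp
  · have h6 : fderiv ℝ w x X' = c₀⁻¹ * fderiv ℝ w x X := by rw [hX', map_smul, smul_eq_mul]
    simp only [hf, hq, h6, hEgg x h3, timeCut_eq (T := T) (show -1 < x 0 by linarith)
      (show x 0 < T + 1 by linarith), smul_eq_mul] at h1
    rw [hY0, show X 0 = c₀ from rfl]
    have h7 : Real.exp (lam * x 0) * Real.exp (-lam * x 0) = 1 := by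
      rw [← Real.exp_add]; simp
    have h8 : c₀ * c₀⁻¹ = 1 := mul_inv_cancel₀ hX0
    have h9 : lam * c₀ = c₀ - c := by rw [hlam]; field_simp
    have h10 : d / c₀ * c₀ = d := div_mul_cancel₀ d hX0
    linear_combination (c₀ * Real.exp (lam * x 0)) * h1 + g x * c₀ * c₀⁻¹ * h7 +
      (g x - Real.exp (lam * x 0) * fderiv ℝ w x X) * h8 +
      Real.exp (lam * x 0) * w x * h9 -
      2 * Real.exp (lam * x 0) ^ 2 * w x * fderiv ℝ w x Y * h10

/-- The competitor is extended across T and replaced by its C¹ representative b. As a² - b² = (a +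
b)(a - b), the difference solves a linear equation with bounded coefficients. An exponential in t
makes its zero order coefficient large, so no smallness is required. -/
theorem boundary_unique (hk : ((n + 2 : ℕ) : ℝ) < 2 * k) {X : Fin (n + 2) → ℝ}
    (hX0 : X 0 ≠ 0) {c d T : ℝ} (hT : 0 < T) {g a a' Xa da2 : (Fin (n + 2) → ℝ) → ℝ}
    (ha : ContDiff ℝ 1 a) (haS : SobBd 1 ⊤ (k + 1) ⊤ a) (ha0 : ∀ x, x 0 < 0 → a x = 0)
    (haeq : ∀ᵐ x, x 0 < T → fderiv ℝ a x X + c * a x +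
      2 * d * a x * fderiv ℝ a x (coordVec (Fin.last (n + 1))) = g x)
    (haS' : SobBd 1 (timeSlab (n + 1) T) (k + 1) ⊤ a') (ha0' : ∀ᵐ x, x 0 < T → x 0 < 0 → a' x = 0)
    (hXa : HasWeakDirDeriv (timeSlab (n + 1) T) X a' Xa)
    (hda : HasWeakDirDeriv (timeSlab (n + 1) T) (coordVec (Fin.last (n + 1)))
      (fun x => a' x ^ 2) da2)
    (heq : ∀ᵐ x, x 0 < T → Xa x + c * a' x + d * da2 x = g x) :
    ∀ᵐ x, x 0 < T → a' x = a x := by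
  set c₀ := X 0 with hc₀
  set Y : Fin (n + 2) → ℝ := coordVec (Fin.last (n + 1)) with hY
  obtain ⟨C, hC⟩ := SobBd.exists_extension (F := ℝ) 1 n T (k + 1)
  obtain ⟨Ea, hEa, hEaa⟩ := hC _ a' haS'
  have hEa0 : SobBd 0 ⊤ (k + 1) ⊤ Ea := (hEa.mono_bound le_top).unweighted
  obtain ⟨b, hb, hEb, -, -⟩ := hEa0.exists_contDiff hk
  have hbS : SobBd 0 ⊤ (k + 1) ⊤ b := hEa0.congr (by rwa [restrict_top])
  have hab : ∀ᵐ x, x 0 < T → a' x = b x := by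
    filter_upwards [hEb] with x h1 h2
    rw [← hEaa x h2, h1]
  have hb0 : ∀ x, x 0 < 0 → b x = 0 := by
    have hopen : IsOpen {x : Fin (n + 2) → ℝ | x 0 < 0} :=
      isOpen_lt (continuous_apply _) continuous_const
    have h1 : b =ᵐ[volume.restrict {x | x 0 < 0}] fun _ => 0 := by
      rw [EventuallyEq, ae_restrict_iff' hopen.measurableSet]
      filter_upwards [hab, ha0'] with x h1 h2 h3
      rw [← h1 (h3.trans hT), h2 (h3.trans hT) h3]
    intro x hx
    exact Measure.eqOn_open_of_ae_eq h1 hopen hb.continuous.continuousOn continuousOn_const hx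
  have hbeq : ∀ᵐ x, x 0 < T → fderiv ℝ b x X + c * b x + 2 * d * b x * fderiv ℝ b x Y = g x := by
    have hab' := ae_restrict_slab.2 hab
    have h1 := ae_restrict_slab.1 (hXa.ae_eq_fderiv hab' hb)
    have h2 := ae_restrict_slab.1 (hda.ae_eq_fderiv (z := fun x => b x ^ 2)
      (hab'.mono fun x hx => by simp only [hx]) (hb.pow 2))
    filter_upwards [h1, h2, heq, hab] with x h3 h4 h5 h6 h7
    have h8 : fderiv ℝ (fun x => b x ^ 2) x Y = 2 * b x * fderiv ℝ b x Y := by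
      rw [((hb.differentiable one_ne_zero x).hasFDerivAt.pow 2).fderiv]
      simp
    rw [← h5 h7, h3 h7, h4 h7, h6 h7, h8]
    ring
  set h : (Fin (n + 2) → ℝ) → ℝ := fun x => (d / c₀) * (a x + b x) with hh
  have hhc : ContDiff ℝ 1 h := contDiff_const.mul (ha.add hb)
  have hhS : SobBd 0 ⊤ (k + 1) ⊤ h :=
    ((haS.unweighted.add hbS).const_smul (d / c₀)).mono_bound le_top
  obtain ⟨⟨C₁, hC₁⟩, h2⟩ := hhS.bounded_of_contDiff hk hhc
  obtain ⟨C₂, hC₂⟩ := h2 Y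
  set D : (Fin (n + 2) → ℝ) → ℝ := fun x => a x - b x with hD
  have hDc : ContDiff ℝ 1 D := ha.sub hb
  have hD0 : ∀ x, x 0 < 0 → D x = 0 := fun x hx => by rw [hD]; simp only [ha0 x hx, hb0 x hx, sub_zero]
  have hDS : SobBd 0 ⊤ (k + 1) ⊤ D :=
    ((haS.unweighted.add (hbS.const_smul (-1))).congr (Eventually.of_forall fun x => by
      simp only [hD, smul_eq_mul]; ring)).mono_bound le_top
  -- With κ = Λ + c/c₀ + ∂_Y h one gets 2κ - ∂_Y h = 1 + C₂ + ∂_Y h ≥ 1, as the energy estimate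
  -- requires.
  set Λ : ℝ := (1 + C₂) / 2 - c / c₀ with hΛ
  have hY0 : Y 0 = 0 := by
    rw [hY, coordVec, Pi.single_eq_of_ne]
    exact (Fin.last_pos).ne
  obtain ⟨A, hA⟩ := timeCut_bddSmooth (n + 1) (k + 1) T (-Λ)
  have htc : ContDiff ℝ ∞ fun x : Fin (n + 2) → ℝ => timeCut T (-Λ) (x 0) :=
    contDiff_comp_coord (timeCut_contDiff T (-Λ)) 0
  have hz := eq_zero_of_energy (X := c₀⁻¹ • X) (Y := Y)
    (z := fun x => timeCut T (-Λ) (x 0) * D x) (h := h)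
    (κ := fun x => Λ + c / c₀ + fderiv ℝ h x Y) (T₀ := T) (C := max C₁ C₂)
    (inv_mul_cancel₀ hX0) hY0 ((htc.of_le (by exact_mod_cast le_top)).mul hDc)
    ((hDS.smul_smooth_top htc hA).mono_order (by omega)) hhc
    (fun x => (hC₁ x).trans (le_max_left _ _)) (fun x => (hC₂ x).trans (le_max_right _ _))
    (fun x => by
      have := (abs_le.1 (hC₂ x)).1
      rw [hΛ]; linarith) (by
    filter_upwards [haeq, hbeq] with x h1 h3 h4
    have hev := timeCut_mul_eventuallyEq (μ := -Λ) hD0 h4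
    have e0 := hev.eq_of_nhds
    have ea := (ha.differentiable one_ne_zero x).hasFDerivAt
    have eb := (hb.differentiable one_ne_zero x).hasFDerivAt
    have eD : ∀ Z, fderiv ℝ D x Z = fderiv ℝ a x Z - fderiv ℝ b x Z := fun Z => by
      rw [hD, (ea.fun_sub eb).fderiv]; rfl
    have eh : fderiv ℝ h x Y = (d / c₀) * (fderiv ℝ a x Y + fderiv ℝ b x Y) := by
      rw [hh, ((ea.fun_add eb).const_mul (d / c₀)).fderiv]; rfl
    rw [hev.fderiv_eq, e0, fderiv_exp_mul hDc, fderiv_exp_mul hDc, map_smul, hY0, eh, Pi.smul_apply,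
      eD, eD, show X 0 = c₀ from rfl]
    simp only [smul_eq_mul, hD, hh]
    have h8 : c₀⁻¹ * c₀ = 1 := inv_mul_cancel₀ hX0
    have h5 := h1 h4
    have h6 := h3 h4
    simp only [div_eq_mul_inv]
    linear_combination (Real.exp (-Λ * x 0) * c₀⁻¹) * (h5 - h6) -
      Real.exp (-Λ * x 0) * Λ * (a x - b x) * h8)
  filter_upwards [hab] with x h1 h3
  have h4 := hz x h3
  rw [(timeCut_mul_eventuallyEq (μ := -Λ) hD0 h3).eq_of_nhds] at h4
  have h5 : D x = 0 := (mul_eq_zero.1 h4).resolve_left (Real.exp_pos _).ne'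
  rw [h1 h3]
  exact (sub_eq_zero.1 h5).symm

end BoundaryEquation
-- Functionals annihilating the stable subspace
section StableSubspace

/-- The vanishing of the functional `E₁ × E₂` characterises the span of `E₁, E₂`. -/
theorem mem_span_iff_cross {E : Fin 2 → Fin 3 → ℂ} (hE : LinearIndependent ℂ E) (v : Fin 3 → ℂ) :
    v ∈ Submodule.span ℂ (Set.range E) ↔ crossProduct (E 0) (E 1) ⬝ᵥ v = 0 := by
  set φ : (Fin 3 → ℂ) →ₗ[ℂ] ℂ := dotProductBilin ℂ ℂ (crossProduct (E 0) (E 1)) with hφ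
  have hne : crossProduct (E 0) (E 1) ≠ 0 := by
    rw [crossProduct_ne_zero_iff_linearIndependent]
    have e : ![E 0, E 1] = E := by ext i; fin_cases i <;> rfl
    rw [e]
    exact hE
  have hle : Submodule.span ℂ (Set.range E) ≤ LinearMap.ker φ := by
    rw [Submodule.span_le]
    rintro _ ⟨i, rfl⟩
    change crossProduct (E 0) (E 1) ⬝ᵥ E i = 0
    rw [dotProduct_comm]
    fin_cases i
    · exact dot_self_cross _ _
    · exact dot_cross_self _ _
  have hsurj : LinearMap.range φ = ⊤ := by
    refine LinearMap.range_eq_top.2 (LinearMap.surjective fun h0 => hne ?_)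
    ext i
    have := LinearMap.congr_fun h0 (Pi.single i 1)
    simpa [hφ] using this
  have hk := LinearMap.finrank_range_add_finrank_ker φ
  rw [hsurj, finrank_top, Module.finrank_self, Module.finrank_fin_fun] at hk
  have hs := finrank_span_eq_card hE
  rw [Fintype.card_fin] at hs
  rw [Submodule.eq_of_le_of_finrank_eq hle (by omega)]
  exact LinearMap.mem_ker

/-- The functional that vanishes on the stable subspace is a left eigenvector, and its eigenvalue
is not stable. -/
theorem exists_left_eigenvalue {f : Module.End ℂ (Fin 3 → ℂ)} {φ : (Fin 3 → ℂ) →ₗ[ℂ] ℂ}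
    (hφ : φ ≠ 0)
    (hS : LinearMap.ker φ = ⨆ μ : {μ : ℂ // μ.re < 0}, Module.End.maxGenEigenspace f μ) :
    ∃ ν : ℂ, 0 ≤ ν.re ∧ ∀ v, φ (f v) = ν * φ v := by
  have hinv : ∀ v ∈ LinearMap.ker φ, f v ∈ LinearMap.ker φ := by
    intro v hv
    rw [hS] at hv ⊢
    have : (⨆ μ : {μ : ℂ // μ.re < 0}, Module.End.maxGenEigenspace f μ) ≤
        (⨆ μ : {μ : ℂ // μ.re < 0}, Module.End.maxGenEigenspace f μ).comap f :=
      iSup_le fun μ w hw => Submodule.mem_iSup_of_mem μ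
        (Module.End.mapsTo_maxGenEigenspace_of_comm (Commute.refl f) μ hw)
    exact this hv
  obtain ⟨v₀, hv₀⟩ : ∃ v₀, φ v₀ = 1 := LinearMap.surjective hφ 1
  -- An invariant hyperplane is the kernel of a left eigenvector: φ ∘ f vanishes on ker φ, hence is
  -- a multiple of φ.
  have hν : ∀ v, φ (f v) = φ (f v₀) * φ v := by
    intro v
    have h1 : v - φ v • v₀ ∈ LinearMap.ker φ := by
      rw [LinearMap.mem_ker, map_sub, map_smul, hv₀, smul_eq_mul, mul_one, sub_self]
    have h2 := LinearMap.mem_ker.1 (hinv _ h1)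
    rw [map_sub, map_smul, map_sub, map_smul, smul_eq_mul, sub_eq_zero] at h2
    rw [h2, mul_comm]
  refine ⟨φ (f v₀), ?_, hν⟩
  by_contra! hneg
  refine hφ (LinearMap.ker_eq_top.1 (top_le_iff.1 ?_))
  rw [← Module.End.iSup_maxGenEigenspace_eq_top f]
  refine iSup_le fun μ v hv => ?_
  by_cases hμ : μ.re < 0
  · rw [hS]
    exact Submodule.mem_iSup_of_mem ⟨μ, hμ⟩ hv
  · obtain ⟨k, hk⟩ := (Module.End.mem_maxGenEigenspace f μ v).1 hv
    -- On a generalized eigenvector for μ this gives (ν - μ)^k φ v = 0. If Re ν < 0 ≤ Re μ, then φ v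
    -- = 0, so φ would vanish on all generalized eigenspaces.
    have hpow : ∀ (k : ℕ) (w : Fin 3 → ℂ), φ (((f - μ • 1) ^ k) w) = (φ (f v₀) - μ) ^ k * φ w := by
      intro k
      induction k with
      | zero => intro w; simp
      | succ k ih =>
        intro w
        rw [pow_succ, Module.End.mul_apply, ih, LinearMap.sub_apply, map_sub, hν w]
        simp
        ring
    rw [LinearMap.mem_ker]
    have h1 := hpow k v
    rw [hk, map_zero] at h1
    refine (mul_eq_zero.1 h1.symm).resolve_left (pow_ne_zero _ fun h0 => hμ ?_)
    rw [← sub_eq_zero.1 h0]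
    exact hneg

/-- The limit of the left eigenvectors selects the outgoing mode. -/
theorem left_eigenvector_limit {x : ℝ → Fin 3 → ℂ} {x₀ : Fin 3 → ℂ} {ρ : ℝ → ℂ}
    {om : Fin 3 → ℝ} {a : Fin 3 → Fin 3 → ℝ} (hx₀ : x₀ ≠ 0)
    (hx : ∀ j, Tendsto (fun γ => x γ j) (𝓝[>] 0) (𝓝 (x₀ j))) (hom : Function.Injective om)
    (ha0 : 0 < a 0 0) (ha2 : 0 < a 2 2)
    (hρ : ∀ᶠ γ in 𝓝[>] 0, 0 ≤ (ρ γ).im)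
    (heq : ∀ᶠ γ : ℝ in 𝓝[>] 0, ∀ j, (ρ γ + om j) * x γ j = -Complex.I * γ * ∑ k, a k j * x γ k) :
    x₀ 1 ≠ 0 ∧ ∀ j, j ≠ 1 → x₀ j = 0 ∧
      Tendsto (fun γ : ℝ => x γ j / γ) (𝓝[>] 0)
        (𝓝 (-Complex.I * (a 1 j * x₀ 1) / (om j - om 1))) := by
  obtain ⟨j₀, hj₀⟩ : ∃ j, x₀ j ≠ 0 := Function.ne_iff.1 hx₀
  have hγ : Tendsto (fun γ : ℝ => (γ : ℂ)) (𝓝[>] 0) (𝓝 0) := by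
    have := (Complex.continuous_ofReal.tendsto 0).mono_left (nhdsWithin_le_nhds (s := Set.Ioi 0))
    simpa using this
  have hpos : ∀ᶠ γ : ℝ in 𝓝[>] 0, 0 < γ := self_mem_nhdsWithin
  have hsum : ∀ j, Tendsto (fun γ : ℝ => ∑ k, (a k j : ℂ) * x γ k) (𝓝[>] 0)
      (𝓝 (∑ k, a k j * x₀ k)) := fun j =>
    tendsto_finsetSum _ fun k _ => (hx k).const_mul _
  have hxne : ∀ᶠ γ in 𝓝[>] 0, x γ j₀ ≠ 0 := (hx j₀).eventually_ne hj₀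
  -- The component j₀ that survives in the limit determines the eigenvalue to first order in γ; the
  -- other components are then forced to zero, since the roots ω_j are distinct.
  have hρlim : Tendsto (fun γ : ℝ => (ρ γ + om j₀) / γ) (𝓝[>] 0)
      (𝓝 (-Complex.I * (∑ k, a k j₀ * x₀ k) / x₀ j₀)) := by
    refine (((hsum j₀).const_mul (-Complex.I)).div (hx j₀) hj₀).congr' ?_
    filter_upwards [heq, hxne, hpos] with γ h1 h2 h3
    have h4 : (γ : ℂ) ≠ 0 := Complex.ofReal_ne_zero.2 h3.ne'
    simp only [Pi.div_apply]
    rw [div_eq_div_iff h2 h4, h1 j₀]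
    ring
  have hρ0 : Tendsto ρ (𝓝[>] 0) (𝓝 (-om j₀)) := by
    have h1 := (hρlim.mul hγ).sub_const (om j₀ : ℂ)
    rw [mul_zero, zero_sub] at h1
    refine h1.congr' ?_
    filter_upwards [hpos] with γ h3
    have h4 : (γ : ℂ) ≠ 0 := Complex.ofReal_ne_zero.2 h3.ne'
    rw [div_mul_cancel₀ _ h4]
    ring
  have hne : ∀ j, j ≠ j₀ → (om j : ℂ) - om j₀ ≠ 0 := fun j hj h0 => by
    rw [sub_eq_zero, Complex.ofReal_inj] at h0
    exact hj (hom h0)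
  have hρj : ∀ j, Tendsto (fun γ => ρ γ + om j) (𝓝[>] 0) (𝓝 (om j - om j₀)) := fun j => by
    have := hρ0.add_const (om j : ℂ)
    rwa [neg_add_eq_sub] at this
  have hzero : ∀ j, j ≠ j₀ → x₀ j = 0 := by
    intro j hj
    have h1 := (hρj j).mul (hx j)
    have h2 : Tendsto (fun γ : ℝ => -Complex.I * γ * ∑ k, a k j * x γ k) (𝓝[>] 0) (𝓝 0) := by
      have := (hγ.const_mul (-Complex.I)).mul (hsum j)
      simpa using this
    have h3 := tendsto_nhds_unique (h1.congr' (heq.mono fun γ h => h j)) h2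
    exact (mul_eq_zero.1 h3).resolve_left (hne j hj)
  have hs : ∀ j, ∑ k, (a k j : ℂ) * x₀ k = a j₀ j * x₀ j₀ := fun j =>
    Finset.sum_eq_single j₀ (fun k _ hk => by rw [hzero k hk, mul_zero]) (by simp)
  -- The limit of (ρ + ω_{j₀})/γ is -i a_{j₀j₀}; its imaginary part is nonnegative because ρ comes
  -- from an eigenvalue that is not stable. Only the outgoing index is compatible with this sign.
  have hsign : a j₀ j₀ ≤ 0 := by
    rw [hs, mul_div_assoc, mul_div_cancel_right₀ _ hj₀] at hρlim
    have h1 := (Complex.continuous_im.tendsto _).comp hρlim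
    have h2 : 0 ≤ (-Complex.I * (a j₀ j₀ : ℂ)).im := by
      refine ge_of_tendsto h1 ?_
      filter_upwards [hρ, hpos] with γ h3 h4
      simp only [Function.comp, Complex.div_ofReal_im, Complex.add_im, Complex.ofReal_im, add_zero]
      positivity
    simp at h2
    exact h2
  obtain rfl : j₀ = 1 := by
    fin_cases j₀
    · exact absurd hsign (not_le.2 ha0)
    · rfl
    · exact absurd hsign (not_le.2 ha2)
  refine ⟨hj₀, fun j hj => ⟨hzero j hj, ?_⟩⟩
  rw [← hs]
  refine (((hsum j).const_mul (-Complex.I)).div (hρj j) (hne j hj)).congr' ?_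
  filter_upwards [heq, (hρj j).eventually_ne (hne j hj), hpos] with γ h1 h2 h3
  have h4 : (γ : ℂ) ≠ 0 := Complex.ofReal_ne_zero.2 h3.ne'
  simp only [Pi.div_apply]
  rw [div_eq_div_iff h2 h4, mul_comm (x γ j), h1 j]
  ring

end StableSubspace
-- The eigenbasis at the boundary frequency and group velocities
namespace PhaseData

section Eigenbasis

variable {n : ℕ} {P : PhaseData n} {S : BoundaryProblem n}
  {lam : Fin 3 → (Fin n → ℝ) × ℝ → ℝ}

theorem Admissible.freq_sq (hP : P.Admissible S lam) :
    P.β 0 ^ 2 + ∑ j, Fin.tail P.β j ^ 2 = 1 := by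
  have := hP.mem_Upsilon.1.2
  rw [freq, Complex.normSq_ofReal] at this
  rw [sq]
  exact this

theorem Admissible.spaceFreq_ne (hP : P.Admissible S lam) (m : Fin 3) : P.spaceFreq m ≠ 0 := by
  intro h0
  have h1 := hP.r_mem m
  have h2 : S.symb (P.spaceFreq m) = 0 := by rw [h0]; simp [BoundaryProblem.symb]
  rw [h2, add_zero, Matrix.smul_mulVec, Matrix.one_mulVec] at h1
  have h3 := (smul_eq_zero.1 h1).resolve_right (hP.r_ne m)
  have h4 : Fin.tail P.β = 0 := congrArg Prod.fst h0
  have h5 := hP.freq_sq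
  simp [h3, h4] at h5

/-- The matrix `∑_{j<d} β_j B_j` at the boundary frequency. -/
def tang (P : PhaseData n) (S : BoundaryProblem n) : Matrix (Fin 3) (Fin 3) ℝ :=
  P.β 0 • 1 + ∑ j, Fin.tail P.β j • S.Bt j

/-- The matrix with columns `r₁, r₂, r₃`. -/
def rMat (P : PhaseData n) : Matrix (Fin 3) (Fin 3) ℝ := (Matrix.of P.r).transpose

/-- The matrix of `B_d⁻¹` in the basis `r₁, r₂, r₃`. -/
def timeMat (P : PhaseData n) (S : BoundaryProblem n) : Matrix (Fin 3) (Fin 3) ℝ :=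
  P.rMat⁻¹ * (S.Bd⁻¹ * P.rMat)

theorem Admissible.tang_mulVec (hP : P.Admissible S lam) (m : Fin 3) :
    (P.tang S).mulVec (P.r m) = -(P.om m) • S.Bd.mulVec (P.r m) := by
  have h1 := hP.r_mem m
  rw [BoundaryProblem.symb, ← add_assoc, Matrix.add_mulVec, Matrix.smul_mulVec] at h1
  rw [neg_smul]
  exact eq_neg_of_add_eq_zero_left h1

theorem Admissible.inv_tang_mulVec (hP : P.Admissible S lam) (hS : S.Noncharacteristic)
    (m : Fin 3) : (S.Bd⁻¹ * P.tang S).mulVec (P.r m) = -(P.om m) • P.r m := by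
  rw [← Matrix.mulVec_mulVec, hP.tang_mulVec, Matrix.mulVec_smul, Matrix.mulVec_mulVec,
    Matrix.nonsing_inv_mul _ hS.isUnit_det, Matrix.one_mulVec]

/-- The vectors r_m are eigenvectors of B_d⁻¹ times the tangential symbol, for the distinct
eigenvalues -ω_m. -/
theorem Admissible.isUnit_rMat (hP : P.Admissible S lam) (hS : S.Noncharacteristic) :
    IsUnit P.rMat.det := by
  have hli : LinearIndependent ℝ P.r := by
    refine Module.End.eigenvectors_linearIndependent' (Matrix.toLin' (S.Bd⁻¹ * P.tang S))
      (fun m => -(P.om m)) (fun i j h => hP.om_injective (neg_injective h)) P.r fun m => ?_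
    refine ⟨Module.End.mem_eigenspace_iff.2 ?_, hP.r_ne m⟩
    rw [Matrix.toLin'_apply, hP.inv_tang_mulVec hS]
  rw [rMat, Matrix.det_transpose, ← Matrix.isUnit_iff_isUnit_det]
  exact Matrix.linearIndependent_rows_iff_isUnit.1 hli

theorem Admissible.expand (hP : P.Admissible S lam) (hS : S.Noncharacteristic)
    (v : Fin 3 → ℝ) : v = ∑ m, (P.l m ⬝ᵥ v) • P.r m := by
  have h1 : P.rMat.mulVec (P.rMat⁻¹.mulVec v) = v := by
    rw [Matrix.mulVec_mulVec, Matrix.mul_nonsing_inv _ (hP.isUnit_rMat hS), Matrix.one_mulVec]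
  conv_lhs => rw [← h1]
  ext i
  simp only [Matrix.mulVec, rMat, dotProduct, Finset.sum_apply, Pi.smul_apply, smul_eq_mul, l,
    Matrix.transpose_apply, Matrix.of_apply]
  exact Finset.sum_congr rfl fun m _ => mul_comm _ _

theorem timeMat_apply (k j : Fin 3) : P.timeMat S k j = P.l k ⬝ᵥ S.Bd⁻¹.mulVec (P.r j) := rfl

/-- In the basis r_m, after factoring out B_d, the symbol becomes diagonal in ω and the shift of τ
enters through the matrix of B_d⁻¹. The dispersion relation can thus be differentiated in τ and in ω
separately. -/
theorem Admissible.det_eq (hP : P.Admissible S lam) (hS : S.Noncharacteristic) (u w : ℝ) :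
    ((P.β 0 + u) • (1 : Matrix (Fin 3) (Fin 3) ℝ) + S.symb (Fin.tail P.β, w)).det =
      S.Bd.det * (Matrix.diagonal (fun j => w - P.om j) + u • P.timeMat S).det := by
  have hR := hP.isUnit_rMat hS
  have h0 : P.tang S * P.rMat = -(S.Bd * (P.rMat * Matrix.diagonal P.om)) := by
    ext i j
    have h1 := congrFun (hP.tang_mulVec j) i
    rw [Matrix.neg_apply, ← Matrix.mul_assoc, Matrix.mul_diagonal]
    rw [Pi.smul_apply, smul_eq_mul, neg_mul, mul_comm] at h1
    exact h1
  have h1 : ((P.β 0 + u) • (1 : Matrix (Fin 3) (Fin 3) ℝ) + S.symb (Fin.tail P.β, w)) * P.rMat =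
      S.Bd * (P.rMat * (Matrix.diagonal (fun j => w - P.om j) + u • P.timeMat S)) := by
    have e1 : (P.β 0 + u) • (1 : Matrix (Fin 3) (Fin 3) ℝ) + S.symb (Fin.tail P.β, w) =
        P.tang S + u • 1 + w • S.Bd := by
      rw [tang, BoundaryProblem.symb, add_smul]; abel
    have e2 : S.Bd * (P.rMat * P.timeMat S) = P.rMat := by
      rw [timeMat, ← Matrix.mul_assoc P.rMat, Matrix.mul_nonsing_inv _ hR, Matrix.one_mul,
        ← Matrix.mul_assoc, Matrix.mul_nonsing_inv _ hS.isUnit_det, Matrix.one_mul]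
    have e3 : Matrix.diagonal (fun j => w - P.om j) =
        w • (1 : Matrix (Fin 3) (Fin 3) ℝ) - Matrix.diagonal P.om := by
      rw [← Matrix.diagonal_one, ← Matrix.diagonal_smul, Matrix.diagonal_sub]
      congr 1; funext j; simp
    rw [e1, e3, Matrix.add_mul, Matrix.add_mul, h0, Matrix.mul_add, Matrix.mul_add, Matrix.mul_sub,
      Matrix.mul_sub, Matrix.mul_smul P.rMat u, Matrix.mul_smul S.Bd u, e2]
    simp only [Matrix.smul_mul, Matrix.mul_smul, Matrix.one_mul, Matrix.mul_one]
    abel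
  have h2 := congrArg Matrix.det h1
  rw [Matrix.det_mul, Matrix.det_mul, Matrix.det_mul] at h2
  have h3 : P.rMat.det ≠ 0 := hR.ne_zero
  refine mul_right_cancel₀ h3 ?_
  rw [h2]; ring

/-- Only the summand avoiding the vanishing factor c m survives. -/
theorem erase_prod (m : Fin 3) {c A : Fin 3 → ℝ} (hc : c m = 0) :
    A 0 * (c 1 * c 2) + A 1 * (c 0 * c 2) + A 2 * (c 0 * c 1) =
      A m * ∏ k ∈ Finset.univ.erase m, c k := by
  have h : ∀ m : Fin 3, (Finset.univ.erase m : Finset (Fin 3)) = {m + 1, m + 2} := by decide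
  have h2 : ∀ m : Fin 3, m + 1 ≠ m + 2 := by decide
  rw [h, Finset.prod_pair (h2 m)]
  fin_cases m
  · change c 0 = 0 at hc
    change _ = A 0 * (c 1 * c 2)
    rw [hc]; ring
  · change c 1 = 0 at hc
    change _ = A 1 * (c 2 * c 0)
    rw [hc]; ring
  · change c 2 = 0 at hc
    change _ = A 2 * (c 0 * c 1)
    rw [hc]; ring

/-- Comparison of the linear coefficients of two cubics in u. For a cubic p the combination (8 (p(1)
- p(-1)) - (p(2) - p(-2))) / 12 is exactly the linear coefficient. -/
theorem linear_coeff_eq {c d : Fin 3 → ℝ} {δ : ℝ} {A : Matrix (Fin 3) (Fin 3) ℝ}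
    (hu : ∀ u : ℝ, (u + c 0) * (u + c 1) * (u + c 2) = δ * (Matrix.diagonal d + u • A).det) :
    c 1 * c 2 + c 0 * c 2 + c 0 * c 1 =
      δ * (A 0 0 * (d 1 * d 2) + A 1 1 * (d 0 * d 2) + A 2 2 * (d 0 * d 1)) := by
  have h1 := hu 1
  have h2 := hu (-1)
  have h3 := hu 2
  have h4 := hu (-2)
  simp only [Matrix.det_fin_three, Matrix.add_apply, Matrix.smul_apply, smul_eq_mul,
    Matrix.diagonal_apply_eq, ne_eq, Fin.reduceEq, not_false_eq_true, Matrix.diagonal_apply_ne,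
    zero_add] at h1 h2 h3 h4
  linear_combination (8 * (h1 - h2) - (h3 - h4)) / 12

/-- The group velocity in the normal direction is the inverse of a diagonal entry. -/
theorem Admissible.timeMat_mul_velNor (hP : P.Admissible S lam) (hS : S.Noncharacteristic)
    (hyp : S.StrictlyHyperbolic lam) (m : Fin 3) : P.timeMat S m m * P.velNor lam m = 1 := by
  have hne := hP.spaceFreq_ne m
  set c : Fin 3 → ℝ := fun k => P.β 0 + lam k (P.spaceFreq m) with hc
  set d : Fin 3 → ℝ := fun j => P.om m - P.om j with hd
  set Q := ∏ k ∈ Finset.univ.erase (P.k m), c k with hQ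
  set D := ∏ k ∈ Finset.univ.erase m, d k with hD
  have hc0 : c (P.k m) = 0 := hP.k_spec m
  have hQne : Q ≠ 0 := by
    refine Finset.prod_ne_zero_iff.2 fun k hk h0 => Finset.ne_of_mem_erase hk ?_
    refine (hyp.strictMono _ hne).injective ?_
    simp only [hc] at h0 hc0
    linarith
  have hu : ∀ u : ℝ, (u + c 0) * (u + c 1) * (u + c 2) =
      S.Bd.det * (Matrix.diagonal d + u • P.timeMat S).det := by
    intro u
    have h1 := hyp.det_eq (P.β 0 + u) (P.spaceFreq m) hne
    have h2 := hP.det_eq hS u (P.om m)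
    rw [show (Fin.tail P.β, P.om m) = P.spaceFreq m from rfl, h1, Fin.prod_univ_three] at h2
    rw [← h2]
    simp only [hc]
    ring
  have hlin := linear_coeff_eq hu
  -- The derivative of the dispersion relation in τ at the root, computed from the factorization and
  -- from the eigenbasis.
  have hτ : Q = S.Bd.det * (P.timeMat S m m * D) := by
    have e1 := erase_prod (P.k m) (A := fun _ => 1) hc0
    have e2 := erase_prod m (c := d) (A := fun j => P.timeMat S j j) (sub_self _)
    simp only [one_mul] at e1
    rw [hQ, ← e1, hD, ← e2, ← hlin]
  -- The derivative in ω at the same point. The quotient of the two identities is the implicit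
  -- differentiation that yields the group velocity.
  have hw : Q * P.velNor lam m = S.Bd.det * D := by
    have hnear : ∀ᶠ w in 𝓝 (P.om m), ((Fin.tail P.β, w) : (Fin n → ℝ) × ℝ) ≠ 0 :=
      (Continuous.prodMk continuous_const continuous_id).continuousAt.eventually_ne hne
    have heq : (fun w => ∏ k, (P.β 0 + lam k (Fin.tail P.β, w))) =ᶠ[𝓝 (P.om m)]
        fun w => S.Bd.det * ∏ j, (w - P.om j) := by
      filter_upwards [hnear] with w hw
      have h1 := hyp.det_eq (P.β 0) (Fin.tail P.β, w) hw
      have h2 := hP.det_eq hS 0 w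
      rw [add_zero, zero_smul, add_zero, Matrix.det_diagonal] at h2
      rw [← h1, h2]
    have hder : ∀ k, HasDerivAt (fun w => P.β 0 + lam k (Fin.tail P.β, w))
        (fderiv ℝ (lam k) (P.spaceFreq m) (0, 1)) (P.om m) := by
      intro k
      have h1 := ((hyp.analytic k _ hne).differentiableAt).hasFDerivAt
      have h2 : HasDerivAt (fun w : ℝ => ((Fin.tail P.β, w) : (Fin n → ℝ) × ℝ)) (0, 1) (P.om m) :=
        (hasDerivAt_const _ _).prodMk (hasDerivAt_id _)
      exact (h1.comp_hasDerivAt (P.om m) h2).const_add _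
    have hL := HasDerivAt.fun_finsetProd (u := Finset.univ) fun k _ => hder k
    have hR := (HasDerivAt.fun_finsetProd (u := Finset.univ) (f := fun j w => w - P.om j)
      fun j _ => (hasDerivAt_id (P.om m)).sub_const (P.om j)).const_mul S.Bd.det
    have h3 := (hL.congr_of_eventuallyEq heq.symm).unique hR
    rw [Finset.sum_eq_single (P.k m), Finset.sum_eq_single m] at h3
    · simp only [smul_eq_mul, mul_one] at h3
      exact h3
    · intro j _ hj
      rw [Finset.prod_eq_zero (Finset.mem_erase.2 ⟨hj.symm, Finset.mem_univ m⟩) (sub_self _),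
        zero_smul]
    · simp
    · intro j _ hj
      refine smul_eq_zero_of_left ?_ _
      exact Finset.prod_eq_zero (Finset.mem_erase.2 ⟨hj.symm, Finset.mem_univ (P.k m)⟩) hc0
    · simp
  refine mul_left_cancel₀ hQne ?_
  rw [mul_one]
  linear_combination P.timeMat S m m * hw - hτ

theorem XLop_zero : P.XLop S 0 = P.bBR S S.Bd⁻¹ := by
  rw [XLop, show (0 : Fin (n + 2)) = Fin.castSucc 0 from rfl, Fin.snoc_castSucc]
  rfl

theorem XLop_last : P.XLop S (Fin.last (n + 1)) = 0 := by
  rw [XLop, Fin.snoc_last]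

/-- Since b · B annihilates the incoming vectors r_0 and r_2, only the r_1 component of each partial
inverse contributes. -/
theorem bBR_eq (h0 : P.b ⬝ᵥ S.B.mulVec (P.r 0) = 0) (h2 : P.b ⬝ᵥ S.B.mulVec (P.r 2) = 0) :
    P.bBR S S.Bd⁻¹ = (P.b ⬝ᵥ S.B.mulVec (P.r 1)) *
      ((P.om 0 - P.om 1)⁻¹ * (P.timeMat S 1 0 * (P.l 0 ⬝ᵥ P.e)) +
        (P.om 2 - P.om 1)⁻¹ * (P.timeMat S 1 2 * (P.l 2 ⬝ᵥ P.e))) := by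
  have e0 : (Finset.univ.erase (0 : Fin 3)) = {1, 2} := by decide
  have e2 : (Finset.univ.erase (2 : Fin 3)) = {0, 1} := by decide
  rw [bBR, Finset.sum_pair (by decide)]
  simp only [R, e0, e2, Finset.sum_pair (show (1 : Fin 3) ≠ 2 by decide),
    Finset.sum_pair (show (0 : Fin 3) ≠ 1 by decide), proj, eComp, Matrix.mulVec_smul,
    Matrix.mulVec_add, dotProduct_add, dotProduct_smul, h0, h2, smul_eq_mul, timeMat_apply]
  ring

end Eigenbasis

end PhaseData
-- The time coefficient of the Lopatinskii field
namespace PhaseData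

section Path

variable {n : ℕ} {P : PhaseData n} {S : BoundaryProblem n}
  {lam : Fin 3 → (Fin n → ℝ) × ℝ → ℝ}

/-- A real vector as a complex vector. -/
def toC {m : ℕ} (v : Fin m → ℝ) : Fin m → ℂ := fun i => (v i : ℂ)

theorem map_mulVec_toC {m : ℕ} (M : Matrix (Fin m) (Fin 3) ℝ) (v : Fin 3 → ℝ) :
    (M.map Complex.ofReal).mulVec (toC v) = toC (M.mulVec v) := by
  ext i; simp [Matrix.mulVec, dotProduct, toC]

theorem toC_smul {m : ℕ} (c : ℝ) (v : Fin m → ℝ) : toC (c • v) = (c : ℂ) • toC v := by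
  ext i; simp [toC]

theorem toC_sum {m : ℕ} (c : Fin 3 → ℝ) (v : Fin 3 → Fin m → ℝ) :
    toC (∑ k, c k • v k) = ∑ k, (c k : ℂ) • toC (v k) := by
  ext i; simp [toC, Finset.sum_apply]

theorem toC_dot {m : ℕ} (v w : Fin m → ℝ) : toC v ⬝ᵥ toC w = ((v ⬝ᵥ w : ℝ) : ℂ) := by
  simp [toC, dotProduct]

/-- The reciprocal of `√(1 + γ²)`. -/
def pathScale (γ : ℝ) : ℝ := (√(1 + γ ^ 2))⁻¹

theorem pathScale_pos (γ : ℝ) : 0 < pathScale γ := by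
  unfold pathScale; positivity

theorem pathScale_sq (γ : ℝ) : pathScale γ ^ 2 * (1 + γ ^ 2) = 1 := by
  have h : (0 : ℝ) < 1 + γ ^ 2 := by positivity
  rw [pathScale, inv_pow, Real.sq_sqrt h.le, inv_mul_cancel₀ h.ne']

theorem pathScale_zero : pathScale 0 = 1 := by simp [pathScale]

theorem continuous_pathScale : Continuous pathScale := by
  unfold pathScale
  refine Continuous.inv₀ (by fun_prop) fun γ => ?_
  positivity

/-- A path on the sphere that enters `γ > 0` from `β`. -/
def path (P : PhaseData n) (γ : ℝ) : ℂ × (Fin n → ℝ) :=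
  (pathScale γ * (P.β 0 - Complex.I * γ), pathScale γ • Fin.tail P.β)

theorem path_zero : P.path 0 = P.freq := by simp [path, freq, pathScale_zero]

theorem continuous_path : Continuous P.path := by
  unfold path
  have := continuous_pathScale
  fun_prop

theorem path_im (γ : ℝ) : -(P.path γ).1.im = pathScale γ * γ := by simp [path]

theorem Admissible.path_mem_sphere (hP : P.Admissible S lam) {γ : ℝ} (hγ : 0 ≤ γ) :
    P.path γ ∈ BoundaryProblem.sphere n := by
  refine ⟨by rw [path_im]; exact mul_nonneg (pathScale_pos γ).le hγ, ?_⟩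
  have h1 := hP.freq_sq
  have h2 := pathScale_sq γ
  simp only [path, Complex.normSq_mul, Complex.normSq_ofReal, Pi.smul_apply, smul_eq_mul, mul_pow,
    ← Finset.mul_sum]
  have h3 : Complex.normSq ((P.β 0 : ℂ) - Complex.I * γ) = P.β 0 ^ 2 + γ ^ 2 := by
    simp [Complex.normSq_apply]; ring
  rw [h3]
  linear_combination h2 + pathScale γ ^ 2 * h1

theorem Admissible.calA_path (hP : P.Admissible S lam) (hS : S.Noncharacteristic) (γ : ℝ)
    (j : Fin 3) : (S.calA (P.path γ)).mulVec (toC (P.r j)) =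
      (-Complex.I * pathScale γ) • (-(P.om j : ℂ) • toC (P.r j) -
        (Complex.I * γ) • ∑ k, (P.timeMat S k j : ℂ) • toC (P.r k)) := by
  have e1 : (P.path γ).1 • (1 : Matrix (Fin 3) (Fin 3) ℂ) +
      ∑ j, ((P.path γ).2 j : ℂ) • (S.Bt j).map Complex.ofReal =
      (pathScale γ : ℂ) • ((P.tang S).map Complex.ofReal - (Complex.I * γ) • 1) := by
    ext a b
    simp only [path, tang, Matrix.add_apply, Matrix.smul_apply, Matrix.sum_apply, Matrix.map_apply,
      Matrix.sub_apply, smul_eq_mul, Pi.smul_apply, Complex.ofReal_add, Complex.ofReal_mul,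
      Complex.ofReal_sum, mul_sub, mul_add, Finset.mul_sum, Matrix.one_apply]
    split_ifs
    · simp only [Complex.ofReal_one, mul_assoc]; ring
    · simp only [Complex.ofReal_zero, mul_assoc]; ring
  have e2 : S.Bd⁻¹.mulVec (P.r j) = ∑ k, P.timeMat S k j • P.r k := by
    simp only [timeMat_apply]
    exact hP.expand hS _
  have e3 : S.Bd⁻¹.mulVec ((P.tang S).mulVec (P.r j)) = -(P.om j) • P.r j := by
    rw [Matrix.mulVec_mulVec, hP.inv_tang_mulVec hS]
  rw [BoundaryProblem.calA, e1, Matrix.smul_mulVec, ← Matrix.mulVec_mulVec, Matrix.smul_mulVec,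
    Matrix.sub_mulVec, Matrix.smul_mulVec, Matrix.one_mulVec, map_mulVec_toC, Matrix.mulVec_smul,
    Matrix.mulVec_sub, Matrix.mulVec_smul, map_mulVec_toC, map_mulVec_toC, e3, e2, toC_smul,
    toC_sum, smul_smul, Complex.ofReal_neg]

theorem Admissible.isUnit_rMat_toC (hP : P.Admissible S lam) (hS : S.Noncharacteristic)
    {x : Fin 3 → ℂ} (hx : ∀ j, x ⬝ᵥ toC (P.r j) = 0) : x = 0 := by
  have hdet : (P.rMat.map Complex.ofReal).det ≠ 0 := by
    have h1 := RingHom.map_det Complex.ofRealHom P.rMat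
    have h2 : (P.rMat.map Complex.ofReal) = Complex.ofRealHom.mapMatrix P.rMat := rfl
    rw [h2, ← h1]
    exact Complex.ofReal_ne_zero.2 (hP.isUnit_rMat hS).ne_zero
  refine Matrix.eq_zero_of_vecMul_eq_zero hdet ?_
  ext j
  exact hx j

/-- The coefficient of `∂_t` in the Lopatinskii vector field does not vanish. -/
theorem Admissible.XLop_zero_ne (hP : P.Admissible S lam) (hS : S.Noncharacteristic)
    (hyp : S.StrictlyHyperbolic lam) (hws : S.WeaklyStable) : P.XLop S 0 ≠ 0 := by
  obtain ⟨W, hWo, hβW, σ, E, Pm, -, hE, hPm, hfac⟩ := hws.factor _ hP.mem_Upsilon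
  have h0mem : P.freq ∈ W ∩ BoundaryProblem.sphere n := ⟨hβW, hP.mem_Upsilon.1⟩
  have hpos : ∀ᶠ γ : ℝ in 𝓝[>] 0, 0 < γ := self_mem_nhdsWithin
  have hmem : ∀ᶠ γ : ℝ in 𝓝[>] 0, P.path γ ∈ W ∩ BoundaryProblem.sphere n := by
    have h1 : ∀ᶠ γ in 𝓝 (0 : ℝ), P.path γ ∈ W :=
      continuous_path.continuousAt.eventually (by rw [path_zero]; exact hWo.mem_nhds hβW)
    filter_upwards [nhdsWithin_le_nhds h1, hpos] with γ h2 h3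
    exact ⟨h2, hP.path_mem_sphere h3.le⟩
  have hpath : Tendsto P.path (𝓝[>] 0) (𝓝[W ∩ BoundaryProblem.sphere n] P.freq) := by
    refine tendsto_nhdsWithin_iff.2 ⟨?_, hmem⟩
    rw [← path_zero]
    exact continuous_path.continuousAt.tendsto.mono_left nhdsWithin_le_nhds
  have hElim : ∀ i j, Tendsto (fun γ => E (P.path γ) i j) (𝓝[>] 0) (𝓝 (E P.freq i j)) := fun i j =>
    tendsto_pi_nhds.1 (tendsto_pi_nhds.1 ((hE.continuousOn _ h0mem).tendsto.comp hpath) i) j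
  have hPlim : ∀ i j, Tendsto (fun γ => Pm (P.path γ) i j) (𝓝[>] 0) (𝓝 (Pm P.freq i j)) :=
    fun i j => ((hPm i j).continuousOn _ h0mem).tendsto.comp hpath
  -- the left eigenvector
  set L : ℂ × (Fin n → ℝ) → Fin 3 → ℂ := fun ζ => crossProduct (E ζ 0) (E ζ 1) with hL
  have hLlim : ∀ i, Tendsto (fun γ => L (P.path γ) i) (𝓝[>] 0) (𝓝 (L P.freq i)) := by
    intro i
    have h := fun a b c d => ((hElim 0 a).mul (hElim 1 b)).sub ((hElim 0 c).mul (hElim 1 d))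
    fin_cases i
    · exact h 1 2 2 1
    · exact h 2 0 0 2
    · exact h 0 1 1 0
  have hspan : ∀ ζ ∈ W ∩ BoundaryProblem.sphere n, ∀ v, v ∈ S.Es ζ ↔ L ζ ⬝ᵥ v = 0 := by
    intro ζ hζ v
    rw [← (hfac ζ hζ).2.1]
    exact mem_span_iff_cross (hfac ζ hζ).1 v
  have hLne : ∀ ζ ∈ W ∩ BoundaryProblem.sphere n, L ζ ≠ 0 := by
    intro ζ hζ
    have e : ![E ζ 0, E ζ 1] = E ζ := by ext i; fin_cases i <;> rfl
    simp only [hL]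
    rw [crossProduct_ne_zero_iff_linearIndependent, e]
    exact (hfac ζ hζ).1
  set x : ℝ → Fin 3 → ℂ := fun γ j => L (P.path γ) ⬝ᵥ toC (P.r j) with hx
  set x₀ : Fin 3 → ℂ := fun j => L P.freq ⬝ᵥ toC (P.r j) with hx₀
  have hx₀ne : x₀ ≠ 0 := fun h => hLne _ h0mem (hP.isUnit_rMat_toC hS fun j => congrFun h j)
  have hxlim : ∀ j, Tendsto (fun γ => x γ j) (𝓝[>] 0) (𝓝 (x₀ j)) := fun j =>
    tendsto_finsetSum _ fun i _ => (hLlim i).mul_const _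
  -- For γ > 0 the space E^s is the genuine stable subspace, so the cross product of the basis
  -- vectors is a left eigenvector whose eigenvalue has nonnegative real part.
  have hν : ∀ᶠ γ : ℝ in 𝓝[>] 0, ∃ ν : ℂ, 0 ≤ ν.re ∧
      ∀ v, L (P.path γ) ⬝ᵥ (S.calA (P.path γ)).mulVec v = ν * (L (P.path γ) ⬝ᵥ v) := by
    filter_upwards [hmem, hpos] with γ h1 h2
    set φ : (Fin 3 → ℂ) →ₗ[ℂ] ℂ := dotProductBilin ℂ ℂ (L (P.path γ)) with hφ
    have hφv : ∀ v, φ v = L (P.path γ) ⬝ᵥ v := fun v => rfl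
    have hφne : φ ≠ 0 := by
      intro h0
      refine hLne _ h1 ?_
      ext i
      have := LinearMap.congr_fun h0 (Pi.single i 1)
      rw [hφv] at this
      simpa using this
    have hposf : P.path γ ∈ BoundaryProblem.posFreq n := by
      show 0 < -(P.path γ).1.im
      rw [path_im]
      exact mul_pos (pathScale_pos γ) h2
    have hker : LinearMap.ker φ = S.stableAux (P.path γ) := by
      ext v
      have h3 := hspan _ h1 v
      rw [BoundaryProblem.Es, if_pos hposf] at h3
      rw [h3, LinearMap.mem_ker, hφv]
    obtain ⟨ν, h3, h4⟩ := exists_left_eigenvalue hφne hker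
    exact ⟨ν, h3, fun v => by simpa [hφv] using h4 v⟩
  obtain ⟨ν, hν⟩ := hν.choice
  -- Rescaling the eigenvalue by i / `pathScale γ` brings the left eigenvector equation to the form
  -- treated in the limit lemma. The diagonal entries 0 and 2 are positive as inverses of the
  -- incoming normal velocities.
  obtain ⟨hx1, hxj⟩ := left_eigenvector_limit (ρ := fun γ => Complex.I * ((pathScale γ)⁻¹ : ℝ) * ν γ)
    (om := P.om) (a := fun k j => P.timeMat S k j) hx₀ne hxlim hP.om_injective
    (pos_of_mul_pos_left (by rw [hP.timeMat_mul_velNor hS hyp]; exact one_pos)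
      hP.incoming_first.le)
    (pos_of_mul_pos_left (by rw [hP.timeMat_mul_velNor hS hyp]; exact one_pos)
      hP.incoming_third.le) (by
    filter_upwards [hν] with γ h1
    rw [mul_assoc, Complex.I_mul_im, Complex.re_ofReal_mul]
    exact mul_nonneg (inv_pos.2 (pathScale_pos γ)).le h1.1) (by
    filter_upwards [hν] with γ h1 j
    have h2 := h1.2 (toC (P.r j))
    rw [hP.calA_path hS, dotProduct_smul, dotProduct_sub, dotProduct_smul, dotProduct_smul,
      dotProduct_sum] at h2
    simp only [dotProduct_smul, smul_eq_mul] at h2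
    have h3 : (pathScale γ : ℂ) * (pathScale γ : ℂ)⁻¹ = 1 :=
      mul_inv_cancel₀ (Complex.ofReal_ne_zero.2 (pathScale_pos γ).ne')
    simp only [hx, Complex.ofReal_inv]
    linear_combination (-Complex.I * (pathScale γ : ℂ)⁻¹) * h2 -
      (Complex.I ^ 2 * (-(P.om j : ℂ) * (L (P.path γ) ⬝ᵥ toC (P.r j)) -
        Complex.I * γ * ∑ k, (P.timeMat S k j : ℂ) * (L (P.path γ) ⬝ᵥ toC (P.r k)))) * h3 -
      (-(P.om j : ℂ) * (L (P.path γ) ⬝ᵥ toC (P.r j)) -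
        Complex.I * γ * ∑ k, (P.timeMat S k j : ℂ) * (L (P.path γ) ⬝ᵥ toC (P.r k))) *
          Complex.I_sq)
  -- the kernel at the boundary frequency
  have hr : ∀ j, j ≠ 1 → P.b ⬝ᵥ S.B.mulVec (P.r j) = 0 := by
    intro j hj
    have h1 : toC (P.r j) ∈ S.Es P.freq := (hspan _ h0mem _).2 (hxj j hj).1
    have h2 := (hP.b_spec _).1 ⟨_, h1, rfl⟩
    rw [map_mulVec_toC] at h2
    have h3 := toC_dot P.b (S.B.mulVec (P.r j))
    rw [show toC P.b ⬝ᵥ toC (S.B.mulVec (P.r j)) =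
      ∑ i, (P.b i : ℂ) * toC (S.B.mulVec (P.r j)) i from rfl, h2] at h3
    exact_mod_cast h3.symm
  have heE : toC P.e ∈ S.kerB ⊓ S.Es P.freq := by
    rw [hP.e_span]
    exact Submodule.mem_span_singleton_self _
  have hBe : (S.B.map Complex.ofReal).mulVec (toC P.e) = 0 := by
    have := LinearMap.mem_ker.1 heE.1
    rwa [Matrix.toLin'_apply] at this
  have hexp : toC P.e = ∑ k, ((P.l k ⬝ᵥ P.e : ℝ) : ℂ) • toC (P.r k) := by
    conv_lhs => rw [hP.expand hS P.e]
    exact toC_sum _ _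
  have hLe : ∀ ζ, L ζ ⬝ᵥ toC P.e = ∑ k, ((P.l k ⬝ᵥ P.e : ℝ) : ℂ) * (L ζ ⬝ᵥ toC (P.r k)) := by
    intro ζ
    rw [hexp, dotProduct_sum]
    simp only [dotProduct_smul, smul_eq_mul]
  -- At β the functional sees only the r_1 component, so e ∈ E^s(β) has none.
  have hl1 : ((P.l 1 ⬝ᵥ P.e : ℝ) : ℂ) = 0 := by
    have h1 := (hspan _ h0mem _).1 heE.2
    rw [hLe, Fin.sum_univ_three] at h1
    have e0 : L P.freq ⬝ᵥ toC (P.r 0) = 0 := (hxj 0 (by decide)).1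
    have e2 : L P.freq ⬝ᵥ toC (P.r 2) = 0 := (hxj 2 (by decide)).1
    rw [e0, e2, mul_zero, mul_zero, zero_add, add_zero] at h1
    exact (mul_eq_zero.1 h1).resolve_right hx1
  -- Otherwise b · B would annihilate the whole basis, contradicting that B is onto and b ≠ 0.
  have hb1 : P.b ⬝ᵥ S.B.mulVec (P.r 1) ≠ 0 := by
    intro h1
    have hall : ∀ v, P.b ⬝ᵥ S.B.mulVec v = 0 := by
      intro v
      rw [hP.expand hS v, Fin.sum_univ_three, Matrix.mulVec_add, Matrix.mulVec_add,
        Matrix.mulVec_smul, Matrix.mulVec_smul, Matrix.mulVec_smul, dotProduct_add, dotProduct_add,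
        dotProduct_smul, dotProduct_smul, dotProduct_smul, hr 0 (by decide), h1, hr 2 (by decide)]
      simp
    have hsurj : Function.Surjective S.B.mulVecLin := by
      rw [← LinearMap.range_eq_top]
      refine Submodule.eq_top_of_finrank_eq ?_
      rw [Module.finrank_fin_fun]
      exact hS.rank_eq
    obtain ⟨v, hv⟩ := hsurj P.b
    have h2 := hall v
    rw [← Matrix.mulVecLin_apply, hv] at h2
    exact hP.b_ne (dotProduct_self_eq_zero.1 h2)
  intro hX0
  rw [XLop_zero, bBR_eq (hr 0 (by decide)) (hr 2 (by decide))] at hX0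
  have hsum := (mul_eq_zero.1 hX0).resolve_left hb1
  -- the vector of the stable space close to `e`
  have hpos' : ∀ᶠ γ : ℝ in 𝓝[>] 0, x γ 1 ≠ 0 := (hxlim 1).eventually_ne hx1
  -- Chosen so that e + y(γ) r_1 is annihilated by the functional, that is, lies in E^s along the
  -- path.
  set y : ℝ → ℂ := fun γ => -(L (P.path γ) ⬝ᵥ toC P.e) / x γ 1 with hy
  -- The limit of y/γ is a multiple of the sum assumed to vanish; hence y = o(γ).
  have hylim : Tendsto (fun γ : ℝ => y γ / γ) (𝓝[>] 0) (𝓝 0) := by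
    have h0 := (hxj 0 (by decide)).2
    have h2 := (hxj 2 (by decide)).2
    have h := (((h0.const_mul ((P.l 0 ⬝ᵥ P.e : ℝ) : ℂ)).add
      (h2.const_mul ((P.l 2 ⬝ᵥ P.e : ℝ) : ℂ))).neg).div (hxlim 1) hx1
    have hsumC : ((P.om 0 : ℂ) - P.om 1)⁻¹ * (P.timeMat S 1 0 * ((P.l 0 ⬝ᵥ P.e : ℝ) : ℂ)) +
        ((P.om 2 : ℂ) - P.om 1)⁻¹ * (P.timeMat S 1 2 * ((P.l 2 ⬝ᵥ P.e : ℝ) : ℂ)) = 0 := by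
      exact_mod_cast congrArg Complex.ofReal hsum
    convert h using 2 with γ
    · simp only [hy, hLe, Fin.sum_univ_three, hl1, hx, Pi.div_apply]
      ring
    · symm
      rw [div_eq_zero_iff]
      left
      linear_combination Complex.I * x₀ 1 * hsumC
  have hylim' : Tendsto y (𝓝[>] 0) (𝓝 0) := by
    have h1 : Tendsto (fun γ : ℝ => (γ : ℂ)) (𝓝[>] 0) (𝓝 0) := by
      have := (Complex.continuous_ofReal.tendsto 0).mono_left
        (nhdsWithin_le_nhds (s := Set.Ioi (0 : ℝ)))
      simpa using this
    have h := hylim.mul h1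
    rw [mul_zero] at h
    refine h.congr' ?_
    filter_upwards [hpos] with γ hγ
    exact div_mul_cancel₀ _ (Complex.ofReal_ne_zero.2 hγ.ne')
  set u : Fin 2 → ℂ := toC (S.B.mulVec (P.r 1)) with hu
  -- By Cramer's rule, k₀ and k₁ are the components of P⁻¹ B r_1; they stay bounded along the path.
  set k₀ : ℂ × (Fin n → ℝ) → ℂ := fun ζ =>
    (Pm ζ 1 1 * u 0 - Pm ζ 0 1 * u 1) / (Pm ζ).det with hk₀
  set k₁ : ℂ × (Fin n → ℝ) → ℂ := fun ζ =>
    (Pm ζ 0 0 * u 1 - Pm ζ 1 0 * u 0) / (Pm ζ).det with hk₁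
  have hdlim : Tendsto (fun γ => (Pm (P.path γ)).det) (𝓝[>] 0) (𝓝 (Pm P.freq).det) := by
    simp only [Matrix.det_fin_two]
    exact ((hPlim 0 0).mul (hPlim 1 1)).sub ((hPlim 0 1).mul (hPlim 1 0))
  have hd0 : (Pm P.freq).det ≠ 0 := (hfac _ h0mem).2.2.1.ne_zero
  have hk₀lim : Tendsto (fun γ => k₀ (P.path γ)) (𝓝[>] 0) (𝓝 (k₀ P.freq)) :=
    (((hPlim 1 1).mul_const _).sub ((hPlim 0 1).mul_const _)).div hdlim hd0
  have hk₁lim : Tendsto (fun γ => k₁ (P.path γ)) (𝓝[>] 0) (𝓝 (k₁ P.freq)) :=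
    (((hPlim 0 0).mul_const _).sub ((hPlim 1 0).mul_const _)).div hdlim hd0
  -- Since B e = 0, applying B to e + y r_1 = c₀ E₁ + c₁ E₂ gives (γ' + iσ) c₀ = y k₀ and c₁ = y k₁,
  -- with γ' = γ · `pathScale γ`. As |γ' + iσ| ≥ γ', c₀ is O(y/γ). Both coefficients tend to zero,
  -- which forces e = 0.
  have hbound : ∀ᶠ γ : ℝ in 𝓝[>] 0, ∀ i, ‖toC P.e i + y γ * toC (P.r 1) i‖ ≤
      ‖y γ / γ‖ * ‖k₀ (P.path γ)‖ * (pathScale γ)⁻¹ * ‖E (P.path γ) 0 i‖ +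
        ‖y γ‖ * ‖k₁ (P.path γ)‖ * ‖E (P.path γ) 1 i‖ := by
    filter_upwards [hmem, hpos, hpos'] with γ h1 h2 h3
    obtain ⟨-, hEs, hdet, hBE⟩ := hfac _ h1
    have hd := hdet.ne_zero
    have hin : toC P.e + y γ • toC (P.r 1) ∈ S.Es (P.path γ) := by
      rw [hspan _ h1, dotProduct_add, dotProduct_smul, smul_eq_mul]
      simp only [hy]
      rw [div_mul_cancel₀ _ h3, add_neg_cancel]
    rw [← hEs, Submodule.mem_span_range_iff_exists_fun] at hin
    obtain ⟨c, hc⟩ := hin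
    rw [Fin.sum_univ_two] at hc
    set δ : ℂ := ((-(P.path γ).1.im : ℝ) : ℂ) + Complex.I * (σ (P.path γ) : ℂ) with hδ
    have hδre : δ.re = pathScale γ * γ := by
      rw [← P.path_im]
      simp [hδ]
    have hs := pathScale_pos γ
    have hδn : pathScale γ * γ ≤ ‖δ‖ := by
      rw [← hδre]
      exact Complex.re_le_norm δ
    have hδ0 : 0 < ‖δ‖ := (mul_pos hs h2).trans_le hδn
    have hv : ∀ i, y γ * u i = Pm (P.path γ) i 0 * (δ * c 0) + Pm (P.path γ) i 1 * c 1 := by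
      intro i
      have e1 := congrArg (fun M => M.mulVec c i) hBE
      have e2 : (Matrix.of (E (P.path γ))).transpose.mulVec c = toC P.e + y γ • toC (P.r 1) := by
        rw [← hc]
        ext l
        simp [Matrix.mulVec, dotProduct, Fin.sum_univ_two, mul_comm]
      simp only [← Matrix.mulVec_mulVec, e2, Matrix.mulVec_add, hBe, Matrix.mulVec_smul,
        map_mulVec_toC, zero_add, Pi.smul_apply, smul_eq_mul] at e1
      rw [hu, e1]
      simp [Matrix.mulVec, dotProduct, Fin.sum_univ_two, Matrix.diagonal_apply, hδ]
    have hc0 : δ * c 0 = y γ * k₀ (P.path γ) := by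
      simp only [hk₀]
      field_simp
      rw [Matrix.det_fin_two]
      linear_combination Pm (P.path γ) 0 1 * hv 1 - Pm (P.path γ) 1 1 * hv 0
    have hc1 : c 1 = y γ * k₁ (P.path γ) := by
      simp only [hk₁]
      field_simp
      rw [Matrix.det_fin_two]
      linear_combination Pm (P.path γ) 1 0 * hv 0 - Pm (P.path γ) 0 0 * hv 1
    have hc0n : ‖c 0‖ ≤ ‖y γ / γ‖ * ‖k₀ (P.path γ)‖ * (pathScale γ)⁻¹ := by
      have e1 := congrArg norm hc0
      rw [norm_mul, norm_mul] at e1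
      rw [norm_div, Complex.norm_real, Real.norm_of_nonneg h2.le, ← div_eq_mul_inv,
        div_mul_eq_mul_div, div_div, ← e1, mul_comm γ, le_div_iff₀ (mul_pos hs h2), mul_comm]
      exact mul_le_mul_of_nonneg_right hδn (norm_nonneg _)
    intro i
    have e := congrFun hc i
    simp only [Pi.add_apply, Pi.smul_apply, smul_eq_mul] at e
    rw [← e]
    refine (norm_add_le _ _).trans (add_le_add ?_ ?_)
    · rw [norm_mul]
      exact mul_le_mul_of_nonneg_right hc0n (norm_nonneg _)
    · rw [norm_mul, hc1, norm_mul]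
  have hsc : Tendsto (fun γ => (pathScale γ)⁻¹) (𝓝[>] 0) (𝓝 1⁻¹) := by
    have h1 := (continuous_pathScale.tendsto 0).mono_left
      (nhdsWithin_le_nhds (s := Set.Ioi (0 : ℝ)))
    rw [pathScale_zero] at h1
    exact h1.inv₀ one_ne_zero
  refine hP.e_ne (funext fun i => ?_)
  have hl := ((hylim'.mul_const (toC (P.r 1) i)).const_add (toC P.e i)).norm
  have hr' := (((hylim.norm.mul hk₀lim.norm).mul hsc).mul (hElim 0 i).norm).add
    ((hylim'.norm.mul hk₁lim.norm).mul (hElim 1 i).norm)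
  have h := le_of_tendsto_of_tendsto hl hr' (hbound.mono fun γ h => h i)
  simpa [toC] using h

end Path

end PhaseData
-- Transport along characteristics from the boundary
section Transport

variable {n : ℕ} {X : Fin (n + 3) → ℝ}

/-- The point reached from the boundary point `(x', 0, θ)` after time `s` along `X`. -/
def slant (X : Fin (n + 3) → ℝ) (p : ℝ × (Fin (n + 2) → ℝ)) : Fin (n + 3) → ℝ :=
  bdryPoint p.2 + p.1 • X

/-- The boundary point on the integral curve of `X` through a given point. -/
def foot (X : Fin (n + 3) → ℝ) (x : Fin (n + 3) → ℝ) : Fin (n + 2) → ℝ :=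
  fun j => x ((normalIdx n).succAbove j) - x (normalIdx n) * X ((normalIdx n).succAbove j)

theorem succAbove_zero_normalIdx : (normalIdx n).succAbove 0 = 0 :=
  Fin.succAbove_ne_zero_zero (by simp [normalIdx, Fin.ext_iff])

theorem succAbove_last_normalIdx : (normalIdx n).succAbove (Fin.last (n + 1)) = Fin.last (n + 2) :=
  Fin.succAbove_ne_last_last (by simp [normalIdx, Fin.ext_iff])

theorem bdryPoint_normal (z : Fin (n + 2) → ℝ) : bdryPoint z (normalIdx n) = 0 :=
  Fin.insertNth_apply_same _ _ _

theorem bdryPoint_succAbove (z : Fin (n + 2) → ℝ) (j : Fin (n + 2)) :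
    bdryPoint z ((normalIdx n).succAbove j) = z j :=
  Fin.insertNth_apply_succAbove _ _ _ _

theorem bdryPoint_zero (z : Fin (n + 2) → ℝ) : bdryPoint z 0 = z 0 := by
  have := bdryPoint_succAbove z 0
  rwa [succAbove_zero_normalIdx] at this

theorem slant_normal (hX : X (normalIdx n) = 1) (p : ℝ × (Fin (n + 2) → ℝ)) :
    slant X p (normalIdx n) = p.1 := by
  simp [slant, hX, bdryPoint_normal]

theorem slant_zero (p : ℝ × (Fin (n + 2) → ℝ)) : slant X p 0 = p.2 0 + p.1 * X 0 := by
  simp [slant, bdryPoint_zero]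

theorem foot_slant (hX : X (normalIdx n) = 1) (p : ℝ × (Fin (n + 2) → ℝ)) :
    foot X (slant X p) = p.2 := by
  ext j
  rw [foot, slant_normal hX]
  simp [slant, bdryPoint_succAbove]

theorem foot_bdryPoint (z : Fin (n + 2) → ℝ) : foot X (bdryPoint z) = z := by
  ext j
  simp [foot, bdryPoint_normal, bdryPoint_succAbove]

theorem slant_foot (hX : X (normalIdx n) = 1) (x : Fin (n + 3) → ℝ) :
    slant X (x (normalIdx n), foot X x) = x := by
  ext i
  rcases Fin.eq_self_or_eq_succAbove (normalIdx n) i with rfl | ⟨j, rfl⟩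
  · rw [slant_normal hX]
  · simp [slant, bdryPoint_succAbove, foot]

theorem foot_contDiff : ContDiff ℝ ∞ (foot X) := by
  unfold foot
  fun_prop

theorem bdryPoint_continuous : Continuous (bdryPoint : (Fin (n + 2) → ℝ) → _) := by
  refine continuous_pi fun i => ?_
  rcases Fin.eq_self_or_eq_succAbove (normalIdx n) i with rfl | ⟨j, rfl⟩
  · simp only [bdryPoint_normal]
    fun_prop
  · simp only [bdryPoint_succAbove]
    fun_prop

theorem slant_continuous : Continuous (slant X) := by
  unfold slant
  exact (bdryPoint_continuous.comp continuous_snd).add (continuous_fst.smul continuous_const)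

/-- The coordinates given by the integral curves of a field transversal to the boundary. -/
def slantHomeo (hX : X (normalIdx n) = 1) : (ℝ × (Fin (n + 2) → ℝ)) ≃ₜ (Fin (n + 3) → ℝ) where
  toFun := slant X
  invFun x := (x (normalIdx n), foot X x)
  left_inv p := Prod.ext (slant_normal hX p) (foot_slant hX p)
  right_inv := slant_foot hX
  continuous_toFun := slant_continuous
  continuous_invFun := (continuous_apply _).prodMk foot_contDiff.continuous

theorem slant_measurableEmbedding (hX : X (normalIdx n) = 1) : MeasurableEmbedding (slant X) :=
  (slantHomeo hX).measurableEmbedding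

/-- A shear in the boundary variables followed by a reindexing of coordinates; the normalisation of
the x_d-component to one makes the Jacobian one. -/
theorem slant_measurePreserving (hX : X (normalIdx n) = 1) :
    MeasurePreserving (slant X) volume volume := by
  have h1 : MeasurePreserving (fun p : ℝ × (Fin (n + 2) → ℝ) =>
      (p.1, p.2 + p.1 • fun j => X ((normalIdx n).succAbove j))) volume volume :=
    MeasurePreserving.skew_product (g := fun s z => z + s • fun j => X ((normalIdx n).succAbove j))
      (MeasurePreserving.id volume)
      (by unfold Function.uncurry; exact (by fun_prop : Continuous fun p :
        ℝ × (Fin (n + 2) → ℝ) => p.2 + p.1 • fun j => X ((normalIdx n).succAbove j)).measurable)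
      (Eventually.of_forall fun s => (measurePreserving_add_right volume _).map_eq)
  have h2 := (volume_preserving_piFinSuccAbove (fun _ : Fin (n + 3) => ℝ) (normalIdx n)).symm
  have h3 : slant X = ⇑(MeasurableEquiv.piFinSuccAbove (fun _ : Fin (n + 3) => ℝ)
      (normalIdx n)).symm ∘ fun p : ℝ × (Fin (n + 2) → ℝ) =>
        (p.1, p.2 + p.1 • fun j => X ((normalIdx n).succAbove j)) := by
    refine funext fun p => funext fun i => ?_
    rcases Fin.eq_self_or_eq_succAbove (normalIdx n) i with rfl | ⟨j, rfl⟩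
    · rw [slant_normal hX]
      simp
    · simp [slant, bdryPoint_succAbove]
  rw [h3]
  exact h2.comp h1

theorem hasDerivAt_slant {u : (Fin (n + 3) → ℝ) → ℝ} (hu : ContDiff ℝ 1 u)
    (z : Fin (n + 2) → ℝ) (s : ℝ) :
    HasDerivAt (fun s => u (slant X (s, z))) (fderiv ℝ u (slant X (s, z)) X) s := by
  have h := (hu.differentiable one_ne_zero (slant X (s, z))).hasFDerivAt.comp_hasDerivAt s
    (((hasDerivAt_id s).smul_const X).const_add (bdryPoint z))
  rw [one_smul] at h
  exact h

/-- The function with `X σ = e σ` that equals `f` on the boundary. -/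
def transport (X : Fin (n + 3) → ℝ) (e : ℝ) (f : (Fin (n + 2) → ℝ) → ℝ) (x : Fin (n + 3) → ℝ) :
    ℝ := Real.exp (e * x (normalIdx n)) * f (foot X x)

theorem transport_slant (hX : X (normalIdx n) = 1) (e : ℝ) (f : (Fin (n + 2) → ℝ) → ℝ)
    (p : ℝ × (Fin (n + 2) → ℝ)) : transport X e f (slant X p) = Real.exp (e * p.1) * f p.2 := by
  rw [transport, slant_normal hX, foot_slant hX]

theorem transport_bdryPoint (e : ℝ) (f : (Fin (n + 2) → ℝ) → ℝ) (z : Fin (n + 2) → ℝ) :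
    transport X e f (bdryPoint z) = f z := by
  simp [transport, foot_bdryPoint, bdryPoint_normal]

theorem transport_contDiff (e : ℝ) {f : (Fin (n + 2) → ℝ) → ℝ} (hf : ContDiff ℝ 1 f) :
    ContDiff ℝ 1 (transport X e f) := by
  unfold transport
  have := hf.comp ((foot_contDiff (X := X)).of_le (mod_cast le_top))
  exact ContDiff.mul (by fun_prop) this

theorem transport_locallyIntegrable (hX : X (normalIdx n) = 1) (e : ℝ)
    {f : (Fin (n + 2) → ℝ) → ℝ} (hf : LocallyIntegrable f) :
    LocallyIntegrable (transport X e f) := by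
  rw [locallyIntegrable_iff]
  intro K hK
  have hK' : IsCompact (slant X ⁻¹' K) := (slantHomeo hX).isCompact_preimage.2 hK
  have hsub : slant X ⁻¹' K ⊆ (Prod.fst '' (slant X ⁻¹' K)) ×ˢ (Prod.snd '' (slant X ⁻¹' K)) :=
    fun p hp => ⟨⟨p, hp, rfl⟩, ⟨p, hp, rfl⟩⟩
  rw [← (slant_measurePreserving hX).integrableOn_comp_preimage (slant_measurableEmbedding hX)]
  have h1 : IntegrableOn (fun s : ℝ => Real.exp (e * s)) (Prod.fst '' (slant X ⁻¹' K)) :=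
    (by fun_prop : Continuous fun s : ℝ => Real.exp (e * s)).continuousOn.integrableOn_compact
      (hK'.image continuous_fst)
  have h2 : IntegrableOn f (Prod.snd '' (slant X ⁻¹' K)) :=
    hf.integrableOn_isCompact (hK'.image continuous_snd)
  have h3 := Integrable.mul_prod h1 h2
  rw [Measure.prod_restrict] at h3
  refine IntegrableOn.mono_set ?_ hsub
  refine h3.congr (Eventually.of_forall fun p => ?_)
  exact (transport_slant hX e f p).symm

/-- Integration along the integral curves of `X`, then over the boundary. -/
theorem integral_slant (hX : X (normalIdx n) = 1) {H : (Fin (n + 3) → ℝ) → ℝ}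
    (hH : Integrable H) : ∫ x, H x = ∫ z, ∫ s, H (slant X (s, z)) := by
  rw [← (slant_measurePreserving hX).integral_comp (slant_measurableEmbedding hX)]
  exact integral_prod_symm _
    ((slant_measurePreserving hX).integrable_comp_of_integrable hH)

/-- Integration along the coordinate `s` last. -/
theorem integral_slant' (hX : X (normalIdx n) = 1) {H : (Fin (n + 3) → ℝ) → ℝ}
    (hH : Integrable H) : ∫ x, H x = ∫ s, ∫ z, H (slant X (s, z)) := by
  rw [← (slant_measurePreserving hX).integral_comp (slant_measurableEmbedding hX)]
  exact integral_prod _ ((slant_measurePreserving hX).integrable_comp_of_integrable hH)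

theorem hasCompactSupport_slant_left (hX : X (normalIdx n) = 1) {u : (Fin (n + 3) → ℝ) → ℝ}
    (hu : HasCompactSupport u) (z : Fin (n + 2) → ℝ) :
    HasCompactSupport fun s => u (slant X (s, z)) := by
  refine HasCompactSupport.intro (hu.image (continuous_apply (normalIdx n))) fun s hs => ?_
  by_contra h0
  exact hs ⟨_, subset_tsupport _ h0, slant_normal hX _⟩

theorem hasCompactSupport_slant_right (hX : X (normalIdx n) = 1) {u : (Fin (n + 3) → ℝ) → ℝ}
    (hu : HasCompactSupport u) (s : ℝ) :
    HasCompactSupport fun z => u (slant X (s, z)) := by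
  refine HasCompactSupport.intro (hu.image (foot_contDiff (X := X)).continuous) fun z hz => ?_
  by_contra h0
  exact hz ⟨_, subset_tsupport _ h0, foot_slant hX _⟩

/-- On each integral curve the pairing is the integral of d/ds (φ e^{es}), times the constant value
of f on that curve. It vanishes by compact support, without any differentiability of f. -/
theorem hasWeakDirDeriv_transport (hX : X (normalIdx n) = 1) (e : ℝ)
    {f : (Fin (n + 2) → ℝ) → ℝ} (hf : LocallyIntegrable f) :
    HasWeakDirDeriv ⊤ X (transport X e f) (fun x => e * transport X e f x) := by
  have hL := transport_locallyIntegrable hX e hf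
  have hL1 : LocallyIntegrableOn (transport X e f) ((⊤ : Opens (Fin (n + 3) → ℝ)) : Set _) :=
    hL.locallyIntegrableOn _
  refine hasWeakDirDeriv_iff.2 ⟨hL1, (hL.smul e).locallyIntegrableOn _, fun φ h1 h2 h3 => ?_⟩
  have i1 := HasWeakDirDeriv.integrable_fderiv_smul (X := X) hL1 h1 h2 h3
  have i2 := integrableOn_smul_of_tsupport_subset hL1 h1.continuous h2 h3
  rw [restrict_top] at i1 i2
  have i2' : Integrable fun x => φ x • (e * transport X e f x) :=
    (i2.const_mul e).congr (Eventually.of_forall fun x => by simp only [smul_eq_mul]; ring)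
  rw [restrict_top, eq_neg_iff_add_eq_zero, ← integral_add i1 i2',
    integral_slant (H := fun x => fderiv ℝ φ x X • transport X e f x +
      φ x • (e * transport X e f x)) hX (i1.add i2')]
  refine integral_eq_zero_of_ae (Eventually.of_forall fun z => ?_)
  have hφ1 : ContDiff ℝ 1 φ := h1.of_le (mod_cast le_top)
  have hd : ∀ s, HasDerivAt (fun s => φ (slant X (s, z)) * Real.exp (e * s))
      (fderiv ℝ φ (slant X (s, z)) X * Real.exp (e * s) +
        φ (slant X (s, z)) * (Real.exp (e * s) * e)) s := fun s => by
    have := (((hasDerivAt_id s).const_mul e).exp)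
    simp only [id, mul_one] at this
    exact (hasDerivAt_slant hφ1 z s).mul this
  have hsl : Continuous fun s => slant X (s, z) := slant_continuous.comp (by fun_prop)
  have hc := hasCompactSupport_slant_left hX h2 z
  have hc' := hasCompactSupport_slant_left hX (fderiv_apply_hasCompactSupport h2 X) z
  have k1 := (h1.continuous.comp hsl)
  have k2 := ((fderiv_apply_contDiff h1 X).continuous.comp hsl)
  have j1 : Integrable fun s => φ (slant X (s, z)) * Real.exp (e * s) :=
    (k1.mul (by fun_prop)).integrable_of_hasCompactSupport hc.mul_right
  have j2 : Integrable fun s => fderiv ℝ φ (slant X (s, z)) X * Real.exp (e * s) +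
      φ (slant X (s, z)) * (Real.exp (e * s) * e) :=
    ((k2.mul (by fun_prop)).integrable_of_hasCompactSupport hc'.mul_right).add
      ((k1.mul (by fun_prop)).integrable_of_hasCompactSupport hc.mul_right)
  have h0 := integral_eq_zero_of_hasDerivAt_of_integrable hd j2 j1
  simp only [transport_slant hX, smul_eq_mul, Pi.zero_apply]
  rw [← zero_mul (f z), ← h0, ← integral_mul_const]
  refine integral_congr_ae (Eventually.of_forall fun s => ?_)
  simp only
  ring

/-- For fixed s the slanted coordinates differ from the boundary coordinates by a translation, so
tangential derivatives commute with transport; the weak identity is applied on each slice. -/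
theorem HasWeakDirDeriv.transport (hX : X (normalIdx n) = 1) (e : ℝ) {j : Fin (n + 2)}
    {f g : (Fin (n + 2) → ℝ) → ℝ} (h : HasWeakDirDeriv ⊤ (coordVec j) f g) :
    HasWeakDirDeriv ⊤ (coordVec ((normalIdx n).succAbove j)) (transport X e f)
      (_root_.transport X e g) := by
  obtain ⟨hf, hg, hfg⟩ := hasWeakDirDeriv_iff.1 h
  have hLf := (transport_locallyIntegrable hX e (locallyIntegrableOn_univ.1 hf)).locallyIntegrableOn
    ((⊤ : Opens (Fin (n + 3) → ℝ)) : Set _)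
  have hLg := (transport_locallyIntegrable hX e (locallyIntegrableOn_univ.1 hg)).locallyIntegrableOn
    ((⊤ : Opens (Fin (n + 3) → ℝ)) : Set _)
  refine hasWeakDirDeriv_iff.2 ⟨hLf, hLg, fun φ h1 h2 h3 => ?_⟩
  have i1 := HasWeakDirDeriv.integrable_fderiv_smul (X := coordVec ((normalIdx n).succAbove j)) hLf h1 h2 h3
  have i2 := integrableOn_smul_of_tsupport_subset hLg h1.continuous h2 h3
  rw [restrict_top] at i1 i2
  rw [restrict_top, integral_slant' hX i1, integral_slant' hX i2, ← integral_neg]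
  refine integral_congr_ae (Eventually.of_forall fun s => ?_)
  have hsl : ContDiff ℝ ∞ fun z => slant X (s, z) := by
    rw [contDiff_pi]
    intro i
    rcases Fin.eq_self_or_eq_succAbove (normalIdx n) i with rfl | ⟨l, rfl⟩
    · simp only [slant_normal hX]
      fun_prop
    · simp only [slant, bdryPoint_succAbove, Pi.add_apply]
      fun_prop
  have hder : ∀ z, fderiv ℝ (fun z => φ (slant X (s, z))) z (coordVec j) =
      fderiv ℝ φ (slant X (s, z)) (coordVec ((normalIdx n).succAbove j)) := fun z => by
    rw [← DifferentiableAt.lineDeriv_eq_fderiv (f := fun z => φ (slant X (s, z)))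
        ((h1.comp hsl).differentiable (by simp) z), ← (h1.differentiable (by simp) (slant X (s, z))).lineDeriv_eq_fderiv, lineDeriv, lineDeriv]
    congr 1
    ext t
    congr 1
    ext i
    rcases Fin.eq_self_or_eq_succAbove (normalIdx n) i with rfl | ⟨l, rfl⟩
    · simp [slant, bdryPoint_normal, coordVec, (Fin.succAbove_ne _ _).symm]
    · simp only [slant, bdryPoint_succAbove, coordVec, Pi.single_apply, Fin.succAbove_right_inj,
        Pi.add_apply, Pi.smul_apply]
      ring
  have key := hfg (fun z => φ (slant X (s, z))) (h1.comp hsl)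
    (hasCompactSupport_slant_right hX h2 s) (fun _ _ => trivial)
  rw [restrict_top] at key
  simp only [hder, smul_eq_mul] at key
  simp only [transport_slant hX, smul_eq_mul]
  have e1 : ∀ u v : (Fin (n + 2) → ℝ) → ℝ, (∫ z, u z * (Real.exp (e * s) * v z)) =
      Real.exp (e * s) * ∫ z, u z * v z := fun u v => by
    rw [← integral_const_mul]
    congr 1
    ext z
    ring
  rw [e1, e1, key, mul_neg]

/-- As f vanishes for t < 0 and time increases along X, only curve parameters 0 < s ≤ T / X_0 matter
in t < T. There the exponential is bounded, and the domain is a finite slab in s. -/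
theorem memLp_transport (hX : X (normalIdx n) = 1) (hX0 : 0 < X 0) (e T : ℝ)
    {f : (Fin (n + 2) → ℝ) → ℝ} (hf : MemLp f 2 volume) (h0 : ∀ᵐ z, z 0 < 0 → f z = 0) :
    MemLp (transport X e f) 2 (volume.restrict (intDomain n T)) := by
  have hm : MeasurableSet (slant X ⁻¹' (intDomain n T : Set (Fin (n + 3) → ℝ))) :=
    ((intDomain n T).isOpen.preimage slant_continuous).measurableSet
  have hmap := ((slant_measurePreserving hX).restrict_preimage_emb (slant_measurableEmbedding hX)
    (intDomain n T : Set (Fin (n + 3) → ℝ))).map_eq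
  rw [← hmap, (slant_measurableEmbedding hX).memLp_map_measure_iff]
  have h1 : MemLp ((Set.Ioc 0 (T / X 0)).indicator fun s : ℝ => Real.exp (e * s)) 2 volume := by
    refine (memLp_indicator_iff_restrict measurableSet_Ioc).2 ?_
    have hc : Continuous fun s : ℝ => Real.exp (e * s) := by fun_prop
    exact (memLp_two_iff_integrable_sq hc.aestronglyMeasurable).2
      ((hc.pow 2).integrableOn_Ioc)
  have h2 : MemLp (fun p : ℝ × (Fin (n + 2) → ℝ) =>
      (Set.Ioc 0 (T / X 0)).indicator (fun s : ℝ => Real.exp (e * s)) p.1 * f p.2) 2 volume := by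
    refine (memLp_two_iff_integrable_sq ?_).2 ?_
    · exact (h1.1.comp_fst).mul (hf.1.comp_snd)
    · have := Integrable.mul_prod h1.integrable_sq hf.integrable_sq
      simp only [mul_pow]
      exact this
  refine (h2.restrict (slant X ⁻¹' (intDomain n T : Set (Fin (n + 3) → ℝ)))).ae_eq ?_
  refine (ae_restrict_iff' hm).2 ?_
  have h3 : ∀ᵐ p : ℝ × (Fin (n + 2) → ℝ), p.2 0 < 0 → f p.2 = 0 :=
    Measure.quasiMeasurePreserving_snd.ae h0
  filter_upwards [h3] with p hp hpm
  obtain ⟨hp1, hp2⟩ : slant X p 0 < T ∧ 0 < slant X p (normalIdx n) := hpm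
  rw [slant_normal hX] at hp2
  rw [slant_zero] at hp1
  rw [Function.comp_apply, transport_slant hX]
  by_cases h4 : p.1 ≤ T / X 0
  · rw [Set.indicator_of_mem (Set.mem_Ioc.2 ⟨hp2, h4⟩)]
  · rw [hp ?_, mul_zero, mul_zero]
    rw [not_le, div_lt_iff₀ hX0] at h4
    linarith

/-- Weak derivatives are local: on the open set U ∩ {t < 0} the function is zero, and uniqueness
applies. -/
theorem HasWeakDirDeriv.ae_eq_zero_of_neg {N : ℕ} {F : Type*} [NormedAddCommGroup F]
    [NormedSpace ℝ F] [CompleteSpace F] {U : Opens (Fin (N + 1) → ℝ)} {Y : Fin (N + 1) → ℝ}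
    {f g : (Fin (N + 1) → ℝ) → F} (h : HasWeakDirDeriv U Y f g)
    (h0 : ∀ᵐ x ∂(volume.restrict (U : Set (Fin (N + 1) → ℝ))), x 0 < 0 → f x = 0) :
    ∀ᵐ x ∂(volume.restrict (U : Set (Fin (N + 1) → ℝ))), x 0 < 0 → g x = 0 := by
  have hV := h.mono (V := U ⊓ timeSlab N 0) inf_le_left
  have hms : MeasurableSet ((U ⊓ timeSlab N 0 : Opens (Fin (N + 1) → ℝ)) :
      Set (Fin (N + 1) → ℝ)) :=
    (U ⊓ timeSlab N 0).isOpen.measurableSet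
  have hf : f =ᵐ[volume.restrict ((U ⊓ timeSlab N 0 : Opens (Fin (N + 1) → ℝ)) : Set _)]
      fun _ => 0 := by
    rw [ae_restrict_iff' U.isOpen.measurableSet] at h0
    refine (ae_restrict_iff' hms).2 ?_
    filter_upwards [h0] with x hx hxm
    exact hx hxm.1 hxm.2
  have hg := (hV.congr hf (ae_eq_refl g)).unique HasWeakDirDeriv.zero
  rw [Filter.EventuallyEq, ae_restrict_iff' hms] at hg
  rw [ae_restrict_iff' U.isOpen.measurableSet]
  filter_upwards [hg] with x hx h1 h2
  exact hx ⟨h1, h2⟩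

theorem SobBd.sum {N κ s : ℕ} {F : Type*} [NormedAddCommGroup F] [NormedSpace ℝ F]
    {U : Opens (Fin (N + 1) → ℝ)} {ι : Type*} (t : Finset ι)
    {f : ι → (Fin (N + 1) → ℝ) → F} (h : ∀ i ∈ t, SobBd κ U s ⊤ (f i)) :
    SobBd κ U s ⊤ (fun x => ∑ i ∈ t, f i x) := by
  classical
  induction t using Finset.induction_on with
  | empty => simpa using SobBd.zero κ U s ⊤
  | insert a t ha ih =>
    simp only [Finset.sum_insert ha]
    exact ((h a (Finset.mem_insert_self a t)).add
      (ih fun i hi => h i (Finset.mem_insert_of_mem hi))).mono_bound le_top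

/-- Tangential derivatives are transports of tangential derivatives of f. The normal one is
recovered from the transport equation as e minus the tangential part of X. Weights pass through
because characteristics keep θ fixed. -/
theorem sobBd_transport (hX : X (normalIdx n) = 1) (hX0 : 0 < X 0)
    (hXl : X (Fin.last (n + 2)) = 0) (e T : ℝ) {s : ℕ} : ∀ {f : (Fin (n + 2) → ℝ) → ℝ},
    SobBd 1 ⊤ s ⊤ f → (∀ᵐ z, z 0 < 0 → f z = 0) →
      SobBd 1 (intDomain n T) s ⊤ (transport X e f) := by
  induction s with
  | zero =>
    intro f hf h0
    have := hf.memLp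
    rw [restrict_top] at this
    exact ⟨memLp_transport hX hX0 e T this h0, le_top⟩
  | succ s ih =>
    intro f hf h0
    refine ⟨fun p hp => ⟨?_, le_top⟩, ?_⟩
    · have h1 := (hf.weight hp).1
      rw [restrict_top] at h1
      refine (memLp_transport hX hX0 e T h1 ?_).ae_eq (Eventually.of_forall fun x => ?_)
      · filter_upwards [h0] with z hz h2
        rw [hz h2, smul_zero]
      · have : foot X x (Fin.last (n + 1)) = x (Fin.last (n + 2)) := by
          rw [foot, succAbove_last_normalIdx, hXl, mul_zero, sub_zero]
        simp only [transport, this, smul_eq_mul]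
        ring
    · choose g hg hgS using hf.2
      have hg0 : ∀ j, ∀ᵐ z, z 0 < 0 → g j z = 0 := fun j => by
        have := (hg j).ae_eq_zero_of_neg (by rwa [restrict_top])
        rwa [restrict_top] at this
      have hT : ∀ j, HasWeakDirDeriv (intDomain n T) (coordVec ((normalIdx n).succAbove j))
          (transport X e f) (transport X e (g j)) := fun j => ((hg j).transport hX e).mono le_top
      have hXd : HasWeakDirDeriv (intDomain n T) X (transport X e f)
          (fun x => e * transport X e f x) :=
        (hasWeakDirDeriv_transport hX e (locallyIntegrableOn_univ.1 (hg 0).1)).mono le_top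
      intro i
      rcases Fin.eq_self_or_eq_succAbove (normalIdx n) i with rfl | ⟨j, rfl⟩
      · refine ⟨_, ?_, SobBd.mono_bound ((((ih hf.of_succ h0).const_smul e).add
          (SobBd.sum Finset.univ fun j _ => ((ih (hgS j) (hg0 j)).const_smul
            (-X ((normalIdx n).succAbove j))).mono_bound le_top))) le_top⟩
        have hsum := hXd.add_dir (HasWeakDirDeriv.sum_dir hXd.1 Finset.univ
          (fun j => coordVec ((normalIdx n).succAbove j))
          (fun j => -X ((normalIdx n).succAbove j)) _ fun j _ => hT j)
        simp only [smul_eq_mul] at hsum ⊢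
        convert hsum using 1
        ext i
        rcases Fin.eq_self_or_eq_succAbove (normalIdx n) i with rfl | ⟨l, rfl⟩
        · simp [coordVec, hX, Finset.sum_apply, (Fin.succAbove_ne _ _).symm]
        · simp [coordVec, Finset.sum_apply, Pi.single_apply, Fin.succAbove_ne]
      · exact ⟨_, hT j, ih (hgS j) (hg0 j)⟩

end Transport
-- Traces, Green's formula and uniqueness for transport
section TransportUnique

/-- The function H is merely locally integrable, so the translation is carried by the test function;
for bounded s its translates remain in one compact set, which supplies the dominating function. -/
theorem hasDerivAt_integral_translate {N : ℕ} {X : Fin N → ℝ} {H ψ : (Fin N → ℝ) → ℝ}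
    (hH : LocallyIntegrable H) (h1 : ContDiff ℝ ∞ ψ) (h2 : HasCompactSupport ψ) (s₀ : ℝ) :
    HasDerivAt (fun s : ℝ => ∫ x, ψ (x + s • X) * H x)
      (∫ x, fderiv ℝ ψ (x + s₀ • X) X * H x) s₀ := by
  have hd := fderiv_apply_contDiff h1 X
  have hdc := fderiv_apply_hasCompactSupport h2 X
  obtain ⟨C, hC⟩ := hdc.exists_bound_of_continuous hd.continuous
  set K : Set (Fin N → ℝ) := (fun p : (Fin N → ℝ) × ℝ => p.1 - p.2 • X) ''
    (tsupport ψ ×ˢ Set.Icc (s₀ - 1) (s₀ + 1)) with hK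
  have hKc : IsCompact K := (h2.prod isCompact_Icc).image (by fun_prop)
  have hmem : ∀ s ∈ Set.Icc (s₀ - 1) (s₀ + 1), ∀ x, x ∉ K → x + s • X ∉ tsupport ψ :=
    fun s hs x hx h => hx ⟨(x + s • X, s), ⟨h, hs⟩, by simp⟩
  have htr : ∀ s : ℝ, Continuous fun x : Fin N → ℝ => x + s • X := fun s => by fun_prop
  have hsupp : ∀ s : ℝ, HasCompactSupport fun x => ψ (x + s • X) := fun s =>
    h2.comp_homeomorph (Homeomorph.addRight (s • X))
  have hint : ∀ s : ℝ, Integrable fun x => ψ (x + s • X) * H x := fun s =>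
    hH.integrable_smul_left_of_hasCompactSupport (h1.continuous.comp (htr s)) (hsupp s)
  refine (hasDerivAt_integral_of_dominated_loc_of_deriv_le
    (F' := fun s x => fderiv ℝ ψ (x + s • X) X * H x) (bound := K.indicator fun x => C * ‖H x‖) (s := Set.Icc (s₀ - 1) (s₀ + 1))
    (Icc_mem_nhds (by linarith) (by linarith)) (Eventually.of_forall fun s => (hint s).1) (hint s₀)
    (((hd.continuous.comp (htr s₀)).aestronglyMeasurable).mul hH.aestronglyMeasurable) ?_ ?_ ?_).2
  · refine Eventually.of_forall fun x s hs => ?_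
    by_cases hx : x ∈ K
    · rw [Set.indicator_of_mem hx, norm_mul]
      exact mul_le_mul_of_nonneg_right (hC _) (norm_nonneg _)
    · have h3 : fderiv ℝ ψ (x + s • X) X = 0 := by
        have := fderiv_apply_tsupport_subset ψ X
        exact image_eq_zero_of_notMem_tsupport (f := fun y => fderiv ℝ ψ y X) fun h => hmem s hs x hx (this h)
      rw [Set.indicator_of_notMem hx, h3, zero_mul, norm_zero]
  · refine IntegrableOn.integrable_indicator ?_ hKc.measurableSet
    exact ((hH.integrableOn_isCompact hKc).norm).const_mul C
  · refine Eventually.of_forall fun x s hs => HasDerivAt.mul_const ?_ _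
    have h := (h1.differentiable (by simp) (x + s • X)).hasFDerivAt.comp_hasDerivAt s
      (((hasDerivAt_id s).smul_const X).const_add x)
    rw [one_smul] at h
    exact h

/-- Uniqueness for a transport equation, from the weak formulation without boundary terms. -/
theorem eq_zero_of_transport {N : ℕ} {X : Fin (N + 1) → ℝ} (hX0 : 0 < X 0) {e T : ℝ}
    {H : (Fin (N + 1) → ℝ) → ℝ} (hH : LocallyIntegrable H) (h0 : ∀ᵐ x, x 0 < 0 → H x = 0)
    (h : ∀ φ : (Fin (N + 1) → ℝ) → ℝ, ContDiff ℝ ∞ φ → HasCompactSupport φ →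
      tsupport φ ⊆ timeSlab N T → ∫ x, (fderiv ℝ φ x X + e * φ x) * H x = 0) :
    ∀ᵐ x, x 0 < T → H x = 0 := by
  refine (timeSlab N T).isOpen.ae_eq_zero_of_integral_contDiff_smul_eq_zero
    (hH.locallyIntegrableOn _) fun ψ h1 h2 h3 => ?_
  have htr : ∀ s : ℝ, ContDiff ℝ ∞ fun x : Fin (N + 1) → ℝ => x + s • X := fun s => by fun_prop
  have hsupp : ∀ s : ℝ, HasCompactSupport fun x => ψ (x + s • X) := fun s =>
    h2.comp_homeomorph (Homeomorph.addRight (s • X))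
  -- Test functions are pushed backwards in time along X and stay in the slab because X 0 > 0. The
  -- weak equation gives F' = -e F, so e^{es} F(s) is constant.
  set F : ℝ → ℝ := fun s => ∫ x, ψ (x + s • X) * H x with hF
  have hFd : ∀ s, 0 ≤ s → HasDerivAt F (-e * F s) s := fun s hs => by
    have hd := hasDerivAt_integral_translate (X := X) hH h1 h2 s
    have hsub : tsupport (fun x => ψ (x + s • X)) ⊆ timeSlab N T := fun x hx => by
      have h4 : x + s • X ∈ tsupport ψ :=
        tsupport_comp_subset_preimage ψ (htr s).continuous hx
      have h5 : (x + s • X) 0 < T := h3 h4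
      simp only [Pi.add_apply, Pi.smul_apply, smul_eq_mul] at h5
      have h6 := mul_nonneg hs hX0.le
      change x 0 < T
      linarith
    have h4 := h _ (h1.comp (htr s)) (hsupp s) hsub
    have h5 : ∀ x, fderiv ℝ (fun x => ψ (x + s • X)) x X = fderiv ℝ ψ (x + s • X) X := fun x => by
      rw [fderiv_comp_add_right]
    have i1 : Integrable fun x => fderiv ℝ ψ (x + s • X) X * H x :=
      hH.integrable_smul_left_of_hasCompactSupport
        ((fderiv_apply_contDiff h1 X).continuous.comp (htr s).continuous)
        ((fderiv_apply_hasCompactSupport h2 X).comp_homeomorph (Homeomorph.addRight (s • X)))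
    have i2 : Integrable fun x => ψ (x + s • X) * H x :=
      hH.integrable_smul_left_of_hasCompactSupport
        (h1.continuous.comp (htr s).continuous) (hsupp s)
    have h6 : (∫ x, fderiv ℝ ψ (x + s • X) X * H x) + e * F s = 0 := by
      rw [← h4, hF]
      simp only
      rw [← integral_const_mul, ← integral_add i1 (i2.const_mul e)]
      refine integral_congr_ae (Eventually.of_forall fun x => ?_)
      simp only [Function.comp_def, h5]
      ring
    rw [eq_neg_of_add_eq_zero_left h6] at hd
    rwa [neg_mul]
  have hG : ∀ s, 0 ≤ s → HasDerivAt (fun s => Real.exp (e * s) * F s) 0 s := fun s hs => by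
    exact (((hasDerivAt_id s).const_mul e).exp.mul (hFd s hs)).congr_deriv
      (by simp only [id]; ring)
  have hS : 0 ≤ |T| / X 0 := by positivity
  have hconst := constant_of_has_deriv_right_zero (a := 0) (b := |T| / X 0)
    (fun s hs => (hG s hs.1).continuousAt.continuousWithinAt)
    (fun s hs => (hG s hs.1).hasDerivWithinAt) _ (Set.right_mem_Icc.2 hS)
  -- After the time |T| / X 0 the translated test function is supported in t < T - |T| ≤ 0, where H
  -- vanishes.
  have hFS : F (|T| / X 0) = 0 := by
    refine integral_eq_zero_of_ae ?_
    filter_upwards [h0] with x hx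
    by_cases h4 : x + (|T| / X 0) • X ∈ tsupport ψ
    · have h5 : (x + (|T| / X 0) • X) 0 < T := h3 h4
      simp only [Pi.add_apply, Pi.smul_apply, smul_eq_mul, div_mul_cancel₀ _ hX0.ne'] at h5
      rw [hx (by linarith [le_abs_self T]), mul_zero, Pi.zero_apply]
    · rw [image_eq_zero_of_notMem_tsupport h4, zero_mul, Pi.zero_apply]
  rw [hFS, mul_zero, mul_zero, Real.exp_zero, one_mul] at hconst
  rw [hF] at hconst
  simpa using hconst.symm

variable {n : ℕ} {X : Fin (n + 3) → ℝ}

theorem integral_halfSpace_fderiv (hX : X (normalIdx n) = 1) {u : (Fin (n + 3) → ℝ) → ℝ}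
    (hu : ContDiff ℝ 1 u) (hc : HasCompactSupport u) :
    ∫ x in {x : Fin (n + 3) → ℝ | 0 < x (normalIdx n)}, fderiv ℝ u x X =
      -∫ z, u (bdryPoint z) := by
  have hms : MeasurableSet {x : Fin (n + 3) → ℝ | 0 < x (normalIdx n)} :=
    (isOpen_lt continuous_const (continuous_apply _)).measurableSet
  have hcont : Continuous fun x => fderiv ℝ u x X :=
    (hu.continuous_fderiv one_ne_zero).clm_apply continuous_const
  have hI : Integrable fun x => fderiv ℝ u x X :=
    hcont.integrable_of_hasCompactSupport (hc.fderiv_apply ℝ X)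
  rw [← integral_indicator hms, integral_slant hX (hI.indicator hms), ← integral_neg]
  refine integral_congr_ae (Eventually.of_forall fun z => ?_)
  have h1 : (fun s => ({x : Fin (n + 3) → ℝ | 0 < x (normalIdx n)}).indicator
      (fun x => fderiv ℝ u x X) (slant X (s, z))) =
      (Set.Ioi (0 : ℝ)).indicator fun s => deriv (fun s => u (slant X (s, z))) s := by
    ext s
    simp only [Set.indicator_apply, Set.mem_ofPred_eq, slant_normal hX, Set.mem_Ioi,
      (hasDerivAt_slant hu z s).deriv]
  have h2 : ContDiff ℝ 1 fun s => u (slant X (s, z)) := by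
    unfold slant
    have h3 : ContDiff ℝ 1 fun s : ℝ => bdryPoint z + s • X := by fun_prop
    exact hu.comp h3
  simp only
  rw [h1, integral_indicator measurableSet_Ioi,
    (hasCompactSupport_slant_left hX hc z).integral_Ioi_deriv_eq h2]
  simp [slant]

theorem isTrace_transport (hX : X (normalIdx n) = 1) (hX0 : 0 < X 0)
    (hXl : X (Fin.last (n + 2)) = 0) (e T : ℝ) {s : ℕ} {f : (Fin (n + 2) → ℝ) → ℝ}
    (hf : ContDiff ℝ 1 f) (hfS : SobBd 1 ⊤ (s + 1) ⊤ f) (h0 : ∀ z, z 0 < 0 → f z = 0) :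
    IsTrace T (transport X e f) f := by
  have hS := sobBd_transport hX hX0 hXl e T hfS (Eventually.of_forall h0)
  have hσ := transport_contDiff (X := X) e hf
  obtain ⟨g, hg, hgS⟩ := hS.2 (normalIdx n)
  have hae := hg.ae_eq_fderiv (ae_eq_refl _) hσ
  refine ⟨hf.continuous.locallyIntegrable.locallyIntegrableOn _, _, HasWeakDirDeriv.of_contDiff hσ,
    hS.memLp, hgS.memLp.ae_eq hae, fun φ => ?_⟩
  have hφ : ContDiff ℝ 1 φ := φ.contDiff.of_le (mod_cast le_top)
  have hφc : HasCompactSupport φ := φ.hasCompactSupport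
  have hz : ∀ x, x ∉ (timeSlab (n + 2) T : Set (Fin (n + 3) → ℝ)) → x ∉ tsupport φ :=
    fun x hx h => hx (φ.tsupport_subset h)
  have key := integral_halfSpace_fderiv (X := coordVec (normalIdx n)) (by simp [coordVec])
    (hφ.mul hσ) hφc.mul_right
  have e1 : ∀ x, fderiv ℝ (fun x => φ x * transport X e f x) x (coordVec (normalIdx n)) =
      fderiv ℝ φ x (coordVec (normalIdx n)) * transport X e f x +
        φ x * fderiv ℝ (transport X e f) x (coordVec (normalIdx n)) := fun x => by
    rw [((hφ.differentiable one_ne_zero x).hasFDerivAt.fun_mul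
      (hσ.differentiable one_ne_zero x).hasFDerivAt).fderiv]
    simp only [add_apply, smul_apply, smul_eq_mul]
    ring
  simp only [e1, transport_bdryPoint] at key
  have hsub : ∀ x ∈ {x : Fin (n + 3) → ℝ | 0 < x (normalIdx n)} \
      (intDomain n T : Set (Fin (n + 3) → ℝ)), fderiv ℝ φ x (coordVec (normalIdx n)) *
        transport X e f x +
          φ x * fderiv ℝ (transport X e f) x (coordVec (normalIdx n)) = 0 := by
    intro x hx
    have hx' := hz x fun h => hx.2 ⟨h, hx.1⟩
    have h3 := image_eq_zero_of_notMem_tsupport fun h =>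
      hx' (fderiv_apply_tsupport_subset φ (coordVec (normalIdx n)) h)
    rw [h3, image_eq_zero_of_notMem_tsupport hx', zero_mul, zero_mul, add_zero]
  rw [← setIntegral_eq_of_subset_of_forall_sdiff_eq_zero
    (isOpen_lt continuous_const (continuous_apply _)).measurableSet (fun x hx => hx.2) hsub, key,
    setIntegral_eq_integral_of_forall_compl_eq_zero]
  intro z hz'
  rw [image_eq_zero_of_notMem_tsupport (hz _ fun h => hz' ?_), zero_mul]
  change z 0 < T
  rw [← bdryPoint_zero z]
  exact h

/-- Green's formula for a solution of a transport equation. -/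
theorem IsTrace.green (hX : X (normalIdx n) = 1) {e T : ℝ} {h : (Fin (n + 3) → ℝ) → ℝ}
    {g : (Fin (n + 2) → ℝ) → ℝ} (hXh : HasWeakDirDeriv (intDomain n T) X h fun x => e * h x)
    (htr : IsTrace T h g) {φ : (Fin (n + 3) → ℝ) → ℝ} (h1 : ContDiff ℝ ∞ φ)
    (h2 : HasCompactSupport φ) (h3 : tsupport φ ⊆ timeSlab (n + 2) T) :
    ∫ x in (intDomain n T : Set (Fin (n + 3) → ℝ)), (fderiv ℝ φ x X + e * φ x) * h x =
      -∫ z in (bdryDomain n T : Set (Fin (n + 2) → ℝ)), φ (bdryPoint z) * g z := by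
  obtain ⟨-, h', hw, hL, hL', hG⟩ := htr
  have hG1 := hG ⟨φ, h1, h2, h3⟩
  change ∫ x in (intDomain n T : Set (Fin (n + 3) → ℝ)),
    (fderiv ℝ φ x (coordVec (normalIdx n)) * h x + φ x * h' x) =
      -∫ z in (bdryDomain n T : Set (Fin (n + 2) → ℝ)), φ (bdryPoint z) * g z at hG1
  have hd : ∀ Z, MemLp (fun x => fderiv ℝ φ x Z) 2
      (volume.restrict (intDomain n T : Set (Fin (n + 3) → ℝ))) := fun Z =>
    ((fderiv_apply_contDiff h1 Z).continuous.memLp_of_hasCompactSupport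
      (fderiv_apply_hasCompactSupport h2 Z)).restrict _
  have hφL : MemLp φ 2 (volume.restrict (intDomain n T : Set (Fin (n + 3) → ℝ))) :=
    (h1.continuous.memLp_of_hasCompactSupport h2).restrict _
  have j1 := fun Z => (hd Z).integrable_mul hL
  have j2 := hφL.integrable_mul hL
  have j3 := hφL.integrable_mul hL'
  -- The field Y = X - ∂_d is tangential, so cut-offs in x_d alone are not differentiated by it and
  -- produce no boundary term. The remaining ∂_d part is the definition of the trace.
  have hY : HasWeakDirDeriv (intDomain n T) (X + (-1 : ℝ) • coordVec (normalIdx n)) h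
      (fun x => e * h x + (-1 : ℝ) • h' x) := hXh.add_dir (hw.smul_dir (-1))
  set Y := X + (-1 : ℝ) • coordVec (normalIdx n) with hYdef
  have hYν : Y (normalIdx n) = 0 := by simp [hYdef, hX, coordVec]
  have jk : Integrable (fun x => fderiv ℝ φ x Y * h x + φ x * (e * h x + (-1 : ℝ) • h' x))
      (volume.restrict (intDomain n T : Set (Fin (n + 3) → ℝ))) := by
    refine ((j1 Y).add ((j2.const_mul e).sub j3)).congr (Eventually.of_forall fun x => ?_)
    simp only [Pi.add_apply, Pi.mul_apply, Pi.sub_apply, smul_eq_mul]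
    ring
  set χ : ℕ → (Fin (n + 3) → ℝ) → ℝ := fun N x =>
    Real.smoothTransition ((N + 1) * x (normalIdx n) - 1) with hχ
  have hχs : ∀ N : ℕ, ContDiff ℝ ∞ fun t : ℝ => Real.smoothTransition ((N + 1) * t - 1) :=
    fun N => Real.smoothTransition.contDiff.comp (by fun_prop)
  have hχc : ∀ N, ContDiff ℝ ∞ (χ N) := fun N => contDiff_comp_coord (hχs N) _
  have hχY : ∀ N x, fderiv ℝ (χ N) x Y = 0 := fun N x => by
    have := fderiv_comp_coord (hχs N) (normalIdx n) x Y
    rw [hYν, mul_zero] at this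
    exact this
  have hzero : ∀ N, ∫ x in (intDomain n T : Set (Fin (n + 3) → ℝ)),
      χ N x * (fderiv ℝ φ x Y * h x + φ x * (e * h x + (-1 : ℝ) • h' x)) = 0 := by
    intro N
    have hsub : tsupport (fun x => χ N x * φ x) ⊆ intDomain n T := by
      intro x hx
      refine ⟨h3 (tsupport_mul_subset_right hx), ?_⟩
      have hcl : IsClosed {x : Fin (n + 3) → ℝ | 1 ≤ (N + 1) * x (normalIdx n)} :=
        isClosed_le continuous_const (by fun_prop)
      have h4 : x ∈ {x : Fin (n + 3) → ℝ | 1 ≤ (N + 1) * x (normalIdx n)} := by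
        refine closure_minimal (fun y hy => ?_) hcl hx
        by_contra h5
        refine hy ?_
        have : χ N y = 0 := Real.smoothTransition.zero_of_nonpos (by
          simp only [Set.mem_ofPred_eq, not_le] at h5
          linarith)
        simp only [this, zero_mul]
      by_contra h5
      have h6 : (1 : ℝ) ≤ (N + 1) * x (normalIdx n) := h4
      have h7 : x (normalIdx n) ≤ 0 := not_lt.1 h5
      have h8 : (0 : ℝ) ≤ N + 1 := by positivity
      nlinarith [mul_nonpos_of_nonneg_of_nonpos h8 h7]
    have h4 := (hasWeakDirDeriv_iff.1 hY).2.2 (fun x => χ N x * φ x) ((hχc N).mul h1)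
      h2.mul_left hsub
    have h5 : ∀ x, fderiv ℝ (fun x => χ N x * φ x) x Y = χ N x * fderiv ℝ φ x Y := fun x => by
      rw [(((hχc N).differentiable (by simp) x).hasFDerivAt.fun_mul
        (h1.differentiable (by simp) x).hasFDerivAt).fderiv]
      simp only [add_apply, smul_apply, smul_eq_mul, hχY, mul_zero, add_zero]
    have k1 := HasWeakDirDeriv.integrable_fderiv_smul (X := Y) hY.1 ((hχc N).mul h1) h2.mul_left hsub
    have k2 := integrableOn_smul_of_tsupport_subset hY.2.1 ((hχc N).mul h1).continuous
      h2.mul_left hsub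
    rw [eq_neg_iff_add_eq_zero, ← integral_add k1 k2] at h4
    rw [← h4]
    refine integral_congr_ae (Eventually.of_forall fun x => ?_)
    simp only [h5, smul_eq_mul]
    ring
  have hlim := tendsto_integral_of_dominated_convergence
    (F := fun (N : ℕ) x => χ N x * (fderiv ℝ φ x Y * h x + φ x * (e * h x + (-1 : ℝ) • h' x)))
    (f := fun x => fderiv ℝ φ x Y * h x + φ x * (e * h x + (-1 : ℝ) • h' x))
    (μ := volume.restrict (intDomain n T : Set (Fin (n + 3) → ℝ)))
    _ (fun N => (hχc N).continuous.aestronglyMeasurable.mul jk.1) jk.norm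
    (fun N => Eventually.of_forall fun x => by
      rw [norm_mul]
      refine mul_le_of_le_one_left (norm_nonneg _) ?_
      rw [Real.norm_of_nonneg (Real.smoothTransition.nonneg _)]
      exact Real.smoothTransition.le_one _)
    ((ae_restrict_iff' (intDomain n T).isOpen.measurableSet).2 (Eventually.of_forall fun x hx => by
      have hx' : 0 < x (normalIdx n) := hx.2
      refine tendsto_const_nhds.congr' ?_
      obtain ⟨N₀, hN₀⟩ := exists_nat_gt (2 / x (normalIdx n))
      filter_upwards [eventually_ge_atTop N₀] with N hN
      have h5 : χ N x = 1 := Real.smoothTransition.one_of_one_le (by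
        have h6 : (N₀ : ℝ) ≤ N := by exact_mod_cast hN
        rw [div_lt_iff₀ hx'] at hN₀
        nlinarith)
      rw [h5, one_mul]))
  simp only [hzero] at hlim
  have hk0 := tendsto_nhds_unique hlim tendsto_const_nhds
  have e1 : ∫ x in (intDomain n T : Set (Fin (n + 3) → ℝ)),
      (fderiv ℝ φ x (coordVec (normalIdx n)) * h x + φ x * h' x) +
        (fderiv ℝ φ x Y * h x + φ x * (e * h x + (-1 : ℝ) • h' x)) =
      ∫ x in (intDomain n T : Set (Fin (n + 3) → ℝ)), (fderiv ℝ φ x X + e * φ x) * h x := by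
    refine integral_congr_ae (Eventually.of_forall fun x => ?_)
    simp only [hYdef, map_add, map_smul, smul_eq_mul]
    ring
  rw [← e1, ← hG1, ← add_zero (∫ x in (intDomain n T : Set (Fin (n + 3) → ℝ)),
    (fderiv ℝ φ x (coordVec (normalIdx n)) * h x + φ x * h' x)), ← hk0]
  exact integral_add ((j1 _).add j3) jk

/-- The difference is extended by zero across the boundary. Equal traces cancel the boundary
integrals in Green's formula, so the extension satisfies the weak equation on the whole slab t < T,
and `eq_zero_of_transport` applies. -/
theorem transport_unique (hX : X (normalIdx n) = 1) (hX0 : 0 < X 0) {e T : ℝ}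
    {σ σ' : (Fin (n + 3) → ℝ) → ℝ} {g g' : (Fin (n + 2) → ℝ) → ℝ}
    (hσ : HasWeakDirDeriv (intDomain n T) X σ fun x => e * σ x)
    (hσ' : HasWeakDirDeriv (intDomain n T) X σ' fun x => e * σ' x)
    (hg : IsTrace T σ g) (hg' : IsTrace T σ' g')
    (h0 : ∀ᵐ x ∂(volume.restrict (intDomain n T : Set (Fin (n + 3) → ℝ))), x 0 < 0 → σ x = 0)
    (h0' : ∀ᵐ x ∂(volume.restrict (intDomain n T : Set (Fin (n + 3) → ℝ))), x 0 < 0 → σ' x = 0)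
    (hgg : g =ᵐ[volume.restrict (bdryDomain n T : Set (Fin (n + 2) → ℝ))] g') :
    σ =ᵐ[volume.restrict (intDomain n T : Set (Fin (n + 3) → ℝ))] σ' := by
  have hms := (intDomain n T).isOpen.measurableSet
  obtain ⟨-, -, -, hL, -, -⟩ := id hg
  obtain ⟨-, -, -, hL', -, -⟩ := id hg'
  set H := (intDomain n T : Set (Fin (n + 3) → ℝ)).indicator fun x => σ x - σ' x with hH
  have hHL : MemLp H 2 volume := (memLp_indicator_iff_restrict hms).2 (hL.sub hL')
  have key := eq_zero_of_transport (e := e) (T := T) hX0 (hHL.locallyIntegrable one_le_two) (by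
    rw [ae_restrict_iff' hms] at h0 h0'
    filter_upwards [h0, h0'] with x h1 h2 h3
    simp only [hH]
    by_cases h4 : x ∈ (intDomain n T : Set (Fin (n + 3) → ℝ))
    · rw [Set.indicator_of_mem h4, h1 h4 h3, h2 h4 h3, sub_zero]
    · rw [Set.indicator_of_notMem h4]) (by
    intro φ h1 h2 h3
    have e1 : (fun x => (fderiv ℝ φ x X + e * φ x) * H x) =
        (intDomain n T : Set (Fin (n + 3) → ℝ)).indicator fun x =>
          (fderiv ℝ φ x X + e * φ x) * σ x - (fderiv ℝ φ x X + e * φ x) * σ' x := by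
      ext x
      by_cases h4 : x ∈ (intDomain n T : Set (Fin (n + 3) → ℝ))
      · simp only [hH, Set.indicator_of_mem h4, mul_sub]
      · simp only [hH, Set.indicator_of_notMem h4, mul_zero]
    have hd : MemLp (fun x => fderiv ℝ φ x X + e * φ x) 2
        (volume.restrict (intDomain n T : Set (Fin (n + 3) → ℝ))) :=
      (((fderiv_apply_contDiff h1 X).continuous.memLp_of_hasCompactSupport
        (fderiv_apply_hasCompactSupport h2 X)).restrict _).add
        (((h1.continuous.memLp_of_hasCompactSupport h2).restrict _).const_mul e)
    rw [e1, integral_indicator hms]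
    refine (integral_sub (hd.integrable_mul hL) (hd.integrable_mul hL')).trans ?_
    simp only [Pi.mul_apply]
    rw [IsTrace.green hX hσ hg h1 h2 h3, IsTrace.green hX hσ' hg' h1 h2 h3, sub_eq_zero, neg_inj]
    refine integral_congr_ae ?_
    filter_upwards [hgg] with z hz
    rw [hz])
  refine (ae_restrict_iff' hms).2 ?_
  filter_upwards [key] with x hx hxm
  have := hx hxm.1
  rw [hH, Set.indicator_of_mem hxm] at this
  exact sub_eq_zero.1 this

end TransportUnique
-- The interior amplitudes
namespace PhaseData

section Solution

variable {n : ℕ} {P : PhaseData n} {S : BoundaryProblem n}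
  {lam : Fin 3 → (Fin n → ℝ) × ℝ → ℝ}

theorem Xphi_last (i : Fin 3) : P.Xphi lam i (Fin.last (n + 2)) = 0 := by simp [Xphi]

theorem Xphi_normal (i : Fin 3) : P.Xphi lam i (normalIdx n) = 1 := by
  simp only [Xphi, normalIdx, Fin.snoc_castSucc, Fin.snoc_last]

theorem Xphi_zero (i : Fin 3) : P.Xphi lam i 0 = (P.velNor lam i)⁻¹ := by
  have h : (0 : Fin (n + 3)) = Fin.castSucc (Fin.castSucc (0 : Fin (n + 1))) := rfl
  rw [h, Xphi, Fin.snoc_castSucc, Fin.snoc_castSucc, Fin.cons_zero]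

/-- Both vectors are multiples of r_i, so the boundary condition is scalar. -/
theorem smul_r_eq_iff (hP : P.Admissible S lam) (i : Fin 3) (u v : ℝ) :
    u • P.r i = v • P.eComp i ↔ u = (P.l i ⬝ᵥ P.e) * v := by
  rw [eComp, proj, smul_smul, (smul_left_injective ℝ (hP.r_ne i)).eq_iff, mul_comm]

/-- The solution of the transport equation with the trace prescribed by the amplitude `a`. -/
def sigma (P : PhaseData n) (S : BoundaryProblem n) (lam : Fin 3 → (Fin n → ℝ) × ℝ → ℝ)
    (a : (Fin (n + 2) → ℝ) → ℝ) (i : Fin 3) : (Fin (n + 3) → ℝ) → ℝ :=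
  transport (P.Xphi lam i) (P.eCoef S i) fun z => (P.l i ⬝ᵥ P.e) * a z

theorem sigma_spec {i : Fin 3} (hi : 0 < P.velNor lam i) (T : ℝ)
    {s : ℕ} {a : (Fin (n + 2) → ℝ) → ℝ} (ha : ContDiff ℝ 1 a) (haS : SobBd 1 ⊤ (s + 1) ⊤ a)
    (ha0 : ∀ z, z 0 < 0 → a z = 0) :
    MemGamma (intDomain n T) (s + 1) (P.sigma S lam a i) ∧
      HasWeakDirDeriv (intDomain n T) (P.Xphi lam i) (P.sigma S lam a i)
        (fun x => P.eCoef S i * P.sigma S lam a i x) ∧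
      IsTrace T (P.sigma S lam a i) fun z => (P.l i ⬝ᵥ P.e) * a z := by
  have hX := P.Xphi_normal (lam := lam) i
  have hX0 : 0 < P.Xphi lam i 0 := by
    rw [Xphi_zero]
    exact inv_pos.2 hi
  have hXl := P.Xphi_last (lam := lam) i
  have hf : ContDiff ℝ 1 fun z => (P.l i ⬝ᵥ P.e) * a z := contDiff_const.mul ha
  have hfS : SobBd 1 ⊤ (s + 1) ⊤ fun z => (P.l i ⬝ᵥ P.e) * a z :=
    (haS.const_smul (P.l i ⬝ᵥ P.e)).mono_bound le_top
  have hf0 : ∀ z, z 0 < 0 → (P.l i ⬝ᵥ P.e) * a z = 0 := fun z hz => by rw [ha0 z hz, mul_zero]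
  refine ⟨memGamma_iff.2 ⟨sobBd_transport hX hX0 hXl _ T hfS (Eventually.of_forall hf0), ?_⟩,
    (hasWeakDirDeriv_transport hX _ hf.continuous.locallyIntegrable).mono le_top,
    isTrace_transport hX hX0 hXl _ T hf hfS hf0⟩
  refine (ae_restrict_iff' (intDomain n T).isOpen.measurableSet).2
    (Eventually.of_forall fun x hx hx0 => ?_)
  have hx2 : 0 < x (normalIdx n) := hx.2
  -- The foot of the characteristic through x lies at an earlier time, since the incoming field
  -- advances in time as x_d grows.
  have h1 : foot (P.Xphi lam i) x 0 < 0 := by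
    rw [foot, succAbove_zero_normalIdx]
    linarith [mul_pos hx2 hX0]
  rw [sigma, transport, hf0 _ h1, mul_zero]

theorem sigma_unique (hP : P.Admissible S lam) {i : Fin 3} (hi : 0 < P.velNor lam i) {T : ℝ}
    {s : ℕ} {a a' : (Fin (n + 2) → ℝ) → ℝ} (ha : ContDiff ℝ 1 a) (haS : SobBd 1 ⊤ (s + 1) ⊤ a)
    (ha0 : ∀ z, z 0 < 0 → a z = 0)
    (haa : a' =ᵐ[volume.restrict (bdryDomain n T : Set (Fin (n + 2) → ℝ))] a)
    {σ : (Fin (n + 3) → ℝ) → ℝ} (hσ : MemGamma (intDomain n T) (s + 1) σ)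
    (hσX : HasWeakDirDeriv (intDomain n T) (P.Xphi lam i) σ fun x => P.eCoef S i * σ x)
    (hg : ∃ g, IsTrace T σ g ∧
      ∀ᵐ z ∂(volume.restrict (bdryDomain n T : Set (Fin (n + 2) → ℝ))),
        g z • P.r i = a' z • P.eComp i) :
    σ =ᵐ[volume.restrict (intDomain n T : Set (Fin (n + 3) → ℝ))] P.sigma S lam a i := by
  obtain ⟨h1, h2, h3⟩ := sigma_spec (P := P) (S := S) hi T ha haS ha0
  obtain ⟨g, hg, hga⟩ := hg
  refine transport_unique (P.Xphi_normal i) (by rw [Xphi_zero]; exact inv_pos.2 hi) hσX h2 hg h3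
    hσ.2 h1.2 ?_
  filter_upwards [hga, haa] with z h4 h5
  rw [(smul_r_eq_iff hP i _ _).1 h4, h5]

end Solution

end PhaseData

end

/-! ### Assembly -/

theorem mainTheorem6 (n : ℕ) (S : BoundaryProblem n) (lam : Fin 3 → (Fin n → ℝ) × ℝ → ℝ)
    (hyp : S.StrictlyHyperbolic lam) (hnc : S.Noncharacteristic) (hws : S.WeaklyStable)
    (P : PhaseData n) (hP : P.Admissible S lam)
    (T : ℝ) (hT : 0 < T) (m : ℕ) (hm : (((n + 1 : ℕ) : ℝ) + 1) / 2 + 1 < (m : ℝ)) :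
    ∃ δ : ℝ, 0 < δ ∧ ∀ G : (Fin (n + 2) → ℝ) → EuclideanSpace ℝ (Fin 2),
      MemGamma (bdryDomain n T) (m + 1) G → normGamma (bdryDomain n T) (m + 1) G < δ →
      ∃ (a : (Fin (n + 2) → ℝ) → ℝ) (σ₁ σ₃ : (Fin (n + 3) → ℝ) → ℝ),
        P.IsKeySolution S lam T m G a σ₁ σ₃ ∧
        ∀ (a' : (Fin (n + 2) → ℝ) → ℝ) (σ₁' σ₃' : (Fin (n + 3) → ℝ) → ℝ),
          P.IsKeySolution S lam T m G a' σ₁' σ₃' →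
            a' =ᵐ[volume.restrict (bdryDomain n T)] a ∧
            σ₁' =ᵐ[volume.restrict (intDomain n T)] σ₁ ∧
            σ₃' =ᵐ[volume.restrict (intDomain n T)] σ₃ := by
  obtain ⟨k, rfl⟩ : ∃ k, m = k + 1 := by
    cases m with
    | zero =>
      have h : (0 : ℝ) ≤ (n + 1 : ℕ) := Nat.cast_nonneg _
      rw [Nat.cast_zero] at hm
      linarith
    | succ k => exact ⟨k, rfl⟩
  -- The boundary has n + 2 = d + 1 variables, so with m = k + 1 the assumption on m is exactly the
  -- Sobolev threshold for k.
  have hk : ((n + 2 : ℕ) : ℝ) < 2 * k := by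
    push_cast at hm ⊢
    linarith
  have hX0 := hP.XLop_zero_ne hnc hyp hws
  obtain ⟨δ, hδ, hsol⟩ := exists_boundary_solution hk hX0 P.XLop_last (P.cCoef S) (P.dCoef S) T hT
  set L : EuclideanSpace ℝ (Fin 2) →L[ℝ] ℝ :=
    -∑ j, P.b j • (EuclideanSpace.proj j : EuclideanSpace ℝ (Fin 2) →L[ℝ] ℝ) with hL
  have hLv : ∀ v, L v = -∑ j, P.b j * v j := fun v => by simp [hL]
  refine ⟨δ / (‖L‖₊ + 1), by positivity, fun G hG hGn => ?_⟩
  -- The extra order of regularity of G is spent on ∂_θ G, which then has order m and the same norm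
  -- bound; the factor ‖L‖ + 1 accounts for the pairing with b.
  obtain ⟨dG, hdG, hdGS⟩ := (hG.sobBd_of_norm_le hGn.le).2 (Fin.last (n + 1))
  have hdG0 := hdG.ae_eq_zero_of_neg hG.2
  obtain ⟨a, ha, haS, ha0, haeq⟩ := hsol (fun z => L (dG z)) ((hdGS.clm_comp L).mono_bound (by
    rw [← NNReal.coe_one, ← NNReal.coe_add, ← NNReal.coe_div, ENNReal.ofReal_coe_nnreal,
      ← ENNReal.coe_mul, ENNReal.coe_le_coe, ← mul_div_assoc, div_le_iff₀ (by positivity), mul_comm]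
    gcongr
    exact le_self_add)) (by
    filter_upwards [ae_restrict_slab.1 hdG0] with z h1 h2 h3
    rw [h1 h2 h3, map_zero])
  have haM : MemGamma (bdryDomain n T) (k + 1) a := memGamma_iff.2
    ⟨haS.restrict le_top, Eventually.of_forall ha0⟩
  obtain ⟨m1, e1, t1⟩ := P.sigma_spec (S := S) hP.incoming_first T ha haS ha0
  obtain ⟨m3, e3, t3⟩ := P.sigma_spec (S := S) hP.incoming_third T ha haS ha0
  refine ⟨a, P.sigma S lam a 0, P.sigma S lam a 2, ⟨haM, m1, m3, e1, e3, ⟨_, _, dG,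
    HasWeakDirDeriv.of_contDiff ha, HasWeakDirDeriv.of_contDiff (ha.pow 2), hdG, ?_⟩,
    ⟨_, t1, Eventually.of_forall fun z => (P.smul_r_eq_iff hP 0 _ _).2 rfl⟩,
    ⟨_, t3, Eventually.of_forall fun z => (P.smul_r_eq_iff hP 2 _ _).2 rfl⟩⟩, ?_⟩
  · refine ae_restrict_slab.2 ?_
    filter_upwards [haeq] with z h1 h2
    rw [← hLv, ← h1 h2, ((ha.differentiable one_ne_zero z).hasFDerivAt.pow 2).fderiv]
    simp only [smul_apply, smul_eq_mul, nsmul_eq_mul]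
    push_cast
    ring
  · intro a' σ₁' σ₃' h
    obtain ⟨Xa, da2, dG', hXa, hda, hdG', heq⟩ := h.bdry_eq
    have haa : a' =ᵐ[volume.restrict (bdryDomain n T : Set (Fin (n + 2) → ℝ))] a := by
      refine ae_restrict_slab.2 (boundary_unique hk hX0 hT ha haS ha0 haeq (memGamma_iff.1 h.a_mem).1
        (ae_restrict_slab.1 h.a_mem.2) hXa hda ?_)
      filter_upwards [ae_restrict_slab.1 heq, ae_restrict_slab.1 (hdG'.unique hdG)] with z h1 h2 h3
      rw [h1 h3, h2 h3, hLv]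
    exact ⟨haa, P.sigma_unique hP hP.incoming_first ha haS ha0 haa h.first_mem h.first_eq
      h.first_trace, P.sigma_unique hP hP.incoming_third ha haS ha0 haa h.third_mem h.third_eq
      h.third_trace⟩
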